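/- Theorem 5.1. Let $q$ be a power of an odd prime. A *biquadratic curve* over $\mathbb{F}_q$ is a smooth projective geometrically irreducible curve $C/\mathbb{F}_q$ with a morphism $\varphi:C\to\mathbb{P}^1$ over $\mathbb{F}_q$ such that $\mathbb{F}_q(C)/\mathbb{F}_q(t)$ is Galois with group $\mathbb{Z}/2\mathbb{Z}\times\mathbb{Z}/2\mathbb{Z}$; isomorphisms of biquadratic curves are isomorphisms of curves over $\mathbb{F}_q$ lying over an automorphism of $\mathbb{P}^1$. For positive integers $g_1,g_2,g_3$ let $\mathcal{B}_{(g_1,g_2,g_3)}(\mathbb{F}_q)$ be the set of isomorphism classes of biquadratic curves over $\mathbb{F}_q$ whose three intermediate quadratic covers of $\mathbb{P}^1$ have genera $g_1,g_2,g_3$ (in some order). Put $\mathrm{Tr}(\mathrm{Frob}_C)=q+1-\#C(\mathbb{F}_q)$ and, for an integer $k\ge 0$, $$ M_k(q,g_1,g_2,g_3)=\Bigl(\sum_{C\in\mathcal{B}_{(g_1,g_2,g_3)}(\mathbb{F}_q)}\frac{1}{|\mathrm{Aut}(C)|}\Bigr)^{-1}\sum_{C\in\mathcal{B}_{(g_1,g_2,g_3)}(\mathbb{F}_q)}\frac{1}{|\mathrm{Aut}(C)|}\left(\frac{\mathrm{Tr}(\mathrm{Frob}_C)}{\sqrt{1+q}}\right)^k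 . $$ Let $X_1,\dots,X_{q+1}$ be independent identically distributed random variables taking the values $-1$, $1$, $3$ with probabilities $\frac{3(q+2)}{4(q+3)}$, $\frac{6}{4(q+3)}$, $\frac{q}{4(q+3)}$ respectively. Then for every integer $k\ge 0$ and every $0<\epsilon<1$ there is a constant $A=A(k,\epsilon)$ such that, for every such $q$ and all integers $n,n_1,n_2\ge 0$ for which $$g_1=\Bigl\lfloor\tfrac{n+n_1-1}{2}\Bigr\rfloor,\qquad g_2=\Bigl\lfloor\tfrac{n+n_2-1}{2}\Bigr\rfloor,\qquad g_3=\Bigl\lfloor\tfrac{n_1+n_2-1}{2}\Bigr\rfloor$$ are positive, the set $\mathcal{B}_{(g_1,g_2,g_3)}(\mathbb{F}_q)$ is finite and non-empty and $$ \left|M_k(q,g_1,g_2,g_3)-(-1)^k\,\mathbb{E}\left(\Bigl(\frac{1}{\sqrt{1+q}}\sum_{i=1}^{q+1}X_i\Bigr)^k\right)\right|\le A\,q^{-\frac{1-\epsilon}{2}\min(n,n_1,n_2)+k}. $$ -/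

import Mathlib

universe u v

/-- A biquadratic curve over `F`: a smooth projective curve `C` with a morphism `C → ℙ¹` over `F`
inducing a Galois extension of function fields with group `ℤ/2 × ℤ/2`. Smooth projective
(geometrically irreducible) curves with a finite morphism to `ℙ¹` are the same as finite extensions
`K` of the rational function field `F(t)` in which `F` is algebraically closed; the curve is
recorded by its function field `K = F(C)`. -/
structure BiquadraticCurve (F : Type u) [Field F] where
  K : Type u
  [instField : Field K]
  [instAlgebra : Algebra F K]
  [instAlgebraRatFunc : Algebra (RatFunc F) K]
  [instTower : IsScalarTower F (RatFunc F) K]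
  finiteDimensional : FiniteDimensional (RatFunc F) K
  isGalois : IsGalois (RatFunc F) K
  isKleinFour : IsKleinFour (K ≃ₐ[RatFunc F] K)
  constants : ∀ a : K, IsIntegral F a → ∃ c : F, algebraMap F K c = a

namespace BiquadraticCurve

attribute [instance] instField instAlgebra instAlgebraRatFunc instTower

section FunctionField

variable (F : Type u) [Field F] (K : Type u) [Field K] [Algebra F K] [Algebra (RatFunc F) K]

/-- For a set `S` of functions, the elements of `K` that are integral over `F[S]`. -/
noncomputable def integralOver (S : Set K) : Submodule F K :=
  Subalgebra.toSubmodule ((integralClosure (Algebra.adjoin F S) K).restrictScalars F)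

/-- The coordinate function `t` of `ℙ¹`, pulled back to the curve. -/
noncomputable def coord : K := algebraMap (RatFunc F) K RatFunc.X

/-- The genus `dim_F H¹(C, 𝒪_C)` of the smooth projective curve `C` with function field `K`.
The inverse images in `C` of the two standard affine lines of `ℙ¹` are affine, with coordinate rings
the integral closures of `F[t]` and of `F[t⁻¹]` in `K`, and the coordinate ring of their
intersection is the integral closure of `F[t, t⁻¹]`. Hence `H¹(C, 𝒪_C)` is the cokernel of the
Čech complex of this covering. -/
noncomputable def genus : ℕ :=
  Module.finrank F
    (integralOver F K {coord F K, (coord F K)⁻¹} ⧸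
      (integralOver F K {coord F K} ⊔ integralOver F K {(coord F K)⁻¹}).comap
        (integralOver F K {coord F K, (coord F K)⁻¹}).subtype)

end FunctionField

variable {F : Type u} [Field F]

/-- `C(F)`: the `F`-rational points of `C`, that is, the places of the function field (the
valuation rings `𝒪 ≠ K` that contain `F`) whose residue field is `F`. -/
def RationalPoint (C : BiquadraticCurve F) : Type u :=
  {O : ValuationSubring C.K // O ≠ ⊤ ∧ (∀ c : F, algebraMap F C.K c ∈ O) ∧
    ∀ y ∈ O, ∃ c : F, O.valuation (y - algebraMap F C.K c) < 1}

/-- The trace of the Frobenius of `C`, `Tr(Frob_C) = q + 1 - #C(𝔽_q)`. -/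
noncomputable def trFrob (C : BiquadraticCurve F) : ℤ :=
  (Nat.card F : ℤ) + 1 - (Nat.card C.RationalPoint : ℤ)

/-- The three intermediate curves of `C → ℙ¹` (which correspond to the three quadratic
subextensions of `K / F(t)`) have genera `g 0`, `g 1`, `g 2`, in some order. -/
def HasGenera (C : BiquadraticCurve F) (g : Fin 3 → ℕ) : Prop :=
  ∃ E : Fin 3 → IntermediateField (RatFunc F) C.K, Function.Injective E ∧
    ∀ i, Module.finrank (RatFunc F) (E i) = 2 ∧ genus F (E i) = g i

/-- Isomorphisms of biquadratic curves: isomorphisms of curves over `F` that lie over an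
automorphism of `ℙ¹`. -/
def Iso (C D : BiquadraticCurve F) : Type u :=
  {e : C.K ≃ₐ[F] D.K // ∃ τ : RatFunc F ≃ₐ[F] RatFunc F,
    ∀ r : RatFunc F, e (algebraMap (RatFunc F) C.K r) = algebraMap (RatFunc F) D.K (τ r)}

def Iso.refl (C : BiquadraticCurve F) : Iso C C :=
  ⟨AlgEquiv.refl, AlgEquiv.refl, fun _ => rfl⟩

def Iso.symm {C D : BiquadraticCurve F} (e : Iso C D) : Iso D C :=
  ⟨e.1.symm, by
    obtain ⟨e, τ, h⟩ := e
    refine ⟨τ.symm, fun r => ?_⟩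
    rw [AlgEquiv.symm_apply_eq, h, AlgEquiv.apply_symm_apply]⟩

def Iso.trans {C D E : BiquadraticCurve F} (e : Iso C D) (e' : Iso D E) : Iso C E :=
  ⟨e.1.trans e'.1, by
    obtain ⟨e, τ, h⟩ := e
    obtain ⟨e', τ', h'⟩ := e'
    refine ⟨τ.trans τ', fun r => ?_⟩
    simp [h, h']⟩

/-- Isomorphy of biquadratic curves. -/
instance isoSetoid (F : Type u) [Field F] : Setoid (BiquadraticCurve F) where
  r C D := Nonempty (Iso C D)
  iseqv := ⟨fun C => ⟨Iso.refl C⟩, fun ⟨e⟩ => ⟨e.symm⟩, fun ⟨e⟩ ⟨e'⟩ => ⟨e.trans e'⟩⟩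

/-- The order of the automorphism group of a biquadratic curve. -/
noncomputable def autCard (C : BiquadraticCurve F) : ℕ := Nat.card (Iso C C)

theorem autCard_eq_of_iso {C D : BiquadraticCurve F} (e : Iso C D) : C.autCard = D.autCard := by
  refine Nat.card_congr
    { toFun := fun a => (e.symm.trans a).trans e
      invFun := fun a => (e.trans a).trans e.symm
      left_inv := fun a => Subtype.ext (AlgEquiv.ext fun x => ?_)
      right_inv := fun a => Subtype.ext (AlgEquiv.ext fun x => ?_) }
  · simp [Iso.trans, Iso.symm]
  · simp [Iso.trans, Iso.symm]

/-- Transport of a rational point along an isomorphism. -/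
noncomputable def RationalPoint.map {C D : BiquadraticCurve F} (e : Iso C D)
    (P : C.RationalPoint) : D.RationalPoint :=
  ⟨P.1.comap (e.1.symm : D.K ≃ₐ[F] C.K).toRingEquiv.toRingHom, by
    obtain ⟨O, h₁, h₂, h₃⟩ := P
    obtain ⟨e, he⟩ := e
    refine ⟨fun h => h₁ ?_, fun c => ?_, fun y hy => ?_⟩
    · rw [eq_top_iff]
      intro x _
      have hx : e x ∈ O.comap (e.symm : D.K ≃ₐ[F] C.K).toRingEquiv.toRingHom := by
        rw [h]; trivial
      simpa using hx
    · simpa using h₂ c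
    · obtain ⟨c, hc⟩ := h₃ (e.symm y) (by simpa using hy)
      refine ⟨c, ?_⟩
      rw [← ValuationSubring.mem_nonunits_iff, ValuationSubring.mem_nonunits_iff_or] at hc ⊢
      simp only [ValuationSubring.mem_comap]
      have key : e.symm (y - algebraMap F D.K c) = e.symm y - algebraMap F C.K c := by simp
      rcases hc with hc | hc
      · left
        rw [← key] at hc
        exact (map_eq_zero_iff _ e.symm.injective).1 hc
      · right
        rw [← key, ← map_inv₀] at hc
        exact hc⟩

theorem trFrob_eq_of_iso {C D : BiquadraticCurve F} (e : Iso C D) : C.trFrob = D.trFrob := by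
  unfold trFrob
  congr 2
  refine Nat.card_congr
    { toFun := RationalPoint.map e
      invFun := RationalPoint.map e.symm
      left_inv := fun P => Subtype.ext (SetLike.ext fun x => ?_)
      right_inv := fun P => Subtype.ext (SetLike.ext fun x => ?_) }
  · simp [RationalPoint.map, Iso.symm]
  · simp [RationalPoint.map, Iso.symm]

/-- The family `𝓑_(g₁,g₂,g₃)(F)`: isomorphism classes of biquadratic curves over `F` whose three
intermediate curves have genera `g₁, g₂, g₃`. -/
def family (F : Type u) [Field F] (g : Fin 3 → ℕ) : Set (Quotient (isoSetoid F)) :=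
  {c | ∃ C : BiquadraticCurve F, ⟦C⟧ = c ∧ C.HasGenera g}

/-- The weight `1 / |Aut C|` of an isomorphism class. -/
noncomputable def weight (c : Quotient (isoSetoid F)) : ℝ :=
  Quotient.lift (fun C : BiquadraticCurve F => (1 : ℝ) / C.autCard)
    (by rintro C D ⟨e⟩; simp only [autCard_eq_of_iso e]) c

/-- `Tr(Frob_C) / √(1 + q)` as a function of the isomorphism class. -/
noncomputable def normalizedTrace (c : Quotient (isoSetoid F)) : ℝ :=
  Quotient.lift (fun C : BiquadraticCurve F => (C.trFrob : ℝ) / √(1 + (Nat.card F : ℝ)))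
    (by rintro C D ⟨e⟩; simp only [trFrob_eq_of_iso e]) c

/-- The `k`-th moment `M_k(q, g₁, g₂, g₃)` of `Tr(Frob_C) / √(1 + q)` over the family, each curve
being counted with weight `1 / |Aut C|`. -/
noncomputable def moment (F : Type u) [Field F] (g : Fin 3 → ℕ) (k : ℕ) : ℝ :=
  (∑ᶠ c ∈ family F g, weight c * normalizedTrace c ^ k) / ∑ᶠ c ∈ family F g, weight c

/-- The law on `{-1, 1, 3}` with weights `3(q+2)/(4(q+3))`, `6/(4(q+3))`, `q/(4(q+3))`. -/
noncomputable def pointLaw (q : ℕ) : MeasureTheory.Measure ℝ :=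
  ENNReal.ofReal (3 * (q + 2) / (4 * (q + 3))) • MeasureTheory.Measure.dirac (-1)
    + ENNReal.ofReal (6 / (4 * (q + 3))) • MeasureTheory.Measure.dirac 1
    + ENNReal.ofReal (q / (4 * (q + 3))) • MeasureTheory.Measure.dirac 3

end BiquadraticCurve

set_option linter.unusedSectionVars false

/-! Geometry. Up to isomorphism a biquadratic cover is obtained from F(t) by adjoining the square
roots z₀, z₁, z₂ of f₁f₂, f₀f₂, f₀f₁, where f₀, f₁, f₂ are squarefree and pairwise coprime
polynomials. A frame consists of such roots with the compatible signs z_i z_k = f_l z_l. For a fixed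
curve D and a fixed automorphism τ of F(t), the frames with prescribed genera form a torsor under
the genus-preserving permutations of the indices times (Fˣ)³ (`card_frames`). Pairs (f, isomorphism
C_f → D) correspond to pairs (τ, frame of D) (`card_sigma_iso`), so the number of triples f with C_f
≅ D is a constant divided by |Aut D| (`card_mul_autCard`). The weighted average over the family is
therefore the plain average over triples (`family_eq_and_moment_eq`). The curve z² = m has genus
⌈deg m / 2⌉ − 1 (`genus_eq_of_sq`); hence the genera determine the degrees of the f_i, except that
one of them may be smaller by one, which is ramification at infinity
(`hasDegrees_iff_exists_mem_triples`).

Traces. −Tr(Frob) is a sum of local traces over the q + 1 points x of ℙ¹(F) (`trFrob_eq`,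
`card_rationalFibre`). A local trace depends only on the component that vanishes at x, if any, and
on quadratic characters of the values of the other components. A k-th power expands into products,
over at most k points, of indicators of ramification types and characters (`placeTrace_pow`).
Prescribed zeros are divided out (`sum_triples_ramAt`), which leaves sums of multiplicative
characters over triples without zeros in a small set T.

Analysis. For a nontrivial character the complete sum over all polynomials of large degree vanishes
(`sum_polyChar_eq_zero`); a sieve passes to squarefree polynomials prime to the other components.
For the trivial character the same sieve is applied to differences of consecutive degrees: the
density of triples hardly depends on the degrees, and classifying by the vanishing component at x
(`tripleSum_insert`) then forces a factor q/(q + 3) per excluded point. In the limit the points are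
independent, unramified with probability q/(q + 3) and of each of the three ramified types with
probability 1/(q + 3). The resulting law of a local trace is that of the X_i
(`integral_pow_pointLaw`).

Uniformity in q. The loss of the sieve is a count of smooth polynomials, which on average over the
other two components is at most y⁻ᵈ up to constants, with y < 1 as close to 1 as desired and
independent of q (`abs_tripleSum_sub_le`). With m the smallest degree, the relative error is of
order (q + 1)ᵏ qᵏ (y⁻¹/q)ᵐ. Dividing by the number of triples requires a lower bound proportional to
the number of all triples of polynomials (`card_triples_empty_ge_of_nine_le`,
`card_triples_empty_ge_of_lt_nine`). Where m ≤ k, or q and m are both bounded, a trivial bound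
suffices. -/

section Development

open Polynomial Finset
open scoped Classical

/-! ### Polynomials over a finite field and the recursions of the sieve. -/

section PolynomialCounting

variable {F : Type*} [Field F] [Fintype F]

local notation "q" => (Fintype.card F : ℝ)

theorem finite_setOf_natDegree_le (n : ℕ) : {f : F[X] | f.natDegree ≤ n}.Finite := by
  have h : Finite (degreeLT F (n + 1)) := Finite.of_equiv _ (degreeLTEquiv F (n + 1)).symm.toEquiv
  refine (Set.toFinite (degreeLT F (n + 1) : Set F[X])).subset fun f hf => ?_
  rw [SetLike.mem_coe, mem_degreeLT]
  exact lt_of_le_of_lt degree_le_natDegree (by exact_mod_cast Nat.lt_succ_of_le hf)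

/-- The polynomials of exact degree `n`. -/
noncomputable def polys (F : Type*) [Field F] [Fintype F] (n : ℕ) : Finset F[X] :=
  Set.Finite.toFinset (s := {f : F[X] | f ≠ 0 ∧ f.natDegree = n})
    ((finite_setOf_natDegree_le n).subset fun _ h => h.2.le)

/-- The monic polynomials of degree `n`. -/
noncomputable def monics (F : Type*) [Field F] [Fintype F] (n : ℕ) : Finset F[X] :=
  Set.Finite.toFinset (s := {f : F[X] | f.Monic ∧ f.natDegree = n})
    ((finite_setOf_natDegree_le n).subset fun _ h => h.2.le)

@[simp] theorem mem_polys {n : ℕ} {f : F[X]} : f ∈ polys F n ↔ f ≠ 0 ∧ f.natDegree = n := by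
  simp [polys]

@[simp] theorem mem_monics {n : ℕ} {f : F[X]} : f ∈ monics F n ↔ f.Monic ∧ f.natDegree = n := by
  simp [monics]

theorem card_monics (n : ℕ) : (monics F n).card = Fintype.card F ^ n := by
  have e : monics F n ≃ (Fin n → F) :=
    (Equiv.subtypeEquivRight fun f => by simp).trans
      ((monicEquivDegreeLT (R := F) n).trans (degreeLTEquiv F n).toEquiv)
  rw [← Fintype.card_coe, Fintype.card_congr e]
  simp

theorem sum_polys {M : Type*} [AddCommMonoid M] (n : ℕ) (φ : F[X] → M) :
    ∑ f ∈ polys F n, φ f = ∑ u : Fˣ, ∑ f ∈ monics F n, φ (C (u : F) * f) := by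
  rw [← Finset.sum_product']
  symm
  refine Finset.sum_bij (fun p _ => C (p.1 : F) * p.2) ?_ ?_ ?_ (fun _ _ => rfl)
  · rintro ⟨u, f⟩ h
    simp only [mem_product, mem_univ, mem_monics, true_and] at h
    simp only [mem_polys]
    exact ⟨mul_ne_zero (C_ne_zero.2 u.ne_zero) h.1.ne_zero, by
      rw [natDegree_C_mul u.ne_zero, h.2]⟩
  · rintro ⟨u, f⟩ h ⟨v, g⟩ h' e
    simp only [mem_product, mem_univ, mem_monics, true_and] at h h' e
    have hl := congrArg leadingCoeff e
    rw [leadingCoeff_mul, leadingCoeff_mul, leadingCoeff_C, leadingCoeff_C, h.1.leadingCoeff,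
      h'.1.leadingCoeff, mul_one, mul_one] at hl
    have huv : u = v := Units.ext hl
    subst huv
    rw [mul_right_inj' (C_ne_zero.2 u.ne_zero)] at e
    rw [e]
  · intro f hf
    rw [mem_polys] at hf
    have hl : f.leadingCoeff ≠ 0 := leadingCoeff_ne_zero.2 hf.1
    refine ⟨(Units.mk0 _ hl, C (f.leadingCoeff)⁻¹ * f), ?_, ?_⟩
    · simp only [mem_product, mem_univ, mem_monics, true_and]
      refine ⟨?_, by rw [natDegree_C_mul (inv_ne_zero hl), hf.2]⟩
      rw [Monic, leadingCoeff_mul, leadingCoeff_C, inv_mul_cancel₀ hl]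
    · simp [← mul_assoc, ← C_mul, mul_inv_cancel₀ hl]

theorem card_units_cast : (Fintype.card Fˣ : ℝ) = q - 1 := by
  rw [Fintype.card_units, Nat.cast_sub Fintype.card_pos]; simp

theorem card_polys (n : ℕ) : ((polys F n).card : ℝ) = (q - 1) * q ^ n := by
  have := sum_polys (F := F) n (fun _ => (1 : ℝ))
  simp only [sum_const, nsmul_eq_mul, mul_one, card_monics, card_univ] at this
  rw [this, card_units_cast]; push_cast; ring

/-- The weighted number of squarefree polynomials of degree `n` that are not divisible by any
element of `S`. -/
noncomputable def sieveSum (ψ : F[X] →* ℝ) (S : Finset F[X]) (n : ℕ) : ℝ :=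
  ∑ f ∈ polys F n with Squarefree f ∧ ∀ p ∈ S, ¬ p ∣ f, ψ f

theorem isRelPrime_of_not_dvd {p f : F[X]} (hp : Irreducible p) (h : ¬ p ∣ f) :
    IsRelPrime p f := (hp.coprime_iff_not_dvd.2 h).isRelPrime

theorem not_dvd_of_monic_irreducible {p r : F[X]} (hp : p.Monic) (hpi : Irreducible p)
    (hr : r.Monic) (hri : Irreducible r) (h : r ≠ p) : ¬ r ∣ p := fun hd =>
  h (eq_of_monic_of_associated hr hp (hri.associated_of_dvd hpi hd))

/-- A squarefree multiple of p is p g with g squarefree and prime to p, so g satisfies the stronger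
condition. In generating functions, adding p to S divides by 1 + ψ(p) t^{deg p}. -/
theorem sieveSum_insert (ψ : F[X] →* ℝ) (S : Finset F[X]) {p : F[X]}
    (hS : ∀ r ∈ S, r.Monic ∧ Irreducible r) (hp : p.Monic) (hpi : Irreducible p) (hpS : p ∉ S)
    (n : ℕ) :
    sieveSum ψ S n = sieveSum ψ (insert p S) n +
      if p.natDegree ≤ n then ψ p * sieveSum ψ (insert p S) (n - p.natDegree) else 0 := by
  have hsplit : sieveSum ψ S n = sieveSum ψ (insert p S) n +
      ∑ f ∈ polys F n with (Squarefree f ∧ ∀ r ∈ S, ¬ r ∣ f) ∧ p ∣ f, ψ f := by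
    unfold sieveSum
    rw [← Finset.sum_filter_add_sum_filter_not _ (fun f => p ∣ f), add_comm]
    congr 1
    · rw [Finset.filter_filter]
      refine Finset.sum_congr (Finset.filter_congr fun f _ => ?_) fun _ _ => rfl
      simp only [Finset.forall_mem_insert]; tauto
    · rw [Finset.filter_filter]
  rw [hsplit]
  congr 1
  split_ifs with hn
  · unfold sieveSum
    rw [Finset.mul_sum]
    symm
    refine Finset.sum_bij (fun f _ => p * f) ?_ ?_ ?_ ?_
    · intro f hf
      simp only [mem_filter, mem_polys, Finset.forall_mem_insert] at hf ⊢
      obtain ⟨⟨hf0, hfd⟩, hsq, hpf, hSf⟩ := hf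
      refine ⟨⟨mul_ne_zero hp.ne_zero hf0, ?_⟩, ⟨?_, ?_⟩, dvd_mul_right _ _⟩
      · rw [natDegree_mul hp.ne_zero hf0, hfd]; omega
      · exact squarefree_mul_iff.2 ⟨isRelPrime_of_not_dvd hpi hpf, hpi.squarefree, hsq⟩
      · intro r hr hd
        rcases (hS r hr).2.prime.dvd_or_dvd hd with h | h
        · exact not_dvd_of_monic_irreducible hp hpi (hS r hr).1 (hS r hr).2
            (fun e => hpS (e ▸ hr)) h
        · exact hSf r hr h
    · intro f _ g _ h
      exact mul_left_cancel₀ hp.ne_zero h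
    · intro f hf
      simp only [mem_filter, mem_polys] at hf
      obtain ⟨⟨hf0, hfd⟩, ⟨hsq, hSf⟩, g, rfl⟩ := hf
      have hg0 : g ≠ 0 := right_ne_zero_of_mul hf0
      refine ⟨g, ?_, rfl⟩
      simp only [mem_filter, mem_polys, Finset.forall_mem_insert]
      obtain ⟨h1, _, h3⟩ := squarefree_mul_iff.1 hsq
      refine ⟨⟨hg0, ?_⟩, h3, ?_, fun r hr hd => hSf r hr (hd.mul_left _)⟩
      · rw [natDegree_mul hp.ne_zero hg0] at hfd; omega
      · intro hd
        exact hpi.not_isUnit (h1 dvd_rfl hd)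
    · intro f _
      rw [map_mul]
  · refine Finset.sum_eq_zero fun f hf => ?_
    simp only [mem_filter, mem_polys] at hf
    exact absurd (natDegree_le_of_dvd hf.2.2 hf.1.1) (by omega)

/-- The number of monic polynomials of degree `n` all of whose irreducible monic factors belong
to `S`. -/
noncomputable def smoothCount (S : Finset F[X]) (n : ℕ) : ℕ :=
  #{b ∈ monics F n | ∀ p : F[X], p.Monic → Irreducible p → p ∣ b → p ∈ S}

/-- After dividing by p the quotient may still contain p, so here the generating function is divided
by 1 − t^{deg p}. This is the recursion of `sieveSum_insert` with its sign reversed, which makes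
`smoothCount` a majorant for the sieve. -/
theorem smoothCount_insert (S : Finset F[X]) {p : F[X]}
    (hp : p.Monic) (hpi : Irreducible p) (hpS : p ∉ S) (n : ℕ) :
    smoothCount (insert p S) n = smoothCount S n +
      if p.natDegree ≤ n then smoothCount (insert p S) (n - p.natDegree) else 0 := by
  unfold smoothCount
  rw [← Finset.card_filter_add_card_filter_not (fun f => p ∣ f), add_comm]
  congr 1
  · rw [Finset.filter_filter]
    refine congrArg _ (Finset.filter_congr fun b _ => ⟨fun h r hr hri hd => ?_, fun h => ⟨fun r hr hri hd => ?_, fun hd => ?_⟩⟩)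
    · exact (Finset.mem_insert.1 (h.1 r hr hri hd)).resolve_left fun e => h.2 (e ▸ hd)
    · exact Finset.mem_insert_of_mem (h r hr hri hd)
    · exact hpS (h p hp hpi hd)
  · split_ifs with hn
    · symm
      refine Finset.card_bij (fun f _ => p * f) ?_ ?_ ?_
      · intro f hf
        simp only [mem_filter, mem_monics] at hf ⊢
        obtain ⟨⟨hf0, hfd⟩, hf⟩ := hf
        refine ⟨⟨⟨hp.mul hf0, ?_⟩, ?_⟩, dvd_mul_right _ _⟩
        · rw [hp.natDegree_mul hf0, hfd]; omega
        · intro r hr hri hd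
          rcases hri.prime.dvd_or_dvd hd with h | h
          · by_cases e : r = p
            · simp [e]
            · exact absurd h (not_dvd_of_monic_irreducible hp hpi hr hri e)
          · exact hf r hr hri h
      · intro f _ g _ h
        exact mul_left_cancel₀ hp.ne_zero h
      · intro f hf
        simp only [mem_filter, mem_monics] at hf
        obtain ⟨⟨⟨hf0, hfd⟩, hSf⟩, g, rfl⟩ := hf
        have hg := hp.of_mul_monic_left hf0
        refine ⟨g, ?_, rfl⟩
        simp only [mem_filter, mem_monics]
        refine ⟨⟨hg, ?_⟩, fun r hr hri hd => hSf r hr hri (hd.mul_left _)⟩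
        rw [hp.natDegree_mul hg] at hfd; omega
    · rw [Finset.card_eq_zero, Finset.filter_eq_empty_iff]
      intro b hb hd
      simp only [mem_filter, mem_monics] at hb
      exact absurd (natDegree_le_of_dvd hd hb.1.1.ne_zero) (by omega)

theorem smoothCount_empty (n : ℕ) : smoothCount (∅ : Finset F[X]) n = if n = 0 then 1 else 0 := by
  unfold smoothCount
  split_ifs with h
  · subst h
    rw [Finset.card_eq_one]
    refine ⟨1, Finset.ext fun b => ?_⟩
    simp only [mem_filter, mem_monics, mem_singleton, notMem_empty, imp_false]
    constructor
    · rintro ⟨⟨h1, h2⟩, -⟩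
      exact h1.natDegree_eq_zero.1 h2
    · rintro rfl
      exact ⟨⟨monic_one, natDegree_one⟩, fun p _ hpi hd => hpi.not_isUnit (isUnit_of_dvd_one hd)⟩
  · rw [Finset.card_eq_zero, Finset.filter_eq_empty_iff]
    intro b hb hd
    rw [mem_monics] at hb
    obtain ⟨g, hg, hgi, hgb⟩ := exists_monic_irreducible_factor b
      (fun hu => h (hb.2 ▸ natDegree_eq_zero_of_isUnit hu))
    exact absurd (hd g hg hgi hgb) (by simp)

/-- One step of the sieve: if `s = s' + θ · (s' shifted by d)` with `|θ| ≤ 1`, a majorant for `s`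
gives one for `s'`. -/
theorem sieve_step {s s' β β' c : ℕ → ℝ} {θ : ℝ} {d : ℕ} (hd : 1 ≤ d) (hθ : |θ| ≤ 1)
    (hs : ∀ n, s n = s' n + if d ≤ n then θ * s' (n - d) else 0)
    (hβ : ∀ n, β' n = β n + if d ≤ n then β' (n - d) else 0)
    (h : ∀ n, |s n| ≤ ∑ p ∈ antidiagonal n, β p.1 * c p.2) (n : ℕ) :
    |s' n| ≤ ∑ p ∈ antidiagonal n, β' p.1 * c p.2 := by
  induction n using Nat.strong_induction_on with
  | _ n ih =>
  have h1 : s' n = s n - if d ≤ n then θ * s' (n - d) else 0 := by rw [hs]; ring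
  -- The majorant obeys the recursion of s' with positive signs only, because convolution with c
  -- commutes with the shift by d.
  have h2 : ∑ p ∈ antidiagonal n, β' p.1 * c p.2 = ∑ p ∈ antidiagonal n, β p.1 * c p.2 +
      if d ≤ n then ∑ p ∈ antidiagonal (n - d), β' p.1 * c p.2 else 0 := by
    rw [Finset.Nat.sum_antidiagonal_eq_sum_range_succ (fun i j => β' i * c j),
      Finset.Nat.sum_antidiagonal_eq_sum_range_succ (fun i j => β i * c j),
      Finset.sum_congr rfl (fun i _ => by rw [hβ i, add_mul])]
    rw [Finset.sum_add_distrib]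
    congr 1
    split_ifs with hn
    · rw [Finset.Nat.sum_antidiagonal_eq_sum_range_succ (fun i j => β' i * c j)]
      obtain ⟨m, rfl⟩ := Nat.exists_eq_add_of_le hn
      rw [show (d + m).succ = d + (m + 1) by omega, Finset.sum_range_add,
        Finset.sum_eq_zero (fun i hi => by rw [if_neg (by simpa using hi)]; ring), zero_add]
      rw [show (d + m - d).succ = m + 1 by omega]
      refine Finset.sum_congr rfl fun i hi => ?_
      rw [if_pos (by omega)]
      congr 2 <;> omega
    · refine Finset.sum_eq_zero fun i hi => ?_
      rw [if_neg (by rw [Finset.mem_range] at hi; omega), zero_mul]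
  rw [h1, h2]
  refine (abs_sub _ _).trans (add_le_add (h n) ?_)
  split_ifs with hn
  · rw [abs_mul]
    exact (mul_le_of_le_one_left (abs_nonneg _) hθ).trans (ih _ (by omega))
  · simp

end PolynomialCounting

/-! ### The sieve inequality and averages of smooth counts. -/

section SmoothPolynomials

variable {F : Type*} [Field F] [Fintype F]

local notation "q" => (Fintype.card F : ℝ)

/-- The monic irreducible factors of a polynomial. -/
noncomputable def primesOf (h : F[X]) : Finset F[X] :=
  (UniqueFactorizationMonoid.normalizedFactors h).toFinset

theorem mem_primesOf {h p : F[X]} (hh : h ≠ 0) :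
    p ∈ primesOf h ↔ Irreducible p ∧ p.Monic ∧ p ∣ h := by
  rw [primesOf, Multiset.mem_toFinset, Polynomial.mem_normalizedFactors_iff hh]

theorem isCoprime_iff_forall_primesOf {h f : F[X]} (hh : h ≠ 0) :
    IsCoprime f h ↔ ∀ p ∈ primesOf h, ¬ p ∣ f := by
  constructor
  · intro hc p hp hpf
    rw [mem_primesOf hh] at hp
    exact hp.1.not_isUnit (hc.isUnit_of_dvd' hpf hp.2.2)
  · intro H
    rw [← isRelPrime_iff_isCoprime]
    intro d hdf hdh
    by_contra hu
    obtain ⟨g, hg, hgi, hgd⟩ := exists_monic_irreducible_factor d hu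
    exact H g ((mem_primesOf hh).2 ⟨hgi, hg, hgd.trans hdh⟩) (hgd.trans hdf)

/-- A sieve bound for sums over squarefree polynomials; `κ` allows differences of consecutive
sums. -/
theorem abs_sieveSum_le (ψ : F[X] →* ℝ) (hψ : ∀ f, |ψ f| ≤ 1) (κ : ℝ) (c : ℕ → ℝ)
    (hc : ∀ n, |sieveSum ψ ∅ n - κ * (if n = 0 then 0 else sieveSum ψ ∅ (n - 1))| ≤ c n)
    (S : Finset F[X]) (hS : ∀ r ∈ S, r.Monic ∧ Irreducible r) (n : ℕ) :
    |sieveSum ψ S n - κ * (if n = 0 then 0 else sieveSum ψ S (n - 1))| ≤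
      ∑ p ∈ antidiagonal n, (smoothCount S p.1 : ℝ) * c p.2 := by
  induction S using Finset.induction_on generalizing n with
  | empty =>
    refine (hc n).trans (le_of_eq ?_)
    rw [Finset.Nat.sum_antidiagonal_eq_sum_range_succ
      (fun i j => (smoothCount (∅ : Finset F[X]) i : ℝ) * c j), Finset.sum_range_succ']
    simp [smoothCount_empty]
  | insert p S hp ih =>
    have hpS := hS p (Finset.mem_insert_self _ _)
    have hS' : ∀ r ∈ S, r.Monic ∧ Irreducible r := fun r hr => hS r (Finset.mem_insert_of_mem hr)
    have hd : 1 ≤ p.natDegree := hpS.2.natDegree_pos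
    refine sieve_step (d := p.natDegree) (θ := ψ p)
      (s := fun n => sieveSum ψ S n - κ * (if n = 0 then 0 else sieveSum ψ S (n - 1)))
      (s' := fun n => sieveSum ψ (insert p S) n -
        κ * (if n = 0 then 0 else sieveSum ψ (insert p S) (n - 1)))
      (β := fun n => (smoothCount S n : ℝ)) (β' := fun n => (smoothCount (insert p S) n : ℝ))
      hd (hψ p) ?_ ?_ (fun n => ih hS' n) n
    · intro n
      rw [sieveSum_insert ψ S hS' hpS.1 hpS.2 hp n]
      rcases Nat.eq_zero_or_pos n with rfl | hn
      · simp [show ¬ p.natDegree ≤ 0 by omega]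
      · rw [if_neg hn.ne', if_neg hn.ne', sieveSum_insert ψ S hS' hpS.1 hpS.2 hp (n - 1)]
        -- The case n = deg p is separate: the shifted sequence is then evaluated at 0, where the
        -- subtracted term is switched off.
        rcases lt_trichotomy n p.natDegree with h | h | h
        · rw [if_neg (by omega), if_neg (by omega), if_neg (by omega)]; ring
        · rw [if_pos h.ge, if_neg (by omega), if_pos h.ge, if_pos (by omega)]; ring
        · rw [if_pos h.le, if_pos (by omega), if_pos h.le, if_neg (by omega),
            show n - 1 - p.natDegree = n - p.natDegree - 1 by omega]; ring
    · intro n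
      rw [smoothCount_insert S hpS.1 hpS.2 hp n]
      push_cast; rfl

theorem exists_mul_eq_of_factors_mem {S S' : Finset F[X]} (b : F[X]) (hb : b.Monic)
    (h : ∀ p : F[X], p.Monic → Irreducible p → p ∣ b → p ∈ S ∪ S') :
    ∃ b₁ b₂ : F[X], b₁.Monic ∧ b₂.Monic ∧ b = b₁ * b₂ ∧
      (∀ p : F[X], p.Monic → Irreducible p → p ∣ b₁ → p ∈ S) ∧
      (∀ p : F[X], p.Monic → Irreducible p → p ∣ b₂ → p ∈ S') := by
  induction hn : b.natDegree using Nat.strong_induction_on generalizing b with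
  | _ n ih =>
  by_cases hu : IsUnit b
  · refine ⟨1, 1, monic_one, monic_one, ?_, ?_, ?_⟩
    · rw [mul_one, hb.eq_one_of_isUnit hu]
    all_goals exact fun p _ hi hd => absurd (isUnit_of_dvd_one hd) hi.not_isUnit
  · obtain ⟨p, hp, hpi, b', rfl⟩ := exists_monic_irreducible_factor b hu
    have hb' := hp.of_mul_monic_left hb
    rw [hp.natDegree_mul hb'] at hn
    have := hpi.natDegree_pos
    obtain ⟨b₁, b₂, h1, h2, rfl, h3, h4⟩ := ih b'.natDegree (by omega) b' hb'
      (fun r hr hri hd => h r hr hri (hd.mul_left _)) rfl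
    have key : ∀ (c : F[X]) (A : Finset F[X]), p ∈ A →
        (∀ r : F[X], r.Monic → Irreducible r → r ∣ c → r ∈ A) →
        ∀ r : F[X], r.Monic → Irreducible r → r ∣ p * c → r ∈ A := by
      intro c A hpA hc r hr hri hd
      rcases hri.prime.dvd_or_dvd hd with h | h
      · by_cases e : r = p
        · rwa [e]
        · exact absurd h (not_dvd_of_monic_irreducible hp hpi hr hri e)
      · exact hc r hr hri h
    rcases Finset.mem_union.1 (h p hp hpi (dvd_mul_right _ _)) with hS | hS
    · exact ⟨p * b₁, b₂, hp.mul h1, h2, by ring, key b₁ S hS h3, h4⟩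
    · exact ⟨b₁, p * b₂, h1, hp.mul h2, by ring, h3, key b₂ S' hS h4⟩

/-- A prime in both S and S' may be assigned to either factor, so this is only an inequality. -/
theorem smoothCount_union_le (S S' : Finset F[X]) (n : ℕ) :
    smoothCount (S ∪ S') n ≤ ∑ p ∈ antidiagonal n, smoothCount S p.1 * smoothCount S' p.2 := by
  simp only [smoothCount]
  simp_rw [← Finset.card_product]
  rw [← Finset.card_sigma]
  refine le_trans (Finset.card_le_card ?_) (Finset.card_image_le (f := fun t => t.2.1 * t.2.2))
  intro b hb
  simp only [mem_filter, mem_monics] at hb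
  obtain ⟨b₁, b₂, h1, h2, rfl, h3, h4⟩ := exists_mul_eq_of_factors_mem b hb.1.1 hb.2
  refine Finset.mem_image.2 ⟨⟨(b₁.natDegree, b₂.natDegree), (b₁, b₂)⟩, ?_, rfl⟩
  simp only [mem_sigma, HasAntidiagonal.mem_antidiagonal, mem_product, mem_filter, mem_monics]
  exact ⟨by rw [← hb.1.2, h1.natDegree_mul h2], ⟨⟨h1, trivial⟩, h3⟩, ⟨h2, trivial⟩, h4⟩

/-- A product of linear factors from S is determined by its exponents, each at most n. The recursion
proves this without naming the exponents. -/
theorem smoothCount_le_of_linear (S : Finset F[X])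
    (hS : ∀ r ∈ S, r.Monic ∧ Irreducible r ∧ r.natDegree = 1) (n : ℕ) :
    smoothCount S n ≤ (n + 1) ^ S.card := by
  induction S using Finset.induction_on generalizing n with
  | empty => rw [smoothCount_empty]; split_ifs <;> simp
  | insert p S hp ih =>
    have hpS := hS p (Finset.mem_insert_self _ _)
    have hrec := smoothCount_insert S hpS.1 hpS.2.1 hp
    rw [hpS.2.2] at hrec
    have ih' := ih fun r hr => hS r (Finset.mem_insert_of_mem hr)
    rw [Finset.card_insert_of_notMem hp]
    have hle : ∀ m ≤ n, smoothCount (insert p S) m ≤ (m + 1) * (n + 1) ^ S.card := by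
      intro m
      induction m with
      | zero =>
        intro _
        rw [hrec 0, if_neg (by omega)]
        refine (ih' 0).trans ?_
        simpa using Nat.one_le_pow _ _ (Nat.succ_pos n)
      | succ m ihm =>
        intro hm
        rw [hrec, if_pos (by omega), Nat.add_sub_cancel]
        have h1 := ihm (by omega)
        have h2 := (ih' (m + 1)).trans (Nat.pow_le_pow_left (show m + 1 + 1 ≤ n + 1 by omega) _)
        linarith
    rw [pow_succ, mul_comm]
    exact hle n le_rfl

/-- The number of pairs `(f, b)` of monic polynomials of degrees `m`, `j` such that all prime
factors of `b` divide `f`. -/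
noncomputable def smoothPairs (F : Type*) [Field F] [Fintype F] (m j : ℕ) : Finset (F[X] × F[X]) :=
  {t ∈ monics F m ×ˢ monics F j | ∀ p : F[X], p.Monic → Irreducible p → p ∣ t.2 → p ∣ t.1}

/-- Averaging over f turns the loss of the sieve into a count of pairs, for which a descent by the
gcd is available. -/
theorem sum_smoothCount_primesOf (m j : ℕ) :
    ∑ f ∈ monics F m, smoothCount (primesOf f) j = (smoothPairs F m j).card := by
  unfold smoothPairs smoothCount
  rw [Finset.card_filter, Finset.sum_product]
  refine Finset.sum_congr rfl fun f hf => ?_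
  rw [Finset.card_filter]
  refine Finset.sum_congr rfl fun b _ => ?_
  rw [mem_monics] at hf
  refine if_congr (forall_congr' fun p => forall_congr' fun hp => forall_congr' fun hi =>
    forall_congr' fun hd => ?_) rfl rfl
  rw [mem_primesOf hf.1.ne_zero]
  exact ⟨fun h => h.2.2, fun h => ⟨hi, hp, h⟩⟩

theorem exists_monic_gcd (f b : F[X]) (hf : f ≠ 0) :
    ∃ g : F[X], g.Monic ∧ g ∣ f ∧ g ∣ b ∧ ∀ p, p ∣ f → p ∣ b → p ∣ g := by
  have h0 : EuclideanDomain.gcd f b ≠ 0 := fun h => hf (EuclideanDomain.gcd_eq_zero_iff.1 h).1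
  refine ⟨normalize (EuclideanDomain.gcd f b), monic_normalize h0, ?_, ?_, fun p h1 h2 => ?_⟩
  · exact normalize_dvd_iff.2 (EuclideanDomain.gcd_dvd_left _ _)
  · exact normalize_dvd_iff.2 (EuclideanDomain.gcd_dvd_right _ _)
  · exact dvd_normalize_iff.2 (EuclideanDomain.dvd_gcd h1 h2)

/-- Take out g = gcd(f, b), so f = g f' and b = g b'. A prime factor of b' divides both f and b,
hence g; so (g, b') is again such a pair, of degrees a and j − a, while f' is arbitrary. As b is not
constant, neither is g. -/
theorem card_smoothPairs_le (m j : ℕ) (hj : 1 ≤ j) :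
    (smoothPairs F m j).card ≤ ∑ a ∈ Icc 1 m with a ≤ j,
      Fintype.card F ^ (m - a) * (smoothPairs F a (j - a)).card := by
  simp_rw [← card_monics, ← Finset.card_product]
  rw [← Finset.card_sigma]
  refine le_trans (Finset.card_le_card ?_)
    (Finset.card_image_le (f := fun t => (t.2.2.1 * t.2.1, t.2.2.1 * t.2.2.2)))
  rintro ⟨f, b⟩ h
  simp only [smoothPairs, mem_filter, mem_product, mem_monics] at h
  obtain ⟨⟨⟨hf, hfm⟩, hb, hbj⟩, hs⟩ := h
  obtain ⟨g, hg, ⟨f', rfl⟩, ⟨b', rfl⟩, hgp⟩ := exists_monic_gcd f b hf.ne_zero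
  have hf' := hg.of_mul_monic_left hf
  have hb' := hg.of_mul_monic_left hb
  rw [hg.natDegree_mul hf'] at hfm
  rw [hg.natDegree_mul hb'] at hbj
  have hg1 : 1 ≤ g.natDegree := by
    obtain ⟨p, hp, hpi, hpb⟩ := exists_monic_irreducible_factor (g * b') (fun hu => by
      have := natDegree_eq_zero_of_isUnit hu
      rw [hg.natDegree_mul hb'] at this; omega)
    exact hpi.natDegree_pos.trans_le
      (natDegree_le_of_dvd (hgp p (hs p hp hpi hpb) hpb) hg.ne_zero)
  refine Finset.mem_image.2 ⟨⟨g.natDegree, f', g, b'⟩, ?_, rfl⟩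
  simp only [smoothPairs, mem_sigma, mem_filter, mem_product, mem_monics, mem_Icc]
  refine ⟨⟨⟨hg1, by omega⟩, by omega⟩, ⟨hf', by omega⟩, ⟨⟨hg, trivial⟩, hb', by omega⟩, ?_⟩
  intro p hp hpi hd
  exact hgp p (hs p hp hpi (hd.mul_left _)) (hd.mul_left _)

/-- On average over f there are O(x⁻ʲ) smooth companions of degree j, uniformly in q, for any fixed
x < 1. -/
theorem card_smoothPairs_le_prod {x : ℝ} (hx : 0 < x) (hx1 : x < 1) (m j : ℕ) :
    ((smoothPairs F m j).card : ℝ) ≤ q ^ m * (∏ i ∈ range m, (1 - x ^ (i + 1))⁻¹) * x⁻¹ ^ j := by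
  have hP : ∀ i, 0 < 1 - x ^ (i + 1) := fun i => by
    have := pow_lt_one₀ hx.le hx1 (Nat.succ_ne_zero i); rw [Nat.succ_eq_add_one] at this; linarith
  have hq : 0 < q := by exact_mod_cast Fintype.card_pos
  have hPm : ∀ m, 1 ≤ ∏ i ∈ range m, (1 - x ^ (i + 1))⁻¹ := fun m => by
    refine Finset.prod_induction _ (fun y => 1 ≤ y) (fun a b ha hb => one_le_mul_of_one_le_of_one_le ha hb)
      le_rfl fun i _ => ?_
    exact (one_le_inv₀ (hP i)).2 (by have := pow_pos hx (i + 1); linarith)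
  induction j using Nat.strong_induction_on generalizing m with
  | _ j ih =>
  rcases Nat.eq_zero_or_pos j with rfl | hj
  · have h1 : (smoothPairs F m 0).card ≤ Fintype.card F ^ m := by
      refine (Finset.card_filter_le _ _).trans ?_
      rw [Finset.card_product, card_monics, card_monics, pow_zero, mul_one]
    have h2 : ((smoothPairs F m 0).card : ℝ) ≤ q ^ m := by exact_mod_cast h1
    rw [pow_zero, mul_one]
    exact h2.trans (le_mul_of_one_le_right (by positivity) (hPm m))
  · have h1 : ((smoothPairs F m j).card : ℝ) ≤ ∑ a ∈ Icc 1 m with a ≤ j,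
        q ^ (m - a) * ((smoothPairs F a (j - a)).card : ℝ) := by
      exact_mod_cast card_smoothPairs_le (F := F) m j hj
    refine h1.trans ?_
    have h2 : ∀ a ∈ (Icc 1 m).filter (· ≤ j), q ^ (m - a) * ((smoothPairs F a (j - a)).card : ℝ) ≤
        q ^ m * x⁻¹ ^ j * (x ^ a * ∏ i ∈ range a, (1 - x ^ (i + 1))⁻¹) := by
      intro a ha
      simp only [mem_filter, mem_Icc] at ha
      refine (mul_le_mul_of_nonneg_left (ih (j - a) (by omega) a) (by positivity)).trans
        (le_of_eq ?_)
      have e1 : q ^ m = q ^ (m - a) * q ^ a := by rw [← pow_add]; congr 1; omega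
      have e2 : x⁻¹ ^ j = x⁻¹ ^ (j - a) * x⁻¹ ^ a := by rw [← pow_add]; congr 1; omega
      have e3 : x⁻¹ ^ a * x ^ a = 1 := by rw [← mul_pow, inv_mul_cancel₀ hx.ne', one_pow]
      rw [e1, e2]
      linear_combination (-(q ^ (m - a) * q ^ a * x⁻¹ ^ (j - a) *
        ∏ i ∈ range a, (1 - x ^ (i + 1))⁻¹)) * e3
    refine (Finset.sum_le_sum h2).trans ?_
    rw [← Finset.mul_sum]
    have h3 : ∑ a ∈ Icc 1 m with a ≤ j, x ^ a * ∏ i ∈ range a, (1 - x ^ (i + 1))⁻¹ ≤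
        ∑ a ∈ Icc 1 m, x ^ a * ∏ i ∈ range a, (1 - x ^ (i + 1))⁻¹ :=
      Finset.sum_le_sum_of_subset_of_nonneg (Finset.filter_subset _ _) fun a _ _ =>
        mul_nonneg (by positivity) (zero_le_one.trans (hPm a))
    -- With P_a the partial product, x^a P_a = P_a − P_{a−1}, so the sum telescopes; this is why the
    -- induction closes with exactly this product.
    have h4 : ∀ m, ∑ a ∈ Icc 1 m, x ^ a * ∏ i ∈ range a, (1 - x ^ (i + 1))⁻¹ =
        ∏ i ∈ range m, (1 - x ^ (i + 1))⁻¹ - 1 := by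
      intro m
      induction m with
      | zero => simp
      | succ m ihm =>
        rw [Finset.sum_Icc_succ_top (by omega), ihm, Finset.prod_range_succ]
        have := (hP m).ne'
        field_simp
        ring
    calc q ^ m * x⁻¹ ^ j * ∑ a ∈ Icc 1 m with a ≤ j, x ^ a * ∏ i ∈ range a, (1 - x ^ (i + 1))⁻¹
        ≤ q ^ m * x⁻¹ ^ j * ∏ i ∈ range m, (1 - x ^ (i + 1))⁻¹ :=
          mul_le_mul_of_nonneg_left (h3.trans (by rw [h4]; linarith)) (by positivity)
      _ = _ := by ring

/-- (1 − u)⁻¹ = 1 + u/(1 − u) ≤ exp(u/(1 − u)), and the exponents are dominated by a geometric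
series. The bound is free of m. -/
theorem prod_inv_one_sub_pow_le {x : ℝ} (hx : 0 < x) (hx1 : x < 1) (m : ℕ) :
    ∏ i ∈ range m, (1 - x ^ (i + 1))⁻¹ ≤ Real.exp ((1 - x)⁻¹ * (1 - x)⁻¹) := by
  have h1x : 0 < 1 - x := by linarith
  have h : ∀ i ∈ range m, (1 - x ^ (i + 1))⁻¹ ≤ Real.exp ((1 - x)⁻¹ * x ^ i) := by
    intro i _
    have hp : x ^ (i + 1) ≤ x := by
      simpa using pow_le_pow_of_le_one hx.le hx1.le (show 1 ≤ i + 1 by omega)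
    have hpos : 0 < 1 - x ^ (i + 1) := by linarith
    have h1 : (1 - x ^ (i + 1))⁻¹ = 1 + x ^ (i + 1) * (1 - x ^ (i + 1))⁻¹ := by
      field_simp; ring
    rw [h1]
    have h2 : x ^ (i + 1) * (1 - x ^ (i + 1))⁻¹ ≤ (1 - x)⁻¹ * x ^ i := by
      rw [mul_comm]
      refine mul_le_mul (inv_anti₀ h1x (by linarith))
        (pow_le_pow_of_le_one hx.le hx1.le (by omega)) (by positivity) (by positivity)
    calc 1 + x ^ (i + 1) * (1 - x ^ (i + 1))⁻¹ ≤ (1 - x)⁻¹ * x ^ i + 1 := by linarith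
      _ ≤ _ := Real.add_one_le_exp _
  refine (Finset.prod_le_prod (fun i _ => ?_) h).trans ?_
  · refine inv_nonneg.2 ?_
    have := pow_lt_one₀ hx.le hx1 (Nat.succ_ne_zero i); rw [Nat.succ_eq_add_one] at this; linarith
  rw [← Real.exp_sum, ← Finset.mul_sum]
  refine Real.exp_le_exp.2 (mul_le_mul_of_nonneg_left ?_ (by positivity))
  exact (summable_geometric_of_lt_one hx.le hx1).sum_le_tsum _ (fun i _ => by positivity) |>.trans
    (tsum_geometric_of_lt_one hx.le hx1).le

/-- Absorbs the powers of the degree produced by the sieve into an arbitrarily slow exponential. -/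
theorem exists_pow_le_const_mul (k : ℕ) {x : ℝ} (hx : 0 < x) (hx1 : x < 1) :
    ∃ C : ℝ, 0 < C ∧ ∀ n : ℕ, ((n : ℝ) + 1) ^ k ≤ C * x⁻¹ ^ n := by
  have h := tendsto_pow_const_mul_const_pow_of_abs_lt_one k (r := x) (by rwa [abs_of_pos hx])
  obtain ⟨B, hB⟩ := (h.comp (Filter.tendsto_add_atTop_nat 1)).bddAbove_range
  refine ⟨max B 1 * x⁻¹, by positivity, fun n => ?_⟩
  have h1 : (((n + 1 : ℕ) : ℝ)) ^ k * x ^ (n + 1) ≤ max B 1 :=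
    (hB ⟨n, rfl⟩).trans (le_max_left _ _)
  have h2 : x⁻¹ ^ n * x ^ n = 1 := by rw [← mul_pow, inv_mul_cancel₀ hx.ne', one_pow]
  push_cast at h1
  calc ((n : ℝ) + 1) ^ k = ((n : ℝ) + 1) ^ k * (x⁻¹ ^ n * x ^ n) * (x⁻¹ * x) := by
        rw [h2, inv_mul_cancel₀ hx.ne']; ring
    _ = (((n : ℝ) + 1) ^ k * x ^ (n + 1)) * (x⁻¹ * x⁻¹ ^ n) := by ring
    _ ≤ max B 1 * (x⁻¹ * x⁻¹ ^ n) := mul_le_mul_of_nonneg_right h1 (by positivity)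
    _ = _ := by ring

end SmoothPolynomials

/-! ### Quadratic character sums over squarefree polynomials. -/

section PolynomialCharacters

variable {F : Type*} [Field F] [Fintype F]

local notation "q" => (Fintype.card F : ℝ)

theorem one_le_card : 1 ≤ q := by exact_mod_cast Fintype.card_pos

/-- The quadratic character of the values of a polynomial at the points of `U`, times the `a`-th
power of the quadratic character of its leading coefficient. -/
noncomputable def polyChar (U : Finset F) (a : ℕ) : F[X] →* ℝ :=
  ((Int.castRingHom ℝ).toMonoidHom.comp (quadraticChar F).toMonoidHom).comp leadingCoeffHom ^ a *
    ∏ x ∈ U, ((Int.castRingHom ℝ).toMonoidHom.comp (quadraticChar F).toMonoidHom).comp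
      (evalRingHom x).toMonoidHom

theorem polyChar_apply (U : Finset F) (a : ℕ) (f : F[X]) :
    polyChar U a f = (quadraticChar F f.leadingCoeff : ℝ) ^ a *
      ∏ x ∈ U, (quadraticChar F (f.eval x) : ℝ) := by
  simp [polyChar]

theorem abs_quadraticChar_le_one (x : F) : |(quadraticChar F x : ℝ)| ≤ 1 := by
  rcases eq_or_ne x 0 with rfl | h
  · simp
  · rcases quadraticChar_dichotomy h with h | h <;> simp [h]

theorem abs_polyChar_le_one (U : Finset F) (a : ℕ) (f : F[X]) : |polyChar U a f| ≤ 1 := by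
  rw [polyChar_apply, abs_mul, abs_pow, Finset.abs_prod]
  exact mul_le_one₀ (pow_le_one₀ (abs_nonneg _) (abs_quadraticChar_le_one _))
    (Finset.prod_nonneg fun _ _ => abs_nonneg _)
    (Finset.prod_le_one (fun _ _ => abs_nonneg _) fun _ _ => abs_quadraticChar_le_one _)

/-- A quadratic character sees a square only through its zeros. -/
theorem polyChar_mul_sq (U : Finset F) (a : ℕ) (f : F[X]) {g : F[X]} (hg : g.Monic) :
    polyChar U a (f * g ^ 2) = if ∀ x ∈ U, g.eval x ≠ 0 then polyChar U a f else 0 := by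
  rw [map_mul, map_pow, polyChar_apply U a g, hg.leadingCoeff]
  split_ifs with h
  · rw [map_one, Int.cast_one, one_pow, one_mul, ← Finset.prod_pow,
      Finset.prod_eq_one fun x hx => ?_, mul_one]
    exact_mod_cast quadraticChar_sq_one (h x hx)
  · push Not at h
    obtain ⟨x, hx, hx0⟩ := h
    rw [Finset.prod_eq_zero hx (by simp [hx0])]; simp

theorem exists_squarefree_mul_sq (f : F[X]) (hf : f ≠ 0) :
    ∃ f₀ g : F[X], Squarefree f₀ ∧ g.Monic ∧ f = f₀ * g ^ 2 := by
  induction hn : f.natDegree using Nat.strong_induction_on generalizing f with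
  | _ n ih =>
  by_cases hs : Squarefree f
  · exact ⟨f, 1, hs, monic_one, by simp⟩
  · simp only [Squarefree, not_forall] at hs
    obtain ⟨x, ⟨f', rfl⟩, hu⟩ := hs
    have hx : x ≠ 0 := by rintro rfl; simp at hf
    have hf' : f' ≠ 0 := right_ne_zero_of_mul hf
    have hd : 0 < x.natDegree := Nat.pos_of_ne_zero fun h => hu (by
      rw [eq_C_of_natDegree_eq_zero h] at hx ⊢
      exact isUnit_C.2 (isUnit_iff_ne_zero.2 fun h0 => hx (by rw [h0, C_0])))
    rw [natDegree_mul (mul_ne_zero hx hx) hf', natDegree_mul hx hx] at hn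
    obtain ⟨f₀, g, h1, h2, h3⟩ := ih f'.natDegree (by omega) f' hf' rfl
    have hl : x.leadingCoeff ≠ 0 := leadingCoeff_ne_zero.2 hx
    -- The square root is made monic by moving the square of its leading coefficient, a unit, into
    -- the squarefree part.
    refine ⟨C (x.leadingCoeff ^ 2) * f₀, normalize x * g, ?_, (monic_normalize hx).mul h2, ?_⟩
    · refine h1.squarefree_of_dvd ?_
      obtain ⟨u, hu⟩ := (isUnit_C.2 (isUnit_iff_ne_zero.2 (pow_ne_zero 2 hl)) : IsUnit (C (x.leadingCoeff ^ 2)))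
      rw [← hu, Units.mul_left_dvd]
    · have : x = C x.leadingCoeff * normalize x := by
        rw [normalize_apply, coe_normUnit_of_ne_zero hx, mul_comm x, ← mul_assoc, ← C_mul,
          mul_inv_cancel₀ hl, C_1, one_mul]
      rw [h3, C_pow]
      linear_combination (x + C x.leadingCoeff * normalize x) * f₀ * g ^ 2 * this

/-- Once gcd(g, g') is removed, the remaining cofactors b and c are coprime, so b² divides f' and c²
divides f; both are therefore 1. -/
theorem squarefree_mul_sq_unique {f f' g g' : F[X]} (hf : Squarefree f) (hf' : Squarefree f')
    (hg : g.Monic) (hg' : g'.Monic) (h : f * g ^ 2 = f' * g' ^ 2) : f = f' ∧ g = g' := by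
  obtain ⟨d, hd, ⟨b, rfl⟩, ⟨c, rfl⟩, hdp⟩ := exists_monic_gcd g g' hg.ne_zero
  have hb := hd.of_mul_monic_left hg
  have hc := hd.of_mul_monic_left hg'
  have hbc : IsRelPrime b c := fun p hpb hpc => by
    have := hdp (d * p) (mul_dvd_mul_left d hpb) (mul_dvd_mul_left d hpc)
    rwa [← mul_one d, mul_assoc, mul_dvd_mul_iff_left hd.ne_zero, one_mul, ← isUnit_iff_dvd_one]
      at this
  have e : f * b ^ 2 = f' * c ^ 2 := by
    have : d ^ 2 * (f * b ^ 2) = d ^ 2 * (f' * c ^ 2) := by linear_combination h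
    exact mul_left_cancel₀ (pow_ne_zero 2 hd.ne_zero) this
  have hb1 : b = 1 := by
    refine hb.eq_one_of_isUnit (hf' b ?_)
    rw [← sq]
    exact (isRelPrime_iff_isCoprime.1 hbc).pow.dvd_of_dvd_mul_right
      ⟨f, by rw [← e, mul_comm]⟩
  have hc1 : c = 1 := by
    refine hc.eq_one_of_isUnit (hf c ?_)
    rw [← sq]
    exact (isRelPrime_iff_isCoprime.1 hbc).symm.pow.dvd_of_dvd_mul_right
      ⟨f', by rw [e, mul_comm]⟩
  subst hb1 hc1
  simpa using e

/-- The number of monic polynomials of degree `i` without zeros in `U`. -/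
noncomputable def nonvanishingCount (U : Finset F) (i : ℕ) : ℕ :=
  #{g ∈ monics F i | ∀ x ∈ U, g.eval x ≠ 0}

theorem nonvanishingCount_empty (i : ℕ) :
    nonvanishingCount (∅ : Finset F) i = Fintype.card F ^ i := by
  simp [nonvanishingCount, card_monics]

theorem nonvanishingCount_insert (U : Finset F) {x : F} (i : ℕ) (hx : x ∉ U) :
    nonvanishingCount U i = nonvanishingCount (insert x U) i +
      if 1 ≤ i then nonvanishingCount U (i - 1) else 0 := by
  unfold nonvanishingCount
  rw [← Finset.card_filter_add_card_filter_not (fun f => eval x f = 0), add_comm]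
  congr 1
  · rw [Finset.filter_filter]
    refine congrArg _ (Finset.filter_congr fun b _ => ?_)
    simp only [Finset.forall_mem_insert]; tauto
  · split_ifs with hn
    · symm
      refine Finset.card_bij (fun f _ => (X - C x) * f) ?_ ?_ ?_
      · intro f hf
        simp only [mem_filter, mem_monics] at hf ⊢
        obtain ⟨⟨hf0, hfd⟩, hf⟩ := hf
        refine ⟨⟨⟨(monic_X_sub_C x).mul hf0, ?_⟩, ?_⟩, by simp⟩
        · rw [(monic_X_sub_C x).natDegree_mul hf0, hfd, natDegree_X_sub_C]; omega
        · intro y hy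
          rw [eval_mul, eval_sub, eval_X, eval_C]
          exact mul_ne_zero (sub_ne_zero.2 fun e => hx (e ▸ hy)) (hf y hy)
      · intro f _ g _ h
        exact mul_left_cancel₀ (X_sub_C_ne_zero x) h
      · intro f hf
        simp only [mem_filter, mem_monics] at hf
        obtain ⟨⟨⟨hf0, hfd⟩, hSf⟩, hfx⟩ := hf
        obtain ⟨g, rfl⟩ := dvd_iff_isRoot.2 hfx
        have hg := (monic_X_sub_C x).of_mul_monic_left hf0
        refine ⟨g, ?_, rfl⟩
        simp only [mem_filter, mem_monics]
        refine ⟨⟨hg, ?_⟩, fun y hy h0 => hSf y hy (by simp [h0])⟩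
        rw [(monic_X_sub_C x).natDegree_mul hg, natDegree_X_sub_C] at hfd; omega
    · rw [Finset.card_eq_zero, Finset.filter_eq_empty_iff]
      intro b hb hd
      simp only [mem_filter, mem_monics] at hb
      have := natDegree_le_of_dvd (dvd_iff_isRoot.2 hd) hb.1.1.ne_zero
      rw [natDegree_X_sub_C] at this
      omega

/-- The convolution of the sums over squarefree polynomials with the counts of squares of
polynomials without zeros in `U'`. -/
noncomputable def squareConv (ψ : F[X] →* ℝ) (U : Finset F) (n : ℕ) : ℝ :=
  ∑ i ∈ range (n / 2 + 1), sieveSum ψ ∅ (n - 2 * i) * nonvanishingCount U i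

/-- Sorts all polynomials by the unique decomposition f₀ g². The complete sum on the left can be
evaluated; the right side contains the squarefree sums that are wanted. -/
theorem sum_polyChar_eq_squareConv (U : Finset F) (a n : ℕ) :
    ∑ f ∈ polys F n, polyChar U a f = squareConv (polyChar U a) U n := by
  have h1 : squareConv (polyChar U a) U n =
      ∑ t ∈ (range (n / 2 + 1)).sigma (fun i =>
        {f ∈ polys F (n - 2 * i) | Squarefree f} ×ˢ monics F i),
        polyChar U a (t.2.1 * t.2.2 ^ 2) := by
    rw [Finset.sum_sigma]
    refine Finset.sum_congr rfl fun i _ => ?_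
    rw [Finset.sum_product]
    simp only [sieveSum, nonvanishingCount, notMem_empty, IsEmpty.forall_iff, implies_true,
      and_true]
    rw [Finset.sum_mul]
    refine Finset.sum_congr rfl fun f _ => ?_
    rw [Finset.sum_congr rfl fun g hg => polyChar_mul_sq U a f (mem_monics.1 hg).1,
      ← Finset.sum_filter, Finset.sum_const, nsmul_eq_mul, mul_comm]
  rw [h1]
  symm
  refine Finset.sum_bij (fun t _ => t.2.1 * t.2.2 ^ 2) ?_ ?_ ?_ (fun _ _ => rfl)
  · rintro ⟨i, f, g⟩ h
    simp only [mem_sigma, mem_range, mem_product, mem_filter, mem_polys, mem_monics] at h ⊢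
    obtain ⟨hi, ⟨⟨hf, hfd⟩, hs⟩, hg, hgi⟩ := h
    refine ⟨mul_ne_zero hf (pow_ne_zero 2 hg.ne_zero), ?_⟩
    rw [natDegree_mul hf (pow_ne_zero 2 hg.ne_zero), natDegree_pow, hfd, hgi]; omega
  · rintro ⟨i, f, g⟩ h ⟨i', f', g'⟩ h' e
    simp only [mem_sigma, mem_range, mem_product, mem_filter, mem_polys, mem_monics] at h h' e
    obtain ⟨rfl, rfl⟩ := squarefree_mul_sq_unique h.2.1.2 h'.2.1.2 h.2.2.1 h'.2.2.1 e
    obtain rfl : i = i' := by rw [← h.2.2.2, ← h'.2.2.2]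
    rfl
  · intro f hf
    rw [mem_polys] at hf
    obtain ⟨f₀, g, h1, h2, rfl⟩ := exists_squarefree_mul_sq f hf.1
    have hf0 : f₀ ≠ 0 := h1.ne_zero
    have hd := hf.2
    rw [natDegree_mul hf0 (pow_ne_zero 2 h2.ne_zero), natDegree_pow] at hd
    refine ⟨⟨g.natDegree, f₀, g⟩, ?_, rfl⟩
    simp only [mem_sigma, mem_range, mem_product, mem_filter, mem_polys, mem_monics]
    exact ⟨by omega, ⟨⟨hf0, by omega⟩, h1⟩, h2, trivial⟩

/-- Each point of U multiplies the generating function of the admissible squares by 1 − t². -/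
theorem squareConv_insert (ψ : F[X] →* ℝ) (U : Finset F) {x : F} (n : ℕ) (hx : x ∉ U) :
    squareConv ψ U n = squareConv ψ (insert x U) n +
      if 2 ≤ n then squareConv ψ U (n - 2) else 0 := by
  unfold squareConv
  have h1 : ∀ i, sieveSum ψ ∅ (n - 2 * i) * nonvanishingCount U i =
      sieveSum ψ ∅ (n - 2 * i) * nonvanishingCount (insert x U) i +
      if 1 ≤ i then sieveSum ψ ∅ (n - 2 * i) * nonvanishingCount U (i - 1) else 0 := by
    intro i
    rw [nonvanishingCount_insert U i hx]
    push_cast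
    split_ifs <;> ring
  rw [Finset.sum_congr rfl fun i _ => h1 i, Finset.sum_add_distrib]
  congr 1
  split_ifs with h
  · rw [Finset.sum_range_succ', show n / 2 = (n - 2) / 2 + 1 by omega]
    simp only [nonpos_iff_eq_zero, one_ne_zero, if_false, add_zero]
    refine Finset.sum_congr rfl fun i _ => ?_
    rw [if_pos (by omega), Nat.add_sub_cancel, show n - 2 * (i + 1) = n - 2 - 2 * i by omega]
  · refine Finset.sum_eq_zero fun i hi => ?_
    rw [mem_range] at hi
    rw [if_neg (by omega)]

/-- Removing a point from U amounts to dividing by 1 − t², that is, to summing at most N + 1 earlier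
coefficients. -/
theorem abs_squareConv_empty_le (ψ : F[X] →* ℝ) (U : Finset F) {c : ℝ} (N : ℕ)
    (h : ∀ n ≤ N, |squareConv ψ U n| ≤ c) :
    ∀ n ≤ N, |squareConv ψ ∅ n| ≤ ((N : ℝ) + 1) ^ U.card * c := by
  have hc : 0 ≤ c := (abs_nonneg _).trans (h 0 (Nat.zero_le _))
  induction U using Finset.induction_on generalizing c with
  | empty => simpa using h
  | insert x U hx ih =>
    have key : ∀ n ≤ N, |squareConv ψ U n| ≤ ((n : ℝ) + 1) * c := by
      intro n
      induction n using Nat.strong_induction_on with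
      | _ n ihn =>
      intro hN
      rw [squareConv_insert ψ U n hx]
      refine (abs_add_le _ _).trans ?_
      split_ifs with h2
      · have h3 := ihn (n - 2) (by omega) (by omega)
        rw [Nat.cast_sub h2] at h3
        push_cast at h3
        linarith [h n hN]
      · rw [abs_zero]
        have : 0 ≤ (n : ℝ) * c := by positivity
        linarith [h n hN]
    have key' : ∀ n ≤ N, |squareConv ψ U n| ≤ ((N : ℝ) + 1) * c := fun n hn =>
      (key n hn).trans (mul_le_mul_of_nonneg_right (by
        have : (n : ℝ) ≤ N := by exact_mod_cast hn
        linarith) hc)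
    rw [Finset.card_insert_of_notMem hx, pow_succ]
    simpa only [mul_assoc] using ih key' (by positivity)

/-- The sum over squarefree polynomials in terms of the convolution with all squares. -/
theorem sieveSum_empty_eq (ψ : F[X] →* ℝ) (n : ℕ) :
    sieveSum ψ ∅ n = squareConv ψ ∅ n - if 2 ≤ n then q * squareConv ψ ∅ (n - 2) else 0 := by
  unfold squareConv
  simp only [nonvanishingCount_empty]
  rw [Finset.sum_range_succ']
  split_ifs with h
  · rw [Finset.mul_sum, show n / 2 = (n - 2) / 2 + 1 by omega]
    simp only [mul_zero, Nat.sub_zero, pow_zero, Nat.cast_one, mul_one]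
    rw [Finset.sum_congr rfl fun i _ => show sieveSum ψ ∅ (n - 2 * (i + 1)) *
      ((Fintype.card F ^ (i + 1) : ℕ) : ℝ) = q * (sieveSum ψ ∅ (n - 2 - 2 * i) *
      ((Fintype.card F ^ i : ℕ) : ℝ)) from ?_]
    · ring
    · rw [show n - 2 * (i + 1) = n - 2 - 2 * i by omega]; push_cast; ring
  · rw [show n / 2 = 0 by omega]; simp

/-- If x ∈ U, let w vanish at the other points of U but not at x. Since deg w = |U| − 1 < n, adding
c w permutes the polynomials of degree n, keeps the leading coefficient and moves only the value at
x; averaging over c makes the character at x sum to zero. If U is empty then a is odd, and scaling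
by units does the same for the leading coefficient. -/
theorem sum_polyChar_eq_zero (hF : ringChar F ≠ 2) (U : Finset F) (a n : ℕ) (hn : U.card ≤ n)
    (h : U.Nonempty ∨ Odd a) : ∑ f ∈ polys F n, polyChar U a f = 0 := by
  rcases U.eq_empty_or_nonempty with rfl | ⟨x, hx⟩
  · have ha : Odd a := h.resolve_left (by simp)
    rw [sum_polys, Finset.sum_comm]
    refine Finset.sum_eq_zero fun f hf => ?_
    rw [mem_monics] at hf
    have h1 : ∀ u : Fˣ, polyChar ∅ a (C (u : F) * f) = (quadraticChar F u : ℝ) := by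
      intro u
      rw [polyChar_apply, leadingCoeff_mul, hf.1.leadingCoeff, leadingCoeff_C, mul_one]
      simp only [Finset.prod_empty, mul_one]
      rcases quadraticChar_dichotomy u.ne_zero with h | h <;> simp [h, ha]
    rw [Finset.sum_congr rfl fun u _ => h1 u]
    have h2 := quadraticChar_sum_zero hF
    have h3 : ∑ u : Fˣ, quadraticChar F u = 0 := by
      rw [← h2]
      refine Finset.sum_bij_ne_zero (fun u _ _ => (u : F)) (fun _ _ _ => mem_univ _)
        (fun u _ _ v _ _ e => Units.ext e) (fun b _ hb => ?_) (fun _ _ _ => rfl)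
      have hb0 : b ≠ 0 := fun h0 => hb (by rw [h0]; simp)
      exact ⟨Units.mk0 b hb0, mem_univ _, hb, rfl⟩
    exact_mod_cast h3
  · set w : F[X] := ∏ y ∈ U.erase x, (X - C y) with hw
    have hwm : w.Monic := monic_prod_of_monic _ _ fun y _ => monic_X_sub_C y
    have hwd : w.natDegree < n := by
      rw [hw, natDegree_prod_of_monic _ _ fun y _ => monic_X_sub_C y]
      simp only [natDegree_X_sub_C, sum_const, smul_eq_mul, mul_one]
      rw [Finset.card_erase_of_mem hx]
      have := Finset.card_pos.2 ⟨x, hx⟩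
      omega
    have hwx : w.eval x ≠ 0 := by
      rw [hw, eval_prod, Finset.prod_ne_zero_iff]
      intro y hy
      rw [eval_sub, eval_X, eval_C, sub_ne_zero]
      exact (Finset.ne_of_mem_erase hy).symm
    have hshift : ∀ c : F, ∀ f ∈ polys F n, f + C c * w ∈ polys F n ∧
        (f + C c * w).leadingCoeff = f.leadingCoeff := by
      intro c f hf
      rw [mem_polys] at hf ⊢
      have hlt : (C c * w).degree < f.degree := by
        rw [degree_eq_natDegree hf.1, hf.2]
        refine lt_of_le_of_lt degree_le_natDegree ?_
        exact_mod_cast (natDegree_C_mul_le c w).trans_lt hwd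
      refine ⟨⟨fun h0 => ?_, ?_⟩, ?_⟩
      · have := degree_add_eq_left_of_degree_lt hlt
        rw [h0, degree_zero] at this
        exact hf.1 (degree_eq_bot.1 this.symm)
      · rw [natDegree_add_eq_left_of_degree_lt hlt, hf.2]
      · rw [leadingCoeff_add_of_degree_lt' hlt]
    have hinv : ∀ c : F, ∑ f ∈ polys F n, polyChar U a (f + C c * w) =
        ∑ f ∈ polys F n, polyChar U a f := by
      intro c
      refine Finset.sum_bij (fun f _ => f + C c * w) (fun f hf => (hshift c f hf).1)
        (fun f _ g _ e => add_right_cancel e) (fun f hf => ?_) (fun _ _ => rfl)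
      refine ⟨f + C (-c) * w, (hshift (-c) f hf).1, ?_⟩
      rw [C_neg]; ring
    have hzero : ∑ c : F, ∑ f ∈ polys F n, polyChar U a (f + C c * w) = 0 := by
      rw [Finset.sum_comm]
      refine Finset.sum_eq_zero fun f hf => ?_
      have h1 : ∀ c : F, polyChar U a (f + C c * w) = (quadraticChar F f.leadingCoeff : ℝ) ^ a *
          (∏ y ∈ U.erase x, (quadraticChar F (f.eval y) : ℝ)) *
          (quadraticChar F (f.eval x + c * w.eval x) : ℝ) := by
        intro c
        rw [polyChar_apply, (hshift c f hf).2, ← Finset.prod_erase_mul _ _ hx, mul_assoc]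
        congr 2
        · refine Finset.prod_congr rfl fun y hy => ?_
          have : w.eval y = 0 := by
            rw [hw, eval_prod]
            exact Finset.prod_eq_zero hy (by simp)
          simp [this]
        · simp
      rw [Finset.sum_congr rfl fun c _ => h1 c, ← Finset.mul_sum]
      have h2 : ∑ c : F, quadraticChar F (f.eval x + c * w.eval x) = 0 := by
        rw [← quadraticChar_sum_zero hF]
        exact Fintype.sum_equiv ((Equiv.mulRight₀ (w.eval x) hwx).trans (Equiv.addLeft (f.eval x)))
          _ _ fun c => rfl
      have h3 : ∑ c : F, (quadraticChar F (f.eval x + c * w.eval x) : ℝ) = 0 := by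
        exact_mod_cast h2
      rw [h3, mul_zero]
    rw [Finset.sum_congr rfl fun c _ => hinv c, Finset.sum_const, nsmul_eq_mul] at hzero
    refine (mul_eq_zero.1 hzero).resolve_left ?_
    simp

/-- The sums over squarefree polynomials of a nontrivial character are small. -/
theorem abs_sieveSum_polyChar_le (hF : ringChar F ≠ 2) (U : Finset F) (a : ℕ)
    (h : U.Nonempty ∨ Odd a) (n : ℕ) :
    |sieveSum (polyChar U a) ∅ n| ≤ 2 * ((n : ℝ) + 1) ^ U.card * ((q - 1) * q ^ U.card) := by
  have hq := one_le_card (F := F)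
  -- The complete sums vanish in degrees at least |U|; below, the trivial count in degree |U| − 1
  -- bounds them. For empty U no degrees remain.
  set c : ℝ := if U.card = 0 then 0 else (q - 1) * q ^ (U.card - 1) with hc
  have hc0 : 0 ≤ c := by
    rw [hc]; split_ifs
    · exact le_rfl
    · exact mul_nonneg (by linarith) (by positivity)
  have h1 : ∀ m, |squareConv (polyChar U a) U m| ≤ c := by
    intro m
    rw [← sum_polyChar_eq_squareConv]
    by_cases hm : U.card ≤ m
    · rw [sum_polyChar_eq_zero hF U a m hm h, abs_zero]; exact hc0
    · refine (Finset.abs_sum_le_sum_abs _ _).trans ?_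
      refine (Finset.sum_le_sum fun f _ => abs_polyChar_le_one U a f).trans ?_
      rw [Finset.sum_const, nsmul_eq_mul, mul_one, card_polys, hc, if_neg (by omega)]
      exact mul_le_mul_of_nonneg_left (pow_le_pow_right₀ hq (by omega)) (by linarith)
  have h2 := abs_squareConv_empty_le (polyChar U a) U n fun m _ => h1 m
  have hqc : c + q * c ≤ 2 * ((q - 1) * q ^ U.card) := by
    rw [hc]; split_ifs with h0
    · simp only [mul_zero, add_zero]; exact mul_nonneg two_pos.le (mul_nonneg (by linarith) (by positivity))
    · obtain ⟨m, hm⟩ := Nat.exists_eq_succ_of_ne_zero h0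
      rw [hm, Nat.succ_eq_add_one, Nat.add_sub_cancel, pow_succ]
      have : 0 ≤ (q - 1) * q ^ m := mul_nonneg (by linarith) (by positivity)
      nlinarith
  rw [sieveSum_empty_eq]
  refine (abs_sub _ _).trans ?_
  have h3 : |if 2 ≤ n then q * squareConv (polyChar U a) ∅ (n - 2) else 0| ≤
      ((n : ℝ) + 1) ^ U.card * (q * c) := by
    split_ifs with hn
    · rw [abs_mul, abs_of_pos (by linarith)]
      have h4 := h2 (n - 2) (Nat.sub_le _ _)
      calc q * |squareConv (polyChar U a) ∅ (n - 2)| ≤ q * (((n : ℝ) + 1) ^ U.card * c) :=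
            mul_le_mul_of_nonneg_left h4 (by linarith)
        _ = _ := by ring
    · rw [abs_zero]; positivity
  calc _ ≤ ((n : ℝ) + 1) ^ U.card * c + ((n : ℝ) + 1) ^ U.card * (q * c) := add_le_add (h2 n le_rfl) h3
    _ = ((n : ℝ) + 1) ^ U.card * (c + q * c) := by ring
    _ ≤ ((n : ℝ) + 1) ^ U.card * (2 * ((q - 1) * q ^ U.card)) :=
        mul_le_mul_of_nonneg_left hqc (by positivity)
    _ = _ := by ring

theorem polyChar_trivial : (polyChar (∅ : Finset F) 0 : F[X] →* ℝ) = 1 := by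
  ext f; simp [polyChar_apply]

/-- The number of squarefree polynomials of degree `n`. -/
theorem sieveSum_one_empty (n : ℕ) : sieveSum (1 : F[X] →* ℝ) ∅ n =
    (q - 1) * (q ^ n - if 2 ≤ n then q ^ (n - 1) else 0) := by
  have h : ∀ n, squareConv (1 : F[X] →* ℝ) (∅ : Finset F) n = (q - 1) * q ^ n := fun n => by
    have := sum_polyChar_eq_squareConv (∅ : Finset F) 0 n
    rw [polyChar_trivial] at this
    rw [← this]
    simp [card_polys]
  rw [sieveSum_empty_eq, h]
  split_ifs with hn
  · rw [h, show n - 1 = n - 2 + 1 by omega]; ring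
  · ring

/-- The number of squarefree polynomials is exactly geometric from degree 2 on, so the difference is
nonzero only for n = 0 and n = 2. -/
theorem abs_sieveSum_one_sub_le (n : ℕ) :
    |sieveSum (1 : F[X] →* ℝ) ∅ n - q * (if n = 0 then 0 else sieveSum (1 : F[X] →* ℝ) ∅ (n - 1))|
      ≤ (q - 1) * q := by
  have hq := one_le_card (F := F)
  have h0 : 0 ≤ (q - 1) * q := mul_nonneg (by linarith) (by linarith)
  have : 0 ≤ (q - 1) * (q - 1) := mul_nonneg (by linarith) (by linarith)
  simp only [sieveSum_one_empty]
  rcases n with _ | _ | _ | n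
  · simp only [if_true, mul_zero, sub_zero, pow_zero]
    rw [if_neg (by norm_num), sub_zero, mul_one, abs_of_nonneg (by linarith)]
    nlinarith
  · simp only [zero_add, one_ne_zero, if_false]
    norm_num
    rw [show (q - 1) * q - q * (q - 1) = 0 by ring, abs_zero]; linarith
  · norm_num
    rw [show (q - 1) * (q ^ 2 - q) - q * ((q - 1) * q) = -((q - 1) * q) by ring, abs_neg,
      abs_of_nonneg h0]
  · rw [if_pos (by omega), if_neg (by omega), if_pos (by omega)]
    simp only [Nat.add_sub_cancel]
    rw [show (q - 1) * (q ^ (n + 1 + 1 + 1) - q ^ (n + 1 + 1)) -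
      q * ((q - 1) * (q ^ (n + 1 + 1) - q ^ (n + 1))) = 0 by ring, abs_zero]
    exact h0

end PolynomialCharacters

/-! ### Sums over triples of coprime squarefree polynomials. -/

section Triples

variable {F : Type*} [Field F] [Fintype F]

local notation "q" => (Fintype.card F : ℝ)

theorem primesOf_mul {f g : F[X]} (hf : f ≠ 0) (hg : g ≠ 0) :
    primesOf (f * g) = primesOf f ∪ primesOf g := by
  rw [primesOf, UniqueFactorizationMonoid.normalizedFactors_mul hf hg, Multiset.toFinset_add]
  rfl

theorem primesOf_C_mul (u : Fˣ) {f : F[X]} (hf : f ≠ 0) : primesOf (C (u : F) * f) = primesOf f := by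
  ext p
  have hu : IsUnit (C (u : F)) := isUnit_C.2 u.isUnit
  rw [mem_primesOf hf, mem_primesOf (mul_ne_zero hu.ne_zero hf), hu.dvd_mul_left]

/-- The polynomial with simple zeros exactly at the points of `T`. -/
noncomputable def zeroPoly (T : Finset F) : F[X] := ∏ x ∈ T, (X - C x)

theorem zeroPoly_monic (T : Finset F) : (zeroPoly T).Monic :=
  monic_prod_of_monic _ _ fun y _ => monic_X_sub_C y

theorem isCoprime_zeroPoly {T : Finset F} {f : F[X]} :
    IsCoprime f (zeroPoly T) ↔ ∀ x ∈ T, f.eval x ≠ 0 := by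
  unfold zeroPoly
  rw [IsCoprime.prod_right_iff]
  refine forall_congr' fun x => forall_congr' fun _ => ?_
  rw [isCoprime_comm, (irreducible_X_sub_C x).coprime_iff_not_dvd, dvd_iff_isRoot, IsRoot]

theorem primesOf_zeroPoly (T : Finset F) : primesOf (zeroPoly T) = T.image (X - C ·) := by
  ext p
  rw [mem_primesOf (zeroPoly_monic T).ne_zero, Finset.mem_image]
  constructor
  · rintro ⟨hi, hm, hd⟩
    obtain ⟨x, hx, hxd⟩ := (hi.prime.dvd_finsetProd_iff _).1 hd
    exact ⟨x, hx, (eq_of_monic_of_associated hm (monic_X_sub_C x)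
      (hi.associated_of_dvd (irreducible_X_sub_C x) hxd)).symm⟩
  · rintro ⟨x, hx, rfl⟩
    exact ⟨irreducible_X_sub_C x, monic_X_sub_C x, Finset.dvd_prod_of_mem _ hx⟩

theorem smoothCount_zeroPoly_le (T : Finset F) (n : ℕ) :
    smoothCount (primesOf (zeroPoly T)) n ≤ (n + 1) ^ T.card := by
  rw [primesOf_zeroPoly]
  refine (smoothCount_le_of_linear _ ?_ n).trans
    (Nat.pow_le_pow_right (Nat.succ_pos n) Finset.card_image_le)
  intro r hr
  obtain ⟨x, -, rfl⟩ := Finset.mem_image.1 hr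
  exact ⟨monic_X_sub_C x, irreducible_X_sub_C x, natDegree_X_sub_C x⟩

theorem sum_polys_smoothCount_le {x : ℝ} (hx : 0 < x) (hx1 : x < 1) (m j : ℕ) :
    ∑ f ∈ polys F m, (smoothCount (primesOf f) j : ℝ) ≤
      Real.exp ((1 - x)⁻¹ * (1 - x)⁻¹) * ((q - 1) * q ^ m) * x⁻¹ ^ j := by
  rw [sum_polys]
  have h1 : ∀ u : Fˣ, ∑ f ∈ monics F m, (smoothCount (primesOf (C (u : F) * f)) j : ℝ) =
      (smoothPairs F m j).card := by
    intro u
    rw [← sum_smoothCount_primesOf]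
    push_cast
    exact Finset.sum_congr rfl fun f hf => by
      rw [primesOf_C_mul u (mem_monics.1 hf).1.ne_zero]
  rw [Finset.sum_congr rfl fun u _ => h1 u, Finset.sum_const, nsmul_eq_mul, Finset.card_univ,
    card_units_cast]
  have hq := one_le_card (F := F)
  have h2 := card_smoothPairs_le_prod (F := F) hx hx1 m j
  have h3 := prod_inv_one_sub_pow_le hx hx1 m
  calc (q - 1) * ((smoothPairs F m j).card : ℝ)
      ≤ (q - 1) * (q ^ m * (∏ i ∈ range m, (1 - x ^ (i + 1))⁻¹) * x⁻¹ ^ j) :=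
        mul_le_mul_of_nonneg_left h2 (by linarith)
    _ ≤ (q - 1) * (q ^ m * Real.exp ((1 - x)⁻¹ * (1 - x)⁻¹) * x⁻¹ ^ j) := by
        refine mul_le_mul_of_nonneg_left ?_ (by linarith)
        gcongr
    _ = _ := by ring

theorem sum_antidiagonal_le {a b : ℕ → ℝ} {A B y : ℝ} (k : ℕ) (hy : 0 < y)
    (ha : ∀ n, a n ≤ A * y⁻¹ ^ n) (hb : ∀ n, b n ≤ B * ((n : ℝ) + 1) ^ k * y⁻¹ ^ n)
    (ha0 : ∀ n, 0 ≤ a n) (hB : 0 ≤ B) (n : ℕ) :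
    ∑ p ∈ antidiagonal n, a p.1 * b p.2 ≤ A * B * ((n : ℝ) + 1) ^ (k + 1) * y⁻¹ ^ n := by
  have hA : 0 ≤ A := by simpa using (ha0 0).trans (ha 0)
  have h : ∀ p ∈ antidiagonal n, a p.1 * b p.2 ≤ A * B * ((n : ℝ) + 1) ^ k * y⁻¹ ^ n := by
    rintro ⟨i, j⟩ hp
    rw [HasAntidiagonal.mem_antidiagonal] at hp
    subst hp
    have h1 : ((j : ℝ) + 1) ^ k ≤ (((i + j : ℕ) : ℝ) + 1) ^ k := by
      refine pow_le_pow_left₀ (by positivity) ?_ _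
      push_cast; linarith [(Nat.cast_nonneg i : (0 : ℝ) ≤ i)]
    calc a i * b j ≤ a i * (B * ((j : ℝ) + 1) ^ k * y⁻¹ ^ j) :=
          mul_le_mul_of_nonneg_left (hb j) (ha0 i)
      _ ≤ (A * y⁻¹ ^ i) * (B * ((j : ℝ) + 1) ^ k * y⁻¹ ^ j) :=
          mul_le_mul_of_nonneg_right (ha i) (by positivity)
      _ = A * B * y⁻¹ ^ (i + j) * ((j : ℝ) + 1) ^ k := by rw [pow_add]; ring
      _ ≤ A * B * y⁻¹ ^ (i + j) * (((i + j : ℕ) : ℝ) + 1) ^ k :=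
          mul_le_mul_of_nonneg_left h1 (by positivity)
      _ = _ := by ring
  refine (Finset.sum_le_card_nsmul _ _ _ h).trans (le_of_eq ?_)
  rw [Finset.Nat.card_antidiagonal, nsmul_eq_mul]
  push_cast; ring

/-- Triples of squarefree and pairwise coprime polynomials without zeros in `T`. -/
def IsModel (T : Finset F) (f : Fin 3 → F[X]) : Prop :=
  (∀ i, Squarefree (f i)) ∧ (∀ i j, i ≠ j → IsCoprime (f i) (f j)) ∧
    ∀ i, ∀ x ∈ T, (f i).eval x ≠ 0

/-- Triples of squarefree and pairwise coprime polynomials of given degrees without zeros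
in `T`. -/
noncomputable def triples (T : Finset F) (d : Fin 3 → ℕ) : Finset (Fin 3 → F[X]) :=
  {f ∈ Fintype.piFinset fun i => polys F (d i) | IsModel T f}

theorem mem_triples {T : Finset F} {d : Fin 3 → ℕ} {f : Fin 3 → F[X]} :
    f ∈ triples T d ↔ (∀ i, (f i).natDegree = d i) ∧ IsModel T f := by
  simp only [triples, mem_filter, Fintype.mem_piFinset, mem_polys]
  exact ⟨fun h => ⟨fun i => (h.1 i).2, h.2⟩, fun h => ⟨fun i => ⟨(h.2.1 i).ne_zero, h.1 i⟩, h.2⟩⟩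

/-- The weighted number of triples. -/
noncomputable def tripleSum (T : Finset F) (ψ : Fin 3 → (F[X] →* ℝ)) (d : Fin 3 → ℕ) : ℝ :=
  ∑ f ∈ triples T d, ∏ i, ψ i (f i)

/-- The pairs that can be completed to triples by a polynomial in position `i`. -/
noncomputable def pairs (T : Finset F) (i : Fin 3) (d : Fin 3 → ℕ) : Finset (Fin 2 → F[X]) :=
  {g ∈ Fintype.piFinset fun j => polys F (d (i.succAbove j)) |
    (∀ j, Squarefree (g j)) ∧ (∀ j k, j ≠ k → IsCoprime (g j) (g k)) ∧
      ∀ j, ∀ x ∈ T, (g j).eval x ≠ 0}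

/-- All conditions linking the component i to the others and to T become coprimality with a single
polynomial, so the sieve can be run over its prime factors. -/
theorem isModel_insertNth {T : Finset F} (i : Fin 3) (a : F[X]) (g : Fin 2 → F[X]) :
    IsModel T (i.insertNth a g) ↔ (Squarefree a ∧ IsCoprime a (g 0 * g 1 * zeroPoly T)) ∧
      (∀ j, Squarefree (g j)) ∧ (∀ j k, j ≠ k → IsCoprime (g j) (g k)) ∧
      ∀ j, ∀ x ∈ T, (g j).eval x ≠ 0 := by
  unfold IsModel
  have h3 : (∀ k, ∀ x ∈ T, (i.insertNth (α := fun _ => F[X]) a g k).eval x ≠ 0) ↔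
      (∀ x ∈ T, a.eval x ≠ 0) ∧ ∀ j, ∀ x ∈ T, (g j).eval x ≠ 0 := by
    rw [Fin.forall_iff_succAbove i]; simp
  rw [IsCoprime.mul_right_iff, IsCoprime.mul_right_iff, isCoprime_zeroPoly, h3,
    Fin.forall_iff_succAbove i, Fin.forall_iff_succAbove i]
  simp only [Fin.insertNth_apply_same, Fin.insertNth_apply_succAbove]
  simp only [Fin.forall_iff_succAbove (n := 2) i (P := fun j => _ ≠ j → _),
    Fin.insertNth_apply_same, Fin.insertNth_apply_succAbove, ne_eq, Fin.succAbove_right_inj,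
    not_true_eq_false, false_imp_iff, true_and, (Fin.succAbove_ne i _), (Fin.succAbove_ne i _).symm,
    not_false_eq_true, true_imp_iff, Fin.forall_fin_two]
  rw [@isCoprime_comm _ _ (g 0) a, @isCoprime_comm _ _ (g 1) a]
  constructor
  · rintro ⟨⟨s, s0, s1⟩, ⟨⟨c0, c1⟩, ⟨-, e0⟩, -, e1, -⟩, v, v0⟩
    exact ⟨⟨s, ⟨c0, c1⟩, v⟩, ⟨s0, s1⟩, ⟨e0, e1, trivial⟩, v0⟩
  · rintro ⟨⟨s, ⟨c0, c1⟩, v⟩, ⟨s0, s1⟩, ⟨e0, e1, -⟩, v0⟩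
    exact ⟨⟨s, s0, s1⟩, ⟨⟨c0, c1⟩, ⟨c0, e0⟩, c1, e1, trivial⟩, v, v0⟩

theorem tripleSum_eq_sum_pairs (T : Finset F) (ψ : Fin 3 → (F[X] →* ℝ)) (i : Fin 3)
    (d : Fin 3 → ℕ) :
    tripleSum T ψ d = ∑ g ∈ pairs T i d, (∏ j, ψ (i.succAbove j) (g j)) *
      sieveSum (ψ i) (primesOf (g 0 * g 1 * zeroPoly T)) (d i) := by
  have h1 : ∀ g ∈ pairs T i d, (∏ j, ψ (i.succAbove j) (g j)) *
      sieveSum (ψ i) (primesOf (g 0 * g 1 * zeroPoly T)) (d i) =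
      ∑ a ∈ polys F (d i) with Squarefree a ∧ IsCoprime a (g 0 * g 1 * zeroPoly T),
        ψ i a * ∏ j, ψ (i.succAbove j) (g j) := by
    intro g hg
    simp only [pairs, mem_filter, Fintype.mem_piFinset, mem_polys] at hg
    have hne : g 0 * g 1 * zeroPoly T ≠ 0 :=
      mul_ne_zero (mul_ne_zero (hg.1 0).1 (hg.1 1).1) (zeroPoly_monic T).ne_zero
    rw [sieveSum, Finset.mul_sum]
    simp_rw [isCoprime_iff_forall_primesOf hne]
    exact Finset.sum_congr rfl fun a _ => mul_comm _ _
  rw [Finset.sum_congr rfl h1, tripleSum]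
  refine Eq.trans ?_ (Finset.sum_sigma (pairs T i d) (fun g => {a ∈ polys F (d i) |
    Squarefree a ∧ IsCoprime a (g 0 * g 1 * zeroPoly T)})
    (fun t => ψ i t.2 * ∏ j, ψ (i.succAbove j) (t.1 j)))
  symm
  refine Finset.sum_bij' (fun t _ => i.insertNth t.2 t.1)
    (fun f _ => ⟨fun j => f (i.succAbove j), f i⟩) ?_ ?_ ?_ ?_ ?_
  · rintro ⟨g, a⟩ h
    simp only [mem_sigma, mem_filter, pairs, Fintype.mem_piFinset] at h
    simp only [triples, mem_filter, Fintype.mem_piFinset]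
    refine ⟨?_, (isModel_insertNth i a g).2 ⟨h.2.2, h.1.2⟩⟩
    rw [Fin.forall_iff_succAbove i]
    exact ⟨by simpa using h.2.1, fun j => by simpa using h.1.1 j⟩
  · intro f hf
    simp only [triples, mem_filter, Fintype.mem_piFinset] at hf
    simp only [mem_sigma, mem_filter, pairs, Fintype.mem_piFinset]
    have := (isModel_insertNth (T := T) i (f i) (fun j => f (i.succAbove j))).1 (by
      have e : i.insertNth (f i) (fun j => f (i.succAbove j)) = f := Fin.insertNth_self_removeNth i f
      rw [e]; exact hf.2)
    exact ⟨⟨fun j => hf.1 _, this.2⟩, hf.1 i, this.1⟩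
  · rintro ⟨g, a⟩ _
    simp
  · intro f _
    exact Fin.insertNth_self_removeNth i f
  · rintro ⟨g, a⟩ _
    rw [Fin.prod_univ_succAbove _ i]
    simp

theorem pairs_update (T : Finset F) (i : Fin 3) (d : Fin 3 → ℕ) (m : ℕ) :
    pairs T i (Function.update d i m) = pairs T i d := by
  unfold pairs
  simp [Fin.succAbove_ne]

theorem sum_pairs_le (T : Finset F) (i : Fin 3) (d : Fin 3 → ℕ) (Φ : F[X] → F[X] → ℝ)
    (hΦ : ∀ a b, 0 ≤ Φ a b) : ∑ g ∈ pairs T i d, Φ (g 0) (g 1) ≤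
      ∑ a ∈ polys F (d (i.succAbove 0)), ∑ b ∈ polys F (d (i.succAbove 1)), Φ a b := by
  rw [← Finset.sum_product' (f := Φ)]
  refine le_trans (le_of_eq ?_) (Finset.sum_le_sum_of_subset_of_nonneg
    (s := (pairs T i d).image fun g => (g 0, g 1)) (f := fun t => Φ t.1 t.2) ?_ ?_)
  · rw [Finset.sum_image]
    intro g _ g' _ e
    simp only [Prod.mk.injEq] at e
    funext t
    fin_cases t
    exacts [e.1, e.2]
  · intro t ht
    obtain ⟨g, hg, rfl⟩ := Finset.mem_image.1 ht
    simp only [pairs, mem_filter, Fintype.mem_piFinset] at hg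
    exact Finset.mem_product.2 ⟨hg.1 0, hg.1 1⟩
  · exact fun t _ _ => hΦ _ _

/-- The smooth count of a product is at most a threefold convolution. Averaged over the two
polynomials, each of them costs a constant times x⁻ʲ, while `zeroPoly T` costs only a power of j +
1. -/
theorem sum_pairs_smoothCount_le (k : ℕ) {x : ℝ} (hx : 0 < x) (hx1 : x < 1) {T : Finset F}
    (hT : T.card ≤ k) (i : Fin 3) (d : Fin 3 → ℕ) (j : ℕ) :
    ∑ g ∈ pairs T i d, (smoothCount (primesOf (g 0 * g 1 * zeroPoly T)) j : ℝ) ≤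
      Real.exp ((1 - x)⁻¹ * (1 - x)⁻¹) ^ 2 *
        ((q - 1) ^ 2 * q ^ (d (i.succAbove 0) + d (i.succAbove 1))) *
        ((j : ℝ) + 1) ^ (k + 2) * x⁻¹ ^ j := by
  set E := Real.exp ((1 - x)⁻¹ * (1 - x)⁻¹) with hE
  have hE0 : 0 < E := Real.exp_pos _
  have hq := one_le_card (F := F)
  have hq1 : 0 ≤ q - 1 := by linarith
  have h1 : ∀ g ∈ pairs T i d, (smoothCount (primesOf (g 0 * g 1 * zeroPoly T)) j : ℝ) ≤
      ∑ p ∈ antidiagonal j, (smoothCount (primesOf (g 0)) p.1 : ℝ) *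
        ∑ p' ∈ antidiagonal p.2, (smoothCount (primesOf (g 1)) p'.1 : ℝ) *
          (smoothCount (primesOf (zeroPoly T)) p'.2 : ℝ) := by
    intro g hg
    simp only [pairs, mem_filter, Fintype.mem_piFinset, mem_polys] at hg
    rw [primesOf_mul (mul_ne_zero (hg.1 0).1 (hg.1 1).1) (zeroPoly_monic T).ne_zero,
      primesOf_mul (hg.1 0).1 (hg.1 1).1, Finset.union_assoc]
    have := smoothCount_union_le (primesOf (g 0)) (primesOf (g 1) ∪ primesOf (zeroPoly T)) j
    refine (Nat.cast_le.2 this).trans ?_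
    push_cast
    refine Finset.sum_le_sum fun p _ => mul_le_mul_of_nonneg_left ?_ (Nat.cast_nonneg _)
    exact_mod_cast smoothCount_union_le (primesOf (g 1)) (primesOf (zeroPoly T)) p.2
  refine (Finset.sum_le_sum h1).trans ?_
  set Φ : F[X] → F[X] → ℝ := fun a b => ∑ p ∈ antidiagonal j,
    (smoothCount (primesOf a) p.1 : ℝ) *
      ∑ p' ∈ antidiagonal p.2, (smoothCount (primesOf b) p'.1 : ℝ) *
        (smoothCount (primesOf (zeroPoly T)) p'.2 : ℝ) with hΦ
  have h2 := sum_pairs_le T i d Φ fun a b => by simp only [hΦ]; positivity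
  refine h2.trans ?_
  have h3 : ∑ a ∈ polys F (d (i.succAbove 0)), ∑ b ∈ polys F (d (i.succAbove 1)), Φ a b =
      ∑ p ∈ antidiagonal j,
        (∑ a ∈ polys F (d (i.succAbove 0)), (smoothCount (primesOf a) p.1 : ℝ)) *
        ∑ p' ∈ antidiagonal p.2,
          (∑ b ∈ polys F (d (i.succAbove 1)), (smoothCount (primesOf b) p'.1 : ℝ)) *
          (smoothCount (primesOf (zeroPoly T)) p'.2 : ℝ) := by
    simp only [hΦ]
    rw [Finset.sum_congr rfl fun a _ => Finset.sum_comm, Finset.sum_comm]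
    refine Finset.sum_congr rfl fun p _ => ?_
    rw [← Finset.sum_mul_sum, Finset.sum_comm]
    simp_rw [Finset.sum_mul]
  rw [h3]
  have hxi : 1 ≤ x⁻¹ := (one_le_inv₀ hx).2 hx1.le
  have h4 : ∀ m, ∑ p' ∈ antidiagonal m,
          (∑ b ∈ polys F (d (i.succAbove 1)), (smoothCount (primesOf b) p'.1 : ℝ)) *
          (smoothCount (primesOf (zeroPoly T)) p'.2 : ℝ) ≤
      (E * ((q - 1) * q ^ d (i.succAbove 1))) * 1 * ((m : ℝ) + 1) ^ (k + 1) * x⁻¹ ^ m := by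
    intro m
    refine sum_antidiagonal_le
      (a := fun j => ∑ b ∈ polys F (d (i.succAbove 1)), (smoothCount (primesOf b) j : ℝ))
      (b := fun j => (smoothCount (primesOf (zeroPoly T)) j : ℝ)) k hx
      (fun n => sum_polys_smoothCount_le hx hx1 _ n) (fun n => ?_) (fun n => by positivity)
      zero_le_one m
    have h5 : (smoothCount (primesOf (zeroPoly T)) n : ℝ) ≤ ((n : ℝ) + 1) ^ T.card := by
      exact_mod_cast smoothCount_zeroPoly_le T n
    rw [one_mul]
    refine h5.trans ((pow_le_pow_right₀ (by linarith [(Nat.cast_nonneg n : (0 : ℝ) ≤ n)]) hT).trans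
      (le_mul_of_one_le_right (by positivity) (one_le_pow₀ hxi)))
  refine (sum_antidiagonal_le
    (a := fun j => ∑ a ∈ polys F (d (i.succAbove 0)), (smoothCount (primesOf a) j : ℝ))
    (b := fun m => ∑ p' ∈ antidiagonal m,
          (∑ b ∈ polys F (d (i.succAbove 1)), (smoothCount (primesOf b) p'.1 : ℝ)) *
          (smoothCount (primesOf (zeroPoly T)) p'.2 : ℝ)) (k + 1) hx
    (fun n => sum_polys_smoothCount_le hx hx1 _ n) h4 (fun n => by positivity)
    (by positivity) j).trans (le_of_eq ?_)
  rw [pow_add]; ring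

/-- The main estimate: sums over triples inherit bounds for the sums over one of the
polynomials. -/
theorem abs_tripleSum_sub_le (k : ℕ) {x : ℝ} (hx : 0 < x) (hx1 : x < 1) {T : Finset F}
    (hT : T.card ≤ k) (ψ : Fin 3 → (F[X] →* ℝ)) (hψ : ∀ i f, |ψ i f| ≤ 1) (i : Fin 3)
    (d : Fin 3 → ℕ) (κ B : ℝ) (hB : 0 ≤ B)
    (hc : ∀ n, |sieveSum (ψ i) ∅ n - κ * (if n = 0 then 0 else sieveSum (ψ i) ∅ (n - 1))| ≤
      B * ((n : ℝ) + 1) ^ k) :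
    |tripleSum T ψ d - κ * (if d i = 0 then 0 else tripleSum T ψ (Function.update d i (d i - 1)))|
      ≤ Real.exp ((1 - x)⁻¹ * (1 - x)⁻¹) ^ 2 * B *
        ((q - 1) ^ 2 * q ^ (d (i.succAbove 0) + d (i.succAbove 1))) *
        ((d i : ℝ) + 1) ^ (2 * k + 3) * x⁻¹ ^ d i := by
  set E := Real.exp ((1 - x)⁻¹ * (1 - x)⁻¹) with hE
  have hq := one_le_card (F := F)
  have hxi : 1 ≤ x⁻¹ := (one_le_inv₀ hx).2 hx1.le
  -- Only the degree of component i changes, so both sums run over the same pairs and the difference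
  -- is formed pair by pair.
  have h1 : tripleSum T ψ d -
      κ * (if d i = 0 then 0 else tripleSum T ψ (Function.update d i (d i - 1))) =
      ∑ g ∈ pairs T i d, (∏ j, ψ (i.succAbove j) (g j)) *
        (sieveSum (ψ i) (primesOf (g 0 * g 1 * zeroPoly T)) (d i) - κ *
          (if d i = 0 then 0 else
            sieveSum (ψ i) (primesOf (g 0 * g 1 * zeroPoly T)) (d i - 1))) := by
    rw [tripleSum_eq_sum_pairs T ψ i, tripleSum_eq_sum_pairs T ψ i, pairs_update,
      Function.update_self]
    split_ifs
    · simp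
    · rw [Finset.mul_sum, ← Finset.sum_sub_distrib]
      exact Finset.sum_congr rfl fun g _ => by ring
  rw [h1]
  refine (Finset.abs_sum_le_sum_abs _ _).trans ?_
  have h2 : ∀ g ∈ pairs T i d, |(∏ j, ψ (i.succAbove j) (g j)) *
        (sieveSum (ψ i) (primesOf (g 0 * g 1 * zeroPoly T)) (d i) - κ *
          (if d i = 0 then 0 else
            sieveSum (ψ i) (primesOf (g 0 * g 1 * zeroPoly T)) (d i - 1)))| ≤
      ∑ p ∈ antidiagonal (d i), (smoothCount (primesOf (g 0 * g 1 * zeroPoly T)) p.1 : ℝ) *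
        (B * ((p.2 : ℝ) + 1) ^ k) := by
    intro g hg
    simp only [pairs, mem_filter, Fintype.mem_piFinset, mem_polys] at hg
    rw [abs_mul, Finset.abs_prod]
    refine (mul_le_of_le_one_left (abs_nonneg _) (Finset.prod_le_one (fun _ _ => abs_nonneg _)
      fun _ _ => hψ _ _)).trans ?_
    refine abs_sieveSum_le (ψ i) (hψ i) κ (fun n => B * ((n : ℝ) + 1) ^ k) hc _ (fun r hr => ?_) _
    rw [mem_primesOf (mul_ne_zero (mul_ne_zero (hg.1 0).1 (hg.1 1).1)
      (zeroPoly_monic T).ne_zero)] at hr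
    exact ⟨hr.2.1, hr.1⟩
  refine (Finset.sum_le_sum h2).trans ?_
  rw [Finset.sum_comm]
  simp_rw [← Finset.sum_mul]
  have h3 : ∀ p ∈ antidiagonal (d i),
      (∑ g ∈ pairs T i d, (smoothCount (primesOf (g 0 * g 1 * zeroPoly T)) p.1 : ℝ)) *
        (B * ((p.2 : ℝ) + 1) ^ k) ≤
      E ^ 2 * B * ((q - 1) ^ 2 * q ^ (d (i.succAbove 0) + d (i.succAbove 1))) *
        ((d i : ℝ) + 1) ^ (2 * k + 2) * x⁻¹ ^ d i := by
    rintro ⟨a, b⟩ hp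
    rw [HasAntidiagonal.mem_antidiagonal] at hp
    simp only at hp ⊢
    have ha : (a : ℝ) ≤ d i := by exact_mod_cast (by omega : a ≤ d i)
    have hb : (b : ℝ) ≤ d i := by exact_mod_cast (by omega : b ≤ d i)
    have h4 : ((a : ℝ) + 1) ^ (k + 2) ≤ ((d i : ℝ) + 1) ^ (k + 2) :=
      pow_le_pow_left₀ (by positivity) (by linarith) _
    have h5 : ((b : ℝ) + 1) ^ k ≤ ((d i : ℝ) + 1) ^ k :=
      pow_le_pow_left₀ (by positivity) (by linarith) _
    have h6 : x⁻¹ ^ a ≤ x⁻¹ ^ d i := pow_le_pow_right₀ hxi (by omega)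
    calc _ ≤ (E ^ 2 * ((q - 1) ^ 2 * q ^ (d (i.succAbove 0) + d (i.succAbove 1))) *
            ((a : ℝ) + 1) ^ (k + 2) * x⁻¹ ^ a) * (B * ((b : ℝ) + 1) ^ k) :=
          mul_le_mul_of_nonneg_right (sum_pairs_smoothCount_le k hx hx1 hT i d a) (by positivity)
      _ ≤ (E ^ 2 * ((q - 1) ^ 2 * q ^ (d (i.succAbove 0) + d (i.succAbove 1))) *
            ((d i : ℝ) + 1) ^ (k + 2) * x⁻¹ ^ d i) * (B * ((d i : ℝ) + 1) ^ k) := by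
          gcongr
      _ = _ := by rw [show 2 * k + 2 = (k + 2) + k by omega, pow_add _ (k + 2) k]; ring
  refine (Finset.sum_le_card_nsmul _ _ _ h3).trans (le_of_eq ?_)
  rw [Finset.Nat.card_antidiagonal, nsmul_eq_mul]
  push_cast; ring

end Triples

/-! ### Prescribed zeros at rational points. -/

section LocalConditions

variable {F : Type*} [Field F] [Fintype F]

local notation "q" => (Fintype.card F : ℝ)

/-- At the point `x`, the component that vanishes is the one prescribed by `ρ` (none of them if
`ρ = none`). -/
def RamAt (f : Fin 3 → F[X]) (x : F) (ρ : Option (Fin 3)) : Prop :=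
  ∀ i, (f i).eval x = 0 ↔ ρ = some i

theorem RamAt.unique {f : Fin 3 → F[X]} {x : F} {ρ ρ' : Option (Fin 3)} (h : RamAt f x ρ)
    (h' : RamAt f x ρ') : ρ = ρ' := by
  cases ρ with
  | some i => exact ((h' i).1 ((h i).2 rfl)).symm
  | none =>
    cases ρ' with
    | none => rfl
    | some i => exact (h i).1 ((h' i).2 rfl)

theorem IsModel.not_eval_eq_zero {T : Finset F} {f : Fin 3 → F[X]} (hf : IsModel T f) {x : F}
    {i j : Fin 3} (hij : i ≠ j) (hi : (f i).eval x = 0) : (f j).eval x ≠ 0 := fun hj => by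
  have h := (hf.2.1 i j hij).isUnit_of_dvd' (dvd_iff_isRoot.2 hi) (dvd_iff_isRoot.2 hj)
  exact (irreducible_X_sub_C x).not_isUnit h

theorem IsModel.exists_ramAt {T : Finset F} {f : Fin 3 → F[X]} (hf : IsModel T f) (x : F) :
    ∃ ρ, RamAt f x ρ := by
  by_cases h : ∃ i, (f i).eval x = 0
  · obtain ⟨i, hi⟩ := h
    refine ⟨some i, fun j => ⟨fun hj => ?_, ?_⟩⟩
    · by_contra hne
      exact hf.not_eval_eq_zero (fun e => hne (by rw [e])) hi hj
    · rintro ⟨⟩; exact hi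
  · push Not at h
    exact ⟨none, fun j => ⟨fun hj => absurd hj (h j), by simp⟩⟩

/-- The points of `T` at which the component `i` is prescribed to vanish. -/
noncomputable def zeroSet (T : Finset F) (ρ : F → Option (Fin 3)) (i : Fin 3) : Finset F :=
  {x ∈ T | ρ x = some i}

theorem eval_zeroPoly_eq_zero {T : Finset F} {x : F} : (zeroPoly T).eval x = 0 ↔ x ∈ T := by
  rw [zeroPoly, eval_prod, Finset.prod_eq_zero_iff]
  simp [sub_eq_zero]

theorem natDegree_zeroPoly (T : Finset F) : (zeroPoly T).natDegree = T.card := by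
  rw [zeroPoly, natDegree_prod_of_monic _ _ fun y _ => monic_X_sub_C y]
  simp

theorem zeroPoly_dvd {T : Finset F} {f : F[X]} (h : ∀ x ∈ T, f.eval x = 0) : zeroPoly T ∣ f :=
  Finset.prod_dvd_of_coprime (fun _ _ _ _ hxy => isCoprime_X_sub_C_of_isUnit_sub
    (sub_ne_zero.2 hxy).isUnit) fun x hx => dvd_iff_isRoot.2 (h x hx)

theorem squarefree_zeroPoly (T : Finset F) : Squarefree (zeroPoly T) := by
  refine Finset.squarefree_prod_of_pairwise_isCoprime (fun x _ y _ hxy => ?_)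
    fun x _ => (irreducible_X_sub_C x).squarefree
  exact (isCoprime_X_sub_C_of_isUnit_sub (sub_ne_zero.2 hxy).isUnit).isRelPrime

/-- Squarefreeness makes the prescribed zeros simple, and coprimality forbids common ones. Dividing
them out leaves a triple without any zeros in T, of correspondingly smaller degrees. -/
theorem sum_triples_ramAt (T₀ T : Finset F) (hT : Disjoint T₀ T) (ρ : F → Option (Fin 3))
    (ψ : Fin 3 → (F[X] →* ℝ)) (d : Fin 3 → ℕ) (hd : ∀ i, (zeroSet T ρ i).card ≤ d i) :
    ∑ f ∈ triples T₀ d with ∀ x ∈ T, RamAt f x (ρ x), ∏ j, ψ j (f j) =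
      (∏ j, ψ j (zeroPoly (zeroSet T ρ j))) *
        tripleSum (T₀ ∪ T) ψ fun i => d i - (zeroSet T ρ i).card := by
  have hZ : ∀ i x, x ∈ zeroSet T ρ i ↔ x ∈ T ∧ ρ x = some i := fun i x => by simp [zeroSet]
  unfold tripleSum
  rw [Finset.mul_sum]
  symm
  refine Finset.sum_bij (fun f _ => fun i => zeroPoly (zeroSet T ρ i) * f i) ?_ ?_ ?_ ?_
  · intro f hf
    rw [mem_triples] at hf
    obtain ⟨hfd, hsq, hco, hev⟩ := hf
    rw [Finset.mem_filter, mem_triples]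
    have hco' : ∀ i j, IsCoprime (f i) (zeroPoly (zeroSet T ρ j)) := fun i j =>
      isCoprime_zeroPoly.2 fun x hx => hev i x (Finset.mem_union_right _ ((hZ _ _).1 hx).1)
    refine ⟨⟨fun i => ?_, fun i => ?_, fun i j hij => ?_, fun i x hx => ?_⟩, fun x hx i => ?_⟩
    · rw [(zeroPoly_monic _).natDegree_mul' (hsq i).ne_zero, natDegree_zeroPoly, hfd]
      have := hd i
      omega
    · exact squarefree_mul_iff.2 ⟨(hco' i i).symm.isRelPrime, squarefree_zeroPoly _, hsq i⟩
    · refine IsCoprime.mul_left (IsCoprime.mul_right ?_ (hco' j i).symm)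
        (IsCoprime.mul_right (hco' i j) (hco i j hij))
      refine isCoprime_zeroPoly.2 fun x hx => ?_
      rw [Ne, eval_zeroPoly_eq_zero, hZ]
      rintro ⟨-, h⟩
      rw [((hZ _ _).1 hx).2] at h
      exact hij (Option.some_injective _ h).symm
    · rw [eval_mul]
      refine mul_ne_zero ?_ (hev i x (Finset.mem_union_left _ hx))
      rw [Ne, eval_zeroPoly_eq_zero, hZ]
      exact fun h => Finset.disjoint_left.1 hT hx h.1
    · rw [eval_mul, mul_eq_zero, or_iff_left (hev i x (Finset.mem_union_right _ hx)),
        eval_zeroPoly_eq_zero, hZ]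
      exact and_iff_right hx
  · intro f _ g _ h
    funext i
    exact mul_left_cancel₀ (zeroPoly_monic _).ne_zero (congrFun h i)
  · intro f hf
    rw [Finset.mem_filter, mem_triples] at hf
    obtain ⟨⟨hfd, hsq, hco, hev⟩, hram⟩ := hf
    have hdvd : ∀ i, ∃ g, f i = zeroPoly (zeroSet T ρ i) * g := fun i => zeroPoly_dvd fun x hx => by
      rw [hZ] at hx
      exact (hram x hx.1 i).2 hx.2
    choose g hg using hdvd
    refine ⟨g, ?_, funext fun i => (hg i).symm⟩
    rw [mem_triples]
    have hsq' : ∀ i, Squarefree (g i) := fun i => (squarefree_mul_iff.1 (hg i ▸ hsq i)).2.2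
    have hcoZ : ∀ i, IsCoprime (g i) (zeroPoly (zeroSet T ρ i)) := fun i =>
      (squarefree_mul_iff.1 (hg i ▸ hsq i)).1.isCoprime.symm
    refine ⟨fun i => ?_, hsq', fun i j hij => ?_, fun i x hx => ?_⟩
    · rw [← hfd i, hg i, (zeroPoly_monic _).natDegree_mul' (hsq' i).ne_zero, natDegree_zeroPoly]
      omega
    · have := hco i j hij
      rw [hg i, hg j] at this
      exact this.of_mul_left_right.of_mul_right_right
    · rcases Finset.mem_union.1 hx with hx | hx
      · have := hev i x hx
        rw [hg i, eval_mul] at this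
        exact right_ne_zero_of_mul this
      · by_cases hxi : ρ x = some i
        · exact isCoprime_zeroPoly.1 (hcoZ i) x ((hZ _ _).2 ⟨hx, hxi⟩)
        · have : (f i).eval x ≠ 0 := fun h => hxi ((hram x hx i).1 h)
          rw [hg i, eval_mul] at this
          exact right_ne_zero_of_mul this
  · intro f _
    rw [← Finset.prod_mul_distrib]
    exact Finset.prod_congr rfl fun i _ => (map_mul _ _ _).symm

/-- Lowering a degree vector at one place (or nowhere). -/
def lower (d : Fin 3 → ℕ) : Option (Fin 3) → Fin 3 → ℕ
  | none => d
  | some i => Function.update d i (d i - 1)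

theorem lower_apply (d : Fin 3 → ℕ) (r : Option (Fin 3)) (i : Fin 3) :
    lower d r i = d i - if r = some i then 1 else 0 := by
  cases r with
  | none => simp [lower]
  | some j =>
    by_cases h : i = j
    · subst h; simp [lower]
    · simp [lower, h, Ne.symm h]

/-- Removing a point from the set of excluded zeros. -/
theorem tripleSum_insert (T : Finset F) {x : F} (hx : x ∉ T) (d : Fin 3 → ℕ) (hd : ∀ i, 1 ≤ d i) :
    tripleSum T (fun _ => 1) d = ∑ r, tripleSum (insert x T) (fun _ => 1) (lower d r) := by
  -- The summand r collects the triples of ramification type r at x; this is `sum_triples_ramAt` for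
  -- the single point x.
  have h1 : ∀ r : Option (Fin 3), tripleSum (insert x T) (fun _ => 1) (lower d r) =
      ∑ f ∈ triples T d with RamAt f x r, ∏ j : Fin 3, (1 : F[X] →* ℝ) (f j) := by
    intro r
    have hz : ∀ i, (zeroSet {x} (fun _ => r) i).card = if r = some i then 1 else 0 := by
      intro i
      unfold zeroSet
      split_ifs with h <;> simp [h]
    have h := sum_triples_ramAt T {x} (by simpa using hx) (fun _ => r) (fun _ => 1) d
      (fun i => by rw [hz]; split_ifs <;> [exact hd i; exact Nat.zero_le _])
    simp only [Finset.mem_singleton, forall_eq] at h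
    rw [h]
    simp only [MonoidHom.one_apply, Finset.prod_const_one, one_mul, hz]
    rw [Finset.union_comm, ← Finset.insert_eq]
    congr 1
    funext i
    exact lower_apply d r i
  simp_rw [h1]
  unfold tripleSum
  simp_rw [Finset.sum_filter]
  rw [Finset.sum_comm]
  refine Finset.sum_congr rfl fun f hf => ?_
  obtain ⟨ρ, hρ⟩ := (mem_triples.1 hf).2.exists_ramAt x
  rw [Finset.sum_eq_single ρ, if_pos hρ]
  · exact fun r _ hr => if_neg fun h => hr (h.unique hρ)
  · simp

end LocalConditions

/-! ### Densities of triples: dependence on the degrees and on excluded points. -/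

section NormalizedEstimates

variable {F : Type*} [Field F] [Fintype F]

local notation "q" => (Fintype.card F : ℝ)

theorem three_le_card (hF : ringChar F ≠ 2) : 3 ≤ Fintype.card F := by
  have h1 : 1 < Fintype.card F := Fintype.one_lt_card
  have h2 : Fintype.card F % 2 = 1 := FiniteField.odd_card_of_char_ne_two hF
  omega

/-- The number of triples of polynomials with nonzero leading coefficients of given degrees, up to
the factors `(1 - 1 / q)`. -/
noncomputable def modelSize (F : Type*) [Field F] [Fintype F] (d : Fin 3 → ℕ) : ℝ :=
  ((Fintype.card F : ℝ) - 1) ^ 3 * (Fintype.card F : ℝ) ^ ∑ i, d i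

theorem modelSize_pos (hF : ringChar F ≠ 2) (d : Fin 3 → ℕ) : 0 < modelSize F d := by
  have : (3 : ℝ) ≤ q := by exact_mod_cast three_le_card hF
  unfold modelSize
  have : 0 < q - 1 := by linarith
  positivity

/-- The proportion of triples. -/
noncomputable def density (T : Finset F) (d : Fin 3 → ℕ) : ℝ :=
  tripleSum T (fun _ => 1) d / modelSize F d

/-- The sum over component i has trivial size about q^{d i}; a nontrivial character there saves all
of it except q^|T| and an arbitrarily slow exponential. -/
theorem abs_tripleSum_polyChar_le (k : ℕ) {y : ℝ} (hy : 0 < y) (hy1 : y < 1) :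
    ∃ C : ℝ, 0 < C ∧ ∀ (F : Type*) [Field F] [Fintype F], ringChar F ≠ 2 →
      ∀ (T : Finset F), T.card ≤ k → ∀ (U : Fin 3 → Finset F) (a : Fin 3 → ℕ) (i : Fin 3),
        U i ⊆ T → ((U i).Nonempty ∨ Odd (a i)) → ∀ d : Fin 3 → ℕ,
        |tripleSum T (fun j => polyChar (U j) (a j)) d| ≤
          C * (Fintype.card F : ℝ) ^ T.card * (y⁻¹ / Fintype.card F) ^ d i * modelSize F d := by
  -- Two factors x⁻ᵈ must fit into y⁻ᵈ: one is the loss of the sieve, the other absorbs the power of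
  -- d i + 1.
  set x := √y with hx
  have hx0 : 0 < x := Real.sqrt_pos.2 hy
  have hxx : x * x = y := Real.mul_self_sqrt hy.le
  have hx1 : x < 1 := by nlinarith
  obtain ⟨C, hC, hCn⟩ := exists_pow_le_const_mul (2 * k + 3) hx0 hx1
  refine ⟨Real.exp ((1 - x)⁻¹ * (1 - x)⁻¹) ^ 2 * 2 * C, by positivity, ?_⟩
  intro F _ _ hF T hT U a i hU ha d
  have hq : (3 : ℝ) ≤ Fintype.card F := by exact_mod_cast three_le_card hF
  set Q : ℝ := (Fintype.card F : ℝ) with hQ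
  have hUk : (U i).card ≤ T.card := Finset.card_le_card hU
  have hQ1 : 0 ≤ Q - 1 := by linarith
  have h := abs_tripleSum_sub_le k hx0 hx1 hT (fun j => polyChar (U j) (a j))
    (fun j f => abs_polyChar_le_one _ _ f) i d 0 (2 * ((Q - 1) * Q ^ T.card)) (by positivity) (by
      intro n
      rw [zero_mul, sub_zero]
      refine (abs_sieveSum_polyChar_le hF (U i) (a i) ha n).trans ?_
      have h1 : ((n : ℝ) + 1) ^ (U i).card ≤ ((n : ℝ) + 1) ^ k :=
        pow_le_pow_right₀ (by linarith [(Nat.cast_nonneg n : (0 : ℝ) ≤ n)]) (hUk.trans hT)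
      have h2 : Q ^ (U i).card ≤ Q ^ T.card := pow_le_pow_right₀ (by linarith) hUk
      calc 2 * ((n : ℝ) + 1) ^ (U i).card * ((Q - 1) * Q ^ (U i).card)
          ≤ 2 * ((n : ℝ) + 1) ^ k * ((Q - 1) * Q ^ T.card) := by gcongr
        _ = _ := by ring)
  rw [zero_mul, sub_zero] at h
  refine h.trans ?_
  set E := Real.exp ((1 - x)⁻¹ * (1 - x)⁻¹) with hE
  have h3 := hCn (d i)
  have e1 : (y⁻¹ / Q) ^ d i * Q ^ d i = x⁻¹ ^ d i * x⁻¹ ^ d i := by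
    rw [← mul_pow, ← mul_pow, div_mul_cancel₀ _ (by linarith : Q ≠ 0), ← hxx, mul_inv]
  have e2 : Q ^ ∑ j, d j = Q ^ d i * Q ^ (d (i.succAbove 0) + d (i.succAbove 1)) := by
    rw [Fin.sum_univ_succAbove _ i, Fin.sum_univ_two, pow_add]
  unfold modelSize
  rw [← hQ, e2]
  calc E ^ 2 * (2 * ((Q - 1) * Q ^ T.card)) *
        ((Q - 1) ^ 2 * Q ^ (d (i.succAbove 0) + d (i.succAbove 1))) *
        ((d i : ℝ) + 1) ^ (2 * k + 3) * x⁻¹ ^ d i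
      ≤ E ^ 2 * (2 * ((Q - 1) * Q ^ T.card)) *
        ((Q - 1) ^ 2 * Q ^ (d (i.succAbove 0) + d (i.succAbove 1))) *
        (C * x⁻¹ ^ d i) * x⁻¹ ^ d i := by gcongr
    _ = E ^ 2 * 2 * C * Q ^ T.card * ((Q - 1) ^ 3 *
        Q ^ (d (i.succAbove 0) + d (i.succAbove 1))) * (x⁻¹ ^ d i * x⁻¹ ^ d i) := by ring
    _ = _ := by rw [← e1]; ring

theorem modelSize_update (i : Fin 3) (d : Fin 3 → ℕ) (hd : 1 ≤ d i) :
    modelSize F d = q * modelSize F (Function.update d i (d i - 1)) := by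
  unfold modelSize
  rw [Fin.sum_univ_succAbove _ i, Fin.sum_univ_succAbove _ i]
  obtain ⟨m, hm⟩ := Nat.exists_eq_add_of_le' hd
  simp only [Function.update_self, ne_eq, Fin.succAbove_ne, not_false_eq_true,
    Function.update_of_ne, hm, Nat.add_sub_cancel]
  rw [show m + 1 + ∑ x, d (i.succAbove x) = (m + ∑ x, d (i.succAbove x)) + 1 by omega, pow_succ]
  ring

/-- The sieve with κ = q. Lowering d i by one divides `modelSize` by q, so the numerator of the
difference of densities is a difference controlled by `abs_sieveSum_one_sub_le`. -/
theorem abs_density_sub_le (k : ℕ) {y : ℝ} (hy : 0 < y) (hy1 : y < 1) :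
    ∃ C : ℝ, 0 < C ∧ ∀ (F : Type*) [Field F] [Fintype F], ringChar F ≠ 2 →
      ∀ (T : Finset F), T.card ≤ k → ∀ (i : Fin 3) (d : Fin 3 → ℕ), 1 ≤ d i →
        |density T d - density T (Function.update d i (d i - 1))| ≤
          C * Fintype.card F * (y⁻¹ / Fintype.card F) ^ d i := by
  set x := √y with hx
  have hx0 : 0 < x := Real.sqrt_pos.2 hy
  have hxx : x * x = y := Real.mul_self_sqrt hy.le
  have hx1 : x < 1 := by nlinarith
  obtain ⟨C, hC, hCn⟩ := exists_pow_le_const_mul (2 * k + 3) hx0 hx1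
  refine ⟨Real.exp ((1 - x)⁻¹ * (1 - x)⁻¹) ^ 2 * C, by positivity, ?_⟩
  intro F _ _ hF T hT i d hd
  have hq : (3 : ℝ) ≤ Fintype.card F := by exact_mod_cast three_le_card hF
  have hS := modelSize_pos hF d
  have hS' := modelSize_pos hF (Function.update d i (d i - 1))
  set Q : ℝ := (Fintype.card F : ℝ) with hQ
  have hQ1 : 0 ≤ Q - 1 := by linarith
  have h := abs_tripleSum_sub_le k hx0 hx1 hT (fun _ => 1)
    (fun j f => by simp) i d Q ((Q - 1) * Q) (by positivity) (by
      intro n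
      refine (abs_sieveSum_one_sub_le n).trans (le_mul_of_one_le_right (by positivity) ?_)
      exact one_le_pow₀ (by linarith [(Nat.cast_nonneg n : (0 : ℝ) ≤ n)]))
  rw [if_neg (by omega)] at h
  have e0 : density T d - density T (Function.update d i (d i - 1)) =
      (tripleSum T (fun _ => 1) d - Q * tripleSum T (fun _ => 1) (Function.update d i (d i - 1))) /
        modelSize F d := by
    unfold density
    rw [modelSize_update i d hd]
    field_simp
    simp only [← hQ]
    ring
  rw [e0, abs_div, abs_of_pos hS, div_le_iff₀ hS]
  refine h.trans ?_
  set E := Real.exp ((1 - x)⁻¹ * (1 - x)⁻¹) with hE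
  have h3 := hCn (d i)
  have e1 : (y⁻¹ / Q) ^ d i * Q ^ d i = x⁻¹ ^ d i * x⁻¹ ^ d i := by
    rw [← mul_pow, ← mul_pow, div_mul_cancel₀ _ (by linarith : Q ≠ 0), ← hxx, mul_inv]
  have e2 : Q ^ ∑ j, d j = Q ^ d i * Q ^ (d (i.succAbove 0) + d (i.succAbove 1)) := by
    rw [Fin.sum_univ_succAbove _ i, Fin.sum_univ_two, pow_add]
  unfold modelSize
  rw [← hQ, e2]
  calc E ^ 2 * ((Q - 1) * Q) *
        ((Q - 1) ^ 2 * Q ^ (d (i.succAbove 0) + d (i.succAbove 1))) *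
        ((d i : ℝ) + 1) ^ (2 * k + 3) * x⁻¹ ^ d i
      ≤ E ^ 2 * ((Q - 1) * Q) *
        ((Q - 1) ^ 2 * Q ^ (d (i.succAbove 0) + d (i.succAbove 1))) *
        (C * x⁻¹ ^ d i) * x⁻¹ ^ d i := by gcongr
    _ = E ^ 2 * C * Q * ((Q - 1) ^ 3 *
        Q ^ (d (i.succAbove 0) + d (i.succAbove 1))) * (x⁻¹ ^ d i * x⁻¹ ^ d i) := by ring
    _ = _ := by rw [← e1]; ring

/-- Iterated version of `abs_density_sub_le`, in one coordinate. -/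
theorem abs_density_update_sub_le {C θ : ℝ} (hC : 0 < C) (hθ : q⁻¹ ≤ θ) (hθ1 : θ ≤ 1)
    {T : Finset F} (i : Fin 3)
    (h : ∀ d : Fin 3 → ℕ, 1 ≤ d i → |density T d - density T (Function.update d i (d i - 1))| ≤
          C * q * θ ^ d i) (d : Fin 3 → ℕ) (s : ℕ) (hs : s ≤ d i) :
    |density T (Function.update d i (d i - s)) - density T d| * q⁻¹ ^ s ≤ s * C * θ ^ d i := by
  have hq : 0 < q := by exact_mod_cast Fintype.card_pos
  have hq' : 0 < q⁻¹ := inv_pos.2 hq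
  have hθ0 : 0 < θ := hq'.trans_le hθ
  have key : ∀ s ≤ d i, |density T (Function.update d i (d i - s)) - density T d| ≤
      s * (C * q * θ ^ (d i + 1 - s)) := by
    intro s
    induction s with
    | zero => intro _; simp
    | succ s ih =>
      intro hs
      have h1 := h (Function.update d i (d i - s)) (by simp; omega)
      simp only [Function.update_self, Function.update_idem] at h1
      rw [show d i - s - 1 = d i - (s + 1) by omega, abs_sub_comm] at h1
      have h2 := ih (by omega)
      have h3 : θ ^ (d i + 1 - s) ≤ θ ^ (d i - s) := pow_le_pow_of_le_one hθ0.le hθ1 (by omega)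
      rw [show d i + 1 - (s + 1) = d i - s by omega]
      have h4 : (s : ℝ) * (C * q * θ ^ (d i + 1 - s)) ≤ s * (C * q * θ ^ (d i - s)) := by gcongr
      have := abs_sub_le (density T (Function.update d i (d i - (s + 1))))
        (density T (Function.update d i (d i - s))) (density T d)
      push_cast
      linarith
  rcases Nat.eq_zero_or_pos s with rfl | hs0
  · simp
  obtain ⟨t, rfl⟩ := Nat.exists_eq_add_of_le' hs0
  refine (mul_le_mul_of_nonneg_right (key _ hs) (by positivity)).trans ?_
  -- Lowering the degree by s = t + 1 loses θ⁻ᵗ in the error. The weight q⁻ˢ, by which `modelSize`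
  -- shrinks, repairs this as q⁻¹ ≤ θ, and its last factor q⁻¹ cancels the q in the one-step bound.
  have h5 : q⁻¹ ^ t ≤ θ ^ t := pow_le_pow_left₀ hq'.le hθ t
  have h6 : θ ^ d i = θ ^ (d i + 1 - (t + 1)) * θ ^ t := by rw [← pow_add]; congr 1; omega
  rw [h6, pow_succ]
  calc ((t + 1 : ℕ) : ℝ) * (C * q * θ ^ (d i + 1 - (t + 1))) * (q⁻¹ ^ t * q⁻¹)
      = ((t + 1 : ℕ) : ℝ) * C * (θ ^ (d i + 1 - (t + 1)) * q⁻¹ ^ t) * (q * q⁻¹) := by ring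
    _ = ((t + 1 : ℕ) : ℝ) * C * (θ ^ (d i + 1 - (t + 1)) * q⁻¹ ^ t) := by
        rw [mul_inv_cancel₀ hq.ne', mul_one]
    _ ≤ _ := by gcongr

/-- The three coordinates are lowered one after another. -/
theorem abs_density_shift_le {C θ : ℝ} (hC : 0 < C) (hθ : q⁻¹ ≤ θ) (hθ1 : θ ≤ 1)
    {T : Finset F}
    (h : ∀ (i : Fin 3) (d : Fin 3 → ℕ), 1 ≤ d i →
      |density T d - density T (Function.update d i (d i - 1))| ≤ C * q * θ ^ d i)
    (d z : Fin 3 → ℕ) (m : ℕ) (hz : ∀ i, z i ≤ d i) (hm : ∀ i, m ≤ d i) :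
    |density T (fun i => d i - z i) - density T d| * q⁻¹ ^ ∑ i, z i ≤ (∑ i, z i : ℕ) * C * θ ^ m := by
  have hq : 1 ≤ q := one_le_card
  have hq' : 0 < q⁻¹ := inv_pos.2 (by linarith)
  have hq1 : q⁻¹ ≤ 1 := inv_le_one_of_one_le₀ hq
  have hθ0 : 0 < θ := hq'.trans_le hθ
  set d1 := Function.update d 0 (d 0 - z 0) with hd1
  set d2 := Function.update d1 1 (d1 1 - z 1) with hd2
  set d3 := Function.update d2 2 (d2 2 - z 2) with hd3
  have e3 : d3 = fun i => d i - z i := by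
    funext i
    fin_cases i <;> simp [hd3, hd2, hd1]
  have step : ∀ (d' : Fin 3 → ℕ) (i : Fin 3), d' i = d i →
      |density T (Function.update d' i (d' i - z i)) - density T d'| * q⁻¹ ^ ∑ i, z i ≤
        z i * C * θ ^ m := by
    intro d' i hi
    have h1 := abs_density_update_sub_le hC hθ hθ1 i (h i) d' (z i) (by rw [hi]; exact hz i)
    have h2 : q⁻¹ ^ ∑ i, z i ≤ q⁻¹ ^ z i := pow_le_pow_of_le_one hq'.le hq1
      (Finset.single_le_sum (f := z) (fun _ _ => Nat.zero_le _) (Finset.mem_univ i))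
    have h3 : θ ^ d' i ≤ θ ^ m := pow_le_pow_of_le_one hθ0.le hθ1 (by rw [hi]; exact hm i)
    calc _ ≤ |density T (Function.update d' i (d' i - z i)) - density T d'| * q⁻¹ ^ z i := by gcongr
      _ ≤ _ := h1
      _ ≤ _ := by gcongr
  have s1 := step d 0 rfl
  have s2 := step d1 1 (by simp [hd1])
  have s3 := step d2 2 (by simp [hd2, hd1])
  rw [← hd1] at s1
  rw [← hd2] at s2
  rw [← hd3] at s3
  rw [← e3]
  have t1 : |density T d3 - density T d| ≤ |density T d3 - density T d2| +
      |density T d2 - density T d1| + |density T d1 - density T d| := by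
    have a1 := abs_sub_le (density T d3) (density T d2) (density T d)
    have a2 := abs_sub_le (density T d2) (density T d1) (density T d)
    linarith
  have t2 := mul_le_mul_of_nonneg_right t1 (show 0 ≤ q⁻¹ ^ ∑ i, z i by positivity)
  refine t2.trans ?_
  have t3 : ((∑ i, z i : ℕ) : ℝ) = z 0 + z 1 + z 2 := by rw [Fin.sum_univ_three]; push_cast; ring
  rw [t3]
  linarith

theorem modelSize_sub (d z : Fin 3 → ℕ) (hz : ∀ i, z i ≤ d i) :
    modelSize F (fun i => d i - z i) = q⁻¹ ^ (∑ i, z i) * modelSize F d := by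
  have hq : q ≠ 0 := by exact_mod_cast Fintype.card_ne_zero
  have e : ∑ i, d i = (∑ i, (d i - z i)) + ∑ i, z i := by
    rw [← Finset.sum_add_distrib]
    exact Finset.sum_congr rfl fun i _ => (Nat.sub_add_cancel (hz i)).symm
  unfold modelSize
  rw [e, pow_add, inv_pow]
  field_simp

theorem lower_eq_sub (d : Fin 3 → ℕ) (r : Option (Fin 3)) :
    lower d r = fun i => d i - if r = some i then 1 else 0 := funext (lower_apply d r)

theorem sum_ite_some (r : Option (Fin 3)) :
    ∑ i, (if r = some i then 1 else 0) = if r = none then 0 else 1 := by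
  cases r with
  | none => simp
  | some j => simp

/-- The limiting probability of a ramification type at a point. -/
noncomputable def ramProb (Q : ℝ) (r : Option (Fin 3)) : ℝ :=
  if r = none then Q / (Q + 3) else 1 / (Q + 3)

theorem ramProb_eq (r : Option (Fin 3)) :
    ramProb q r = q / (q + 3) * q⁻¹ ^ (if r = none then 0 else 1) := by
  have hq : q ≠ 0 := by exact_mod_cast Fintype.card_ne_zero
  unfold ramProb
  split_ifs
  · simp
  · field_simp

theorem tripleSum_eq_density (hF : ringChar F ≠ 2) (T : Finset F) (d : Fin 3 → ℕ) :
    tripleSum T (fun _ => 1) d = density T d * modelSize F d := by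
  rw [density, div_mul_cancel₀ _ (modelSize_pos hF d).ne']

/-- Normalised form of `tripleSum_insert`. The type `none` keeps the degrees; each of the other
three lowers one degree and so carries the weight q⁻¹. Replacing the shifted densities by the one at
d gives the factor 1 + 3/q. -/
theorem abs_density_insert_le (hF : ringChar F ≠ 2) {C θ : ℝ} (hC : 0 < C) (hθ : q⁻¹ ≤ θ)
    (hθ1 : θ ≤ 1) {T : Finset F} {x : F} (hx : x ∉ T)
    (h : ∀ (i : Fin 3) (d : Fin 3 → ℕ), 1 ≤ d i → |density (insert x T) d -
      density (insert x T) (Function.update d i (d i - 1))| ≤ C * q * θ ^ d i)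
    (d : Fin 3 → ℕ) (m : ℕ) (hm : ∀ i, m ≤ d i) (hm1 : 1 ≤ m) :
    |density T d - (1 + 3 * q⁻¹) * density (insert x T) d| ≤ 3 * (C * θ ^ m) := by
  have hS := modelSize_pos hF d
  have e1 : density T d = ∑ r : Option (Fin 3),
      q⁻¹ ^ (if r = none then 0 else 1) * density (insert x T) (lower d r) := by
    rw [density, tripleSum_insert T hx d fun i => hm1.trans (hm i), Finset.sum_div]
    refine Finset.sum_congr rfl fun r _ => ?_
    rw [tripleSum_eq_density hF, lower_eq_sub, modelSize_sub d _ fun i => by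
      split_ifs <;> [exact hm1.trans (hm i); exact Nat.zero_le _], sum_ite_some]
    field_simp
  have e2 : (1 + 3 * q⁻¹) * density (insert x T) d = ∑ r : Option (Fin 3),
      q⁻¹ ^ (if r = none then 0 else 1) * density (insert x T) d := by
    rw [Fintype.sum_option]
    simp; ring
  rw [e1, e2, ← Finset.sum_sub_distrib]
  refine (Finset.abs_sum_le_sum_abs _ _).trans ?_
  rw [Fintype.sum_option]
  simp only [if_true, pow_zero, one_mul, lower, sub_self, abs_zero, zero_add, reduceCtorEq,
    if_false, pow_one]
  have h1 : ∀ i : Fin 3, |q⁻¹ * density (insert x T) (Function.update d i (d i - 1)) -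
      q⁻¹ * density (insert x T) d| ≤ C * θ ^ m := by
    intro i
    have := abs_density_shift_le hC hθ hθ1 h d (fun j => if some i = some j then 1 else 0) m
      (fun j => by split_ifs <;> [exact hm1.trans (hm j); exact Nat.zero_le _]) hm
    rw [← lower_eq_sub, sum_ite_some, if_neg (by simp)] at this
    simp only [lower, pow_one, Nat.cast_one, one_mul] at this
    rw [← mul_sub, abs_mul, abs_of_nonneg (by positivity), mul_comm]
    exact this
  refine (Finset.sum_le_sum fun i _ => h1 i).trans (le_of_eq ?_)
  simp

/-- Iterates the preceding estimate over T: since (1 + 3/q)⁻¹ = q/(q + 3), each excluded point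
contributes the limiting probability that no component vanishes there. -/
theorem abs_density_empty_le (hF : ringChar F ≠ 2) {C θ : ℝ} (hC : 0 < C) (hθ : q⁻¹ ≤ θ)
    (hθ1 : θ ≤ 1) (k : ℕ)
    (h : ∀ (T : Finset F), T.card ≤ k → ∀ (i : Fin 3) (d : Fin 3 → ℕ), 1 ≤ d i →
      |density T d - density T (Function.update d i (d i - 1))| ≤ C * q * θ ^ d i)
    (d : Fin 3 → ℕ) (m : ℕ) (hm : ∀ i, m ≤ d i) (hm1 : 1 ≤ m) (T : Finset F) (hT : T.card ≤ k) :
    |density T d - (q / (q + 3)) ^ T.card * density (∅ : Finset F) d| ≤ 3 * T.card * (C * θ ^ m) := by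
  have hq : 0 < q := by exact_mod_cast Fintype.card_pos
  have hθ0 : 0 < θ := (inv_pos.2 hq).trans_le hθ
  induction T using Finset.induction_on with
  | empty => simp
  | insert x T hx ih =>
    rw [Finset.card_insert_of_notMem hx] at hT ⊢
    have h1 := ih (by omega)
    have hT' : (insert x T).card ≤ k := by rwa [Finset.card_insert_of_notMem hx]
    have h2 : |density T d - (1 + 3 * q⁻¹) * density (insert x T) d| ≤ 3 * (C * θ ^ m) :=
      abs_density_insert_le hF hC hθ hθ1 hx (h (insert x T) hT') d m hm hm1
    have hp1 : q / (q + 3) ≤ 1 := (div_le_one (by linarith)).2 (by linarith)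
    have hp0 : 0 ≤ q / (q + 3) := by positivity
    have e : density (insert x T) d - (q / (q + 3)) ^ (T.card + 1) * density (∅ : Finset F) d =
        q / (q + 3) * (-(density T d - (1 + 3 * q⁻¹) * density (insert x T) d) +
          (density T d - (q / (q + 3)) ^ T.card * density (∅ : Finset F) d)) := by
      rw [pow_succ]; field_simp; ring
    rw [e, abs_mul, abs_of_nonneg hp0]
    refine (mul_le_of_le_one_left (abs_nonneg _) hp1).trans ((abs_add_le _ _).trans ?_)
    rw [abs_neg]
    push_cast
    linarith

end NormalizedEstimates

/-! ### Joint distribution of ramification types and characters. -/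

section JointEstimate

variable {F : Type*} [Field F] [Fintype F]

local notation "q" => (Fintype.card F : ℝ)

/-- The points of `T` at which a character that involves the component `j` is prescribed. -/
noncomputable def twistSet (T : Finset F) (e : F → Option (Fin 3)) (j : Fin 3) : Finset F :=
  {x ∈ T | ∃ i, e x = some i ∧ i ≠ j}

/-- The exponent of the leading coefficient of the component `j` in the prescribed character at
infinity. -/
noncomputable def twistExp (a : Option (Fin 3)) (j : Fin 3) : ℕ :=
  if ∃ i, a = some i ∧ i ≠ j then 1 else 0

/-- The approximate number of triples whose degrees are given by `lower d r` for some `r`. -/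
noncomputable def mainTerm (F : Type*) [Field F] [Fintype F] (d : Fin 3 → ℕ) : ℝ :=
  (1 + 3 * (Fintype.card F : ℝ)⁻¹) * density (∅ : Finset F) d * modelSize F d

theorem sum_card_zeroSet (T : Finset F) (ρ : F → Option (Fin 3)) :
    ∑ i, (zeroSet T ρ i).card = ∑ x ∈ T, if ρ x = none then 0 else 1 := by
  simp only [zeroSet, Finset.card_filter]
  rw [Finset.sum_comm]
  exact Finset.sum_congr rfl fun x _ => sum_ite_some (ρ x)

theorem sum_card_zeroSet_le (T : Finset F) (ρ : F → Option (Fin 3)) :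
    ∑ i, (zeroSet T ρ i).card ≤ T.card := by
  rw [sum_card_zeroSet, Finset.card_eq_sum_ones]
  exact Finset.sum_le_sum fun x _ => by split_ifs <;> simp

theorem prod_ramProb (T : Finset F) (ρ : F → Option (Fin 3)) :
    ∏ x ∈ T, ramProb q (ρ x) = (q / (q + 3)) ^ T.card * q⁻¹ ^ ∑ i, (zeroSet T ρ i).card := by
  rw [sum_card_zeroSet, ← Finset.prod_pow_eq_pow_sum, ← Finset.prod_const,
    ← Finset.prod_mul_distrib]
  exact Finset.prod_congr rfl fun x _ => ramProb_eq (ρ x)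

/-- The prescribed zeros and the lowering r combine into one degree shift z'. Its weight q⁻¹ per
unit and the factor q/(q + 3) per point make up the product of the `ramProb`; the factor 1 + 3/q in
`mainTerm` compensates the q/(q + 3) in `ramProb q r`. -/
theorem abs_sum_triples_trivial_sub_le (hF : ringChar F ≠ 2) {C θ : ℝ} (hC : 0 < C)
    (hθ : q⁻¹ ≤ θ) (hθ1 : θ ≤ 1) (k : ℕ)
    (h : ∀ (T : Finset F), T.card ≤ k → ∀ (i : Fin 3) (d : Fin 3 → ℕ), 1 ≤ d i →
      |density T d - density T (Function.update d i (d i - 1))| ≤ C * q * θ ^ d i)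
    (T : Finset F) (hT : T.card ≤ k) (ρ : F → Option (Fin 3)) (r : Option (Fin 3))
    (d : Fin 3 → ℕ) (m : ℕ) (hm : ∀ i, m ≤ d i) (hkm : k + 1 ≤ m) :
    |∑ f ∈ triples ∅ (lower d r) with ∀ x ∈ T, RamAt f x (ρ x), (1 : ℝ) -
      (∏ x ∈ T, ramProb q (ρ x)) * ramProb q r * mainTerm F d| ≤
      (4 * k + 1) * C * θ ^ m * modelSize F d := by
  have hS := modelSize_pos hF d
  have hq : 1 ≤ q := one_le_card
  have hq' : 0 < q⁻¹ := inv_pos.2 (by linarith)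
  have hq1 : q⁻¹ ≤ 1 := inv_le_one_of_one_le₀ hq
  have hθ0 : 0 < θ := hq'.trans_le hθ
  have hzle := sum_card_zeroSet_le T ρ
  have hzi : ∀ i, (zeroSet T ρ i).card ≤ T.card := fun i => Finset.card_filter_le _ _
  set z' : Fin 3 → ℕ := fun i => (zeroSet T ρ i).card + if r = some i then 1 else 0 with hz'
  have hz'd : ∀ i, z' i ≤ d i := fun i => by
    have := hzi i; have := hm i
    simp only [hz']; split_ifs <;> omega
  have hsum : ∑ i, z' i = ∑ i, (zeroSet T ρ i).card + if r = none then 0 else 1 := by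
    rw [hz', Finset.sum_add_distrib, sum_ite_some]
  have hsum_le : ∑ i, z' i ≤ k + 1 := by rw [hsum]; split_ifs <;> omega
  have e1 : ∑ f ∈ triples ∅ (lower d r) with ∀ x ∈ T, RamAt f x (ρ x), (1 : ℝ) =
      density T (fun i => d i - z' i) * q⁻¹ ^ (∑ i, z' i) * modelSize F d := by
    have := sum_triples_ramAt ∅ T (Finset.disjoint_empty_left T) ρ (fun _ => 1) (lower d r)
      fun i => by
        have := hz'd i
        simp only [hz'] at this
        rw [lower_apply]; omega
    simp only [MonoidHom.one_apply, Finset.prod_const_one, one_mul, Finset.empty_union] at this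
    rw [this, show (fun i => lower d r i - (zeroSet T ρ i).card) = fun i => d i - z' i from
      funext fun i => by rw [lower_apply]; simp only [hz']; omega,
      tripleSum_eq_density hF, modelSize_sub d z' hz'd]
    ring
  have e2 : (∏ x ∈ T, ramProb q (ρ x)) * ramProb q r * mainTerm F d =
      (q / (q + 3)) ^ T.card * density (∅ : Finset F) d * q⁻¹ ^ (∑ i, z' i) * modelSize F d := by
    rw [prod_ramProb, hsum, pow_add, ramProb_eq, mainTerm]
    have : q / (q + 3) * (1 + 3 * q⁻¹) = 1 := by field_simp
    linear_combination ((q / (q + 3)) ^ T.card * q⁻¹ ^ (∑ i, (zeroSet T ρ i).card) *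
      q⁻¹ ^ (if r = none then 0 else 1) * density (∅ : Finset F) d * modelSize F d) * this
  have s1 := abs_density_shift_le hC hθ hθ1 (h T hT) d z' m hz'd hm
  have s2 := abs_density_empty_le hF hC hθ hθ1 k h d m hm (by omega) T hT
  have s3 : q⁻¹ ^ (∑ i, z' i) ≤ 1 := pow_le_one₀ hq'.le hq1
  have s4 : 0 < q⁻¹ ^ (∑ i, z' i) := pow_pos hq' _
  rw [e1, e2, ← sub_mul, abs_mul, abs_of_pos hS]
  refine mul_le_mul_of_nonneg_right ?_ hS.le
  rw [show density T (fun i => d i - z' i) * q⁻¹ ^ (∑ i, z' i) -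
      (q / (q + 3)) ^ T.card * density (∅ : Finset F) d * q⁻¹ ^ (∑ i, z' i) =
      (density T (fun i => d i - z' i) - density T d) * q⁻¹ ^ (∑ i, z' i) +
      (density T d - (q / (q + 3)) ^ T.card * density (∅ : Finset F) d) * q⁻¹ ^ (∑ i, z' i) by
    ring]
  refine (abs_add_le _ _).trans ?_
  rw [abs_mul, abs_mul, abs_of_pos s4]
  have s5 : |density T d - (q / (q + 3)) ^ T.card * density (∅ : Finset F) d| *
      q⁻¹ ^ (∑ i, z' i) ≤ 3 * T.card * (C * θ ^ m) :=
    (mul_le_of_le_one_right (abs_nonneg _) s3).trans s2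
  have s6 : ((∑ i, z' i : ℕ) : ℝ) ≤ k + 1 := by exact_mod_cast hsum_le
  have s7 : (T.card : ℝ) ≤ k := by exact_mod_cast hT
  have s8 : 0 ≤ C * θ ^ m := by positivity
  nlinarith

/-- The characters of the prescribed factors have absolute value at most 1 and can be dropped. The
degree that component i loses by the division is recovered from the ratio of the model sizes,
because q⁻¹ ≤ θ. -/
theorem abs_sum_triples_twisted_le (hF : ringChar F ≠ 2) {C θ : ℝ} (hC : 0 < C)
    (hθ : q⁻¹ ≤ θ) (hθ1 : θ ≤ 1) (k : ℕ)
    (h : ∀ (T : Finset F), T.card ≤ k → ∀ (U : Fin 3 → Finset F) (a : Fin 3 → ℕ) (i : Fin 3),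
        U i ⊆ T → ((U i).Nonempty ∨ Odd (a i)) → ∀ d : Fin 3 → ℕ,
        |tripleSum T (fun j => polyChar (U j) (a j)) d| ≤
          C * q ^ T.card * θ ^ d i * modelSize F d)
    (T : Finset F) (hT : T.card ≤ k) (ρ : F → Option (Fin 3)) (U : Fin 3 → Finset F)
    (a : Fin 3 → ℕ) (i : Fin 3) (hU : U i ⊆ T) (hUa : (U i).Nonempty ∨ Odd (a i))
    (r : Option (Fin 3)) (d : Fin 3 → ℕ) (m : ℕ) (hm : ∀ i, m ≤ d i) (hkm : k + 1 ≤ m) :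
    |∑ f ∈ triples ∅ (lower d r) with ∀ x ∈ T, RamAt f x (ρ x), ∏ j, polyChar (U j) (a j) (f j)| ≤
      C * q ^ T.card * θ ^ m * modelSize F d := by
  have hS := modelSize_pos hF d
  have hq : 1 ≤ q := one_le_card
  have hq' : 0 < q⁻¹ := inv_pos.2 (by linarith)
  have hθ0 : 0 < θ := hq'.trans_le hθ
  have hzi : ∀ i, (zeroSet T ρ i).card ≤ T.card := fun i => Finset.card_filter_le _ _
  set z' : Fin 3 → ℕ := fun i => (zeroSet T ρ i).card + if r = some i then 1 else 0 with hz'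
  have hz'd : ∀ i, z' i ≤ d i := fun i => by
    have := hzi i; have := hm i
    simp only [hz']; split_ifs <;> omega
  rw [sum_triples_ramAt ∅ T (Finset.disjoint_empty_left T) ρ (fun j => polyChar (U j) (a j))
    (lower d r) fun i => by
        have := hz'd i
        simp only [hz'] at this
        rw [lower_apply]; omega, Finset.empty_union,
    show (fun i => lower d r i - (zeroSet T ρ i).card) = fun i => d i - z' i from
      funext fun i => by rw [lower_apply]; simp only [hz']; omega, abs_mul, Finset.abs_prod]
  refine (mul_le_of_le_one_left (abs_nonneg _)
    (Finset.prod_le_one (fun _ _ => abs_nonneg _) fun j _ => abs_polyChar_le_one _ _ _)).trans ?_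
  refine (h T hT U a i hU hUa _).trans ?_
  rw [modelSize_sub d z' hz'd, ← mul_assoc]
  refine mul_le_mul_of_nonneg_right ?_ hS.le
  have h1 : q⁻¹ ^ ∑ i, z' i ≤ θ ^ z' i :=
    (pow_le_pow_left₀ hq'.le hθ _).trans (pow_le_pow_of_le_one hθ0.le hθ1
      (Finset.single_le_sum (f := z') (fun _ _ => Nat.zero_le _) (Finset.mem_univ i)))
  have h2 : θ ^ (d i - z' i) * θ ^ z' i ≤ θ ^ m := by
    rw [← pow_add, Nat.sub_add_cancel (hz'd i)]
    exact pow_le_pow_of_le_one hθ0.le hθ1 (hm i)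
  calc C * q ^ T.card * θ ^ (d i - z' i) * q⁻¹ ^ ∑ i, z' i
      ≤ C * q ^ T.card * θ ^ (d i - z' i) * θ ^ z' i := by gcongr
    _ = C * q ^ T.card * (θ ^ (d i - z' i) * θ ^ z' i) := by ring
    _ ≤ _ := by gcongr

theorem exists_ne_fin_three (i : Fin 3) : ∃ j : Fin 3, i ≠ j := ⟨i + 1, by fin_cases i <;> decide⟩

theorem twistSet_eq_empty {T : Finset F} {e : F → Option (Fin 3)} (h : ∀ x ∈ T, e x = none)
    (j : Fin 3) : twistSet T e j = ∅ := by
  rw [twistSet, Finset.filter_eq_empty_iff]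
  rintro x hx ⟨i, hi, -⟩
  simp [h x hx] at hi

theorem abs_sum_triples_sub_le (k : ℕ) {y : ℝ} (hy : 1 / 3 ≤ y) (hy1 : y < 1) :
    ∃ C : ℝ, 0 < C ∧ ∀ (F : Type*) [Field F] [Fintype F], ringChar F ≠ 2 →
      ∀ (T : Finset F), T.card ≤ k → ∀ (ρ e : F → Option (Fin 3)) (a r : Option (Fin 3))
        (d : Fin 3 → ℕ) (m : ℕ), (∀ i, m ≤ d i) → k + 1 ≤ m →
        |∑ f ∈ triples ∅ (lower d r) with ∀ x ∈ T, RamAt f x (ρ x),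
            ∏ j, polyChar (twistSet T e j) (twistExp a j) (f j) -
          (if (∀ x ∈ T, e x = none) ∧ a = none then
            (∏ x ∈ T, ramProb (Fintype.card F) (ρ x)) * ramProb (Fintype.card F) r * mainTerm F d
            else 0)| ≤
          C * (Fintype.card F : ℝ) ^ k * (y⁻¹ / Fintype.card F) ^ m * modelSize F d := by
  have hy0 : 0 < y := by linarith
  obtain ⟨C₁, hC₁, h₁⟩ := abs_tripleSum_polyChar_le k hy0 hy1
  obtain ⟨C₂, hC₂, h₂⟩ := abs_density_sub_le k hy0 hy1
  refine ⟨C₁ + (4 * k + 1) * C₂, by positivity, ?_⟩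
  intro F _ _ hF T hT ρ e a r d m hm hkm
  have hq : (3 : ℝ) ≤ Fintype.card F := by exact_mod_cast three_le_card hF
  have hS := modelSize_pos hF d
  set Q : ℝ := (Fintype.card F : ℝ) with hQ
  have hQ0 : 0 < Q := by linarith
  -- As q ≥ 3, the assumption y ≥ 1/3 makes θ = y⁻¹/q at most 1.
  have hyinv : y⁻¹ ≤ 3 := by rw [inv_le_comm₀ hy0 (by norm_num)]; linarith
  have hyinv1 : 1 ≤ y⁻¹ := (one_le_inv₀ hy0).2 hy1.le
  have hθ : Q⁻¹ ≤ y⁻¹ / Q := by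
    rw [inv_eq_one_div]; gcongr
  have hθ1 : y⁻¹ / Q ≤ 1 := (div_le_one hQ0).2 (by linarith)
  have hθ0 : 0 < y⁻¹ / Q := by positivity
  have hQT : Q ^ T.card ≤ Q ^ k := pow_le_pow_right₀ (by linarith) hT
  have hQ1 : 1 ≤ Q ^ k := one_le_pow₀ (by linarith)
  split_ifs with htriv
  · obtain ⟨he, rfl⟩ := htriv
    have : ∀ f : Fin 3 → F[X], ∏ j, polyChar (twistSet T e j) (twistExp none j) (f j) = 1 := by
      intro f
      refine Finset.prod_eq_one fun j _ => ?_
      rw [twistSet_eq_empty he, twistExp, if_neg (by simp), polyChar_trivial, MonoidHom.one_apply]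
    simp only [this]
    refine (abs_sum_triples_trivial_sub_le hF hC₂ hθ hθ1 k (h₂ F hF) T hT ρ r d m hm hkm).trans ?_
    refine mul_le_mul_of_nonneg_right (mul_le_mul_of_nonneg_right ?_ (by positivity)) hS.le
    have : (4 * (k : ℝ) + 1) * C₂ ≤ (4 * k + 1) * C₂ * Q ^ k :=
      le_mul_of_one_le_right (by positivity) hQ1
    have : 0 ≤ C₁ * Q ^ k := by positivity
    linarith
  · rw [sub_zero]
    -- A prescribed character of index i involves the two components different from i; either of
    -- them carries a nontrivial character.
    have hi : ∃ i, (twistSet T e i).Nonempty ∨ Odd (twistExp a i) := by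
      rw [not_and_or] at htriv
      rcases htriv with h | h
      · push Not at h
        obtain ⟨x, hx, hx'⟩ := h
        obtain ⟨i, hi⟩ := Option.ne_none_iff_exists'.1 hx'
        obtain ⟨j, hj⟩ := exists_ne_fin_three i
        exact ⟨j, Or.inl ⟨x, by simp only [twistSet, mem_filter]; exact ⟨hx, i, hi, hj⟩⟩⟩
      · obtain ⟨i, hi⟩ := Option.ne_none_iff_exists'.1 h
        obtain ⟨j, hj⟩ := exists_ne_fin_three i
        exact ⟨j, Or.inr (by rw [twistExp, if_pos ⟨i, hi, hj⟩]; exact odd_one)⟩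
    obtain ⟨i, hi⟩ := hi
    refine (abs_sum_triples_twisted_le hF hC₁ hθ hθ1 k (h₁ F hF) T hT ρ (twistSet T e) (twistExp a)
      i (Finset.filter_subset _ _) hi r d m hm hkm).trans ?_
    refine mul_le_mul_of_nonneg_right (mul_le_mul_of_nonneg_right ?_ (by positivity)) hS.le
    have : C₁ * Q ^ T.card ≤ C₁ * Q ^ k := by gcongr
    have : 0 ≤ (4 * (k : ℝ) + 1) * C₂ * Q ^ k := by positivity
    linarith

end JointEstimate

/-! ### Local traces at the points of the projective line. -/

section PlaceTraces

variable {F : Type*} [Field F] [Fintype F]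

local notation "q" => (Fintype.card F : ℝ)

theorem forall_fin_three {p : Fin 3 → Prop} : (∀ i, p i) ↔ p 0 ∧ p 1 ∧ p 2 := by
  simp [Fin.forall_fin_succ]

/-- The value of the component `j` at a point of the projective line, suitably scaled at
infinity. -/
noncomputable def localValue (f : Fin 3 → F[X]) : Option F → Fin 3 → F
  | none, j => (f j).leadingCoeff
  | some x, j => (f j).eval x

/-- The ramification type of a place of the projective line. -/
def RamPlace (f : Fin 3 → F[X]) : Option F → Option (Fin 3) → Prop
  | none, ρ => ∀ i, Even (∑ j ∈ univ.erase i, (f j).natDegree) ↔ ρ = none ∨ ρ = some i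
  | some x, ρ => RamAt f x ρ

/-- The quadratic character of the value of the product of the components other than `e`. -/
noncomputable def localChar (f : Fin 3 → F[X]) (x : Option F) (e : Option (Fin 3)) : ℝ :=
  ∏ j, if ∃ i, e = some i ∧ i ≠ j then (quadraticChar F (localValue f x j) : ℝ) else 1

/-- The number of rational points above a place, minus one. -/
noncomputable def placeTrace (f : Fin 3 → F[X]) (x : Option F) : ℝ :=
  ∑ i, if RamPlace f x none ∨ RamPlace f x (some i) then localChar f x (some i) else 0

theorem RamPlace.unique {f : Fin 3 → F[X]} {x : Option F} {ρ ρ' : Option (Fin 3)}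
    (h : RamPlace f x ρ) (h' : RamPlace f x ρ') : ρ = ρ' := by
  cases x with
  | some x => exact RamAt.unique h h'
  | none =>
    have key : ∀ i, (ρ = none ∨ ρ = some i) ↔ (ρ' = none ∨ ρ' = some i) :=
      fun i => (h i).symm.trans (h' i)
    revert key
    clear h h'
    revert ρ ρ'
    decide

/-- At infinity the three cofactor degrees add up to an even number, so either all of them are even
or exactly one is. -/
theorem exists_ramPlace {f : Fin 3 → F[X]} (hf : IsModel ∅ f) (x : Option F) :
    ∃ ρ, RamPlace f x ρ := by
  cases x with
  | some x => exact hf.exists_ramAt x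
  | none =>
    have e0 : (univ.erase 0 : Finset (Fin 3)) = {1, 2} := by decide
    have e1 : (univ.erase 1 : Finset (Fin 3)) = {0, 2} := by decide
    have e2 : (univ.erase 2 : Finset (Fin 3)) = {0, 1} := by decide
    simp only [RamPlace, forall_fin_three, e0, e1, e2]
    rw [Finset.sum_pair (by decide), Finset.sum_pair (by decide), Finset.sum_pair (by decide)]
    simp only [Nat.even_add]
    by_cases h0 : Even (f 0).natDegree <;> by_cases h1 : Even (f 1).natDegree <;>
      by_cases h2 : Even (f 2).natDegree <;>
      simp only [h0, h1, h2, true_iff, false_iff, iff_true, iff_false, not_true_eq_false] <;>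
      first
        | exact ⟨none, by decide⟩
        | exact ⟨some 0, by decide⟩
        | exact ⟨some 1, by decide⟩
        | exact ⟨some 2, by decide⟩

theorem localValue_ne_zero {f : Fin 3 → F[X]} (hf : IsModel ∅ f) {x : Option F}
    {ρ : Option (Fin 3)} (h : RamPlace f x ρ) {j : Fin 3} (hj : ρ ≠ some j) :
    localValue f x j ≠ 0 := by
  cases x with
  | none => exact leadingCoeff_ne_zero.2 (hf.1 j).ne_zero
  | some x => exact fun h0 => hj ((h j).1 h0)

theorem localChar_none (f : Fin 3 → F[X]) (x : Option F) : localChar f x none = 1 := by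
  simp [localChar]

/-- The coefficients of the powers of the trace at a place in terms of ramification types and
local characters. -/
noncomputable def traceCoeff (n : ℕ) : Option (Fin 3) × Option (Fin 3) → ℝ
  | (none, none) => (3 ^ n + 3 * (-1) ^ n) / 4
  | (none, some _) => (3 ^ n - (-1) ^ n) / 4
  | (some _, none) => if Even n then 1 else 0
  | (some i, some j) => if j = i ∧ ¬ Even n then 1 else 0

theorem quadraticChar_eq_one_or {a : F} (ha : a ≠ 0) :
    (quadraticChar F a : ℝ) = 1 ∨ (quadraticChar F a : ℝ) = -1 := by
  rcases quadraticChar_dichotomy ha with h | h <;> simp [h]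

/-- At an unramified place the three local characters are signs with product 1, since every
component enters twice; the trace is 3 or −1, and its n-th power is interpolated linearly between
these values. At a ramified place a single sign survives, so only the parity of n matters. -/
theorem placeTrace_pow {f : Fin 3 → F[X]} (hf : IsModel ∅ f) (x : Option F) (n : ℕ) :
    placeTrace f x ^ n = ∑ p : Option (Fin 3) × Option (Fin 3),
      traceCoeff n p * ((if RamPlace f x p.1 then 1 else 0) * localChar f x p.2) := by
  obtain ⟨ρ, hρ⟩ := exists_ramPlace hf x
  have hiff : ∀ ρ', RamPlace f x ρ' ↔ ρ' = ρ := fun ρ' =>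
    ⟨fun h => h.unique hρ, fun h => h ▸ hρ⟩
  simp only [placeTrace, hiff]
  rw [Fintype.sum_prod_type, Finset.sum_eq_single ρ (fun ρ' _ h => by simp [h]) (by simp)]
  simp only [if_true, one_mul]
  rw [Fintype.sum_option, localChar_none]
  have hval : ∀ j, ρ ≠ some j → localValue f x j ≠ 0 := fun j hj => localValue_ne_zero hf hρ hj
  cases ρ with
  | none =>
    have hv := fun j => quadraticChar_eq_one_or (hval j (by simp))
    simp only [true_or, if_true, traceCoeff, localChar, Fin.sum_univ_three, Fin.prod_univ_three,
      Option.some.injEq, exists_eq_left']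
    have n01 : (0 : Fin 3) ≠ 1 := by decide
    have n02 : (0 : Fin 3) ≠ 2 := by decide
    have n12 : (1 : Fin 3) ≠ 2 := by decide
    rcases hv 0 with h0 | h0 <;> rcases hv 1 with h1 | h1 <;> rcases hv 2 with h2 | h2 <;>
      simp only [h0, h1, h2, n01, n02, n12, n01.symm, n02.symm, n12.symm, ne_eq, not_true_eq_false,
        not_false_eq_true, if_true, if_false] <;> norm_num <;> ring
  | some i =>
    have hc : localChar f x (some i) = 1 ∨ localChar f x (some i) = -1 := by
      have hv := fun j (hj : i ≠ j) => quadraticChar_eq_one_or (hval j (by simpa using hj))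
      unfold localChar
      refine Finset.prod_induction _ (fun t : ℝ => t = 1 ∨ t = -1) ?_ (Or.inl rfl) ?_
      · rintro a b (rfl | rfl) (rfl | rfl) <;> simp
      · intro j _
        simp only [Option.some.injEq, exists_eq_left']
        split_ifs with hj
        · exact hv j hj
        · exact Or.inl rfl
    simp only [reduceCtorEq, false_or, Option.some.injEq, traceCoeff]
    rw [Finset.sum_eq_single i (fun j _ h => by simp [h]) (by simp),
      Finset.sum_eq_single i (fun j _ h => by simp [h]) (by simp)]
    rcases Nat.even_or_odd n with hn | hn
    · rcases hc with h | h <;> simp [h, hn, hn.neg_one_pow]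
    · have hn' : ¬ Even n := Nat.not_even_iff_odd.2 hn
      rcases hc with h | h <;> simp [h, hn', hn.neg_one_pow]

theorem abs_traceCoeff_le (n : ℕ) (p : Option (Fin 3) × Option (Fin 3)) :
    |traceCoeff n p| ≤ 3 ^ n := by
  have h3 : (1 : ℝ) ≤ 3 ^ n := one_le_pow₀ (by norm_num)
  have h1 : (-1 : ℝ) ^ n = 1 ∨ (-1 : ℝ) ^ n = -1 := neg_one_pow_eq_or ℝ n
  obtain ⟨ρ, e⟩ := p
  rw [abs_le]
  cases ρ <;> cases e <;> simp only [traceCoeff]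
  · rcases h1 with h | h <;> rw [h] <;> constructor <;> linarith
  · rcases h1 with h | h <;> rw [h] <;> constructor <;> linarith
  · split_ifs <;> constructor <;> linarith
  · split_ifs <;> constructor <;> linarith

/-- The limiting moments of the trace at a place. -/
noncomputable def placeMoment (Q : ℝ) (n : ℕ) : ℝ :=
  ∑ ρ, traceCoeff n (ρ, none) * ramProb Q ρ

theorem sum_ramProb {Q : ℝ} (hQ : 0 < Q) : ∑ ρ, ramProb Q ρ = 1 := by
  rw [Fintype.sum_option]
  simp [ramProb]
  field_simp

theorem ramProb_nonneg {Q : ℝ} (hQ : 0 < Q) (ρ : Option (Fin 3)) : 0 ≤ ramProb Q ρ := by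
  unfold ramProb; split_ifs <;> positivity

theorem abs_placeMoment_le {Q : ℝ} (hQ : 0 < Q) (n : ℕ) : |placeMoment Q n| ≤ 3 ^ n := by
  unfold placeMoment
  refine (Finset.abs_sum_le_sum_abs _ _).trans ?_
  calc ∑ ρ, |traceCoeff n (ρ, none) * ramProb Q ρ| ≤ ∑ ρ, 3 ^ n * ramProb Q ρ := by
        refine Finset.sum_le_sum fun ρ _ => ?_
        rw [abs_mul, abs_of_nonneg (ramProb_nonneg hQ ρ)]
        exact mul_le_mul_of_nonneg_right (abs_traceCoeff_le n _) (ramProb_nonneg hQ ρ)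
    _ = 3 ^ n := by rw [← Finset.mul_sum, sum_ramProb hQ, mul_one]

theorem prod_option {α M : Type*} [CommMonoid M] (S : Finset (Option α)) (h : Option α → M) :
    ∏ x ∈ S, h x = (if none ∈ S then h none else 1) * ∏ x ∈ S.eraseNone, h (some x) := by
  have h1 : ∏ x ∈ S.eraseNone, h (some x) = ∏ x ∈ S.erase none, h x := by
    rw [← Finset.map_some_eraseNone, Finset.prod_map]
    simp
  rw [h1]
  split_ifs with hn
  · exact (Finset.mul_prod_erase S h hn).symm
  · rw [one_mul, Finset.erase_eq_of_notMem hn]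

/-- Regroups a product over places by components: each component collects the finite points at which
it is involved, and its leading coefficient plays the role of its value at infinity. -/
theorem prod_localChar (S : Finset (Option F)) (e : Option F → Option (Fin 3))
    (f : Fin 3 → F[X]) :
    ∏ x ∈ S, localChar f x (e x) =
      ∏ j, polyChar (twistSet S.eraseNone (fun x => e (some x)) j)
        (twistExp (if none ∈ S then e none else none) j) (f j) := by
  unfold localChar
  rw [Finset.prod_comm]
  refine Finset.prod_congr rfl fun j _ => ?_
  rw [prod_option, polyChar_apply, twistSet, Finset.prod_filter]
  congr 1
  unfold twistExp
  by_cases hS : none ∈ S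
  · simp only [hS, if_true]
    by_cases h : ∃ i, e none = some i ∧ i ≠ j
    · rw [if_pos h, if_pos h, pow_one]; rfl
    · rw [if_neg h, if_neg h, pow_zero]
  · simp [hS]

/-- If all d i have the same parity, lowering one component flips the parity of precisely the two
cofactors that contain it. So the type at infinity is constant on triples of degrees `lower d r`. -/
theorem ramPlace_none_iff {d : Fin 3 → ℕ} (hd : ∀ i, 1 ≤ d i) (hp : ∀ i j, Even (d i) ↔ Even (d j))
    {r : Option (Fin 3)} {f : Fin 3 → F[X]} (hf : ∀ i, (f i).natDegree = lower d r i)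
    (ρ : Option (Fin 3)) : RamPlace f none ρ ↔ ρ = r := by
  have key : RamPlace f none r := by
    have e0 : (univ.erase 0 : Finset (Fin 3)) = {1, 2} := by decide
    have e1 : (univ.erase 1 : Finset (Fin 3)) = {0, 2} := by decide
    have e2 : (univ.erase 2 : Finset (Fin 3)) = {0, 1} := by decide
    simp only [RamPlace, forall_fin_three, e0, e1, e2, hf]
    rw [Finset.sum_pair (by decide), Finset.sum_pair (by decide), Finset.sum_pair (by decide)]
    simp only [Nat.even_add]
    have hlow : ∀ i, Even (lower d r i) ↔ (Even (d 0) ↔ r ≠ some i) := by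
      intro i
      rw [lower_apply]
      by_cases h : r = some i
      · simp only [h, if_true, ne_eq, not_true_eq_false, iff_false]
        rw [Nat.even_sub (hd i), hp 0 i]; simp
      · simp only [h, if_false, ne_eq, not_false_eq_true, iff_true, Nat.sub_zero]
        exact hp i 0
    simp only [hlow]
    clear hlow hf
    by_cases h0 : Even (d 0) <;> simp only [h0] <;> rcases r with _ | i <;>
      first | (simp; done) | (fin_cases i <;> simp)
  exact ⟨fun h => h.unique key, fun h => h ▸ key⟩

end PlaceTraces

/-! ### Moments of the trace over triples. -/

section Moments

variable {F : Type*} [Field F] [Fintype F]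

local notation "q" => (Fintype.card F : ℝ)

theorem eraseNone_card_le {α : Type*} (S : Finset (Option α)) : S.eraseNone.card ≤ S.card := by
  rw [← Finset.card_map Function.Embedding.some, Finset.map_some_eraseNone]
  exact Finset.card_erase_le

theorem filter_ramPlace {d : Fin 3 → ℕ} (hd : ∀ i, 1 ≤ d i)
    (hp : ∀ i j, Even (d i) ↔ Even (d j)) (r : Option (Fin 3)) (S : Finset (Option F))
    (ρ : Option F → Option (Fin 3)) :
    {f ∈ triples (∅ : Finset F) (lower d r) | ∀ x ∈ S, RamPlace f x (ρ x)} =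
      if none ∈ S → ρ none = r then
        {f ∈ triples (∅ : Finset F) (lower d r) | ∀ x ∈ S.eraseNone, RamAt f x (ρ (some x))} else ∅ := by
  ext f
  split_ifs with h
  · simp only [mem_filter, and_congr_right_iff, Finset.mem_eraseNone]
    intro hf
    refine ⟨fun H x hx => H (some x) hx, fun H x hx => ?_⟩
    cases x with
    | some x => exact H x hx
    | none => exact (ramPlace_none_iff hd hp (mem_triples.1 hf).1 _).2 (h hx)
  · push Not at h
    simp only [mem_filter, Finset.notMem_empty, iff_false, not_and]
    intro hf H
    exact h.2 ((ramPlace_none_iff hd hp (mem_triples.1 hf).1 _).1 (H none h.1))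

/-- The index r encodes the type at infinity. If infinity belongs to S, only r = ρ(∞) survives and
supplies the factor of that place; otherwise every r contributes and the `ramProb` add up to 1. -/
theorem abs_sum_ramPlace_sub_le (k : ℕ) {y : ℝ} (hy : 1 / 3 ≤ y) (hy1 : y < 1) :
    ∃ C : ℝ, 0 < C ∧ ∀ (F : Type*) [Field F] [Fintype F], ringChar F ≠ 2 →
      ∀ (S : Finset (Option F)), S.card ≤ k → ∀ (ρ e : Option F → Option (Fin 3))
        (d : Fin 3 → ℕ) (m : ℕ), (∀ i j, Even (d i) ↔ Even (d j)) → (∀ i, m ≤ d i) → k + 1 ≤ m →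
        |∑ r, ∑ f ∈ triples ∅ (lower d r), ∏ x ∈ S,
            ((if RamPlace f x (ρ x) then 1 else 0) * localChar f x (e x)) -
          (∏ x ∈ S, if e x = none then ramProb (Fintype.card F) (ρ x) else 0) * mainTerm F d| ≤
          C * (Fintype.card F : ℝ) ^ k * (y⁻¹ / Fintype.card F) ^ m * modelSize F d := by
  obtain ⟨C, hC, h⟩ := abs_sum_triples_sub_le k hy hy1
  refine ⟨4 * C, by positivity, ?_⟩
  intro F _ _ hF S hS ρ e d m hp hm hkm
  have hd : ∀ i, 1 ≤ d i := fun i => by have := hm i; omega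
  have hQ0 : (0 : ℝ) < Fintype.card F := by exact_mod_cast Fintype.card_pos
  have hy0 : 0 < y := by linarith
  set T := S.eraseNone with hT
  set a := if none ∈ S then e none else none with ha
  have hTk : T.card ≤ k := (eraseNone_card_le S).trans hS
  set E := C * (Fintype.card F : ℝ) ^ k * (y⁻¹ / Fintype.card F) ^ m * modelSize F d with hE
  have hE0 : 0 ≤ E := by have := modelSize_pos hF d; positivity
  have e1 : ∀ r, ∑ f ∈ triples ∅ (lower d r), ∏ x ∈ S,
      ((if RamPlace f x (ρ x) then 1 else 0) * localChar f x (e x)) =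
      if none ∈ S → ρ none = r then
        ∑ f ∈ triples ∅ (lower d r) with ∀ x ∈ T, RamAt f x (ρ (some x)),
          ∏ j, polyChar (twistSet T (fun x => e (some x)) j) (twistExp a j) (f j) else 0 := by
    intro r
    simp only [Finset.prod_mul_distrib, prod_localChar]
    have h1 : ∀ f : Fin 3 → F[X], ∏ x ∈ S, (if RamPlace f x (ρ x) then (1 : ℝ) else 0) =
        if ∀ x ∈ S, RamPlace f x (ρ x) then 1 else 0 := fun f => Finset.prod_ite_zero.trans (by simp)
    simp only [h1, ite_mul, one_mul, zero_mul]
    rw [← Finset.sum_filter, filter_ramPlace hd hp]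
    by_cases hr : none ∈ S → ρ none = r
    · rw [if_pos hr, if_pos hr]
    · rw [if_neg hr, if_neg hr, Finset.sum_empty]
  have e2 : (∏ x ∈ S, if e x = none then ramProb (Fintype.card F) (ρ x) else 0) * mainTerm F d =
      ∑ r, if none ∈ S → ρ none = r then
        (if (∀ x ∈ T, e (some x) = none) ∧ a = none then
          (∏ x ∈ T, ramProb (Fintype.card F) (ρ (some x))) * ramProb (Fintype.card F) r *
            mainTerm F d else 0) else 0 := by
    rw [prod_option, ← hT, Finset.prod_ite_zero]
    by_cases hn : none ∈ S
    · simp only [hn, if_true, true_imp_iff, ha, Finset.sum_ite_eq, mem_univ]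
      by_cases h1 : e none = none <;> by_cases h2 : ∀ x ∈ T, e (some x) = none
      · simp only [h1, if_true, and_true, if_pos h2]; ring
      · simp only [h1, if_true, and_true, if_neg h2]; ring
      · simp only [h1, if_false, and_false]; ring
      · simp only [h1, if_false, and_false]; ring
    · simp only [hn, if_false, false_imp_iff, if_true, ha, and_true, one_mul]
      by_cases h2 : ∀ x ∈ T, e (some x) = none
      · simp only [if_pos h2]
        rw [← Finset.sum_mul, ← Finset.mul_sum, sum_ramProb hQ0, mul_one]
      · simp only [if_neg h2]; simp
  rw [e2, Finset.sum_congr rfl fun r _ => e1 r, ← Finset.sum_sub_distrib]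
  refine (Finset.abs_sum_le_sum_abs _ _).trans ?_
  refine (Finset.sum_le_card_nsmul _ _ E fun r _ => ?_).trans (le_of_eq ?_)
  · split_ifs with h1 h2
    · have := h F hF T hTk (fun x => ρ (some x)) (fun x => e (some x)) a r d m hm hkm
      rwa [if_pos h2] at this
    · have := h F hF T hTk (fun x => ρ (some x)) (fun x => e (some x)) a r d m hm hkm
      rwa [if_neg h2] at this
    · simpa using hE0
  · rw [Finset.card_univ, Fintype.card_option, Fintype.card_fin, nsmul_eq_mul, hE]
    push_cast; ring

/-- Expansion of a product of sums over a finite set, indexed by functions on the whole type. -/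
theorem prod_sum_eq_sum_piFinset {α ι R : Type*} [Fintype α] [DecidableEq α] [Fintype ι] [CommSemiring R]
    (z : ι) (S : Finset α) (g : α → ι → R) :
    ∏ x ∈ S, ∑ j, g x j =
      ∑ p ∈ Fintype.piFinset (fun x => if x ∈ S then univ else {z}), ∏ x ∈ S, g x (p x) := by
  have h := Finset.prod_univ_sum (fun x => if x ∈ S then univ else {z})
    (fun x j => if x ∈ S then g x j else 1)
  have h1 : ∀ p : α → ι, ∏ x, (if x ∈ S then g x (p x) else 1) = ∏ x ∈ S, g x (p x) := fun p => by
    rw [Finset.prod_ite_mem, Finset.univ_inter]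
  simp only [h1] at h
  rw [← h, ← Finset.univ_inter S, ← Finset.prod_ite_mem, Finset.univ_inter]
  refine Finset.prod_congr rfl fun x _ => ?_
  split_ifs with hx <;> simp

theorem card_piFinset_ite {α ι : Type*} [Fintype α] [DecidableEq α] [Fintype ι] (z : ι) (S : Finset α) :
    (Fintype.piFinset (fun x => if x ∈ S then univ else {z})).card = Fintype.card ι ^ S.card := by
  rw [Fintype.card_piFinset]
  have : ∀ x, (if x ∈ S then (univ : Finset ι) else {z}).card =
      if x ∈ S then Fintype.card ι else 1 := fun x => by split_ifs <;> simp
  simp only [this]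
  rw [Finset.prod_ite_mem, Finset.univ_inter, Finset.prod_const]

/-- The moments of the sum of independent place traces in the limit. -/
noncomputable def limitMoment (F : Type*) [Field F] [Fintype F] (k : ℕ) : ℝ :=
  ∑ κ : Fin k → Option F, ∏ x ∈ univ.image κ, placeMoment (Fintype.card F) #{l | κ l = x}

theorem sum_card_fiber {α : Type*} [DecidableEq α] {k : ℕ} (κ : Fin k → α) :
    ∑ x ∈ univ.image κ, #{l | κ l = x} = k := by
  rw [← Finset.card_eq_sum_card_image, Finset.card_univ, Fintype.card_fin]

theorem abs_limitMoment_le (k : ℕ) : |limitMoment F k| ≤ 3 ^ k * (q + 1) ^ k := by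
  have hQ0 : 0 < q := by exact_mod_cast Fintype.card_pos
  unfold limitMoment
  refine (Finset.abs_sum_le_sum_abs _ _).trans ?_
  refine (Finset.sum_le_card_nsmul _ _ (3 ^ k) fun κ _ => ?_).trans (le_of_eq ?_)
  · rw [Finset.abs_prod]
    refine (Finset.prod_le_prod (fun _ _ => abs_nonneg _)
      fun x _ => abs_placeMoment_le hQ0 _).trans (le_of_eq ?_)
    rw [Finset.prod_pow_eq_pow_sum, sum_card_fiber]
  · rw [Finset.card_univ, Fintype.card_fun, Fintype.card_fin, Fintype.card_option, nsmul_eq_mul]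
    push_cast; ring

/-- The power is expanded over maps κ from the l factors to the places, and the powers occurring at
each place are linearised by `placeTrace_pow`. The exponent l is kept separate from k because the
case l = 0 counts the triples themselves. -/
theorem abs_sum_trace_pow_sub_mainTerm_le (k : ℕ) {y : ℝ} (hy : 1 / 3 ≤ y) (hy1 : y < 1) :
    ∃ C : ℝ, 0 < C ∧ ∀ (F : Type*) [Field F] [Fintype F], ringChar F ≠ 2 →
      ∀ (d : Fin 3 → ℕ) (m : ℕ), (∀ i j, Even (d i) ↔ Even (d j)) → (∀ i, m ≤ d i) → k + 1 ≤ m →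
        ∀ l ≤ k, |∑ r, ∑ f ∈ triples ∅ (lower d r), (∑ x : Option F, placeTrace f x) ^ l -
          limitMoment F l * mainTerm F d| ≤
          C * ((Fintype.card F : ℝ) + 1) ^ l * ((Fintype.card F : ℝ) ^ k *
            (y⁻¹ / Fintype.card F) ^ m * modelSize F d) := by
  obtain ⟨C, hC, h⟩ := abs_sum_ramPlace_sub_le k hy hy1
  -- 48 = 16 · 3: there are 16 pairs (type, character) at each of at most k places, and the
  -- coefficients multiply to at most 3^l.
  refine ⟨48 ^ k * C, by positivity, ?_⟩
  intro F _ _ hF d m hp hm hkm l hl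
  have hQ0 : (0 : ℝ) < Fintype.card F := by exact_mod_cast Fintype.card_pos
  have hy0 : 0 < y := by linarith
  set E := (Fintype.card F : ℝ) ^ k * (y⁻¹ / Fintype.card F) ^ m * modelSize F d with hE
  have hE0 : 0 ≤ E := by have := modelSize_pos hF d; positivity
  have e1 : ∀ r, ∀ f ∈ triples (∅ : Finset F) (lower d r), (∑ x : Option F, placeTrace f x) ^ l =
      ∑ κ : Fin l → Option F, ∏ x ∈ univ.image κ, ∑ p : Option (Fin 3) × Option (Fin 3),
        traceCoeff #{i | κ i = x} p *
          ((if RamPlace f x p.1 then 1 else 0) * localChar f x p.2) := by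
    intro r f hf
    rw [Fintype.sum_pow]
    refine Finset.sum_congr rfl fun κ _ => ?_
    rw [Finset.prod_comp (placeTrace f) κ]
    exact Finset.prod_congr rfl fun x _ => placeTrace_pow (mem_triples.1 hf).2 x _
  have e2 : ∑ r, ∑ f ∈ triples (∅ : Finset F) (lower d r), (∑ x : Option F, placeTrace f x) ^ l =
      ∑ κ : Fin l → Option F,
        ∑ p ∈ Fintype.piFinset (fun x => if x ∈ univ.image κ then univ else {(none, none)}),
          (∏ x ∈ univ.image κ, traceCoeff #{i | κ i = x} (p x)) *
          ∑ r, ∑ f ∈ triples (∅ : Finset F) (lower d r), ∏ x ∈ univ.image κ,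
            ((if RamPlace f x (p x).1 then 1 else 0) * localChar f x (p x).2) := by
    rw [Finset.sum_congr rfl fun r _ => Finset.sum_congr rfl (e1 r)]
    simp only [prod_sum_eq_sum_piFinset ((none, none) : Option (Fin 3) × Option (Fin 3)),
      Finset.prod_mul_distrib, Finset.mul_sum]
    rw [Finset.sum_congr rfl fun r _ => Finset.sum_comm, Finset.sum_comm]
    refine Finset.sum_congr rfl fun κ _ => ?_
    rw [Finset.sum_congr rfl fun r _ => Finset.sum_comm, Finset.sum_comm]
  have e3 : limitMoment F l * mainTerm F d =
      ∑ κ : Fin l → Option F,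
        ∑ p ∈ Fintype.piFinset (fun x => if x ∈ univ.image κ then univ else {(none, none)}),
          (∏ x ∈ univ.image κ, traceCoeff #{i | κ i = x} (p x)) *
          ((∏ x ∈ univ.image κ, if (p x).2 = none then ramProb (Fintype.card F) (p x).1 else 0) *
            mainTerm F d) := by
    unfold limitMoment
    rw [Finset.sum_mul]
    refine Finset.sum_congr rfl fun κ _ => ?_
    simp only [← mul_assoc, ← Finset.prod_mul_distrib]
    rw [← Finset.sum_mul, ← prod_sum_eq_sum_piFinset
      ((none, none) : Option (Fin 3) × Option (Fin 3)) (univ.image κ)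
      (fun x p => traceCoeff #{i | κ i = x} p *
        if p.2 = none then ramProb (Fintype.card F) p.1 else 0)]
    congr 1
    refine Finset.prod_congr rfl fun x _ => ?_
    rw [Fintype.sum_prod_type]
    refine Finset.sum_congr rfl fun ρ _ => ?_
    rw [Fintype.sum_option]
    simp
  rw [e2, e3, ← Finset.sum_sub_distrib]
  refine (Finset.abs_sum_le_sum_abs _ _).trans ?_
  refine (Finset.sum_le_card_nsmul _ _ (48 ^ k * C * E) fun κ _ => ?_).trans (le_of_eq ?_)
  · have hSl : (univ.image κ).card ≤ l := Finset.card_image_le.trans (by simp)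
    rw [← Finset.sum_sub_distrib]
    refine (Finset.abs_sum_le_sum_abs _ _).trans ?_
    refine (Finset.sum_le_card_nsmul _ _ (3 ^ l * (C * E)) fun p _ => ?_).trans ?_
    · rw [← mul_sub, abs_mul]
      refine mul_le_mul ?_ ?_ (abs_nonneg _) (by positivity)
      · rw [Finset.abs_prod]
        refine (Finset.prod_le_prod (fun _ _ => abs_nonneg _)
          fun x _ => abs_traceCoeff_le _ _).trans (le_of_eq ?_)
        rw [Finset.prod_pow_eq_pow_sum, sum_card_fiber]
      · have := h F hF (univ.image κ) (hSl.trans hl) (fun x => (p x).1) (fun x => (p x).2) d m hp hm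
          hkm
        rw [hE]
        calc _ ≤ _ := this
          _ = _ := by ring
    · rw [card_piFinset_ite, nsmul_eq_mul, Fintype.card_prod, Fintype.card_option, Fintype.card_fin]
      push_cast
      have h16 : (16 : ℝ) ^ (univ.image κ).card ≤ 16 ^ k :=
        pow_le_pow_right₀ (by norm_num) (hSl.trans hl)
      have h3 : (3 : ℝ) ^ l ≤ 3 ^ k := pow_le_pow_right₀ (by norm_num) hl
      calc _ ≤ (16 : ℝ) ^ k * (3 ^ k * (C * E)) :=
            mul_le_mul h16 (mul_le_mul_of_nonneg_right h3 (by positivity)) (by positivity)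
              (by positivity)
        _ = 48 ^ k * C * E := by rw [show (48 : ℝ) = 16 * 3 by norm_num, mul_pow]; ring
  · rw [Finset.card_univ, Fintype.card_fun, Fintype.card_fin, Fintype.card_option, nsmul_eq_mul]
    push_cast; ring

theorem limitMoment_zero : limitMoment F 0 = 1 := by
  simp [limitMoment]

/-- The case l = 0 identifies the main term with the number of triples up to the same kind of error,
which is then multiplied by |limitMoment| ≤ 3ᵏ(q + 1)ᵏ. -/
theorem abs_sum_trace_pow_sub_le (k : ℕ) {y : ℝ} (hy : 1 / 3 ≤ y) (hy1 : y < 1) :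
    ∃ C : ℝ, 0 < C ∧ ∀ (F : Type*) [Field F] [Fintype F], ringChar F ≠ 2 →
      ∀ (d : Fin 3 → ℕ) (m : ℕ), (∀ i j, Even (d i) ↔ Even (d j)) → (∀ i, m ≤ d i) → k + 1 ≤ m →
        |∑ r, ∑ f ∈ triples ∅ (lower d r), (∑ x : Option F, placeTrace f x) ^ k -
          limitMoment F k * ∑ r, ((triples (∅ : Finset F) (lower d r)).card : ℝ)| ≤
          C * ((Fintype.card F : ℝ) + 1) ^ k * ((Fintype.card F : ℝ) ^ k *
            (y⁻¹ / Fintype.card F) ^ m * modelSize F d) := by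
  obtain ⟨C, hC, h⟩ := abs_sum_trace_pow_sub_mainTerm_le k hy hy1
  refine ⟨C + 3 ^ k * C, by positivity, ?_⟩
  intro F _ _ hF d m hp hm hkm
  set E := (Fintype.card F : ℝ) ^ k * (y⁻¹ / Fintype.card F) ^ m * modelSize F d with hE
  have h1 := h F hF d m hp hm hkm k le_rfl
  have h2 := h F hF d m hp hm hkm 0 (Nat.zero_le _)
  simp only [pow_zero, limitMoment_zero, one_mul, Finset.sum_const, nsmul_eq_mul, mul_one] at h2
  have h3 := abs_limitMoment_le (F := F) k
  have h4 := mul_le_mul h3 h2 (abs_nonneg _) (by positivity)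
  rw [← abs_mul] at h4
  have e : ∀ A L M N : ℝ, A - L * M = (A - L * N) - L * (M - N) := fun _ _ _ _ => by ring
  rw [e _ _ _ (mainTerm F d)]
  refine (abs_sub _ _).trans ?_
  refine (add_le_add h1 h4).trans (le_of_eq ?_)
  ring

end Moments

/-! ### A union bound for the number of triples. -/

section LowerBound

variable {F : Type*} [Field F] [Fintype F]

local notation "q" => (Fintype.card F : ℝ)

/-- The polynomials of degree `n` without zeros in `T`. -/
noncomputable def zeroFree (T : Finset F) (n : ℕ) : Finset F[X] :=
  {f ∈ polys F n | ∀ x ∈ T, f.eval x ≠ 0}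

theorem mem_zeroFree {T : Finset F} {n : ℕ} {f : F[X]} :
    f ∈ zeroFree T n ↔ (f ≠ 0 ∧ f.natDegree = n) ∧ ∀ x ∈ T, f.eval x ≠ 0 := by
  simp [zeroFree]

/-- The monic irreducible polynomials of degree `n` without zeros in `T`. -/
noncomputable def zeroFreePrimes (T : Finset F) (n : ℕ) : Finset F[X] :=
  {f ∈ monics F n | Irreducible f ∧ ∀ x ∈ T, f.eval x ≠ 0}

theorem mem_zeroFreePrimes {T : Finset F} {n : ℕ} {f : F[X]} :
    f ∈ zeroFreePrimes T n ↔ (f.Monic ∧ f.natDegree = n) ∧ Irreducible f ∧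
      ∀ x ∈ T, f.eval x ≠ 0 := by
  simp [zeroFreePrimes]

theorem card_zeroFree_zero (T : Finset F) : ((zeroFree T 0).card : ℝ) = q - 1 := by
  have : zeroFree T 0 = polys F 0 := by
    refine Finset.filter_true_of_mem fun f hf x _ => ?_
    rw [mem_polys] at hf
    rw [eq_C_of_natDegree_eq_zero hf.2, eval_C]
    intro h
    exact hf.1 (by rw [eq_C_of_natDegree_eq_zero hf.2, h, C_0])
  rw [this, card_polys]; simp

theorem card_zeroFree_insert {T : Finset F} {x : F} (hx : x ∉ T) (n : ℕ) :
    (zeroFree T (n + 1)).card = (zeroFree (insert x T) (n + 1)).card + (zeroFree T n).card := by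
  have h1 : (zeroFree (insert x T) (n + 1)) = {f ∈ zeroFree T (n + 1) | f.eval x ≠ 0} := by
    ext f
    simp only [mem_zeroFree, mem_filter, mem_insert, forall_eq_or_imp]
    tauto
  have h2 : {f ∈ zeroFree T (n + 1) | ¬ f.eval x ≠ 0} =
      (zeroFree T n).image fun f => (X - C x) * f := by
    ext f
    simp only [mem_filter, mem_zeroFree, mem_image, not_not]
    constructor
    · rintro ⟨⟨⟨h0, h1⟩, h2⟩, h3⟩
      obtain ⟨g, rfl⟩ := dvd_iff_isRoot.2 h3
      have hg : g ≠ 0 := right_ne_zero_of_mul h0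
      refine ⟨g, ⟨⟨hg, ?_⟩, fun y hy => ?_⟩, rfl⟩
      · rw [natDegree_mul (X_sub_C_ne_zero x) hg, natDegree_X_sub_C] at h1
        omega
      · have := h2 y hy
        rw [eval_mul] at this
        exact right_ne_zero_of_mul this
    · rintro ⟨g, ⟨⟨h0, h1⟩, h2⟩, rfl⟩
      refine ⟨⟨⟨mul_ne_zero (X_sub_C_ne_zero x) h0, ?_⟩, fun y hy => ?_⟩, by simp⟩
      · rw [natDegree_mul (X_sub_C_ne_zero x) h0, natDegree_X_sub_C, h1, add_comm]
      · rw [eval_mul]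
        refine mul_ne_zero ?_ (h2 y hy)
        simp only [eval_sub, eval_X, eval_C]
        exact sub_ne_zero.2 fun e => hx (e ▸ hy)
  rw [h1, ← Finset.card_filter_add_card_filter_not (s := zeroFree T (n + 1))
    (fun f => f.eval x ≠ 0), h2,
    Finset.card_image_of_injective _ (mul_right_injective₀ (X_sub_C_ne_zero x))]

theorem card_zeroFree_one (T : Finset F) : ((zeroFree T 1).card : ℝ) = (q - 1) * (q - T.card) := by
  induction T using Finset.induction_on with
  | empty =>
    have : zeroFree (∅ : Finset F) 1 = polys F 1 := by simp [zeroFree]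
    rw [this, card_polys]; simp
  | insert x T hx ih =>
    have h := card_zeroFree_insert hx 0
    have h' : ((zeroFree T 1).card : ℝ) = (zeroFree (insert x T) 1).card + (zeroFree T 0).card := by
      exact_mod_cast h
    rw [ih, card_zeroFree_zero] at h'
    rw [Finset.card_insert_of_notMem hx]
    push_cast
    linarith

theorem card_zeroFree (T : Finset F) {n : ℕ} (hn : T.card ≤ n) :
    ((zeroFree T n).card : ℝ) = (q - 1) * q ^ n * (1 - q⁻¹) ^ T.card := by
  have hq : q ≠ 0 := by exact_mod_cast Fintype.card_ne_zero
  induction T using Finset.induction_on generalizing n with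
  | empty =>
    have : zeroFree (∅ : Finset F) n = polys F n := by simp [zeroFree]
    rw [this, card_polys]; simp
  | insert x T hx ih =>
    rw [Finset.card_insert_of_notMem hx] at hn ⊢
    obtain ⟨m, rfl⟩ := Nat.exists_eq_add_of_le' (show 1 ≤ n by omega)
    have h := card_zeroFree_insert hx m
    have h' : ((zeroFree T (m + 1)).card : ℝ) =
        (zeroFree (insert x T) (m + 1)).card + (zeroFree T m).card := by exact_mod_cast h
    rw [ih (by omega), ih (by omega)] at h'
    rw [pow_succ, pow_succ] at *
    have : (q - 1) * (q ^ m * q) * (1 - q⁻¹) ^ T.card - (q - 1) * q ^ m * (1 - q⁻¹) ^ T.card =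
      (q - 1) * (q ^ m * q) * ((1 - q⁻¹) ^ T.card * (1 - q⁻¹)) := by field_simp
    linarith

theorem card_zeroFree_le (T : Finset F) (n : ℕ) :
    ((zeroFree T n).card : ℝ) ≤ (q - 1) * q ^ n := by
  rw [← card_polys]
  exact_mod_cast Finset.card_filter_le _ _

/-- The q − 1 scalar multiples of a monic polynomial are distinct and have the same zeros.
Irreducibility is simply given away. -/
theorem card_zeroFreePrimes_mul_le (T : Finset F) (n : ℕ) :
    ((zeroFreePrimes T n).card : ℝ) * (q - 1) ≤ (zeroFree T n).card := by
  have h := sum_polys (F := F) n fun f => if ∀ x ∈ T, f.eval x ≠ 0 then (1 : ℝ) else 0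
  rw [← Finset.sum_filter, Finset.sum_const, nsmul_one] at h
  unfold zeroFree
  rw [h, mul_comm, ← card_units_cast, ← nsmul_eq_mul, ← Finset.card_univ, ← Finset.sum_const]
  refine Finset.sum_le_sum fun u _ => ?_
  rw [← Finset.sum_filter, Finset.sum_const, nsmul_one]
  norm_cast
  refine Finset.card_le_card fun f hf => ?_
  rw [mem_zeroFreePrimes] at hf
  rw [mem_filter, mem_monics]
  exact ⟨hf.1, fun x hx => by rw [eval_C_mul]; exact mul_ne_zero u.ne_zero (hf.2.2 x hx)⟩

/-- Such an f is P² h with P a monic prime, and both P and h inherit the absence of zeros in T. -/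
theorem card_not_squarefree_le (T : Finset F) (n : ℕ) :
    #{f ∈ zeroFree T n | ¬ Squarefree f} ≤
      ∑ a ∈ Icc 1 (n / 2), (zeroFreePrimes T a).card * (zeroFree T (n - 2 * a)).card := by
  simp only [← Finset.card_product]
  rw [← Finset.card_sigma]
  refine Finset.card_le_card_of_surjOn (fun t => t.2.1 * t.2.1 * t.2.2) ?_
  intro f hf
  rw [Finset.mem_coe, mem_filter, mem_zeroFree] at hf
  obtain ⟨⟨⟨h0, hn⟩, hT⟩, hs⟩ := hf
  rw [squarefree_iff_no_irreducibles h0] at hs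
  push Not at hs
  obtain ⟨p, hp, hdvd⟩ := hs
  have hpm := monic_normalize hp.ne_zero
  have hpi : Irreducible (normalize p) := (associated_normalize p).irreducible hp
  have hdvd' : normalize p * normalize p ∣ f :=
    ((normalize_associated p).mul_mul (normalize_associated p)).dvd.trans hdvd
  set P := normalize p with hP
  obtain ⟨h, rfl⟩ := hdvd'
  have hh : h ≠ 0 := right_ne_zero_of_mul h0
  rw [natDegree_mul (mul_ne_zero hpi.ne_zero hpi.ne_zero) hh,
    natDegree_mul hpi.ne_zero hpi.ne_zero] at hn
  have h1 : 0 < P.natDegree := hpi.natDegree_pos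
  simp only [eval_mul] at hT
  refine ⟨⟨P.natDegree, (P, h)⟩, ?_, rfl⟩
  simp only [coe_sigma, Set.mem_sigma_iff, Finset.mem_coe, Finset.mem_Icc, mem_product,
    mem_zeroFreePrimes, mem_zeroFree]
  refine ⟨⟨h1, by omega⟩, ⟨⟨hpm, trivial⟩, hpi, fun x hx => ?_⟩, ⟨hh, by omega⟩, fun x hx => ?_⟩
  · exact left_ne_zero_of_mul (left_ne_zero_of_mul (hT x hx))
  · exact right_ne_zero_of_mul (hT x hx)

theorem card_not_coprime_le (T : Finset F) (m n : ℕ) :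
    #{f ∈ zeroFree T m ×ˢ zeroFree T n | ¬ IsCoprime f.1 f.2} ≤
      ∑ a ∈ Icc 1 (min m n), (zeroFreePrimes T a).card *
        ((zeroFree T (m - a)).card * (zeroFree T (n - a)).card) := by
  simp only [← Finset.card_product]
  rw [← Finset.card_sigma]
  refine Finset.card_le_card_of_surjOn (fun t => (t.2.1 * t.2.2.1, t.2.1 * t.2.2.2)) ?_
  rintro ⟨f, g⟩ hf
  rw [Finset.mem_coe, mem_filter, mem_product, mem_zeroFree, mem_zeroFree] at hf
  obtain ⟨⟨⟨⟨f0, fn⟩, fT⟩, ⟨⟨g0, gn⟩, gT⟩⟩, hc⟩ := hf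
  dsimp only at *
  have : ∃ p, Irreducible p ∧ p ∣ f ∧ p ∣ g := by
    by_contra H
    push Not at H
    exact hc (isCoprime_of_irreducible_dvd (fun h => f0 h.1) fun z hz h1 h2 => H z hz h1 h2)
  obtain ⟨p, hp, hpf, hpg⟩ := this
  have hpm := monic_normalize hp.ne_zero
  have hpi : Irreducible (normalize p) := (associated_normalize p).irreducible hp
  rw [← normalize_dvd_iff] at hpf hpg
  set P := normalize p with hP
  obtain ⟨h, rfl⟩ := hpf
  obtain ⟨h', rfl⟩ := hpg
  have hh := right_ne_zero_of_mul f0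
  have hh' := right_ne_zero_of_mul g0
  rw [natDegree_mul hpi.ne_zero hh] at fn
  rw [natDegree_mul hpi.ne_zero hh'] at gn
  have h1 : 0 < P.natDegree := hpi.natDegree_pos
  simp only [eval_mul] at fT gT
  refine ⟨⟨P.natDegree, (P, h, h')⟩, ?_, rfl⟩
  simp only [coe_sigma, Set.mem_sigma_iff, Finset.mem_coe, Finset.mem_Icc, mem_product,
    mem_zeroFreePrimes, mem_zeroFree]
  refine ⟨⟨h1, le_min (by omega) (by omega)⟩, ⟨⟨hpm, trivial⟩, hpi, fun x hx => ?_⟩,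
    ⟨⟨hh, by omega⟩, fun x hx => ?_⟩, ⟨hh', by omega⟩, fun x hx => ?_⟩
  · exact left_ne_zero_of_mul (fT x hx)
  · exact right_ne_zero_of_mul (fT x hx)
  · exact right_ne_zero_of_mul (gT x hx)

/-- Six bad events: three components that may fail to be squarefree and three pairs that may fail to
be coprime. -/
theorem card_zeroFree_triples_le {T : Finset F} {d : Fin 3 → ℕ} {s : ℝ}
    (h1 : ∀ i, (#{f ∈ zeroFree T (d i) | ¬ Squarefree f} : ℝ) ≤ s * (zeroFree T (d i)).card)
    (h2 : ∀ i j, i ≠ j → (#{f ∈ zeroFree T (d i) ×ˢ zeroFree T (d j) | ¬ IsCoprime f.1 f.2} : ℝ) ≤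
      s * ((zeroFree T (d i)).card * (zeroFree T (d j)).card)) :
    (1 - 6 * s) * ∏ i, ((zeroFree T (d i)).card : ℝ) ≤ (triples T d).card := by
  set A := Fintype.piFinset fun i => zeroFree T (d i) with hA
  set B : Fin 3 → Finset (Fin 3 → F[X]) := fun i => {f ∈ A | ¬ Squarefree (f i)} with hB
  set D : Fin 3 → Finset (Fin 3 → F[X]) := fun k =>
    {f ∈ A | ¬ IsCoprime (f (k.succAbove 0)) (f (k.succAbove 1))} with hD
  have hAcard : (A.card : ℝ) = ∏ i, ((zeroFree T (d i)).card : ℝ) := by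
    rw [hA, Fintype.card_piFinset]; push_cast; rfl
  have hBcard : ∀ i, ((B i).card : ℝ) ≤ s * A.card := by
    intro i
    have e : (B i).card ≤ (({f ∈ zeroFree T (d i) | ¬ Squarefree f}) ×ˢ
        (Fintype.piFinset fun j => zeroFree T (d (i.succAbove j)))).card := by
      refine Finset.card_le_card_of_injOn (fun f => (f i, fun j => f (i.succAbove j))) ?_ ?_
      · intro f hf
        simp only [hB, hA, coe_filter, Fintype.mem_piFinset, Set.mem_ofPred_eq] at hf
        simp only [Finset.coe_product, Set.mem_prod, coe_filter, Set.mem_ofPred_eq,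
          Finset.mem_coe, Fintype.mem_piFinset]
        exact ⟨⟨hf.1 i, hf.2⟩, fun j => hf.1 _⟩
      · intro f _ g _ hfg
        simp only [Prod.mk.injEq] at hfg
        funext j
        rcases eq_or_ne j i with rfl | hj
        · exact hfg.1
        · obtain ⟨l, rfl⟩ := Fin.exists_succAbove_eq hj
          exact congrFun hfg.2 l
    rw [Finset.card_product, Fintype.card_piFinset] at e
    have e' : ((B i).card : ℝ) ≤ (#{f ∈ zeroFree T (d i) | ¬ Squarefree f} : ℝ) *
        ∏ j, ((zeroFree T (d (i.succAbove j))).card : ℝ) := by exact_mod_cast e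
    rw [hAcard, Fin.prod_univ_succAbove _ i, ← mul_assoc]
    have hP : (0 : ℝ) ≤ ∏ j, ((zeroFree T (d (i.succAbove j))).card : ℝ) :=
      Finset.prod_nonneg fun _ _ => Nat.cast_nonneg _
    have t := mul_le_mul_of_nonneg_right (h1 i) hP
    exact e'.trans t
  have hDcard : ∀ k, ((D k).card : ℝ) ≤ s * A.card := by
    intro k
    have e : (D k).card ≤ (({f ∈ zeroFree T (d (k.succAbove 0)) ×ˢ zeroFree T (d (k.succAbove 1)) |
        ¬ IsCoprime f.1 f.2}) ×ˢ zeroFree T (d k)).card := by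
      refine Finset.card_le_card_of_injOn
        (fun f => ((f (k.succAbove 0), f (k.succAbove 1)), f k)) ?_ ?_
      · intro f hf
        simp only [hD, hA, coe_filter, Fintype.mem_piFinset, Set.mem_ofPred_eq] at hf
        simp only [Finset.coe_product, Set.mem_prod, coe_filter, Set.mem_ofPred_eq,
          Finset.mem_coe, mem_product]
        exact ⟨⟨⟨hf.1 _, hf.1 _⟩, hf.2⟩, hf.1 k⟩
      · intro f _ g _ hfg
        simp only [Prod.mk.injEq] at hfg
        funext j
        rcases eq_or_ne j k with rfl | hj
        · exact hfg.2
        · obtain ⟨l, rfl⟩ := Fin.exists_succAbove_eq hj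
          fin_cases l
          · exact hfg.1.1
          · exact hfg.1.2
    rw [Finset.card_product] at e
    have e' : ((D k).card : ℝ) ≤
        (#{f ∈ zeroFree T (d (k.succAbove 0)) ×ˢ zeroFree T (d (k.succAbove 1)) |
          ¬ IsCoprime f.1 f.2} : ℝ) * (zeroFree T (d k)).card := by exact_mod_cast e
    have hne : k.succAbove 0 ≠ k.succAbove 1 := fun h => by
      simpa using Fin.succAbove_right_injective h
    rw [hAcard, Fin.prod_univ_succAbove _ k, Fin.prod_univ_two]
    have t := mul_le_mul_of_nonneg_right (h2 _ _ hne)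
      (Nat.cast_nonneg (α := ℝ) (zeroFree T (d k)).card)
    refine e'.trans (t.trans (le_of_eq ?_))
    ring
  have hcover : A ⊆ triples T d ∪ (univ.biUnion B ∪ univ.biUnion D) := by
    intro f hf
    by_contra H
    simp only [mem_union, Finset.mem_biUnion, mem_univ, true_and, not_or, not_exists, hB, hD,
      mem_filter, hf, not_not] at H
    obtain ⟨H1, H2, H3⟩ := H
    rw [hA, Fintype.mem_piFinset] at hf
    simp only [mem_zeroFree] at hf
    refine H1 (mem_triples.2 ⟨fun i => (hf i).1.2, H2, fun i j hij => ?_, fun i => (hf i).2⟩)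
    have a0 := H3 0
    have a1 := H3 1
    have a2 := H3 2
    have c0 : (0 : Fin 3).succAbove 0 = 1 := by decide
    have c1 : (0 : Fin 3).succAbove 1 = 2 := by decide
    have c2 : (1 : Fin 3).succAbove 0 = 0 := by decide
    have c3 : (1 : Fin 3).succAbove 1 = 2 := by decide
    have c4 : (2 : Fin 3).succAbove 0 = 0 := by decide
    have c5 : (2 : Fin 3).succAbove 1 = 1 := by decide
    rw [c0, c1] at a0
    rw [c2, c3] at a1
    rw [c4, c5] at a2
    fin_cases i <;> fin_cases j <;>
      first
        | exact absurd rfl hij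
        | assumption
        | exact IsCoprime.symm (by assumption)
  have hle := (Finset.card_le_card hcover).trans ((Finset.card_union_le _ _).trans
    (Nat.add_le_add_left ((Finset.card_union_le _ _).trans
      (Nat.add_le_add Finset.card_biUnion_le Finset.card_biUnion_le)) _))
  have hle' : (A.card : ℝ) ≤ (triples T d).card + (∑ i, ((B i).card : ℝ) + ∑ i, ((D i).card : ℝ)) :=
    by exact_mod_cast hle
  have s1 : ∑ i, ((B i).card : ℝ) ≤ 3 * (s * A.card) :=
    (Finset.sum_le_sum fun i _ => hBcard i).trans (by simp)
  have s2 : ∑ i, ((D i).card : ℝ) ≤ 3 * (s * A.card) :=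
    (Finset.sum_le_sum fun i _ => hDcard i).trans (by simp)
  rw [← hAcard]
  linarith

end LowerBound

/-! ### Explicit constants for large and for small fields. -/

section LowerBoundInstances

variable {F : Type*} [Field F] [Fintype F]

local notation "q" => (Fintype.card F : ℝ)

/-- W a measures the loss when a degree drops by a. A repeated prime of degree a lowers one
component by 2a, hence W (2a); a common prime lowers two components by a, hence W a ^ 2. -/
theorem card_triples_ge {T : Finset F} {d : Fin 3 → ℕ} {s : ℝ} {W b : ℕ → ℝ}
    (hN : ∀ i, ∀ a ≤ d i, ((zeroFree T (d i - a)).card : ℝ) ≤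
      W a * q⁻¹ ^ a * (zeroFree T (d i)).card)
    (hp : ∀ a, 1 ≤ a → ((zeroFreePrimes T a).card : ℝ) ≤ b a)
    (hs1 : ∀ K, ∑ a ∈ Icc 1 K, b a * q⁻¹ ^ (2 * a) * W (2 * a) ≤ s)
    (hs2 : ∀ K, ∑ a ∈ Icc 1 K, b a * q⁻¹ ^ (2 * a) * W a ^ 2 ≤ s) :
    (1 - 6 * s) * ∏ i, ((zeroFree T (d i)).card : ℝ) ≤ (triples T d).card := by
  have hb : ∀ a, 1 ≤ a → 0 ≤ b a := fun a ha => (Nat.cast_nonneg _).trans (hp a ha)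
  refine card_zeroFree_triples_le (fun i => ?_) fun i j _ => ?_
  · have h := card_not_squarefree_le T (d i)
    have h' : (#{f ∈ zeroFree T (d i) | ¬ Squarefree f} : ℝ) ≤ ∑ a ∈ Icc 1 (d i / 2),
      ((zeroFreePrimes T a).card : ℝ) * (zeroFree T (d i - 2 * a)).card := by exact_mod_cast h
    refine h'.trans ?_
    refine le_trans (Finset.sum_le_sum (g := fun a => b a * q⁻¹ ^ (2 * a) * W (2 * a) *
      (zeroFree T (d i)).card) fun a ha => ?_) ?_
    · rw [Finset.mem_Icc] at ha
      calc ((zeroFreePrimes T a).card : ℝ) * (zeroFree T (d i - 2 * a)).card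
          ≤ b a * (W (2 * a) * q⁻¹ ^ (2 * a) * (zeroFree T (d i)).card) :=
            mul_le_mul (hp a ha.1) (hN i (2 * a) (by omega)) (Nat.cast_nonneg _) (hb a ha.1)
        _ = _ := by ring
    · rw [← Finset.sum_mul]
      exact mul_le_mul_of_nonneg_right (hs1 _) (Nat.cast_nonneg _)
  · have h := card_not_coprime_le T (d i) (d j)
    have h' : (#{f ∈ zeroFree T (d i) ×ˢ zeroFree T (d j) | ¬ IsCoprime f.1 f.2} : ℝ) ≤
      ∑ a ∈ Icc 1 (min (d i) (d j)), ((zeroFreePrimes T a).card : ℝ) *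
        ((zeroFree T (d i - a)).card * (zeroFree T (d j - a)).card) := by exact_mod_cast h
    refine h'.trans ?_
    refine le_trans (Finset.sum_le_sum (g := fun a => b a * q⁻¹ ^ (2 * a) * W a ^ 2 *
      ((zeroFree T (d i)).card * (zeroFree T (d j)).card)) fun a ha => ?_) ?_
    · rw [Finset.mem_Icc] at ha
      have h1 := hN i a (ha.2.trans (min_le_left _ _))
      have h2 := hN j a (ha.2.trans (min_le_right _ _))
      calc ((zeroFreePrimes T a).card : ℝ) *
            ((zeroFree T (d i - a)).card * (zeroFree T (d j - a)).card)
          ≤ b a * ((W a * q⁻¹ ^ a * (zeroFree T (d i)).card) *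
            (W a * q⁻¹ ^ a * (zeroFree T (d j)).card)) :=
            mul_le_mul (hp a ha.1) (mul_le_mul h1 h2 (Nat.cast_nonneg _)
              ((Nat.cast_nonneg _).trans h1)) (by positivity) (hb a ha.1)
        _ = _ := by ring
    · rw [← Finset.sum_mul]
      exact mul_le_mul_of_nonneg_right (hs2 _) (by positivity)

theorem sum_Icc_pow_le {x : ℝ} (hx : 0 ≤ x) (hx1 : x < 1) (m K : ℕ) :
    ∑ a ∈ Icc 1 K with m ≤ a, x ^ a ≤ x ^ m / (1 - x) := by
  refine (Finset.sum_le_sum_of_subset_of_nonneg (t := Ico m (K + 1)) (fun a ha => ?_)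
    fun a _ _ => by positivity).trans (geom_sum_Ico_le_of_lt_one hx hx1)
  simp only [mem_filter, Finset.mem_Icc] at ha
  rw [Finset.mem_Ico]; omega

/-- With T empty both sums are ∑ q⁻ᵃ ≤ 1/(q − 1) ≤ 1/8, and 1 − 6/8 = 1/4. -/
theorem card_triples_empty_ge_of_nine_le (hq9 : 9 ≤ Fintype.card F) (d : Fin 3 → ℕ) :
    1 / 4 * modelSize F d ≤ (triples (∅ : Finset F) d).card := by
  have hq : (9 : ℝ) ≤ q := by exact_mod_cast hq9
  have hr : q⁻¹ ≤ 1 / 9 := by rw [inv_le_comm₀ (by linarith) (by norm_num)]; linarith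
  have hr0 : 0 < q⁻¹ := inv_pos.2 (by linarith)
  have hq0 : q ≠ 0 := by linarith
  have hN : ∀ n, ((zeroFree (∅ : Finset F) n).card : ℝ) = (q - 1) * q ^ n := fun n => by
    rw [card_zeroFree ∅ (by simp)]; simp
  have hsum : ∀ K, ∑ a ∈ Icc 1 K, q ^ a * q⁻¹ ^ (2 * a) * 1 ≤ (1 / 8 : ℝ) := by
    intro K
    have h1 := sum_Icc_pow_le hr0.le (by linarith) 1 K
    rw [Finset.filter_true_of_mem fun a ha => (Finset.mem_Icc.1 ha).1, pow_one] at h1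
    have h2 : ∀ a, q ^ a * q⁻¹ ^ (2 * a) * 1 = q⁻¹ ^ a := fun a => by
      rw [two_mul, pow_add, ← mul_assoc, ← mul_pow, mul_inv_cancel₀ hq0]; simp
    simp only [h2]
    refine h1.trans ?_
    rw [div_le_iff₀ (by linarith)]
    linarith
  have h := card_triples_ge (F := F) (T := ∅) (d := d) (s := 1 / 8) (W := fun _ => 1)
    (b := fun a => q ^ a)
    (fun i a ha => by
      rw [hN, hN, one_mul]
      obtain ⟨e, he⟩ := Nat.exists_eq_add_of_le ha
      rw [he, Nat.add_sub_cancel_left, pow_add, inv_pow]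
      field_simp; rfl)
    (fun a _ => by
      have := card_zeroFreePrimes_mul_le (∅ : Finset F) a
      rw [hN, mul_comm] at this
      exact le_of_mul_le_mul_left this (by linarith)) hsum
      (by simpa using hsum)
  simp only [hN] at h
  rw [Finset.prod_mul_distrib, Finset.prod_const, Finset.card_univ, Fintype.card_fin,
    Finset.prod_pow_eq_pow_sum] at h
  unfold modelSize
  linarith

/-- For q = 3, 5, 7 the quantity 1/(q − 1) is not below 1/6, so the plain union bound gives nothing.
Excluding zeros at three rational points leaves only q − 3 linear primes and brings the sums down to
1/8. -/
theorem card_triples_empty_ge_of_lt_nine (hF : ringChar F ≠ 2) (hq9 : Fintype.card F < 9)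
    (d : Fin 3 → ℕ) (hd : ∀ i, 19 ≤ d i) :
    1 / 4 * (8 / 27) ^ 3 * modelSize F d ≤ (triples (∅ : Finset F) d).card := by
  have hq3 := three_le_card hF
  have hq : (3 : ℝ) ≤ q := by exact_mod_cast hq3
  have hq8 : q ≤ 8 := by exact_mod_cast Nat.lt_succ_iff.1 hq9
  have hr : q⁻¹ ≤ 1 / 3 := by rw [inv_le_comm₀ (by linarith) (by norm_num)]; linarith
  have hr0 : 0 < q⁻¹ := inv_pos.2 (by linarith)
  have hq0 : q ≠ 0 := by linarith
  have hqr : q * q⁻¹ = 1 := mul_inv_cancel₀ hq0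
  obtain ⟨T, -, hT⟩ := Finset.exists_subset_card_eq
    (show 3 ≤ (univ : Finset F).card by rwa [Finset.card_univ])
  -- Primes of degree a are bounded by the exact count of zero-free polynomials, which needs |T'| ≤
  -- a; two of the three points can be used from a = 2 on.
  obtain ⟨T', hT'T, hT'⟩ := Finset.exists_subset_card_eq (show 2 ≤ T.card by omega)
  have hN : ∀ n, 3 ≤ n → ((zeroFree T n).card : ℝ) = (q - 1) * q ^ n * (1 - q⁻¹) ^ 3 := fun n hn => by
    rw [card_zeroFree T (by omega), hT]
  have hv : (8 / 27 : ℝ) ≤ (1 - q⁻¹) ^ 3 := by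
    calc (8 / 27 : ℝ) = (2 / 3) ^ 3 := by norm_num
      _ ≤ _ := pow_le_pow_left₀ (by norm_num) (by linarith) 3
  -- As d i ≥ 19, the degree d i − a is at least 3 = |T| for a ≤ 16 and the exact count applies.
  -- Beyond that the factor (1 − 1/q)³ ≥ 8/27 is given away.
  set W : ℕ → ℝ := fun a => if a ≤ 16 then 1 else 27 / 8 with hW
  set b : ℕ → ℝ := fun a => if a = 1 then q - 3 else q ^ a * (1 - q⁻¹) ^ 2 with hb
  -- The threshold is 8 because 2a exceeds 16 afterwards; 12 is larger than both 27/8 and (27/8)².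
  have hsum : ∀ K, ∑ a ∈ Icc 1 K, b a * q⁻¹ ^ (2 * a) * (if a ≤ 8 then 1 else 12) ≤ (1 / 8 : ℝ) := by
    intro K
    have h2 := sum_Icc_pow_le hr0.le (by linarith) 2 K
    have h9 := sum_Icc_pow_le hr0.le (by linarith) 9 K
    rw [Finset.sum_filter] at h2 h9
    have hterm : ∀ a ∈ Icc 1 K, b a * q⁻¹ ^ (2 * a) * (if a ≤ 8 then 1 else 12) ≤
        (if a = 1 then (q - 3) * q⁻¹ ^ 2 else 0) + (1 - q⁻¹) ^ 2 * (if 2 ≤ a then q⁻¹ ^ a else 0) +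
          12 * (if 9 ≤ a then q⁻¹ ^ a else 0) := by
      intro a ha
      rw [Finset.mem_Icc] at ha
      rcases eq_or_lt_of_le ha.1 with rfl | h1
      · simp [hb]
      · have e : q ^ a * (1 - q⁻¹) ^ 2 * q⁻¹ ^ (2 * a) = (1 - q⁻¹) ^ 2 * q⁻¹ ^ a := by
          rw [two_mul, pow_add, show q ^ a * (1 - q⁻¹) ^ 2 * (q⁻¹ ^ a * q⁻¹ ^ a) =
            (1 - q⁻¹) ^ 2 * q⁻¹ ^ a * (q ^ a * q⁻¹ ^ a) by ring, ← mul_pow, hqr]; simp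
        simp only [hb, if_neg (show a ≠ 1 by omega), if_pos (show 2 ≤ a by omega), e]
        have h3 : (1 - q⁻¹) ^ 2 ≤ 1 := pow_le_one₀ (by linarith) (by linarith)
        have h4 : 0 < q⁻¹ ^ a := pow_pos hr0 a
        by_cases h8 : a ≤ 8
        · rw [if_pos h8, if_neg (show ¬ 9 ≤ a by omega)]; linarith
        · rw [if_neg h8, if_pos (show 9 ≤ a by omega)]
          have h5 : (1 - q⁻¹) ^ 2 * q⁻¹ ^ a ≤ q⁻¹ ^ a := mul_le_of_le_one_left h4.le h3
          have h6 : 0 ≤ (1 - q⁻¹) ^ 2 * q⁻¹ ^ a := by positivity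
          linarith
    refine (Finset.sum_le_sum hterm).trans ?_
    rw [Finset.sum_add_distrib, Finset.sum_add_distrib, ← Finset.mul_sum, ← Finset.mul_sum]
    have h1 : ∑ a ∈ Icc 1 K, (if a = 1 then (q - 3) * q⁻¹ ^ 2 else 0) ≤ (q - 3) * q⁻¹ ^ 2 := by
      rw [Finset.sum_ite_eq']
      split_ifs
      · exact le_rfl
      · have : 0 ≤ q - 3 := by linarith
        positivity
    have h2' := mul_le_mul_of_nonneg_left h2 (sq_nonneg (1 - q⁻¹))
    have h9' := mul_le_mul_of_nonneg_left h9 (show (0 : ℝ) ≤ 12 by norm_num)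
    refine (add_le_add (add_le_add h1 h2') h9').trans ?_
    -- What remains is an inequality in q alone, checked for each value from 3 to 8.
    generalize hcard : Fintype.card F = c at *
    interval_cases c <;> norm_num
  have hw1 : ∀ a, W (2 * a) ≤ if a ≤ 8 then 1 else 12 := by
    intro a
    simp only [hW]
    split_ifs <;> first | omega | norm_num
  have hw2 : ∀ a, W a ^ 2 ≤ if a ≤ 8 then 1 else 12 := by
    intro a
    simp only [hW]
    split_ifs <;> first | omega | norm_num
  have hp : ∀ a, 1 ≤ a → ((zeroFreePrimes T a).card : ℝ) ≤ b a := by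
    intro a ha
    rcases eq_or_lt_of_le ha with rfl | h1
    · have := card_zeroFreePrimes_mul_le T 1
      rw [card_zeroFree_one, hT, mul_comm] at this
      simp only [hb, if_true]
      exact le_of_mul_le_mul_left this (by linarith)
    · have h2 := card_zeroFreePrimes_mul_le T' a
      rw [card_zeroFree T' (by omega), hT', mul_comm, mul_assoc] at h2
      have h3 := le_of_mul_le_mul_left h2 (by linarith)
      simp only [hb, if_neg (show a ≠ 1 by omega)]
      refine le_trans ?_ h3
      norm_cast
      refine Finset.card_le_card fun f hf => ?_
      rw [mem_zeroFreePrimes] at hf ⊢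
      exact ⟨hf.1, hf.2.1, fun x hx => hf.2.2 x (hT'T hx)⟩
  have hb0 : ∀ a, 1 ≤ a → 0 ≤ b a := fun a ha => (Nat.cast_nonneg _).trans (hp a ha)
  have h := card_triples_ge (F := F) (T := T) (d := d) (s := 1 / 8) (W := W) (b := b)
    (fun i a ha => by
      have hdi := hd i
      rw [hN (d i) (by omega)]
      have e : q ^ d i = q ^ (d i - a) * q ^ a := by rw [← pow_add, Nat.sub_add_cancel ha]
      have e' : q⁻¹ ^ a * ((q - 1) * q ^ d i * (1 - q⁻¹) ^ 3) =
          (q - 1) * q ^ (d i - a) * (1 - q⁻¹) ^ 3 := by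
        rw [e, show q⁻¹ ^ a * ((q - 1) * (q ^ (d i - a) * q ^ a) * (1 - q⁻¹) ^ 3) =
          (q - 1) * q ^ (d i - a) * (1 - q⁻¹) ^ 3 * (q ^ a * q⁻¹ ^ a) by ring, ← mul_pow, hqr]
        simp
      rw [mul_assoc, e']
      by_cases ha8 : a ≤ 16
      · simp only [hW, if_pos ha8, one_mul]
        rw [hN _ (by omega)]
      · simp only [hW, if_neg ha8]
        refine (card_zeroFree_le T _).trans ?_
        have : 0 < (q - 1) * q ^ (d i - a) := by
          have : 0 < q - 1 := by linarith
          positivity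
        nlinarith) hp
    (fun K => (Finset.sum_le_sum fun a ha => mul_le_mul_of_nonneg_left (hw1 a)
      (mul_nonneg (hb0 a (Finset.mem_Icc.1 ha).1) (by positivity))).trans (hsum K))
    (fun K => (Finset.sum_le_sum fun a ha => mul_le_mul_of_nonneg_left (hw2 a)
      (mul_nonneg (hb0 a (Finset.mem_Icc.1 ha).1) (by positivity))).trans (hsum K))
  have hsub : (triples T d).card ≤ (triples (∅ : Finset F) d).card := by
    refine Finset.card_le_card fun f hf => ?_
    rw [mem_triples] at hf ⊢
    exact ⟨hf.1, hf.2.1, hf.2.2.1, by simp⟩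
  have hsub' : ((triples T d).card : ℝ) ≤ (triples (∅ : Finset F) d).card := by exact_mod_cast hsub
  refine le_trans ?_ (h.trans hsub')
  rw [Finset.prod_congr rfl fun i _ => hN (d i) (by have := hd i; omega), Finset.prod_mul_distrib,
    Finset.prod_mul_distrib, Finset.prod_const, Finset.prod_const, Finset.card_univ,
    Fintype.card_fin, Finset.prod_pow_eq_pow_sum]
  change _ ≤ (1 - 6 * (1 / 8)) * (modelSize F d * _)
  have hS := modelSize_pos hF d
  have hv3 : ((8 / 27 : ℝ)) ^ 3 ≤ ((1 - q⁻¹) ^ 3) ^ 3 := pow_le_pow_left₀ (by norm_num) hv 3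
  nlinarith

end LowerBoundInstances

/-! ### The random model and the comparison with averages over triples. -/

section RandomModel

open MeasureTheory ProbabilityTheory

variable {F : Type*} [Field F] [Fintype F]

local notation "q" => (Fintype.card F : ℝ)

/-- The law mixes two cases: with probability q/(q + 3) the place is unramified and the trace is 3
or −1 with weights 1/4 and 3/4; with probability 3/(q + 3) it is ramified and the trace is ±1 with
equal weights. -/
theorem integral_pow_pointLaw (n : ℕ) :
    ∫ x, x ^ n ∂(BiquadraticCurve.pointLaw (Fintype.card F)) = placeMoment q n := by
  have hq : 0 < q := by exact_mod_cast Fintype.card_pos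
  have hd : ∀ a : ℝ, Integrable (fun x : ℝ => x ^ n) (Measure.dirac a) :=
    fun a => integrable_dirac (by simp)
  unfold BiquadraticCurve.pointLaw
  rw [integral_add_measure, integral_add_measure, integral_smul_measure, integral_smul_measure,
    integral_smul_measure, integral_dirac, integral_dirac, integral_dirac,
    ENNReal.toReal_ofReal (by positivity), ENNReal.toReal_ofReal (by positivity),
    ENNReal.toReal_ofReal (by positivity)]
  · unfold placeMoment
    rw [Fintype.sum_option]
    simp only [traceCoeff, ramProb, if_true, reduceCtorEq, if_false, Finset.sum_const,
      Finset.card_univ, Fintype.card_fin, nsmul_eq_mul, smul_eq_mul, one_pow, mul_one]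
    rcases Nat.even_or_odd n with h | h
    · rw [h.neg_one_pow, if_pos h]; push_cast; field_simp; ring
    · rw [h.neg_one_pow, if_neg (Nat.not_even_iff_odd.2 h)]; push_cast; field_simp; ring
  · exact (hd _).smul_measure ENNReal.ofReal_ne_top
  · exact (hd _).smul_measure ENNReal.ofReal_ne_top
  · exact ((hd _).smul_measure ENNReal.ofReal_ne_top).add_measure
      ((hd _).smul_measure ENNReal.ofReal_ne_top)
  · exact (hd _).smul_measure ENNReal.ofReal_ne_top

theorem ae_abs_le_pointLaw (Q : ℕ) : ∀ᵐ x ∂(BiquadraticCurve.pointLaw Q), |x| ≤ 3 := by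
  have hd : ∀ (c : ENNReal) (a : ℝ), |a| ≤ 3 → ∀ᵐ x ∂(c • Measure.dirac a), |x| ≤ 3 := by
    intro c a ha
    refine Measure.ae_smul_measure ?_ c
    rw [ae_dirac_iff (measurableSet_le (by fun_prop) measurable_const)]
    exact ha
  unfold BiquadraticCurve.pointLaw
  rw [ae_add_measure_iff, ae_add_measure_iff]
  exact ⟨⟨hd _ _ (by norm_num), hd _ _ (by norm_num)⟩, hd _ _ (by norm_num)⟩

theorem placeMoment_zero (Q : ℝ) (hQ : 0 < Q) : placeMoment Q 0 = 1 := by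
  rw [← sum_ramProb hQ]
  unfold placeMoment
  refine Finset.sum_congr rfl fun ρ _ => ?_
  cases ρ <;> simp [traceCoeff]
  norm_num

/-- A zeroth moment is 1, so the product over the image of κ extends to all places. -/
theorem limitMoment_eq_sum_prod (k : ℕ) {ι : Type*} [Fintype ι] [DecidableEq ι]
    (e : ι ≃ Option F) : limitMoment F k = ∑ κ : Fin k → ι, ∏ i, placeMoment q #{l | κ l = i} := by
  have hq : 0 < q := by exact_mod_cast Fintype.card_pos
  unfold limitMoment
  rw [← (Equiv.arrowCongr (Equiv.refl (Fin k)) e).sum_comp]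
  refine Finset.sum_congr rfl fun κ _ => ?_
  rw [Finset.prod_subset (Finset.subset_univ _), ← e.prod_comp]
  · refine Finset.prod_congr rfl fun i _ => ?_
    simp [Equiv.arrowCongr]
  · intro x _ hx
    rw [show #{l | (Equiv.arrowCongr (Equiv.refl (Fin k)) e) κ l = x} = 0 from ?_,
      placeMoment_zero _ hq]
    rw [Finset.card_eq_zero, Finset.filter_eq_empty_iff]
    intro l _ hl
    exact hx (Finset.mem_image.2 ⟨l, Finset.mem_univ _, hl⟩)

/-- The power expands over maps κ into products of powers of the X_i, and independence turns their
expectations into products of moments. -/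
theorem integral_sum_pow_eq_limitMoment {Ω : Type*} [MeasurableSpace Ω] (P : Measure Ω)
    [IsProbabilityMeasure P] {ι : Type*} [Fintype ι] [DecidableEq ι] (e : ι ≃ Option F)
    (X : ι → Ω → ℝ) (hX : iIndepFun X P)
    (hlaw : ∀ i, HasLaw (X i) (BiquadraticCurve.pointLaw (Fintype.card F)) P) (k : ℕ) :
    ∫ ω, (∑ i, X i ω) ^ k ∂P = limitMoment F k := by
  have hmeas : ∀ i, AEMeasurable (X i) P := fun i => (hlaw i).aemeasurable
  have hbound : ∀ i, ∀ᵐ ω ∂P, |X i ω| ≤ 3 := by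
    intro i
    have := ae_abs_le_pointLaw (Fintype.card F)
    rw [← (hlaw i).map_eq] at this
    exact ae_of_ae_map (hmeas i) this
  have hbound' : ∀ᵐ ω ∂P, ∀ i, |X i ω| ≤ 3 := ae_all_iff.2 hbound
  have hint : ∀ κ : Fin k → ι, Integrable (fun ω => ∏ l, X (κ l) ω) P := by
    intro κ
    refine Integrable.of_bound (Finset.aemeasurable_fun_prod _ fun l _ =>
      hmeas (κ l)).aestronglyMeasurable (3 ^ k) ?_
    filter_upwards [hbound'] with ω hω
    rw [Real.norm_eq_abs, Finset.abs_prod]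
    refine (Finset.prod_le_prod (fun _ _ => abs_nonneg _) fun l _ => hω (κ l)).trans (le_of_eq ?_)
    simp
  simp only [Fintype.sum_pow]
  rw [integral_finsetSum _ fun κ _ => hint κ, limitMoment_eq_sum_prod k e]
  refine Finset.sum_congr rfl fun κ _ => ?_
  have e1 : ∀ ω, ∏ l, X (κ l) ω = ∏ i, (X i ω) ^ #{l | κ l = i} := by
    intro ω
    rw [Finset.prod_comp (fun i => X i ω) κ]
    refine Finset.prod_subset (Finset.subset_univ _) fun i _ hi => ?_
    rw [show #{l | κ l = i} = 0 from ?_, pow_zero]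
    rw [Finset.card_eq_zero, Finset.filter_eq_empty_iff]
    intro l _ hl
    exact hi (Finset.mem_image.2 ⟨l, Finset.mem_univ _, hl⟩)
  simp only [e1]
  rw [hX.integral_fun_prod_comp (f := fun i x => x ^ #{l | κ l = i}) hmeas
    fun i => (by fun_prop : Measurable fun x : ℝ => x ^ #{l | κ l = i}).aestronglyMeasurable]
  refine Finset.prod_congr rfl fun i _ => ?_
  rw [← integral_pow_pointLaw]
  exact (hlaw i).integral_comp (f := fun x : ℝ => x ^ #{l | κ l = i})
    (by fun_prop : Measurable fun x : ℝ => x ^ #{l | κ l = i}).aestronglyMeasurable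

theorem sqrt_one_add_pow_le (k : ℕ) : √(1 + q) ^ k ≤ 2 ^ k * q ^ ((k : ℝ) / 2) := by
  have hq : 1 ≤ q := one_le_card
  have h1 : √(1 + q) ≤ 2 * √q := by
    rw [show (2 : ℝ) = √4 by rw [show (4 : ℝ) = 2 ^ 2 by norm_num]; simp, ← Real.sqrt_mul (by norm_num)]
    exact Real.sqrt_le_sqrt (by linarith)
  refine (pow_le_pow_left₀ (Real.sqrt_nonneg _) h1 k).trans (le_of_eq ?_)
  rw [mul_pow, Real.sqrt_eq_rpow, ← Real.rpow_natCast (q ^ (1 / 2 : ℝ)), ← Real.rpow_mul (by linarith)]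
  congr 2; ring

theorem exists_abs_average_sub_le (k : ℕ) {ε : ℝ} (hε : 0 < ε) (hε1 : ε < 1) :
    ∃ A : ℝ, ∀ (F : Type*) [Field F] [Fintype F], ringChar F ≠ 2 →
      ∀ (d : Fin 3 → ℕ) (m : ℕ), (∀ i j, Even (d i) ↔ Even (d j)) → (∀ i, m ≤ d i) → k + 1 ≤ m →
        (9 ≤ Fintype.card F ∨ 19 ≤ m) →
        |(∑ r, ∑ f ∈ triples ∅ (lower d r), (∑ x : Option F, placeTrace f x) ^ k) /
            (∑ r, ((triples (∅ : Finset F) (lower d r)).card : ℝ)) - limitMoment F k| ≤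
          A * (Fintype.card F : ℝ) ^ (-((1 - ε) / 2) * m + k) *
            √(1 + (Fintype.card F : ℝ)) ^ k := by
  -- Then y⁻¹ = 3^{ε/2} ≤ q^{ε/2}, so (y⁻¹/q)ᵐ ≤ q^{(ε/2 − 1)m}.
  set y : ℝ := 3 ^ (-(ε / 2)) with hy
  have hy0 : 0 < y := Real.rpow_pos_of_pos (by norm_num) _
  have hy1 : y < 1 := Real.rpow_lt_one_of_one_lt_of_neg (by norm_num) (by linarith)
  have hy3 : 1 / 3 ≤ y := by
    rw [hy, one_div, ← Real.rpow_neg_one 3]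
    exact Real.rpow_le_rpow_of_exponent_le (by norm_num) (by linarith)
  obtain ⟨C, hC, h⟩ := abs_sum_trace_pow_sub_le k hy3 hy1
  set c : ℝ := 1 / 4 * (8 / 27) ^ 3 with hc
  have hc0 : 0 < c := by norm_num [hc]
  refine ⟨C / c * 2 ^ k, ?_⟩
  intro F _ _ hF d m hp hm hkm hbig
  have hS := modelSize_pos hF d
  have hq3 : (3 : ℝ) ≤ Fintype.card F := by exact_mod_cast three_le_card hF
  have hcount : c * modelSize F d ≤ ∑ r, ((triples (∅ : Finset F) (lower d r)).card : ℝ) := by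
    have h1 : c * modelSize F d ≤ (triples (∅ : Finset F) d).card := by
      rcases lt_or_ge (Fintype.card F) 9 with h9 | h9
      · exact card_triples_empty_ge_of_lt_nine hF h9 d fun i =>
          (hbig.resolve_left (by omega)).trans (hm i)
      · refine le_trans ?_ (card_triples_empty_ge_of_nine_le h9 d)
        refine mul_le_mul_of_nonneg_right ?_ hS.le
        norm_num [hc]
    refine h1.trans ?_
    rw [Fintype.sum_option]
    exact le_add_of_nonneg_right (Finset.sum_nonneg fun _ _ => Nat.cast_nonneg _)
  set M := ∑ r, ((triples (∅ : Finset F) (lower d r)).card : ℝ) with hM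
  have hM0 : 0 < M := (mul_pos hc0 hS).trans_le hcount
  have hmain := h F hF d m hp hm hkm
  rw [← hM] at hmain
  set S := ∑ r, ∑ f ∈ triples (∅ : Finset F) (lower d r), (∑ x : Option F, placeTrace f x) ^ k
  have e0 : S / M - limitMoment F k = (S - limitMoment F k * M) / M := by field_simp
  rw [e0, abs_div, abs_of_pos hM0]
  set Q : ℝ := (Fintype.card F : ℝ) with hQ
  have hQ0 : 0 < Q := by linarith
  have hs : Q + 1 = √(1 + Q) * √(1 + Q) := by rw [Real.mul_self_sqrt (by linarith)]; ring
  have hθ : (y⁻¹ / Q) ^ m ≤ Q ^ ((ε / 2 - 1) * m) := by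
    rw [← Real.rpow_natCast, Real.rpow_mul hQ0.le]
    refine Real.rpow_le_rpow (by positivity) ?_ (Nat.cast_nonneg _)
    rw [Real.rpow_sub_one hQ0.ne']
    refine div_le_div_of_nonneg_right ?_ hQ0.le
    rw [hy, ← Real.rpow_neg (by norm_num), neg_neg]
    exact Real.rpow_le_rpow (by norm_num) hq3 (by linarith)
  -- Of (1 + q)ᵏ one square root goes into the normalisation of the moment. The other is O(q^{m/2})
  -- because k ≤ m; this is where half of the exponent m is given up.
  have hsk : √(1 + Q) ^ k ≤ 2 ^ k * Q ^ ((m : ℝ) / 2) := by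
    refine (sqrt_one_add_pow_le k).trans (mul_le_mul_of_nonneg_left ?_ (by positivity))
    refine Real.rpow_le_rpow_of_exponent_le (by linarith) ?_
    have : (k : ℝ) ≤ m := by exact_mod_cast (by omega : k ≤ m)
    linarith
  have hprod : √(1 + Q) ^ k * (y⁻¹ / Q) ^ m ≤ 2 ^ k * Q ^ (-((1 - ε) / 2) * m) := by
    refine (mul_le_mul hsk hθ (by positivity) (by positivity)).trans (le_of_eq ?_)
    rw [mul_assoc, ← Real.rpow_add hQ0]
    congr 2; ring
  rw [div_le_iff₀ hM0]
  refine hmain.trans ?_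
  have e1 : Q ^ (-((1 - ε) / 2) * m + k) = Q ^ (-((1 - ε) / 2) * (m : ℝ)) * Q ^ k := by
    rw [Real.rpow_add hQ0, Real.rpow_natCast]
  calc C * (Q + 1) ^ k * (Q ^ k * (y⁻¹ / Q) ^ m * modelSize F d)
      = C * √(1 + Q) ^ k * Q ^ k * (√(1 + Q) ^ k * (y⁻¹ / Q) ^ m) * modelSize F d := by
        rw [hs, mul_pow]; ring
    _ ≤ C * √(1 + Q) ^ k * Q ^ k * (2 ^ k * Q ^ (-((1 - ε) / 2) * (m : ℝ))) *
          modelSize F d := by gcongr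
    _ = C / c * 2 ^ k * (Q ^ (-((1 - ε) / 2) * (m : ℝ)) * Q ^ k) * √(1 + Q) ^ k *
          (c * modelSize F d) := by field_simp
    _ ≤ C / c * 2 ^ k * Q ^ (-((1 - ε) / 2) * m + k) * √(1 + Q) ^ k * M := by
        rw [e1]; gcongr

theorem abs_placeTrace_le (f : Fin 3 → F[X]) (x : Option F) : |placeTrace f x| ≤ 3 := by
  unfold placeTrace
  refine (Finset.abs_sum_le_sum_abs _ _).trans ((Finset.sum_le_card_nsmul _ _ 1 fun i _ => ?_).trans
    (by simp))
  split_ifs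
  · unfold localChar
    rw [Finset.abs_prod]
    refine Finset.prod_le_one (fun _ _ => abs_nonneg _) fun j _ => ?_
    split_ifs
    · exact abs_quadraticChar_le_one _
    · simp
  · simp

theorem abs_sum_placeTrace_le (f : Fin 3 → F[X]) : |∑ x : Option F, placeTrace f x| ≤ 3 * (q + 1) := by
  refine (Finset.abs_sum_le_sum_abs _ _).trans
    ((Finset.sum_le_card_nsmul _ _ 3 fun x _ => abs_placeTrace_le f x).trans (le_of_eq ?_))
  rw [Finset.card_univ, Fintype.card_option, nsmul_eq_mul]; push_cast; ring

/-- The trivial estimate suffices when the exponent is small compared with the moment, or when the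
field and the exponent are bounded. -/
theorem abs_sub_limitMoment_le_of_small (k m : ℕ) {ε : ℝ} (hε : 0 < ε) (hε1 : ε < 1)
    (hF : ringChar F ≠ 2) {a : ℝ} (ha : |a| ≤ (3 * (q + 1)) ^ k)
    (hsmall : m ≤ k ∨ (Fintype.card F < 9 ∧ m < 19)) :
    |a - limitMoment F k| ≤
      2 * 6 ^ k * 9 ^ 10 * q ^ (-((1 - ε) / 2) * m + k) * √(1 + q) ^ k := by
  have hq3 : (3 : ℝ) ≤ q := by exact_mod_cast three_le_card hF
  have h1 : |a - limitMoment F k| ≤ 2 * 3 ^ k * (√(1 + q) ^ k * √(1 + q) ^ k) := by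
    refine (abs_sub _ _).trans ((add_le_add ha (abs_limitMoment_le k)).trans (le_of_eq ?_))
    have hss : √(1 + q) ^ k * √(1 + q) ^ k = (q + 1) ^ k := by
      rw [← mul_pow, Real.mul_self_sqrt (by linarith), add_comm]
    rw [hss, mul_pow]; ring
  refine h1.trans ?_
  -- For m ≤ k the exponent on the right is at least k/2. In the other case it falls short of k/2 by
  -- at most 19/2 < 10, and q ≤ 9 lets 9^10 make up for it.
  have h2 : q ^ ((k : ℝ) / 2) ≤ 9 ^ 10 * q ^ (-((1 - ε) / 2) * m + k) := by
    rcases hsmall with h | ⟨h9, h19⟩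
    · have hmk : (m : ℝ) ≤ k := by exact_mod_cast h
      have : q ^ ((k : ℝ) / 2) ≤ q ^ (-((1 - ε) / 2) * m + k) := by
        refine Real.rpow_le_rpow_of_exponent_le (by linarith) ?_
        have : 0 ≤ (m : ℝ) := Nat.cast_nonneg _
        nlinarith
      refine this.trans (le_mul_of_one_le_left (by positivity) (by norm_num))
    · have hq9 : q ≤ 9 := by exact_mod_cast h9.le
      have hm19 : (m : ℝ) ≤ 19 := by exact_mod_cast h19.le
      have hm0 : 0 ≤ (m : ℝ) := Nat.cast_nonneg _
      have hk0 : 0 ≤ (k : ℝ) := Nat.cast_nonneg _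
      have e : q ^ ((k : ℝ) / 2) ≤ q ^ ((10 : ℕ) : ℝ) * q ^ (-((1 - ε) / 2) * m + k) := by
        rw [← Real.rpow_add (by linarith)]
        refine Real.rpow_le_rpow_of_exponent_le (by linarith) ?_
        push_cast
        nlinarith
      refine e.trans (mul_le_mul_of_nonneg_right ?_ (by positivity))
      rw [Real.rpow_natCast]
      exact pow_le_pow_left₀ (by linarith) hq9 10
  have h3 := (sqrt_one_add_pow_le (F := F) k).trans
    (mul_le_mul_of_nonneg_left h2 (by positivity))
  calc 2 * 3 ^ k * (√(1 + q) ^ k * √(1 + q) ^ k)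
      ≤ 2 * 3 ^ k * ((2 ^ k * (9 ^ 10 * q ^ (-((1 - ε) / 2) * m + k))) * √(1 + q) ^ k) := by gcongr
    _ = _ := by rw [show (6 : ℝ) = 2 * 3 by norm_num, mul_pow]; ring

end RandomModel

/-! ### Square classes of rational functions. -/

section RationalFunctions

variable {F : Type*} [Field F]

local notation "ι" => algebraMap F[X] (RatFunc F)

theorem algebraMap_polynomial_injective : Function.Injective ι := RatFunc.algebraMap_injective F

theorem algebraMap_C_eq (c : F) : ι (C c) = algebraMap F (RatFunc F) c := by
  rw [IsScalarTower.algebraMap_apply F F[X] (RatFunc F)]; rfl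

/-- If two squarefree polynomials differ by the square of a rational function, then this function is
constant. -/
theorem exists_const_of_squarefree {m m' : F[X]} (hm : Squarefree m) (hm' : Squarefree m')
    {r : RatFunc F} (h : ι m' = r ^ 2 * ι m) :
    ∃ c : F, c ≠ 0 ∧ r = algebraMap F (RatFunc F) c := by
  have hd : ι r.denom ≠ 0 := RatFunc.algebraMap_ne_zero r.denom_ne_zero
  have h1 : m' * r.denom ^ 2 = r.num ^ 2 * m := by
    apply algebraMap_polynomial_injective (F := F)
    have hr : r * ι r.denom = ι r.num := by
      nth_rw 1 [← RatFunc.num_div_denom r]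
      rw [div_mul_cancel₀ _ hd]
    rw [map_mul, map_mul, map_pow, map_pow, h, ← hr]; ring
  have hcop := RatFunc.isCoprime_num_denom r
  have hden : IsUnit r.denom := hm _ (by
    rw [← pow_two]
    exact (hcop.symm.pow (m := 2) (n := 2)).dvd_of_dvd_mul_left (Dvd.intro_left _ h1))
  have hnum : IsUnit r.num := hm' _ (by
    rw [← pow_two]
    exact (hcop.pow (m := 2) (n := 2)).dvd_of_dvd_mul_right (Dvd.intro _ h1.symm))
  obtain ⟨a, ha, ha'⟩ := isUnit_iff.1 hnum
  obtain ⟨b, hb, hb'⟩ := isUnit_iff.1 hden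
  refine ⟨a / b, div_ne_zero ha.ne_zero hb.ne_zero, ?_⟩
  rw [← RatFunc.num_div_denom r, ← ha', ← hb', algebraMap_C_eq, algebraMap_C_eq, map_div₀]

theorem eq_C_mul_of_squarefree {m m' : F[X]} (hm : Squarefree m) (hm' : Squarefree m')
    {r : RatFunc F} (h : ι m' = r ^ 2 * ι m) : ∃ c : F, c ≠ 0 ∧ m' = C c * m := by
  obtain ⟨c, hc, rfl⟩ := exists_const_of_squarefree hm hm' h
  refine ⟨c ^ 2, pow_ne_zero 2 hc, algebraMap_polynomial_injective (F := F) ?_⟩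
  rw [h, map_mul, algebraMap_C_eq, map_pow]

theorem exists_polynomial_squarefree_mul_sq (f : F[X]) (hf : f ≠ 0) :
    ∃ f₀ g : F[X], Squarefree f₀ ∧ g ≠ 0 ∧ f = f₀ * g ^ 2 := by
  induction hn : f.natDegree using Nat.strong_induction_on generalizing f with
  | _ n ih =>
  by_cases hs : Squarefree f
  · exact ⟨f, 1, hs, one_ne_zero, by simp⟩
  · simp only [Squarefree, not_forall] at hs
    obtain ⟨x, ⟨y, rfl⟩, hx⟩ := hs
    have hx0 : x ≠ 0 := by rintro rfl; simp at hf
    have hy0 : y ≠ 0 := right_ne_zero_of_mul hf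
    have hdx : 0 < x.natDegree := Nat.pos_of_ne_zero fun h => hx (by
      rw [eq_C_of_natDegree_eq_zero h] at hx0 ⊢
      exact isUnit_C.2 (C_ne_zero.1 hx0).isUnit)
    rw [natDegree_mul (mul_ne_zero hx0 hx0) hy0, natDegree_mul hx0 hx0] at hn
    obtain ⟨f₀, g, h1, h2, h3⟩ := ih y.natDegree (by omega) y hy0 rfl
    exact ⟨f₀, g * x, h1, mul_ne_zero h2 hx0, by rw [h3]; ring⟩

/-- Up to the square of its denominator, r is the product of numerator and denominator. -/
theorem exists_squarefree_representative {r : RatFunc F} (hr : r ≠ 0) :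
    ∃ m : F[X], Squarefree m ∧ ∃ s : RatFunc F, s ≠ 0 ∧ r = s ^ 2 * ι m := by
  have hd : ι r.denom ≠ 0 := RatFunc.algebraMap_ne_zero r.denom_ne_zero
  obtain ⟨m, g, h1, h2, h3⟩ := exists_polynomial_squarefree_mul_sq (r.num * r.denom)
    (mul_ne_zero (RatFunc.num_ne_zero hr) r.denom_ne_zero)
  refine ⟨m, h1, ι g / ι r.denom, div_ne_zero (RatFunc.algebraMap_ne_zero h2) hd, ?_⟩
  have h4 := congrArg ι h3
  rw [map_mul, map_mul, map_pow] at h4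
  nth_rw 1 [← RatFunc.num_div_denom r]
  field_simp
  linear_combination h4

/-! ### Automorphisms of the rational function field. -/

section Automorphisms

-- The image of X generates the whole field, and the degree of F(X) over F(r) is the maximum of the
-- two degrees of r. So τ is a Möbius transformation.
open IntermediateField in
theorem max_natDegree_automorphism (τ : RatFunc F ≃ₐ[F] RatFunc F) :
    max (τ RatFunc.X).num.natDegree (τ RatFunc.X).denom.natDegree = 1 := by
  rw [← RatFunc.finrank_eq_max_natDegree]
  have h : F⟮τ RatFunc.X⟯ = ⊤ := by
    have h1 := IntermediateField.adjoin_map F {(RatFunc.X : RatFunc F)} τ.toAlgHom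
    rw [RatFunc.adjoin_X, Set.image_singleton] at h1
    rw [show τ RatFunc.X = τ.toAlgHom RatFunc.X from rfl, ← h1, ← AlgHom.fieldRange_eq_map]
    exact AlgHom.fieldRange_eq_top.2 τ.surjective
  rw [h]
  exact IntermediateField.finrank_top

theorem automorphism_apply_polynomial (τ : RatFunc F ≃ₐ[F] RatFunc F) (m : F[X]) :
    τ (ι m) = aeval (τ RatFunc.X) m := by
  rw [show τ RatFunc.X = τ.toAlgHom RatFunc.X from rfl, Polynomial.aeval_algHom_apply,
    RatFunc.aeval_X_left_eq_algebraMap]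
  rfl

theorem automorphism_ext {τ τ' : RatFunc F ≃ₐ[F] RatFunc F}
    (h : τ RatFunc.X = τ' RatFunc.X) : τ = τ' := by
  refine AlgEquiv.ext fun r => ?_
  rw [← RatFunc.num_div_denom r, map_div₀, map_div₀]
  simp only [automorphism_apply_polynomial, h]

instance finite_automorphisms [Finite F] : Finite (RatFunc F ≃ₐ[F] RatFunc F) := by
  have := Fintype.ofFinite F
  have hfin : Finite {f : F[X] | f.natDegree ≤ 1} := (finite_setOf_natDegree_le 1).to_subtype
  have hdeg := fun τ : RatFunc F ≃ₐ[F] RatFunc F => max_natDegree_automorphism τ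
  refine Finite.of_injective (β := {f : F[X] | f.natDegree ≤ 1} × {f : F[X] | f.natDegree ≤ 1})
    (fun τ => (⟨(τ RatFunc.X).num, (le_max_left _ _).trans (hdeg τ).le⟩,
      ⟨(τ RatFunc.X).denom, (le_max_right _ _).trans (hdeg τ).le⟩)) fun τ τ' h => ?_
  simp only [Prod.mk.injEq, Subtype.mk.injEq] at h
  refine automorphism_ext ?_
  rw [← RatFunc.num_div_denom (τ RatFunc.X), ← RatFunc.num_div_denom (τ' RatFunc.X), h.1, h.2]

/-- Homogenise m to the even degree 2e with e = ⌈deg m / 2⌉. Multiplying m(a/b) by the square b^{2e}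
gives a polynomial of degree at most 2e, as a and b are linear; passing to its squarefree part only
lowers the degree. -/
theorem exists_squarefree_automorphism_le (τ : RatFunc F ≃ₐ[F] RatFunc F) {m : F[X]}
    (hm : Squarefree m) : ∃ m' : F[X], Squarefree m' ∧
      (m'.natDegree + 1) / 2 ≤ (m.natDegree + 1) / 2 ∧
      ∃ r : RatFunc F, r ≠ 0 ∧ τ (ι m) = r ^ 2 * ι m' := by
  set e := (m.natDegree + 1) / 2 with he
  set a := (τ RatFunc.X).num with ha
  set b := (τ RatFunc.X).denom with hb
  have hdeg := max_natDegree_automorphism τ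
  have ha1 : a.natDegree ≤ 1 := (le_max_left _ _).trans hdeg.le
  have hb1 : b.natDegree ≤ 1 := (le_max_right _ _).trans hdeg.le
  have hb0 : ι b ≠ 0 := RatFunc.algebraMap_ne_zero (τ RatFunc.X).denom_ne_zero
  set M : F[X] := ∑ i ∈ range (2 * e + 1), C (m.coeff i) * a ^ i * b ^ (2 * e - i) with hM
  have hMdeg : M.natDegree ≤ 2 * e := by
    refine natDegree_sum_le_of_forall_le _ _ fun i hi => ?_
    rw [Finset.mem_range] at hi
    refine natDegree_mul_le.trans ?_
    have h1 : (C (m.coeff i) * a ^ i).natDegree ≤ i := by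
      refine (natDegree_C_mul_le _ _).trans (natDegree_pow_le.trans ?_)
      nlinarith
    have h2 : (b ^ (2 * e - i)).natDegree ≤ 2 * e - i := by
      refine natDegree_pow_le.trans ?_
      nlinarith
    omega
  have hMeq : τ (ι m) * ι b ^ (2 * e) = ι M := by
    rw [automorphism_apply_polynomial, aeval_eq_sum_range' (n := 2 * e + 1) (by omega),
      Finset.sum_mul, hM, map_sum]
    refine Finset.sum_congr rfl fun i hi => ?_
    rw [Finset.mem_range] at hi
    rw [map_mul, map_mul, map_pow, map_pow, algebraMap_C_eq, Algebra.smul_def]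
    have h1 : τ RatFunc.X = ι a / ι b := (RatFunc.num_div_denom _).symm
    rw [h1, div_pow, show ι b ^ (2 * e) = ι b ^ i * ι b ^ (2 * e - i) by
      rw [← pow_add]; congr 1; omega]
    field_simp
  have hτ0 : τ (ι m) ≠ 0 := by
    rw [Ne, map_eq_zero]
    exact RatFunc.algebraMap_ne_zero hm.ne_zero
  have hM0 : M ≠ 0 := by
    intro h
    rw [h, map_zero] at hMeq
    exact (mul_ne_zero hτ0 (pow_ne_zero _ hb0)) hMeq
  obtain ⟨m', g, h1, h2, h3⟩ := exists_polynomial_squarefree_mul_sq M hM0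
  refine ⟨m', h1, ?_, ι g / ι b ^ e, div_ne_zero (RatFunc.algebraMap_ne_zero h2)
    (pow_ne_zero _ hb0), ?_⟩
  · have : m'.natDegree ≤ M.natDegree := natDegree_le_of_dvd ⟨_, h3⟩ hM0
    omega
  · have h4 := congrArg ι h3
    rw [map_mul, map_pow, ← hMeq] at h4
    field_simp
    rw [← pow_mul, mul_comm e 2]
    linear_combination h4

/-- The inequality is applied to τ and then to its inverse, which leads back to m up to a constant.
-/
theorem exists_squarefree_automorphism (τ : RatFunc F ≃ₐ[F] RatFunc F) {m : F[X]}
    (hm : Squarefree m) : ∃ m' : F[X], Squarefree m' ∧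
      (m'.natDegree + 1) / 2 = (m.natDegree + 1) / 2 ∧
      ∃ r : RatFunc F, r ≠ 0 ∧ τ (ι m) = r ^ 2 * ι m' := by
  obtain ⟨m', h1, h2, r, hr, h3⟩ := exists_squarefree_automorphism_le τ hm
  obtain ⟨m'', h1', h2', r', hr', h3'⟩ := exists_squarefree_automorphism_le τ.symm h1
  refine ⟨m', h1, le_antisymm h2 ?_, r, hr, h3⟩
  have h4 := congrArg τ.symm h3
  rw [AlgEquiv.symm_apply_apply, map_mul, map_pow, h3'] at h4
  obtain ⟨c, hc, h5⟩ := eq_C_mul_of_squarefree h1' hm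
    (show ι m = (τ.symm r * r') ^ 2 * ι m'' by rw [h4]; ring)
  rw [h5, natDegree_C_mul hc]
  exact h2'

end Automorphisms

end RationalFunctions

/-! ### Frames: compatible systems of square roots. -/

section Frames

variable {F : Type*} [Field F]

local notation "ι" => algebraMap F[X] (RatFunc F)

/-- The product of the components other than `i`. -/
noncomputable def cofactor (f : Fin 3 → F[X]) (i : Fin 3) : F[X] := ∏ l ∈ univ.erase i, f l

theorem cofactor_zero (f : Fin 3 → F[X]) : cofactor f 0 = f 1 * f 2 := by
  rw [cofactor, show (univ.erase 0 : Finset (Fin 3)) = {1, 2} by decide,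
    Finset.prod_pair (by decide)]

theorem cofactor_one (f : Fin 3 → F[X]) : cofactor f 1 = f 0 * f 2 := by
  rw [cofactor, show (univ.erase 1 : Finset (Fin 3)) = {0, 2} by decide,
    Finset.prod_pair (by decide)]

theorem cofactor_two (f : Fin 3 → F[X]) : cofactor f 2 = f 0 * f 1 := by
  rw [cofactor, show (univ.erase 2 : Finset (Fin 3)) = {0, 1} by decide,
    Finset.prod_pair (by decide)]

theorem cofactor_eq {f : Fin 3 → F[X]} {i k l : Fin 3} (hik : i ≠ k) (hil : i ≠ l) (hkl : k ≠ l) :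
    cofactor f i = f k * f l := by
  rw [cofactor, show (univ.erase i : Finset (Fin 3)) = {k, l} by
    ext x; revert i k l x; decide, Finset.prod_pair hkl]

/-- Triples of squarefree and pairwise coprime polynomials whose products in pairs are not
constant. -/
structure IsAdmissible (f : Fin 3 → F[X]) : Prop where
  isModel : IsModel ∅ f
  natDegree_pos : ∀ i, 0 < (cofactor f i).natDegree

theorem IsModel.ne_zero {T : Finset F} {f : Fin 3 → F[X]} (hf : IsModel T f) (i : Fin 3) :
    f i ≠ 0 := (hf.1 i).ne_zero

theorem IsModel.squarefree_cofactor {T : Finset F} {f : Fin 3 → F[X]} (hf : IsModel T f)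
    (i : Fin 3) : Squarefree (cofactor f i) :=
  Finset.squarefree_prod_of_pairwise_isCoprime
    (fun k _ l _ hkl => (hf.2.1 k l hkl).isRelPrime) fun l _ => hf.1 l

variable {K : Type*} [Field K]

/-- Square roots of the products in pairs of the components of `f`, with compatible signs. -/
structure IsFrame (j : RatFunc F →+* K) (f : Fin 3 → F[X]) (z : Fin 3 → K) : Prop where
  sq : ∀ i, z i ^ 2 = j (ι (cofactor f i))
  mul : ∀ i k l, i ≠ k → i ≠ l → k ≠ l → z i * z k = j (ι (f l)) * z l

theorem exists_other (i : Fin 3) : ∃ k l : Fin 3, i ≠ k ∧ i ≠ l ∧ k ≠ l := by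
  revert i; decide

/-- The relation for z 0 z 1 determines z 2, and every other relation follows from it after
cancelling f 2. -/
theorem isFrame_of_mul {j : RatFunc F →+* K} {f : Fin 3 → F[X]} (hf : ∀ i, f i ≠ 0) {z : Fin 3 → K}
    (h0 : z 0 ^ 2 = j (ι (cofactor f 0))) (h1 : z 1 ^ 2 = j (ι (cofactor f 1)))
    (h2 : z 0 * z 1 = j (ι (f 2)) * z 2) : IsFrame j f z := by
  have hj : ∀ i, j (ι (f i)) ≠ 0 := fun i => by
    rw [Ne, map_eq_zero]; exact RatFunc.algebraMap_ne_zero (hf i)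
  have h2' := hj 2
  rw [cofactor_zero, map_mul, map_mul] at h0
  rw [cofactor_one, map_mul, map_mul] at h1
  have e02 : z 0 * z 2 = j (ι (f 1)) * z 1 := by
    apply mul_left_cancel₀ h2'
    linear_combination (-z 0) * h2 + z 1 * h0
  have e12 : z 1 * z 2 = j (ι (f 0)) * z 0 := by
    apply mul_left_cancel₀ h2'
    linear_combination (-z 1) * h2 + z 0 * h1
  have e2 : z 2 ^ 2 = j (ι (f 0)) * j (ι (f 1)) := by
    apply mul_left_cancel₀ h2'
    apply mul_left_cancel₀ h2'
    linear_combination (-(z 0 * z 1) - j (ι (f 2)) * z 2) * h2 + z 1 ^ 2 * h0 +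
      j (ι (f 1)) * j (ι (f 2)) * h1
  refine ⟨fun i => ?_, fun i k l hik hil hkl => ?_⟩
  · fin_cases i
    · simpa [cofactor_zero] using h0
    · simpa [cofactor_one] using h1
    · simpa [cofactor_two] using e2
  · fin_cases i <;> fin_cases k <;> fin_cases l <;>
      first
        | exact absurd rfl hik
        | exact absurd rfl hil
        | exact absurd rfl hkl
        | assumption
        | (rw [mul_comm]; assumption)

namespace IsFrame

variable {j : RatFunc F →+* K} {f : Fin 3 → F[X]} {z : Fin 3 → K}

theorem map_ne_zero (j : RatFunc F →+* K) {p : F[X]} (hp : p ≠ 0) : j (ι p) ≠ 0 := by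
  rw [Ne, map_eq_zero]; exact RatFunc.algebraMap_ne_zero hp

theorem notMem_range (hf : IsAdmissible f) (hz : IsFrame j f z) (i : Fin 3) (r : RatFunc F) :
    z i ≠ j r := by
  intro h
  have h1 : j (ι (cofactor f i)) = j (r ^ 2 * ι 1) := by
    rw [← hz.sq, h, map_one, mul_one, map_pow]
  obtain ⟨c, hc, h2⟩ := eq_C_mul_of_squarefree squarefree_one (hf.isModel.squarefree_cofactor i)
    (j.injective h1)
  have := hf.natDegree_pos i
  rw [h2, mul_one, natDegree_C] at this
  exact absurd this (lt_irrefl _)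

theorem ne_zero (hf : IsAdmissible f) (hz : IsFrame j f z) (i : Fin 3) : z i ≠ 0 := by
  rw [← map_zero j]; exact hz.notMem_range hf i 0

theorem two_independent (hf : IsAdmissible f) (hz : IsFrame j f z) (i : Fin 3) {a b : RatFunc F}
    (h : j a + j b * z i = 0) : a = 0 ∧ b = 0 := by
  by_cases hb : b = 0
  · subst hb
    rw [map_zero, zero_mul, add_zero, map_eq_zero] at h
    exact ⟨h, rfl⟩
  · exfalso
    refine hz.notMem_range hf i (-a / b) ?_
    have hb' : j b ≠ 0 := by rwa [Ne, map_eq_zero]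
    rw [map_div₀, map_neg, eq_div_iff hb']
    linear_combination h

theorem mul_mem (hz : IsFrame j f z) {i k l : Fin 3} (hik : i ≠ k) (hil : i ≠ l) (hkl : k ≠ l)
    (hf : IsAdmissible f) {r : RatFunc F} : z i * z k ≠ j r := by
  intro h
  refine hz.notMem_range hf l (r / ι (f l)) ?_
  have h1 := hz.mul i k l hik hil hkl
  have h2 := map_ne_zero j (hf.isModel.ne_zero l)
  rw [map_div₀, eq_div_iff h2, ← h, h1]; ring

/-- Since z 2 is a multiple of z 0 z 1, a relation is linear in z 1 over the field generated by z 0.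
If the coefficient of z 1 were nonzero, then z 1 = x + y z 0; squaring gives 2xy = 0, so z 1 or z 0
z 1 would lie in the base field. -/
theorem independent (h2 : (2 : F) ≠ 0) (hf : IsAdmissible f) (hz : IsFrame j f z) {a : RatFunc F}
    {b : Fin 3 → RatFunc F} (h : j a + ∑ i, j (b i) * z i = 0) : a = 0 ∧ ∀ i, b i = 0 := by
  have h2K : (2 : K) ≠ 0 := by
    have : (2 : K) = j (algebraMap F (RatFunc F) 2) := by rw [map_ofNat, map_ofNat]
    rw [this, Ne, map_eq_zero, map_eq_zero]; exact h2
  rw [Fin.sum_univ_three] at h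
  have hz2 := hz.mul 0 1 2 (by decide) (by decide) (by decide)
  have hf2 := map_ne_zero j (hf.isModel.ne_zero 2)
  have hf2' : ι (f 2) ≠ 0 := RatFunc.algebraMap_ne_zero (hf.isModel.ne_zero 2)
  set c := b 2 / ι (f 2) with hc
  have hb2 : j (b 2) = j c * j (ι (f 2)) := by rw [← map_mul, hc, div_mul_cancel₀ _ hf2']
  have h' : (j a + j (b 0) * z 0) + (j (b 1) + j c * z 0) * z 1 = 0 := by
    linear_combination h + j c * hz2 - z 2 * hb2
  have key : b 1 = 0 ∧ c = 0 := by
    by_contra hne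
    have hs0 := hz.sq 0
    have hs1 := hz.sq 1
    set m0 := ι (cofactor f 0) with hm0
    -- N is the norm of the coefficient of z 1; dividing by it rationalises the quotient.
    set N := b 1 ^ 2 - c ^ 2 * m0 with hN
    have hNne : N ≠ 0 := by
      intro h0
      have e : (j (b 1) + j c * z 0) * (j (b 1) + j (-c) * z 0) = 0 := by
        have : j N = 0 := by rw [h0, map_zero]
        rw [hN, map_sub, map_mul, map_pow, map_pow] at this
        rw [map_neg]
        linear_combination this - j c ^ 2 * hs0
      rcases mul_eq_zero.1 e with e | e
      · exact hne (hz.two_independent hf 0 e)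
      · have := hz.two_independent hf 0 e
        exact hne ⟨this.1, neg_eq_zero.1 this.2⟩
    set x := -(a * b 1 - b 0 * c * m0) / N with hx
    set y := -(b 0 * b 1 - a * c) / N with hy
    have hjN : j N ≠ 0 := by rwa [Ne, map_eq_zero]
    have hz1 : z 1 = j x + j y * z 0 := by
      have e1 : j x = -(j a * j (b 1) - j (b 0) * j c * j m0) / j N := by
        rw [hx]; simp [map_div₀]
      have e2 : j y = -(j (b 0) * j (b 1) - j a * j c) / j N := by
        rw [hy]; simp [map_div₀]
      have e3 : j N = j (b 1) ^ 2 - j c ^ 2 * j m0 := by rw [hN]; simp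
      rw [e1, e2, div_mul_eq_mul_div, ← add_div, eq_div_iff hjN, e3]
      linear_combination (j (b 1) - j c * z 0) * h' + (j c ^ 2 * z 1 + j c * j (b 0)) * hs0
    have h4 : j (x ^ 2 + y ^ 2 * m0 - ι (cofactor f 1)) + j (2 * x * y) * z 0 = 0 := by
      simp only [map_sub, map_add, map_mul, map_pow, map_ofNat]
      rw [← hs1, hz1]
      linear_combination (-(j y) ^ 2) * hs0
    have h5 := (hz.two_independent hf 0 h4).2
    have h2R : (2 : RatFunc F) ≠ 0 := by
      intro h0
      apply h2K
      rw [← map_ofNat j 2, h0, map_zero]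
    rcases mul_eq_zero.1 h5 with h6 | h6
    · have hx0 : x = 0 := (mul_eq_zero.1 h6).resolve_left h2R
      rw [hx0, map_zero, zero_add] at hz1
      refine hz.mul_mem (i := 0) (k := 1) (l := 2) (by decide) (by decide) (by decide) hf
        (r := y * m0) ?_
      rw [hz1, map_mul, ← hs0]; ring
    · rw [h6, map_zero, zero_mul, add_zero] at hz1
      exact hz.notMem_range hf 1 x hz1
  obtain ⟨hb1, hc0⟩ := key
  rw [hb1, hc0, map_zero, zero_mul, add_zero, zero_mul, add_zero] at h'
  obtain ⟨ha, hb0⟩ := hz.two_independent hf 0 h'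
  refine ⟨ha, fun i => ?_⟩
  fin_cases i
  · exact hb0
  · exact hb1
  · have : b 2 = c * ι (f 2) := by rw [hc, div_mul_cancel₀ _ hf2']
    simpa [hc0] using this

end IsFrame

/-- Linear combinations of `1` and a frame. -/
noncomputable def comb (j : RatFunc F →+* K) (z : Fin 3 → K) (a : RatFunc F) (b : Fin 3 → RatFunc F) : K :=
  j a + ∑ i, j (b i) * z i

/-- A frame spans the field. -/
def Spans (j : RatFunc F →+* K) (z : Fin 3 → K) : Prop := ∀ y, ∃ a b, y = comb j z a b

theorem IsFrame.comb_injective (h2 : (2 : F) ≠ 0) {j : RatFunc F →+* K} {f : Fin 3 → F[X]}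
    {z : Fin 3 → K} (hf : IsAdmissible f) (hz : IsFrame j f z) {a a' : RatFunc F}
    {b b' : Fin 3 → RatFunc F} (h : comb j z a b = comb j z a' b') : a = a' ∧ b = b' := by
  have h1 : j (a - a') + ∑ i, j (b i - b' i) * z i = 0 := by
    simp only [map_sub, sub_mul, Finset.sum_sub_distrib]
    unfold comb at h
    linear_combination h
  obtain ⟨h3, h4⟩ := hz.independent h2 hf h1
  exact ⟨sub_eq_zero.1 h3, funext fun i => sub_eq_zero.1 (h4 i)⟩

/-- The multiplication table involves only f. This is what makes frames over the same triple
interchangeable. -/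
theorem IsFrame.comb_mul {j : RatFunc F →+* K} {f : Fin 3 → F[X]} {z : Fin 3 → K}
    (hz : IsFrame j f z) (a a' : RatFunc F) (b b' : Fin 3 → RatFunc F) :
    comb j z a b * comb j z a' b' =
      comb j z (a * a' + ∑ i, b i * b' i * ι (cofactor f i))
        ![a * b' 0 + a' * b 0 + ι (f 0) * (b 1 * b' 2 + b 2 * b' 1),
          a * b' 1 + a' * b 1 + ι (f 1) * (b 0 * b' 2 + b 2 * b' 0),
          a * b' 2 + a' * b 2 + ι (f 2) * (b 0 * b' 1 + b 1 * b' 0)] := by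
  have s0 := hz.sq 0
  have s1 := hz.sq 1
  have s2 := hz.sq 2
  have m01 := hz.mul 0 1 2 (by decide) (by decide) (by decide)
  have m02 := hz.mul 0 2 1 (by decide) (by decide) (by decide)
  have m12 := hz.mul 1 2 0 (by decide) (by decide) (by decide)
  simp only [comb, Fin.sum_univ_three, map_add, map_mul, Matrix.cons_val_zero, Matrix.cons_val_one,
    Matrix.cons_val]
  linear_combination j (b 0) * j (b' 0) * s0 + j (b 1) * j (b' 1) * s1 + j (b 2) * j (b' 2) * s2 +
    (j (b 0) * j (b' 1) + j (b 1) * j (b' 0)) * m01 +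
    (j (b 0) * j (b' 2) + j (b 2) * j (b' 0)) * m02 +
    (j (b 1) * j (b' 2) + j (b 2) * j (b' 1)) * m12

theorem comb_zero (j : RatFunc F →+* K) (z : Fin 3 → K) (a : RatFunc F) : comb j z a 0 = j a := by
  simp [comb]

theorem comb_single (j : RatFunc F →+* K) (z : Fin 3 → K) (i : Fin 3) (b : RatFunc F) :
    comb j z 0 (Pi.single i b) = j b * z i := by
  unfold comb
  rw [Finset.sum_eq_single i]
  · simp
  · intro k _ hk; simp [Pi.single_eq_of_ne hk]
  · simp

theorem comb_add (j : RatFunc F →+* K) (z : Fin 3 → K) (a a' : RatFunc F)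
    (b b' : Fin 3 → RatFunc F) : comb j z a b + comb j z a' b' = comb j z (a + a') (b + b') := by
  simp only [comb, map_add, Pi.add_apply, add_mul, Finset.sum_add_distrib]; ring

/-- Frames over the same triple give a homomorphism. -/
theorem IsFrame.exists_lift (h2 : (2 : F) ≠ 0) {K' : Type*} [Field K'] {j : RatFunc F →+* K}
    {j' : RatFunc F →+* K'} {f : Fin 3 → F[X]} {z : Fin 3 → K} {z' : Fin 3 → K'}
    (hf : IsAdmissible f) (hz : IsFrame j f z) (hs : Spans j z) (hz' : IsFrame j' f z') :
    ∃ φ : K →+* K', (∀ r, φ (j r) = j' r) ∧ ∀ i, φ (z i) = z' i := by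
  choose A B hAB using hs
  -- The chosen coordinates are the only ones, by linear independence, so the map defined through
  -- them respects the field operations.
  have hφ : ∀ a b, comb j' z' (A (comb j z a b)) (B (comb j z a b)) = comb j' z' a b := by
    intro a b
    obtain ⟨h3, h4⟩ := hz.comb_injective h2 hf (hAB (comb j z a b))
    rw [← h3, ← h4]
  have hj : ∀ r, comb j' z' (A (j r)) (B (j r)) = j' r := fun r => by
    rw [← comb_zero j z r, hφ, comb_zero]
  refine ⟨{ toFun := fun y => comb j' z' (A y) (B y)
            map_one' := ?_, map_mul' := ?_, map_zero' := ?_, map_add' := ?_ }, hj, fun i => ?_⟩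
  · have := hj 1
    rwa [map_one, map_one] at this
  · intro x y
    have hxy : x * y = comb j z (A x) (B x) * comb j z (A y) (B y) := by rw [← hAB, ← hAB]
    change comb j' z' (A (x * y)) (B (x * y)) = _
    rw [hxy, hz.comb_mul, hφ, ← hz'.comb_mul]
  · have := hj 0
    rwa [map_zero, map_zero] at this
  · intro x y
    have hxy : x + y = comb j z (A x) (B x) + comb j z (A y) (B y) := by rw [← hAB, ← hAB]
    change comb j' z' (A (x + y)) (B (x + y)) = _
    rw [hxy, comb_add, hφ, ← comb_add]
  · change comb j' z' (A (z i)) (B (z i)) = z' i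
    have e : comb j z 0 (Pi.single i 1) = z i := by rw [comb_single, map_one, one_mul]
    rw [← e, hφ, comb_single, map_one, one_mul]

theorem Spans.hom_ext {K' : Type*} [Field K'] {j : RatFunc F →+* K} {z : Fin 3 → K}
    (hs : Spans j z) {φ ψ : K →+* K'} (h1 : ∀ r, φ (j r) = ψ (j r)) (h3 : ∀ i, φ (z i) = ψ (z i)) :
    φ = ψ := by
  ext y
  obtain ⟨a, b, rfl⟩ := hs y
  simp [comb, h1, h3]

/-- Elements with a square in the base field are multiples of an element of the frame. -/
theorem IsFrame.eq_mul_of_sq (h2 : (2 : F) ≠ 0) {j : RatFunc F →+* K} {f : Fin 3 → F[X]}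
    {z : Fin 3 → K} (hf : IsAdmissible f) (hz : IsFrame j f z) (hs : Spans j z) {y : K}
    (hy : ∀ r, y ≠ j r) {s : RatFunc F} (hys : y ^ 2 = j s) :
    ∃ i r, y = j r * z i := by
  obtain ⟨a, b, rfl⟩ := hs y
  have hsq : ∀ x : RatFunc F, ∀ i, ι (cofactor f i) ≠ x ^ 2 := by
    intro x i h
    have h1 : z i ^ 2 = (j x) ^ 2 := by rw [hz.sq, h, map_pow]
    rcases sq_eq_sq_iff_eq_or_eq_neg.1 h1 with h | h
    · exact hz.notMem_range hf i x h
    · exact hz.notMem_range hf i (-x) (by rw [h, map_neg])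
  have h2R : (2 : RatFunc F) ≠ 0 := by
    have : (2 : RatFunc F) = algebraMap F (RatFunc F) 2 := (map_ofNat _ 2).symm
    rw [this, Ne, map_eq_zero]; exact h2
  have hfi : ∀ i, ι (f i) ≠ 0 := fun i => RatFunc.algebraMap_ne_zero (hf.isModel.ne_zero i)
  rw [pow_two, hz.comb_mul, ← comb_zero j z s] at hys
  have hB := (hz.comb_injective h2 hf hys).2
  have e0 : a * b 0 + ι (f 0) * (b 1 * b 2) = 0 := by
    have := congrFun hB 0
    simp only [Matrix.cons_val_zero, Pi.zero_apply] at this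
    refine (mul_eq_zero.1 (?_ : (2 : RatFunc F) * _ = 0)).resolve_left h2R
    linear_combination this
  have e1 : a * b 1 + ι (f 1) * (b 0 * b 2) = 0 := by
    have := congrFun hB 1
    simp only [Matrix.cons_val_one, Matrix.cons_val_zero, Pi.zero_apply] at this
    refine (mul_eq_zero.1 (?_ : (2 : RatFunc F) * _ = 0)).resolve_left h2R
    linear_combination this
  have e2 : a * b 2 + ι (f 2) * (b 0 * b 1) = 0 := by
    have := congrFun hB 2
    simp only [Matrix.cons_val, Pi.zero_apply] at this
    refine (mul_eq_zero.1 (?_ : (2 : RatFunc F) * _ = 0)).resolve_left h2R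
    linear_combination this
  -- If a ≠ 0, two of the coefficient equations give f₁ b₀² = f₀ b₁², so f₀ f₁ would be a square
  -- unless all b i vanish, and then y would lie in the base field. Once a = 0, all products b i b k
  -- vanish and at most one b i is left.
  have ha : a = 0 := by
    by_contra ha
    have d01 : ι (f 1) * b 0 ^ 2 = ι (f 0) * b 1 ^ 2 := by
      apply mul_left_cancel₀ ha
      linear_combination (ι (f 1) * b 0) * e0 - (ι (f 0) * b 1) * e1
    have d02 : ι (f 2) * b 0 ^ 2 = ι (f 0) * b 2 ^ 2 := by
      apply mul_left_cancel₀ ha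
      linear_combination (ι (f 2) * b 0) * e0 - (ι (f 0) * b 2) * e2
    have hb0 : b 0 = 0 := by
      by_contra hb0
      have hb1 : b 1 ≠ 0 := by
        intro h
        rw [h, zero_pow two_ne_zero, mul_zero] at d01
        exact (mul_ne_zero (hfi 1) (pow_ne_zero 2 hb0)) d01
      refine hsq (ι (f 1) * b 0 / b 1) 2 ?_
      rw [cofactor_two, map_mul, div_pow, eq_div_iff (pow_ne_zero 2 hb1)]
      linear_combination (-ι (f 1)) * d01
    have hb1 : b 1 = 0 := by
      rw [hb0, zero_pow two_ne_zero, mul_zero] at d01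
      exact pow_eq_zero_iff (two_ne_zero) |>.1 ((mul_eq_zero.1 d01.symm).resolve_left (hfi 0))
    have hb2 : b 2 = 0 := by
      rw [hb0, zero_pow two_ne_zero, mul_zero] at d02
      exact pow_eq_zero_iff (two_ne_zero) |>.1 ((mul_eq_zero.1 d02.symm).resolve_left (hfi 0))
    refine hy a ?_
    simp [comb, Fin.sum_univ_three, hb0, hb1, hb2]
  subst ha
  simp only [zero_mul, zero_add, mul_eq_zero, hfi, false_or] at e0 e1 e2
  unfold comb
  rw [Fin.sum_univ_three, map_zero, zero_add]
  rcases e0 with h | h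
  · rcases e1 with h' | h'
    · exact ⟨2, b 2, by simp [h, h']⟩
    · exact ⟨0, b 0, by simp [h, h']⟩
  · rcases e2 with h' | h'
    · exact ⟨1, b 1, by simp [h, h']⟩
    · exact ⟨0, b 0, by simp [h, h']⟩

/-- Square roots of two squarefree polynomials are part of a frame. -/
theorem exists_frame_of_two {j : RatFunc F →+* K} {w₀ w₁ : K} {m₀ m₁ : F[X]}
    (hm₀ : Squarefree m₀) (hm₁ : Squarefree m₁) (hw₀ : w₀ ^ 2 = j (ι m₀))
    (hw₁ : w₁ ^ 2 = j (ι m₁)) :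
    ∃ f z, IsModel ∅ f ∧ IsFrame j f z ∧ z 0 = w₀ ∧ z 1 = w₁ ∧ cofactor f 0 = m₀ ∧
      cofactor f 1 = m₁ := by
  -- The common part d becomes the third component: m₀ = d f₁ and m₁ = d f₀.
  set d := EuclideanDomain.gcd m₀ m₁ with hd
  obtain ⟨f1, hf1⟩ : d ∣ m₀ := EuclideanDomain.gcd_dvd_left _ _
  obtain ⟨f0, hf0⟩ : d ∣ m₁ := EuclideanDomain.gcd_dvd_right _ _
  have hd0 : d ≠ 0 := by
    intro h; rw [h, zero_mul] at hf1; exact hm₀.ne_zero hf1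
  have hcop : IsCoprime f0 f1 := by
    have h := EuclideanDomain.gcd_eq_gcd_ab m₀ m₁
    rw [← hd] at h
    refine ⟨EuclideanDomain.gcdB m₀ m₁, EuclideanDomain.gcdA m₀ m₁, ?_⟩
    apply mul_left_cancel₀ hd0
    linear_combination EuclideanDomain.gcdA m₀ m₁ * (-hf1) +
      EuclideanDomain.gcdB m₀ m₁ * (-hf0) - h
  have hc1 : IsCoprime d f1 := IsRelPrime.isCoprime (squarefree_mul_iff.1 (hf1 ▸ hm₀)).1
  have hc0 : IsCoprime d f0 := IsRelPrime.isCoprime (squarefree_mul_iff.1 (hf0 ▸ hm₁)).1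
  have hsd : Squarefree d := hm₀.squarefree_of_dvd ⟨_, hf1⟩
  have hs0 : Squarefree f0 := hm₁.squarefree_of_dvd ⟨_, hf0.trans (mul_comm _ _)⟩
  have hs1 : Squarefree f1 := hm₀.squarefree_of_dvd ⟨_, hf1.trans (mul_comm _ _)⟩
  set f : Fin 3 → F[X] := ![f0, f1, d] with hf
  have hmodel : IsModel ∅ f := by
    refine ⟨fun i => ?_, fun i k hik => ?_, by simp⟩
    · fin_cases i
      · exact hs0
      · exact hs1
      · exact hsd
    · fin_cases i <;> fin_cases k <;>
        first
          | exact absurd rfl hik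
          | exact hcop
          | exact hcop.symm
          | exact hc0
          | exact hc0.symm
          | exact hc1
          | exact hc1.symm
  have e0 : cofactor f 0 = m₀ := by rw [cofactor_zero, hf1]; simp [hf, mul_comm]
  have e1 : cofactor f 1 = m₁ := by rw [cofactor_one, hf0]; simp [hf, mul_comm]
  have hjd := IsFrame.map_ne_zero j hd0
  refine ⟨f, ![w₀, w₁, w₀ * w₁ / j (ι d)], hmodel, isFrame_of_mul hmodel.ne_zero ?_ ?_ ?_, rfl, rfl,
    e0, e1⟩
  · rw [e0]; exact hw₀
  · rw [e1]; exact hw₁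
  · simp only [Matrix.cons_val_zero, Matrix.cons_val_one, Matrix.cons_val, hf]
    field_simp

/-- Three square roots whose product lies in the base field give a frame. -/
theorem exists_frame {j : RatFunc F →+* K} {w : Fin 3 → K} {m : Fin 3 → F[X]}
    (hm : ∀ i, Squarefree (m i)) (hdeg : ∀ i, 0 < (m i).natDegree)
    (hw : ∀ i, w i ^ 2 = j (ι (m i))) {s : RatFunc F} (hs : w 0 * w 1 * w 2 = j s) :
    ∃ f z, IsAdmissible f ∧ IsFrame j f z ∧ ∀ i, (cofactor f i).natDegree = (m i).natDegree := by
  obtain ⟨f, z, hf, hz, h0, h1, e0, e1⟩ := exists_frame_of_two (hm 0) (hm 1) (hw 0) (hw 1)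
  have hm2 := IsFrame.map_ne_zero j (hm 2).ne_zero
  have hf2 := IsFrame.map_ne_zero j (hf.ne_zero 2)
  -- Both z 2 and w 2 agree with z 0 z 1 up to factors from the base field, so their squares, being
  -- squarefree, differ by a constant and have the same degree.
  have h2 : z 2 = j (s / (ι (f 2) * ι (m 2))) * w 2 := by
    have := hz.mul 0 1 2 (by decide) (by decide) (by decide)
    rw [h0, h1] at this
    rw [map_div₀, map_mul, div_mul_eq_mul_div, eq_div_iff (mul_ne_zero hf2 hm2), ← hs, ← hw 2]
    linear_combination (-(w 2) ^ 2) * this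
  obtain ⟨c, hc, e2⟩ := eq_C_mul_of_squarefree (r := s / (ι (f 2) * ι (m 2))) (hm 2)
    (hf.squarefree_cofactor 2) (j.injective (by rw [← hz.sq 2, h2, map_mul, map_pow, mul_pow, hw 2]))
  have hdegs : ∀ i, (cofactor f i).natDegree = (m i).natDegree := by
    rw [forall_fin_three]
    exact ⟨by rw [e0], by rw [e1], by rw [e2, natDegree_C_mul hc]⟩
  exact ⟨f, z, ⟨hf, fun i => by rw [hdegs]; exact hdeg i⟩, hz, hdegs⟩

end Frames

/-! ### Rational functions integral over F[X], F[X⁻¹] and F[X, X⁻¹]. -/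

section GenusFormula

variable {F : Type*} [Field F]

local notation "ι" => algebraMap F[X] (RatFunc F)

/-- Otherwise the square of a nonconstant denominator would divide the squarefree m. -/
theorem exists_polynomial_of_sq_mul {m p : F[X]} (hm : Squarefree m) {b : RatFunc F}
    (h : b ^ 2 * ι m = ι p) : ∃ p', b = ι p' := by
  have hd : ι b.denom ≠ 0 := RatFunc.algebraMap_ne_zero b.denom_ne_zero
  have hr : b * ι b.denom = ι b.num := by
    nth_rw 1 [← RatFunc.num_div_denom b]
    rw [div_mul_cancel₀ _ hd]
  have h1 : p * b.denom ^ 2 = b.num ^ 2 * m := by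
    apply algebraMap_polynomial_injective (F := F)
    rw [map_mul, map_mul, map_pow, map_pow, ← h, ← hr]; ring
  have hcop := RatFunc.isCoprime_num_denom b
  have hden : IsUnit b.denom := hm _ (by
    rw [← pow_two]
    exact (hcop.symm.pow (m := 2) (n := 2)).dvd_of_dvd_mul_left (Dvd.intro_left _ h1))
  obtain ⟨c, hc⟩ := hden.exists_right_inv
  refine ⟨b.num * c, ?_⟩
  rw [map_mul, ← hr, mul_assoc, ← map_mul, hc, map_one, mul_one]

theorem ratFunc_X_eq : (RatFunc.X : RatFunc F) = ι X := RatFunc.algebraMap_X.symm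

theorem isIntegral_adjoin_X {r : RatFunc F}
    (h : IsIntegral (Algebra.adjoin F {(RatFunc.X : RatFunc F)}) r) : ∃ p, r = ι p := by
  have hle : ∀ x : Algebra.adjoin F {(RatFunc.X : RatFunc F)}, ∃ p, ι p = x := by
    rintro ⟨x, hx⟩
    induction hx using Algebra.adjoin_induction with
    | mem x hx =>
      have hx' : x = RatFunc.X := hx
      exact ⟨X, RatFunc.algebraMap_X.trans hx'.symm⟩
    | algebraMap c => exact ⟨C c, algebraMap_C_eq c⟩
    | add x y _ _ hx hy =>
      obtain ⟨p, hp⟩ := hx; obtain ⟨p', hp'⟩ := hy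
      exact ⟨p + p', by simp only [map_add] at hp hp' ⊢; rw [hp, hp']⟩
    | mul x y _ _ hx hy =>
      obtain ⟨p, hp⟩ := hx; obtain ⟨p', hp'⟩ := hy
      exact ⟨p * p', by simp only [map_mul] at hp hp' ⊢; rw [hp, hp']⟩
  choose g hg using hle
  have hι := algebraMap_polynomial_injective (F := F)
  let φ : Algebra.adjoin F {(RatFunc.X : RatFunc F)} →+* F[X] :=
    { toFun := g
      map_one' := hι (by rw [hg]; simp)
      map_mul' := fun x y => hι (by rw [map_mul, hg, hg, hg]; rfl)
      map_zero' := hι (by rw [hg]; simp)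
      map_add' := fun x y => hι (by rw [map_add, hg, hg, hg]; rfl) }
  have h1 : IsIntegral F[X] r := by
    refine IsIntegral.map_of_comp_eq φ (RingHom.id _) ?_ h
    ext x
    exact hg x
  obtain ⟨p, hp⟩ := IsIntegrallyClosed.isIntegral_iff.1 h1
  exact ⟨p, hp.symm⟩

theorem adjoin_X_X_inv {x : RatFunc F}
    (hx : x ∈ Algebra.adjoin F {(RatFunc.X : RatFunc F), RatFunc.X⁻¹}) :
    ∃ n p, RatFunc.X ^ n * x = ι p := by
  have hX : (RatFunc.X : RatFunc F) ≠ 0 := RatFunc.X_ne_zero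
  induction hx using Algebra.adjoin_induction with
  | mem x hx =>
    rcases hx with rfl | hx
    · exact ⟨0, X, by rw [pow_zero, one_mul, ratFunc_X_eq]⟩
    · refine ⟨1, 1, ?_⟩
      rw [Set.mem_singleton_iff.1 hx, pow_one, mul_inv_cancel₀ hX, map_one]
  | algebraMap c => exact ⟨0, C c, by rw [pow_zero, one_mul, algebraMap_C_eq]⟩
  | add x y _ _ hx hy =>
    obtain ⟨n, p, hp⟩ := hx; obtain ⟨n', p', hp'⟩ := hy
    refine ⟨n + n', X ^ n' * p + X ^ n * p', ?_⟩
    rw [map_add, map_mul, map_mul, map_pow, map_pow, ← ratFunc_X_eq, ← hp, ← hp']; ring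
  | mul x y _ _ hx hy =>
    obtain ⟨n, p, hp⟩ := hx; obtain ⟨n', p', hp'⟩ := hy
    refine ⟨n + n', p * p', ?_⟩
    rw [map_mul, ← hp, ← hp']; ring

/-- Clearing denominators turns the integral equation into one over F[X] with leading coefficient
X^M. By the rational root theorem the denominator of r divides X^M. -/
theorem isIntegral_adjoin_X_X_inv {r : RatFunc F}
    (h : IsIntegral (Algebra.adjoin F {(RatFunc.X : RatFunc F), RatFunc.X⁻¹}) r) :
    ∃ n p, RatFunc.X ^ n * r = ι p := by
  obtain ⟨P, hP, hr⟩ := h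
  choose N G hG using fun i => adjoin_X_X_inv (P.coeff i).2
  set M := ∑ i ∈ range (P.natDegree + 1), N i with hM
  have hle : ∀ i ∈ range (P.natDegree + 1), N i ≤ M := fun i hi =>
    Finset.single_le_sum (f := N) (fun _ _ => Nat.zero_le _) hi
  set Q : F[X][X] := ∑ i ∈ range (P.natDegree + 1), monomial i (X ^ (M - N i) * G i) with hQ
  have hcoeff : ∀ i ∈ range (P.natDegree + 1),
      ι (X ^ (M - N i) * G i) = RatFunc.X ^ M * (P.coeff i : RatFunc F) := by
    intro i hi
    rw [map_mul, ← hG i, map_pow, ← ratFunc_X_eq, ← mul_assoc, ← pow_add,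
      Nat.sub_add_cancel (hle i hi)]
  have hroot : aeval r Q = 0 := by
    rw [hQ, map_sum]
    rw [eval₂_eq_sum_range] at hr
    rw [← mul_zero (RatFunc.X ^ M), ← hr, Finset.mul_sum]
    refine Finset.sum_congr rfl fun i hi => ?_
    rw [aeval_monomial, hcoeff i hi, mul_assoc]; rfl
  have hQc : ∀ i, Q.coeff i = if i ∈ range (P.natDegree + 1) then X ^ (M - N i) * G i else 0 := by
    intro i
    simp only [hQ, finsetSum_coeff, coeff_monomial]
    rw [Finset.sum_ite_eq']
  have hlead : Q.coeff P.natDegree = X ^ M := by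
    apply algebraMap_polynomial_injective (F := F)
    rw [hQc, if_pos (by simp), hcoeff _ (by simp), hP.coeff_natDegree, map_pow, ← ratFunc_X_eq]
    simp
  have hdeg : Q.natDegree = P.natDegree := by
    refine le_antisymm (natDegree_le_iff_coeff_eq_zero.2 fun i hi => ?_)
      (le_natDegree_of_ne_zero ?_)
    · rw [hQc, if_neg (by simp; omega)]
    · rw [hlead]; exact pow_ne_zero _ X_ne_zero
  have h1 := den_dvd_of_is_root hroot
  rw [leadingCoeff, hdeg, hlead] at h1
  obtain ⟨c, hc⟩ := h1
  refine ⟨M, IsFractionRing.num F[X] r * c, ?_⟩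
  have h2 := IsFractionRing.mk'_num_den' F[X] r
  have h3 : ι (IsFractionRing.den F[X] r) ≠ 0 :=
    RatFunc.algebraMap_ne_zero (nonZeroDivisors.coe_ne_zero _)
  rw [div_eq_iff h3] at h2
  rw [map_mul, h2, ratFunc_X_eq, ← map_pow, hc, map_mul]; ring

/-- F[X⁻¹] lies in the valuation ring at infinity, which is integrally closed. -/
theorem isIntegral_adjoin_X_inv {r : RatFunc F}
    (h : IsIntegral (Algebra.adjoin F {(RatFunc.X : RatFunc F)⁻¹}) r) :
    RatFunc.inftyValuation F r ≤ 1 := by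
  set O := (RatFunc.inftyValuation F).valuationSubring
  have hle : ∀ x : Algebra.adjoin F {(RatFunc.X : RatFunc F)⁻¹}, (x : RatFunc F) ∈ O := by
    rintro ⟨x, hx⟩
    change x ∈ O
    induction hx using Algebra.adjoin_induction with
    | mem x hx =>
      rw [Set.mem_singleton_iff.1 hx, Valuation.mem_valuationSubring_iff, map_inv₀,
        RatFunc.inftyValuation.X]
      rw [← WithZero.exp_neg, ← WithZero.exp_zero, WithZero.exp_le_exp]
      norm_num
    | algebraMap c =>
      rw [Valuation.mem_valuationSubring_iff]
      by_cases hc : c = 0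
      · simp [hc]
      · exact (RatFunc.inftyValuation.C F hc).le
    | add x y _ _ hx hy => exact O.add_mem _ _ hx hy
    | mul x y _ _ hx hy => exact O.mul_mem _ _ hx hy
  have h1 : IsIntegral O r := by
    refine IsIntegral.map_of_comp_eq
      ((algebraMap (Algebra.adjoin F {(RatFunc.X : RatFunc F)⁻¹}) (RatFunc F)).codRestrict
        O.toSubring hle) (RingHom.id _) ?_ h
    ext x; rfl
  obtain ⟨y, hy⟩ := IsIntegrallyClosed.isIntegral_iff.1 h1
  rw [← Valuation.mem_valuationSubring_iff, ← hy]
  exact y.2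

theorem inftyValuation_le_one_iff {p : F[X]} (hp : p ≠ 0) (n : ℕ) {r : RatFunc F}
    (h : RatFunc.X ^ n * r = ι p) :
    RatFunc.inftyValuation F r ≤ 1 ↔ p.natDegree ≤ n := by
  have hX : (RatFunc.X : RatFunc F) ≠ 0 := RatFunc.X_ne_zero
  have hr : r ≠ 0 := by
    rintro rfl
    rw [mul_zero] at h
    exact RatFunc.algebraMap_ne_zero hp h.symm
  have h1 := congrArg RatFunc.intDegree h
  have h2 : RatFunc.intDegree ((RatFunc.X : RatFunc F) ^ n) = n := by
    rw [ratFunc_X_eq, ← map_pow, RatFunc.intDegree_polynomial, natDegree_X_pow]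
  rw [RatFunc.intDegree_mul (pow_ne_zero n hX) hr, h2, RatFunc.intDegree_polynomial] at h1
  rw [RatFunc.inftyValuation_apply, RatFunc.inftyValuation_of_nonzero F hr, ← WithZero.exp_zero,
    WithZero.exp_le_exp]
  omega

theorem mem_adjoin_X_inv {p : F[X]} {n : ℕ} (hp : p.natDegree ≤ n) {r : RatFunc F}
    (h : RatFunc.X ^ n * r = ι p) : r ∈ Algebra.adjoin F {(RatFunc.X : RatFunc F)⁻¹} := by
  have hX : (RatFunc.X : RatFunc F) ≠ 0 := RatFunc.X_ne_zero
  have h1 : r = ∑ i ∈ range (n + 1), algebraMap F (RatFunc F) (p.coeff i) * RatFunc.X⁻¹ ^ (n - i) := by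
    apply mul_left_cancel₀ (pow_ne_zero n hX)
    rw [h, Finset.mul_sum]
    conv_lhs => rw [p.as_sum_range' (n + 1) (Nat.lt_succ_of_le hp)]
    rw [map_sum]
    refine Finset.sum_congr rfl fun i hi => ?_
    rw [← C_mul_X_pow_eq_monomial, map_mul, map_pow, algebraMap_C_eq, ← ratFunc_X_eq]
    have hi' : i ≤ n := Nat.lt_succ_iff.1 (Finset.mem_range.1 hi)
    have e : RatFunc.X ^ n = RatFunc.X ^ i * (RatFunc.X : RatFunc F) ^ (n - i) := by
      rw [← pow_add, Nat.add_sub_cancel' hi']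
    rw [e, inv_pow, mul_comm (algebraMap F (RatFunc F) _) (_ ^ _)⁻¹, ← mul_assoc,
      mul_assoc (_ ^ i), mul_inv_cancel₀ (pow_ne_zero _ hX), mul_one, mul_comm]
  have h2 : (RatFunc.X : RatFunc F)⁻¹ ∈ Algebra.adjoin F {(RatFunc.X : RatFunc F)⁻¹} :=
    Algebra.subset_adjoin (Set.mem_singleton _)
  rw [h1]
  exact sum_mem fun i _ => mul_mem (Subalgebra.algebraMap_mem _ _) (pow_mem h2 _)

end GenusFormula

/-! ### Integrality in a quadratic extension. -/

section GenusOfQuadratic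

variable {F : Type u} [Field F] {E : Type u} [Field E] [Algebra F E] [Algebra (RatFunc F) E]
  [IsScalarTower F (RatFunc F) E]

local notation "ι" => algebraMap F[X] (RatFunc F)
local notation "A" => algebraMap (RatFunc F) E

theorem mem_integralOver_image (S : Set (RatFunc F)) (y : E) :
    y ∈ BiquadraticCurve.integralOver F E (A '' S) ↔ IsIntegral (Algebra.adjoin F S) y := by
  have hmap : Algebra.adjoin F (A '' S) =
      (Algebra.adjoin F S).map (IsScalarTower.toAlgHom F (RatFunc F) E) := by
    rw [AlgHom.map_adjoin]; rfl
  have hinj : Function.Injective (IsScalarTower.toAlgHom F (RatFunc F) E) :=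
    (algebraMap (RatFunc F) E).injective
  have e1 : y ∈ BiquadraticCurve.integralOver F E (A '' S) ↔
      IsIntegral (Algebra.adjoin F (A '' S)) y := Iff.rfl
  rw [e1, hmap]
  set e := (Algebra.adjoin F S).equivMapOfInjective (IsScalarTower.toAlgHom F (RatFunc F) E) hinj
  constructor
  · intro h
    refine IsIntegral.map_of_comp_eq e.symm.toRingHom (RingHom.id _) ?_ h
    ext x
    obtain ⟨x, rfl⟩ := e.surjective x
    change A (e.symm (e x) : RatFunc F) = (e x : E)
    rw [e.symm_apply_apply]; rfl
  · intro h
    refine IsIntegral.map_of_comp_eq e.toRingHom (RingHom.id _) ?_ h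
    ext x
    rfl

theorem exists_conj {m : RatFunc F} {z : E} (hz : z ^ 2 = A m) (hzA : ∀ r, z ≠ A r)
    (hs : ∀ y, ∃ a b, y = A a + A b * z) : ∃ σ : E →ₐ[RatFunc F] E, σ z = -z := by
  have huniq : ∀ a b a' b', A a + A b * z = A a' + A b' * z → a = a' ∧ b = b' := by
    intro a b a' b' h
    have hb : b = b' := by
      by_contra hb
      have hb' : A (b - b') ≠ 0 := by rw [Ne, map_eq_zero]; exact sub_ne_zero.2 hb
      refine hzA ((a' - a) / (b - b')) ?_
      rw [map_div₀, eq_div_iff hb', map_sub, map_sub]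
      linear_combination h
    subst hb
    exact ⟨(algebraMap (RatFunc F) E).injective (add_right_cancel h), rfl⟩
  choose a b hab using hs
  have hu : ∀ y c d, y = A c + A d * z → a y = c ∧ b y = d := fun y c d h =>
    huniq _ _ _ _ ((hab y).symm.trans h)
  have hA : ∀ r, a (A r) = r ∧ b (A r) = 0 := fun r => hu _ _ _ (by simp)
  refine ⟨{ toFun := fun y => A (a y) - A (b y) * z
            map_one' := ?_, map_mul' := fun x y => ?_, map_zero' := ?_, map_add' := fun x y => ?_
            commutes' := fun r => ?_ }, ?_⟩
  · obtain ⟨h1, h2⟩ := hA 1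
    rw [map_one] at h1 h2
    simp [h1, h2]
  · obtain ⟨h1, h2⟩ := hu (x * y) (a x * a y + b x * b y * m) (a x * b y + b x * a y) (by
      conv_lhs => rw [hab x, hab y]
      simp only [map_add, map_mul]
      linear_combination A (b x) * A (b y) * hz)
    simp only [h1, h2, map_add, map_mul]
    linear_combination (- A (b x) * A (b y)) * hz
  · obtain ⟨h1, h2⟩ := hA 0
    rw [map_zero] at h1 h2
    simp [h1, h2]
  · obtain ⟨h1, h2⟩ := hu (x + y) (a x + a y) (b x + b y) (by
      conv_lhs => rw [hab x, hab y]
      simp only [map_add]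
      ring)
    simp only [h1, h2, map_add]
    ring
  · obtain ⟨h1, h2⟩ := hA r
    simp [h1, h2]
  · obtain ⟨h1, h2⟩ := hu z 0 1 (by simp)
    change A (a z) - A (b z) * z = -z
    rw [h1, h2]; simp

/-- The conjugate a − b z is integral as well. Half of the trace is a, and subtracting the norm from
a² leaves b² m. -/
theorem isIntegral_iff_of_conj (h2 : (2 : F) ≠ 0) {m : RatFunc F} {z : E} (hz : z ^ 2 = A m)
    {σ : E →ₐ[RatFunc F] E} (hσ : σ z = -z) (S : Set (RatFunc F)) (a b : RatFunc F) :
    IsIntegral (Algebra.adjoin F S) (A a + A b * z) ↔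
      IsIntegral (Algebra.adjoin F S) a ∧ IsIntegral (Algebra.adjoin F S) (b ^ 2 * m) := by
  set R := Algebra.adjoin F S
  have hinj : Function.Injective (IsScalarTower.toAlgHom R (RatFunc F) E) :=
    (algebraMap (RatFunc F) E).injective
  have hdown : ∀ r : RatFunc F, IsIntegral R (A r) ↔ IsIntegral R r := fun r =>
    isIntegral_algHom_iff (IsScalarTower.toAlgHom R (RatFunc F) E) hinj
  constructor
  · intro h
    have h' : IsIntegral R (A a - A b * z) := by
      have := h.map (σ.restrictScalars R)
      simpa [hσ, sub_eq_add_neg] using this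
    have ha : IsIntegral R a := by
      have h1 : IsIntegral R (2 * a) := by
        rw [← hdown]
        have := h.add h'
        rw [map_mul, map_ofNat]
        convert! this using 1
        ring
      have h3 : IsIntegral R (algebraMap F (RatFunc F) 2⁻¹) :=
        isIntegral_algebraMap (x := algebraMap F R 2⁻¹)
      have h4 := h3.mul h1
      rwa [← mul_assoc, ← map_ofNat (algebraMap F (RatFunc F)) 2, ← map_mul, inv_mul_cancel₀ h2,
        map_one, one_mul] at h4
    refine ⟨ha, ?_⟩
    have h5 : IsIntegral R (a ^ 2 - b ^ 2 * m) := by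
      rw [← hdown]
      have := h.mul h'
      convert! this using 1
      simp only [map_sub, map_mul, map_pow]
      linear_combination A b ^ 2 * hz
    have := (ha.pow 2).sub h5
    rwa [sub_sub_cancel] at this
  · rintro ⟨ha, hb⟩
    refine ((hdown a).2 ha).add (IsIntegral.of_pow (n := 2) two_pos ?_)
    rw [mul_pow, hz, ← map_pow, ← map_mul]
    exact (hdown _).2 hb

end GenusOfQuadratic

/-! ### The genus of a quadratic cover of the line. -/

section GenusOfQuadratic

variable {F : Type u} [Field F] {E : Type u} [Field E] [Algebra F E] [Algebra (RatFunc F) E]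
  [IsScalarTower F (RatFunc F) E]

local notation "ι" => algebraMap F[X] (RatFunc F)
local notation "A" => algebraMap (RatFunc F) E

theorem natDegree_mod_X_pow (p : F[X]) (n : ℕ) : p % X ^ n = 0 ∨ (p % X ^ n).natDegree < n := by
  by_cases h : p % X ^ n = 0
  · exact Or.inl h
  · refine Or.inr ((natDegree_lt_iff_degree_lt h).2 ?_)
    have := EuclideanDomain.mod_lt p (pow_ne_zero n (X_ne_zero (R := F)))
    rwa [← degree_X_pow (R := F) n]

/-- Decomposition of a Laurent polynomial into a polynomial, a middle part and a part of small
degree. -/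
theorem exists_laurent_decomposition {r : RatFunc F} {n : ℕ} {p : F[X]}
    (h : RatFunc.X ^ n * r = ι p) (e : ℕ) :
    ∃ (a b c : F[X]) (s : RatFunc F) (n' : ℕ), r = ι a + ι b * (RatFunc.X ^ e)⁻¹ + s ∧
      b ∈ degreeLT F e ∧ RatFunc.X ^ n' * s = ι c ∧ (c = 0 ∨ c.natDegree + (e + 1) ≤ n') := by
  have hX : ∀ k, (RatFunc.X : RatFunc F) ^ k ≠ 0 := fun k => pow_ne_zero k RatFunc.X_ne_zero
  -- Dividing Xᵉ p by Xⁿ cuts the expansion of r below X^{−e}; dividing the quotient by Xᵉ cuts it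
  -- at X⁰.
  set p' := X ^ e * p with hp'
  set Q := p' / X ^ n with hQ
  refine ⟨Q / X ^ e, Q % X ^ e, p' % X ^ n, (RatFunc.X ^ (n + e))⁻¹ * ι (p' % X ^ n), n + e, ?_, ?_,
    ?_, ?_⟩
  · apply mul_left_cancel₀ (hX (n + e))
    have e1 : RatFunc.X ^ (n + e) * r = ι p' := by
      rw [hp', map_mul, ← h, map_pow, ← ratFunc_X_eq]; ring
    have e2 : RatFunc.X ^ n * ι Q + ι (p' % X ^ n) = ι p' := by
      rw [ratFunc_X_eq, ← map_pow, ← map_mul, ← map_add, EuclideanDomain.div_add_mod]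
    have e3 : RatFunc.X ^ e * ι (Q / X ^ e) + ι (Q % X ^ e) = ι Q := by
      rw [ratFunc_X_eq, ← map_pow, ← map_mul, ← map_add, EuclideanDomain.div_add_mod]
    have e4 := mul_inv_cancel₀ (hX e)
    have e5 := mul_inv_cancel_left₀ (hX (n + e)) (ι (p' % X ^ n))
    rw [e1, ← e2, ← e3, mul_add (_ ^ (n + e)), e5, pow_add]
    linear_combination (-(RatFunc.X ^ n * ι (Q % X ^ e))) * e4
  · rw [mem_degreeLT]
    rw [← degree_X_pow (R := F) e]
    exact EuclideanDomain.mod_lt Q (pow_ne_zero e (X_ne_zero (R := F)))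
  · rw [mul_inv_cancel_left₀ (hX _)]
  · refine (natDegree_mod_X_pow p' n).imp_right fun h => ?_
    omega

theorem mem_adjoin_of_X_pow_mul {r : RatFunc F} {n : ℕ} {p : F[X]} (h : RatFunc.X ^ n * r = ι p) :
    r ∈ Algebra.adjoin F {(RatFunc.X : RatFunc F), RatFunc.X⁻¹} := by
  have hX : (RatFunc.X : RatFunc F) ^ n ≠ 0 := pow_ne_zero n RatFunc.X_ne_zero
  have h1 : (RatFunc.X : RatFunc F) ∈ Algebra.adjoin F {(RatFunc.X : RatFunc F), RatFunc.X⁻¹} :=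
    Algebra.subset_adjoin (Set.mem_insert _ _)
  have h2 : (RatFunc.X : RatFunc F)⁻¹ ∈ Algebra.adjoin F {(RatFunc.X : RatFunc F), RatFunc.X⁻¹} :=
    Algebra.subset_adjoin (Set.mem_insert_of_mem _ (Set.mem_singleton _))
  have h3 : ι p = aeval (RatFunc.X : RatFunc F) p := by
    rw [ratFunc_X_eq, aeval_algebraMap_apply, aeval_X_left_apply]
  have h4 : r = RatFunc.X⁻¹ ^ n * ι p := by rw [← h, inv_pow, inv_mul_cancel_left₀ hX]
  rw [h4, h3]
  refine mul_mem (pow_mem h2 n) ?_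
  have := aeval_mem_adjoin_singleton F (RatFunc.X : RatFunc F) (p := p)
  exact Algebra.adjoin_mono (Set.singleton_subset_iff.2 (Set.mem_insert _ _)) this

theorem isIntegral_of_mem {R : Subalgebra F (RatFunc F)} {r : RatFunc F} (h : r ∈ R) :
    IsIntegral R r := isIntegral_algebraMap (R := R) (x := ⟨r, h⟩)

theorem algebraMap_mem_adjoin_X (p : F[X]) : ι p ∈ Algebra.adjoin F {(RatFunc.X : RatFunc F)} := by
  have h3 : ι p = aeval (RatFunc.X : RatFunc F) p := by
    rw [ratFunc_X_eq, aeval_algebraMap_apply, aeval_X_left_apply]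
  rw [h3]
  exact aeval_mem_adjoin_singleton F _

/-- The genus of the curve `z² = m`. -/
theorem genus_eq_of_sq (h2 : (2 : F) ≠ 0) {m : F[X]} (hm : Squarefree m) (hdeg : 0 < m.natDegree)
    {z : E} (hz : z ^ 2 = A (ι m)) (hs : ∀ y, ∃ a b, y = A a + A b * z) :
    BiquadraticCurve.genus F E = (m.natDegree + 1) / 2 - 1 := by
  have hX : ∀ k, (RatFunc.X : RatFunc F) ^ k ≠ 0 := fun k => pow_ne_zero k RatFunc.X_ne_zero
  have hAi := (algebraMap (RatFunc F) E).injective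
  have hι := algebraMap_polynomial_injective (F := F)
  have hzA : ∀ r, z ≠ A r := by
    intro r h
    have h1 : ι m = r ^ 2 * ι 1 := hAi (by rw [← hz, h, map_one, mul_one, map_pow])
    obtain ⟨c, hc, h3⟩ := eq_C_mul_of_squarefree squarefree_one hm h1
    rw [h3, mul_one, natDegree_C] at hdeg
    exact absurd hdeg (lt_irrefl _)
  obtain ⟨σ, hσ⟩ := exists_conj hz hzA hs
  set e := (m.natDegree + 1) / 2 with he
  have hb : ∀ {b b' a a' : RatFunc F}, A a + A b * z = A a' + A b' * z → b = b' := by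
    intro b b' a a' h
    by_contra hb
    have hb' : A (b - b') ≠ 0 := by rw [Ne, map_eq_zero]; exact sub_ne_zero.2 hb
    refine hzA ((a' - a) / (b - b')) ?_
    rw [map_div₀, eq_div_iff hb', map_sub, map_sub]
    linear_combination h
  have hc : BiquadraticCurve.coord F E = A RatFunc.X := rfl
  set V₁ := BiquadraticCurve.integralOver F E {BiquadraticCurve.coord F E} with hV₁
  set V₂ := BiquadraticCurve.integralOver F E {(BiquadraticCurve.coord F E)⁻¹} with hV₂
  set V := BiquadraticCurve.integralOver F E
    {BiquadraticCurve.coord F E, (BiquadraticCurve.coord F E)⁻¹} with hV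
  have mem₁ : ∀ a b, A a + A b * z ∈ V₁ ↔
      IsIntegral (Algebra.adjoin F {(RatFunc.X : RatFunc F)}) a ∧
      IsIntegral (Algebra.adjoin F {(RatFunc.X : RatFunc F)}) (b ^ 2 * ι m) := fun a b => by
    rw [← isIntegral_iff_of_conj h2 hz hσ, ← mem_integralOver_image, Set.image_singleton]
    rfl
  have mem₂ : ∀ a b, A a + A b * z ∈ V₂ ↔
      IsIntegral (Algebra.adjoin F {(RatFunc.X : RatFunc F)⁻¹}) a ∧
      IsIntegral (Algebra.adjoin F {(RatFunc.X : RatFunc F)⁻¹}) (b ^ 2 * ι m) := fun a b => by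
    rw [← isIntegral_iff_of_conj h2 hz hσ, ← mem_integralOver_image, Set.image_singleton, map_inv₀]
    rfl
  have mem : ∀ a b, A a + A b * z ∈ V ↔
      IsIntegral (Algebra.adjoin F {(RatFunc.X : RatFunc F), RatFunc.X⁻¹}) a ∧
      IsIntegral (Algebra.adjoin F {(RatFunc.X : RatFunc F), RatFunc.X⁻¹}) (b ^ 2 * ι m) :=
    fun a b => by
      rw [← isIntegral_iff_of_conj h2 hz hσ, ← mem_integralOver_image, Set.image_pair, map_inv₀]
      rfl
  -- sufficient and necessary conditions on the coefficients
  have mem₁_of : ∀ a b : F[X], A (ι a) + A (ι b) * z ∈ V₁ := fun a b => by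
    rw [mem₁, ← map_pow, ← map_mul]
    exact ⟨isIntegral_of_mem (algebraMap_mem_adjoin_X _), isIntegral_of_mem (algebraMap_mem_adjoin_X _)⟩
  -- At infinity b z is integral as soon as 2 deg b + deg m ≤ 0, which for integers means deg b ≤
  -- −e.
  have mem₂_of : ∀ {a b : RatFunc F} {n n' : ℕ} {p p' : F[X]}, RatFunc.X ^ n * a = ι p →
      RatFunc.X ^ n' * b = ι p' → (p = 0 ∨ p.natDegree + 1 ≤ n) → (p' = 0 ∨ p'.natDegree + e ≤ n') →
      A a + A b * z ∈ V₂ := by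
    intro a b n n' p p' ha hb h1 h3
    rw [mem₂]
    constructor
    · refine isIntegral_of_mem (mem_adjoin_X_inv (n := n) (p := p) ?_ ha)
      rcases h1 with rfl | h1
      · simp
      · omega
    · refine isIntegral_of_mem (mem_adjoin_X_inv (n := 2 * n') (p := p' ^ 2 * m) ?_ ?_)
      · rcases h3 with rfl | h3
        · simp
        · refine natDegree_mul_le.trans ?_
          rw [natDegree_pow]
          omega
      · rw [map_mul, map_pow, ← hb]; ring
  have mem_of : ∀ {a b : RatFunc F} {n n' : ℕ} {p p' : F[X]}, RatFunc.X ^ n * a = ι p →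
      RatFunc.X ^ n' * b = ι p' → A a + A b * z ∈ V := by
    intro a b n n' p p' ha hb
    rw [mem]
    refine ⟨isIntegral_of_mem (mem_adjoin_of_X_pow_mul ha),
      isIntegral_of_mem (mem_adjoin_of_X_pow_mul (n := 2 * n') (p := p' ^ 2 * m) ?_)⟩
    rw [map_mul, map_pow, ← hb]; ring
  have of_mem : ∀ {a b : RatFunc F}, A a + A b * z ∈ V →
      (∃ n p, RatFunc.X ^ n * a = ι p) ∧ ∃ n p, RatFunc.X ^ n * b = ι p := by
    intro a b h
    obtain ⟨h1, h3⟩ := (mem a b).1 h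
    refine ⟨isIntegral_adjoin_X_X_inv h1, ?_⟩
    obtain ⟨n, p, hp⟩ := isIntegral_adjoin_X_X_inv h3
    obtain ⟨p', hp'⟩ := exists_polynomial_of_sq_mul hm (b := RatFunc.X ^ n * b) (p := X ^ n * p) (by
      rw [map_mul, ← hp, map_pow, ← ratFunc_X_eq]; ring)
    exact ⟨n, p', hp'⟩
  have of_mem₁ : ∀ {a b : RatFunc F}, A a + A b * z ∈ V₁ → ∃ p, b = ι p := by
    intro a b h
    obtain ⟨p, hp⟩ := isIntegral_adjoin_X ((mem₁ a b).1 h).2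
    exact exists_polynomial_of_sq_mul hm hp
  have le₁ : V₁ ≤ V := fun y hy => by
    obtain ⟨a, b, rfl⟩ := hs y
    obtain ⟨p, hp⟩ := isIntegral_adjoin_X ((mem₁ a b).1 hy).1
    obtain ⟨p', hp'⟩ := of_mem₁ hy
    exact mem_of (n := 0) (n' := 0) (by simpa using hp) (by simpa using hp')
  have le₂ : V₂ ≤ V := fun y hy => by
    obtain ⟨a, b, rfl⟩ := hs y
    have hle : Algebra.adjoin F {(RatFunc.X : RatFunc F)⁻¹} ≤
        Algebra.adjoin F {(RatFunc.X : RatFunc F), RatFunc.X⁻¹} :=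
      Algebra.adjoin_mono (Set.singleton_subset_iff.2 (Set.mem_insert_of_mem _ rfl))
    have up : ∀ r : RatFunc F, IsIntegral (Algebra.adjoin F {(RatFunc.X : RatFunc F)⁻¹}) r →
        IsIntegral (Algebra.adjoin F {(RatFunc.X : RatFunc F), RatFunc.X⁻¹}) r := fun r h =>
      IsIntegral.map_of_comp_eq (Subalgebra.inclusion hle).toRingHom (RingHom.id _) (by ext; rfl) h
    obtain ⟨h1, h3⟩ := (mem₂ a b).1 hy
    exact (mem a b).2 ⟨up _ h1, up _ h3⟩
  have of_mem₂ : ∀ {a b : RatFunc F}, A a + A b * z ∈ V₂ →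
      ∃ n p, RatFunc.X ^ n * b = ι p ∧ (p = 0 ∨ p.natDegree + e ≤ n) := by
    intro a b h
    obtain ⟨n, p, hp⟩ := (of_mem (le₂ h)).2
    refine ⟨n, p, hp, or_iff_not_imp_left.2 fun hp0 => ?_⟩
    have h3 := isIntegral_adjoin_X_inv ((mem₂ a b).1 h).2
    have h4 : RatFunc.X ^ (2 * n) * (b ^ 2 * ι m) = ι (p ^ 2 * m) := by
      rw [map_mul, map_pow, ← hp]; ring
    rw [inftyValuation_le_one_iff (mul_ne_zero (pow_ne_zero 2 hp0) hm.ne_zero) _ h4,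
      natDegree_mul (pow_ne_zero 2 hp0) hm.ne_zero, natDegree_pow] at h3
    omega
  -- the basis of the cokernel
  set L : F[X] →ₗ[F] E :=
    { toFun := fun P => A (ι P * (RatFunc.X ^ (e - 1))⁻¹) * z
      map_add' := fun P Q => by simp only [map_add, add_mul]
      map_smul' := fun c P => by
        rw [smul_eq_C_mul, map_mul ι, algebraMap_C_eq, RingHom.id_apply, Algebra.smul_def,
          IsScalarTower.algebraMap_apply F (RatFunc F) E]
        simp only [map_mul]
        ring } with hL
  have hLapp : ∀ P, L P = A 0 + A (ι P * (RatFunc.X ^ (e - 1))⁻¹) * z := fun P => by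
    rw [map_zero, zero_add]; rfl
  have hLV : ∀ P, L P ∈ V := fun P => by
    rw [hLapp]
    refine mem_of (n := 0) (p := 0) (n' := e - 1) (p' := P) (by simp) ?_
    rw [mul_comm (ι P), mul_inv_cancel_left₀ (hX _)]
  set W := (V₁ ⊔ V₂).comap V.subtype with hW
  set β : degreeLT F (e - 1) →ₗ[F] V ⧸ W :=
    W.mkQ ∘ₗ (L.codRestrict V hLV) ∘ₗ (degreeLT F (e - 1)).subtype with hβ
  have he1 : 1 ≤ e := by omega
  -- The coefficient P X^{−(e−1)} has degree between −(e−1) and −1. A polynomial plus an element of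
  -- degree at most −e has degree at least 0 or at most −e, so the two can agree only for P = 0.
  have hinj : Function.Injective β := by
    rw [injective_iff_map_eq_zero]
    rintro ⟨P, hP⟩ h
    have h1 : L P ∈ V₁ ⊔ V₂ := (Submodule.Quotient.mk_eq_zero W).1 h
    obtain ⟨y₁, hy₁, y₂, hy₂, hsum⟩ := Submodule.mem_sup.1 h1
    obtain ⟨a₁, b₁, rfl⟩ := hs y₁
    obtain ⟨a₂, b₂, rfl⟩ := hs y₂
    obtain ⟨p₁, rfl⟩ := of_mem₁ hy₁
    obtain ⟨n, p₂, hp₂, hd⟩ := of_mem₂ hy₂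
    rw [hLapp] at hsum
    have h3 : ι p₁ + b₂ = ι P * (RatFunc.X ^ (e - 1))⁻¹ := hb (a := a₁ + a₂) (a' := 0) (by
      rw [← hsum, map_add, map_add]; ring)
    have h4 : X ^ (n + (e - 1)) * p₁ + X ^ (e - 1) * p₂ = X ^ n * P := hι (by
      have h5 : ι P = (ι p₁ + b₂) * RatFunc.X ^ (e - 1) := by
        rw [h3, inv_mul_cancel_right₀ (hX _)]
      rw [map_add, map_mul, map_mul, map_mul, map_pow, map_pow, map_pow, ← hp₂, h5,
        ← ratFunc_X_eq]; ring)
    have hP0 : P = 0 := by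
      by_contra hP0
      have hPd : P.natDegree < e - 1 := by
        rw [mem_degreeLT, ← natDegree_lt_iff_degree_lt hP0] at hP; exact hP
      have hd1 : (X ^ n * P).natDegree = n + P.natDegree := by
        rw [natDegree_mul (pow_ne_zero _ X_ne_zero) hP0, natDegree_X_pow]
      have hd2 : p₂ ≠ 0 → (X ^ (e - 1) * p₂).natDegree = e - 1 + p₂.natDegree := fun h => by
        rw [natDegree_mul (pow_ne_zero _ X_ne_zero) h, natDegree_X_pow]
      have hd3 : (X ^ (e - 1) * p₂).natDegree < n + (e - 1) ∨ p₂ = 0 := by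
        by_cases h : p₂ = 0
        · exact Or.inr h
        · rw [hd2 h]; rcases hd with hd | hd
          · exact absurd hd h
          · left; omega
      by_cases hp₁ : p₁ = 0
      · rw [hp₁, mul_zero, zero_add] at h4
        have hp₂0 : p₂ ≠ 0 := by
          rintro rfl
          rw [mul_zero] at h4
          exact mul_ne_zero (pow_ne_zero n X_ne_zero) hP0 h4.symm
        have := congrArg natDegree h4
        rw [hd1, hd2 hp₂0] at this
        rcases hd with hd | hd
        · exact hp₂0 hd
        · omega
      · have hd4 : (X ^ (n + (e - 1)) * p₁).natDegree = n + (e - 1) + p₁.natDegree := by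
          rw [natDegree_mul (pow_ne_zero _ X_ne_zero) hp₁, natDegree_X_pow]
        have hd5 : (X ^ (e - 1) * p₂).natDegree < (X ^ (n + (e - 1)) * p₁).natDegree ∨ p₂ = 0 :=
          hd3.imp_left fun h => by omega
        have hd6 : (X ^ n * P).natDegree = n + (e - 1) + p₁.natDegree := by
          rw [← h4]
          rcases hd5 with h | h
          · rw [natDegree_add_eq_left_of_natDegree_lt h, hd4]
          · rw [h, mul_zero, add_zero, hd4]
        omega
    exact Subtype.ext hP0
  -- The coefficient of z is cut at X⁰ and at X^{−(e−1)}, leaving the middle part P. The coefficient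
  -- a is cut at X⁰ only: the parameter 0 leaves no middle part.
  have hsurj : Function.Surjective β := by
    intro y
    obtain ⟨⟨y, hy⟩, rfl⟩ := W.mkQ_surjective y
    obtain ⟨a, b, rfl⟩ := hs y
    obtain ⟨⟨n, p, hp⟩, ⟨n', p', hp'⟩⟩ := of_mem hy
    obtain ⟨a₁, a₂, a₃, s, k, ha, ha₂, hs1, hd1⟩ := exists_laurent_decomposition hp 0
    obtain ⟨b₁, b₂, b₃, s', k', hb', hb₂, hs2, hd2⟩ := exists_laurent_decomposition hp' (e - 1)
    rw [Nat.sub_add_cancel he1] at hd2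
    have ha₂0 : a₂ = 0 := by
      rw [mem_degreeLT] at ha₂
      exact degree_eq_bot.1 (Nat.WithBot.lt_zero_iff.1 (by exact_mod_cast ha₂))
    refine ⟨⟨b₂, hb₂⟩, ?_⟩
    change W.mkQ _ = W.mkQ _
    rw [← sub_eq_zero, ← map_sub]
    refine (Submodule.Quotient.mk_eq_zero W).2 ?_
    change L b₂ - (A a + A b * z) ∈ V₁ ⊔ V₂
    rw [← neg_sub, Submodule.neg_mem_iff]
    have key : A a + A b * z - L b₂ = (A (ι a₁) + A (ι b₁) * z) + (A s + A s' * z) := by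
      rw [hLapp, ha, hb', ha₂0]
      simp only [map_add, map_mul, map_zero]
      ring
    rw [key]
    exact Submodule.add_mem_sup (mem₁_of _ _) (mem₂_of hs1 hs2 (by simpa using hd1) hd2)
  have hfin : Module.finrank F (V ⧸ W) = e - 1 := by
    rw [← (LinearEquiv.ofBijective β ⟨hinj, hsurj⟩).finrank_eq,
      (degreeLTEquiv F (e - 1)).finrank_eq, Module.finrank_fin_fun]
  exact hfin

end GenusOfQuadratic

/-! ### Quadratic field extensions when 2 is invertible. -/

section QuadraticExtensions

variable {k E : Type*} [Field k] [Field E] [Algebra k E]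

theorem exists_add_mul_of_finrank_eq_two (h : Module.finrank k E = 2) {z : E}
    (hz : ∀ r, z ≠ algebraMap k E r) (y : E) :
    ∃ a b, y = algebraMap k E a + algebraMap k E b * z := by
  have hli : LinearIndependent k ![1, z] := by
    rw [LinearIndependent.pair_iff]
    intro s t hst
    rw [Algebra.smul_def, Algebra.smul_def, mul_one] at hst
    by_cases ht : t = 0
    · subst ht
      rw [map_zero, zero_mul, add_zero, map_eq_zero] at hst
      exact ⟨hst, rfl⟩
    · exfalso
      have ht' : algebraMap k E t ≠ 0 := by rwa [Ne, map_eq_zero]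
      refine hz (-s / t) ?_
      rw [map_div₀, map_neg, eq_div_iff ht']
      linear_combination hst
  have : FiniteDimensional k E := FiniteDimensional.of_finrank_pos (by omega)
  have hspan := hli.span_eq_top_of_card_eq_finrank' (by simp [h])
  have hy : y ∈ Submodule.span k (Set.range ![1, z]) := by rw [hspan]; trivial
  rw [Matrix.range_cons, Matrix.range_cons, Matrix.range_empty, Set.union_empty,
    Set.singleton_union, Submodule.mem_span_pair] at hy
  obtain ⟨a, b, rfl⟩ := hy
  exact ⟨a, b, by rw [Algebra.smul_def, Algebra.smul_def, mul_one]⟩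

/-- Completing the square. -/
theorem exists_sq_of_finrank_eq_two (h2 : (2 : k) ≠ 0) (h : Module.finrank k E = 2) :
    ∃ (w : E) (r : k), (∀ s, w ≠ algebraMap k E s) ∧ w ^ 2 = algebraMap k E r := by
  obtain ⟨z, hz⟩ : ∃ z : E, ∀ r, z ≠ algebraMap k E r := by
    by_contra! hcon
    have hsurj : Function.Surjective (Algebra.linearMap k E) := fun z => by
      obtain ⟨r, hr⟩ := hcon z
      exact ⟨r, hr.symm⟩
    have h1 := (LinearEquiv.ofBijective (Algebra.linearMap k E)
      ⟨(algebraMap k E).injective, hsurj⟩).finrank_eq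
    rw [h, Module.finrank_self] at h1
    omega
  obtain ⟨a, b, hab⟩ := exists_add_mul_of_finrank_eq_two h hz (z ^ 2)
  have h2E : algebraMap k E 2 = 2 := map_ofNat _ 2
  have h2' : (2 : E) ≠ 0 := by rw [← h2E, Ne, map_eq_zero]; exact h2
  refine ⟨z - algebraMap k E (b / 2), a + (b / 2) ^ 2, fun s hs => hz (s + b / 2) ?_, ?_⟩
  · rw [map_add, ← hs]; ring
  · rw [map_add, map_pow, map_div₀, h2E]
    field_simp
    linear_combination 4 * hab

theorem finrank_adjoin_sqrt {r : k} {w : E} (hw : ∀ s, w ≠ algebraMap k E s)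
    (hr : w ^ 2 = algebraMap k E r) : Module.finrank k (IntermediateField.adjoin k {w}) = 2 := by
  have hmonic : (X ^ 2 - C r : k[X]).Monic := monic_X_pow_sub_C r two_ne_zero
  have hdeg : (X ^ 2 - C r : k[X]).natDegree = 2 := natDegree_X_pow_sub_C
  have hroot : aeval w (X ^ 2 - C r : k[X]) = 0 := by simp [hr]
  have hirr : Irreducible (X ^ 2 - C r : k[X]) := by
    refine (irreducible_iff_roots_eq_zero_of_degree_le_three (by omega) (by omega)).2 ?_
    refine Multiset.eq_zero_of_forall_notMem fun s hs => ?_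
    rw [mem_roots hmonic.ne_zero, IsRoot, eval_sub, eval_pow, eval_X, eval_C, sub_eq_zero] at hs
    rw [← hs, map_pow] at hr
    rcases sq_eq_sq_iff_eq_or_eq_neg.1 hr with h | h
    · exact hw s h
    · exact hw (-s) (by rw [h, map_neg])
  rw [IntermediateField.adjoin.finrank ⟨_, hmonic, hroot⟩,
    ← minpoly.eq_of_irreducible_of_monic hirr hroot hmonic, hdeg]

end QuadraticExtensions

/-! ### Frames of biquadratic curves and the genera of their quotients. -/

section FramesOfCurves

variable {F : Type u} [Field F]

local notation "ι" => algebraMap F[X] (RatFunc F)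

namespace BiquadraticCurve

variable (D : BiquadraticCurve F)

/-- The embedding of the rational function field twisted by an automorphism. -/
noncomputable def twistedMap (τ : RatFunc F ≃ₐ[F] RatFunc F) : RatFunc F →+* D.K :=
  (algebraMap (RatFunc F) D.K).comp (τ : RatFunc F →+* RatFunc F)

theorem twistedMap_apply (τ : RatFunc F ≃ₐ[F] RatFunc F) (r : RatFunc F) :
    D.twistedMap τ r = algebraMap (RatFunc F) D.K (τ r) := rfl

theorem twistedMap_symm_apply (τ : RatFunc F ≃ₐ[F] RatFunc F) (r : RatFunc F) :
    D.twistedMap τ (τ.symm r) = algebraMap (RatFunc F) D.K r := by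
  rw [twistedMap_apply, AlgEquiv.apply_symm_apply]

theorem finrank_eq_four : Module.finrank (RatFunc F) D.K = 4 := by
  have := D.finiteDimensional
  have := D.isGalois
  have := D.isKleinFour
  rw [← IsGalois.card_aut_eq_finrank, IsKleinFour.card_four]

/-- The Riemann–Hurwitz condition on the degrees of a triple. -/
def _root_.HasDegrees (g : Fin 3 → ℕ) (f : Fin 3 → F[X]) : Prop :=
  IsModel ∅ f ∧ ∀ i, ((cofactor f i).natDegree + 1) / 2 = g i + 1

theorem _root_.HasDegrees.isAdmissible {g : Fin 3 → ℕ} {f : Fin 3 → F[X]} (h : HasDegrees g f) :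
    IsAdmissible f := ⟨h.1, fun i => by have := h.2 i; omega⟩

variable {D}

/-- 1, z 0, z 1, z 2 are four independent elements in degree four; τ merely relabels the scalars. -/
theorem spans (h2 : (2 : F) ≠ 0) {τ : RatFunc F ≃ₐ[F] RatFunc F} {f : Fin 3 → F[X]}
    {z : Fin 3 → D.K} (hf : IsAdmissible f) (hz : IsFrame (D.twistedMap τ) f z) :
    Spans (D.twistedMap τ) z := by
  have hli : LinearIndependent (RatFunc F) ![1, z 0, z 1, z 2] := by
    rw [Fintype.linearIndependent_iff]
    intro c hc
    rw [Fin.sum_univ_four] at hc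
    simp only [Matrix.cons_val_zero, Matrix.cons_val_one, Matrix.cons_val, Algebra.smul_def,
      mul_one] at hc
    obtain ⟨h0, h1⟩ := hz.independent h2 hf (a := τ.symm (c 0)) (b := fun i => τ.symm (c i.succ)) (by
      rw [Fin.sum_univ_three]
      simp only [twistedMap_symm_apply]
      rw [← add_assoc, ← add_assoc]
      exact hc)
    intro i
    refine τ.symm.injective ?_
    rw [map_zero]
    refine Fin.cases h0 (fun i => h1 i) i
  have := D.finiteDimensional
  have hspan := hli.span_eq_top_of_card_eq_finrank' (by simp [D.finrank_eq_four])
  intro y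
  have hy : y ∈ Submodule.span (RatFunc F) (Set.range ![1, z 0, z 1, z 2]) := by
    rw [hspan]; trivial
  obtain ⟨c, rfl⟩ := (Submodule.mem_span_range_iff_exists_fun _).1 hy
  refine ⟨τ.symm (c 0), fun i => τ.symm (c i.succ), ?_⟩
  rw [comb, Fin.sum_univ_four, Fin.sum_univ_three]
  simp only [twistedMap_symm_apply, Matrix.cons_val_zero, Matrix.cons_val_one, Matrix.cons_val,
    Algebra.smul_def, mul_one]
  rw [← add_assoc, ← add_assoc]
  rfl

/-- Square roots of constants are constant. -/
theorem mem_range_of_sq_eq_C {w : D.K} {c : F} (h : w ^ 2 = algebraMap (RatFunc F) D.K (ι (C c))) :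
    ∃ r, w = algebraMap (RatFunc F) D.K r := by
  have hint : IsIntegral F w := by
    refine IsIntegral.of_pow (n := 2) two_pos ?_
    rw [h, algebraMap_C_eq, ← IsScalarTower.algebraMap_apply]
    exact isIntegral_algebraMap
  obtain ⟨a, ha⟩ := D.constants w hint
  exact ⟨algebraMap F (RatFunc F) a, by rw [← IsScalarTower.algebraMap_apply, ha]⟩

/-- Each quadratic subfield is generated by the root of a squarefree polynomial, which is not
constant because the constants of K lie in F. Two of these roots extend to a frame, and the third
subfield, being different from the first two, can only be the one generated by z 2. -/
theorem exists_frame_of_hasGenera (h2 : (2 : F) ≠ 0) {g : Fin 3 → ℕ} (hD : D.HasGenera g) :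
    ∃ f z, HasDegrees g f ∧ IsFrame (algebraMap (RatFunc F) D.K) f z := by
  have h2R : (2 : RatFunc F) ≠ 0 := by
    rw [← map_ofNat (algebraMap F (RatFunc F)) 2, Ne, map_eq_zero]; exact h2
  obtain ⟨E, hEinj, hE⟩ := hD
  have key : ∀ i, ∃ (w : E i) (m : F[X]), Squarefree m ∧ 0 < m.natDegree ∧
      w ^ 2 = algebraMap (RatFunc F) (E i) (ι m) ∧ (m.natDegree + 1) / 2 = g i + 1 ∧
      ∀ y : E i, ∃ a b, y = algebraMap (RatFunc F) (E i) a + algebraMap (RatFunc F) (E i) b * w := by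
    intro i
    obtain ⟨w, r, hw, hr⟩ := exists_sq_of_finrank_eq_two h2R (hE i).1
    have hr0 : r ≠ 0 := by
      rintro rfl
      rw [map_zero, sq_eq_zero_iff] at hr
      exact hw 0 (by rw [hr, map_zero])
    obtain ⟨m, hm, s, hs, rfl⟩ := exists_squarefree_representative hr0
    have hs' : algebraMap (RatFunc F) (E i) s ≠ 0 := by rwa [Ne, map_eq_zero]
    set w' := w / algebraMap (RatFunc F) (E i) s with hw'
    have hw2 : w' ^ 2 = algebraMap (RatFunc F) (E i) (ι m) := by
      rw [hw', div_pow, hr, map_mul, map_pow, mul_div_cancel_left₀ _ (pow_ne_zero 2 hs')]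
    have hwn : ∀ t, w' ≠ algebraMap (RatFunc F) (E i) t := by
      intro t ht
      refine hw (t * s) ?_
      rw [map_mul, ← ht, hw', div_mul_cancel₀ _ hs']
    have hmd : 0 < m.natDegree := by
      refine Nat.pos_of_ne_zero fun h => ?_
      rw [eq_C_of_natDegree_eq_zero h] at hw2
      obtain ⟨t, ht⟩ := mem_range_of_sq_eq_C (w := (w' : D.K)) (congrArg Subtype.val hw2)
      exact hwn t (Subtype.ext ht)
    have hspan := exists_add_mul_of_finrank_eq_two (hE i).1 hwn
    refine ⟨w', m, hm, hmd, hw2, ?_, hspan⟩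
    have := genus_eq_of_sq h2 hm hmd hw2 hspan
    rw [(hE i).2] at this
    omega
  choose w m hm hmd hw hg hspan using key
  set v : Fin 3 → D.K := fun i => w i with hv
  have hvsq : ∀ i, v i ^ 2 = algebraMap (RatFunc F) D.K (ι (m i)) := fun i =>
    congrArg Subtype.val (hw i)
  have hne : ∀ i l r, i ≠ l → v i ≠ algebraMap (RatFunc F) D.K r * v l := by
    intro i l r hil h
    have hr : r ≠ 0 := by
      rintro rfl
      have h1 := hvsq i
      rw [h, map_zero, zero_mul, zero_pow two_ne_zero] at h1
      exact IsFrame.map_ne_zero _ (hm i).ne_zero h1.symm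
    have hr' : algebraMap (RatFunc F) D.K r ≠ 0 := by rwa [Ne, map_eq_zero]
    have hmem : v l ∈ E i := by
      have : v l = (algebraMap (RatFunc F) D.K r)⁻¹ * v i := by rw [h, inv_mul_cancel_left₀ hr']
      rw [this, ← map_inv₀]
      exact mul_mem ((E i).algebraMap_mem _) (w i).2
    have hle : E l ≤ E i := by
      intro y hy
      obtain ⟨a, b, hab⟩ := hspan l ⟨y, hy⟩
      have : y = algebraMap (RatFunc F) D.K a + algebraMap (RatFunc F) D.K b * v l :=
        congrArg Subtype.val hab
      rw [this]
      exact add_mem ((E i).algebraMap_mem _) (mul_mem ((E i).algebraMap_mem _) hmem)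
    have := D.finiteDimensional
    exact hil (hEinj (IntermediateField.eq_of_le_of_finrank_eq hle
      (by rw [(hE i).1, (hE l).1])).symm)
  obtain ⟨f, z, hf, hz, hz0, hz1, e0, e1⟩ :=
    exists_frame_of_two (hm 0) (hm 1) (hvsq 0) (hvsq 1)
  have hz01 := hz.mul 0 1 2 (by decide) (by decide) (by decide)
  rw [hz0, hz1] at hz01
  have hv1 : v 1 ≠ 0 := fun h => by
    have h1 := hvsq 1
    rw [h, zero_pow two_ne_zero] at h1
    exact IsFrame.map_ne_zero _ (hm 1).ne_zero h1.symm
  have hadm : IsAdmissible f := by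
    refine ⟨hf, forall_fin_three.2 ⟨by rw [e0]; exact hmd 0, by rw [e1]; exact hmd 1, ?_⟩⟩
    -- If the third cofactor were constant, z 2 would be a constant too, and the first two roots
    -- would be proportional.
    refine Nat.pos_of_ne_zero fun h => ?_
    have h3 := hz.sq 2
    rw [eq_C_of_natDegree_eq_zero h] at h3
    obtain ⟨t, ht⟩ := mem_range_of_sq_eq_C h3
    refine hne 0 1 (ι (f 2) * t / ι (m 1)) (by decide) ?_
    have hm1 := IsFrame.map_ne_zero (algebraMap (RatFunc F) D.K) (hm 1).ne_zero
    rw [map_div₀, map_mul, ← ht, div_mul_eq_mul_div, eq_div_iff hm1, ← hz01, ← hvsq 1]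
    ring
  have hv2 : ∀ r, v 2 ≠ algebraMap (RatFunc F) D.K r := by
    intro r h
    have h1 : ι (m 2) = r ^ 2 * ι 1 := (algebraMap (RatFunc F) D.K).injective (by
      rw [← hvsq 2, h, map_one, mul_one, map_pow])
    obtain ⟨c, hc, h3⟩ := eq_C_mul_of_squarefree squarefree_one (hm 2) h1
    have := hmd 2
    rw [h3, mul_one, natDegree_C] at this
    exact absurd this (lt_irrefl _)
  obtain ⟨i, r, hir⟩ := IsFrame.eq_mul_of_sq h2 hadm hz
    (spans (τ := AlgEquiv.refl) h2 hadm hz) hv2 (hvsq 2)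
  have hi : i = 2 := by
    fin_cases i
    · exact absurd (hir.trans (by rw [← hz0]; rfl)) (hne 2 0 r (by decide))
    · exact absurd (hir.trans (by rw [← hz1]; rfl)) (hne 2 1 r (by decide))
    · rfl
  subst hi
  have h4 : ι (m 2) = r ^ 2 * ι (cofactor f 2) := (algebraMap (RatFunc F) D.K).injective (by
    rw [← hvsq 2, hir, mul_pow, hz.sq, map_mul, map_pow])
  obtain ⟨c, hc, h5⟩ := eq_C_mul_of_squarefree (hf.squarefree_cofactor 2) (hm 2) h4
  refine ⟨f, z, ⟨hf, forall_fin_three.2 ⟨by rw [e0, hg 0], by rw [e1, hg 1], ?_⟩⟩, hz⟩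
  rw [← hg 2, h5, natDegree_C_mul hc]

theorem hasGenera_of_frame (h2 : (2 : F) ≠ 0) {g : Fin 3 → ℕ} {f : Fin 3 → F[X]}
    {z : Fin 3 → D.K} (hf : HasDegrees g f) (hz : IsFrame (algebraMap (RatFunc F) D.K) f z) :
    D.HasGenera g := by
  have hadm := hf.isAdmissible
  set E : Fin 3 → IntermediateField (RatFunc F) D.K := fun i => IntermediateField.adjoin _ {z i}
    with hE
  have hmem : ∀ i, z i ∈ E i := fun i => IntermediateField.mem_adjoin_simple_self _ _
  have hrank : ∀ i, Module.finrank (RatFunc F) (E i) = 2 := fun i =>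
    finrank_adjoin_sqrt (hz.notMem_range hadm i) (hz.sq i)
  have hspan : ∀ i (y : E i), ∃ a b, y = algebraMap (RatFunc F) (E i) a +
      algebraMap (RatFunc F) (E i) b * ⟨z i, hmem i⟩ := fun i =>
    exists_add_mul_of_finrank_eq_two (hrank i) fun r h =>
      hz.notMem_range hadm i r (congrArg Subtype.val h)
  refine ⟨E, fun i l hil => ?_, fun i => ⟨hrank i, ?_⟩⟩
  · by_contra hne
    obtain ⟨a, b, hab⟩ := hspan i ⟨z l, by rw [hil]; exact hmem l⟩
    have h1 : z l = algebraMap (RatFunc F) D.K a + algebraMap (RatFunc F) D.K b * z i :=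
      congrArg Subtype.val hab
    have h3 := (hz.comb_injective h2 hadm (a := 0) (a' := a) (b := Pi.single l 1)
      (b' := Pi.single i b) (by
        rw [comb_single, map_one, one_mul, h1, ← comb_single, ← comb_zero _ z, comb_add]
        simp)).2
    have h4 := congrFun h3 l
    rw [Pi.single_eq_same, Pi.single_eq_of_ne (Ne.symm hne)] at h4
    exact one_ne_zero h4
  · rw [genus_eq_of_sq h2 (hadm.isModel.squarefree_cofactor i) (hadm.natDegree_pos i)
      (z := (⟨z i, hmem i⟩ : E i)) (Subtype.ext (hz.sq i)) (hspan i), hf.2 i]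
    rfl

end BiquadraticCurve

end FramesOfCurves

/-! ### Counting the frames of a curve. -/

section FrameCount

variable {F : Type u} [Field F]

local notation "ι" => algebraMap F[X] (RatFunc F)

theorem squarefree_C_mul {c : F} (hc : c ≠ 0) {p : F[X]} (hp : Squarefree p) :
    Squarefree (C c * p) :=
  hp.squarefree_of_dvd ((isUnit_C.2 hc.isUnit).mul_left_dvd.2 dvd_rfl)

theorem isCoprime_C_mul {c d : F} (hc : c ≠ 0) (hd : d ≠ 0) {p r : F[X]} (h : IsCoprime p r) :
    IsCoprime (C c * p) (C d * r) :=
  (isCoprime_mul_unit_left_left (isUnit_C.2 hc.isUnit) _ _).2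
    ((isCoprime_mul_unit_left_right (isUnit_C.2 hd.isUnit) _ _).2 h)

/-- Rescaling and permuting a triple. -/
noncomputable def rescale (f : Fin 3 → F[X]) (σ : Equiv.Perm (Fin 3)) (a : Fin 3 → Fˣ) :
    Fin 3 → F[X] := fun i => C ((∏ l, (a l : F)) / (a i : F) ^ 2) * f (σ i)

theorem prod_fin_three_eq {M : Type*} [CommMonoid M] (a : Fin 3 → M) {i k l : Fin 3} (hik : i ≠ k)
    (hil : i ≠ l) (hkl : k ≠ l) : ∏ j, a j = a i * (a k * a l) := by
  rw [← Finset.mul_prod_erase univ a (Finset.mem_univ i),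
    show (univ.erase i : Finset (Fin 3)) = {k, l} by ext x; revert i k l x; decide,
    Finset.prod_pair hkl]

/-- The scaling factors are chosen so that those with indices k and l multiply to a_i²; the new root
is then a_i z_{σ i}. -/
theorem cofactor_rescale (f : Fin 3 → F[X]) (σ : Equiv.Perm (Fin 3)) (a : Fin 3 → Fˣ) (i : Fin 3) :
    cofactor (rescale f σ a) i = C ((a i : F) ^ 2) * cofactor f (σ i) := by
  obtain ⟨k, l, hik, hil, hkl⟩ := exists_other i
  rw [cofactor_eq hik hil hkl, cofactor_eq (σ.injective.ne hik) (σ.injective.ne hil)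
    (σ.injective.ne hkl), rescale, rescale, prod_fin_three_eq _ hik hil hkl]
  have e : (a i : F) ^ 2 = (a i * (a k * a l) / (a k : F) ^ 2) * (a i * (a k * a l) / (a l : F) ^ 2) := by
    have := (a k).ne_zero
    have := (a l).ne_zero
    field_simp
  rw [e, C_mul]
  ring

theorem isModel_rescale {f : Fin 3 → F[X]} (hf : IsModel ∅ f) (σ : Equiv.Perm (Fin 3))
    (a : Fin 3 → Fˣ) : IsModel ∅ (rescale f σ a) := by
  have hne : ∀ i, (∏ l, (a l : F)) / (a i : F) ^ 2 ≠ 0 := fun i =>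
    div_ne_zero (Finset.prod_ne_zero_iff.2 fun l _ => (a l).ne_zero) (pow_ne_zero 2 (a i).ne_zero)
  exact ⟨fun i => squarefree_C_mul (hne i) (hf.1 _), fun i k hik =>
    isCoprime_C_mul (hne i) (hne k) (hf.2.1 _ _ (σ.injective.ne hik)), by simp⟩

theorem hasDegrees_rescale {g : Fin 3 → ℕ} {f : Fin 3 → F[X]} (hf : HasDegrees g f)
    {σ : Equiv.Perm (Fin 3)} (hσ : ∀ i, g (σ i) = g i) (a : Fin 3 → Fˣ) :
    HasDegrees g (rescale f σ a) :=
  ⟨isModel_rescale hf.1 σ a, fun i => by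
    rw [cofactor_rescale, natDegree_C_mul (pow_ne_zero 2 (a i).ne_zero), hf.2, hσ]⟩

theorem isFrame_rescale {K : Type*} [Field K] {j : RatFunc F →+* K} {f : Fin 3 → F[X]}
    {z : Fin 3 → K} (hz : IsFrame j f z) (σ : Equiv.Perm (Fin 3)) (a : Fin 3 → Fˣ) :
    IsFrame j (rescale f σ a) fun i => j (ι (C (a i : F))) * z (σ i) := by
  refine ⟨fun i => ?_, fun i k l hik hil hkl => ?_⟩
  · rw [cofactor_rescale, map_mul, map_mul, mul_pow, hz.sq, C_pow, map_pow, map_pow]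
  · have h := hz.mul (σ i) (σ k) (σ l) (σ.injective.ne hik) (σ.injective.ne hil)
      (σ.injective.ne hkl)
    have e : C (a i : F) * C (a k : F) = C ((∏ l, (a l : F)) / (a l : F) ^ 2) * C (a l : F) := by
      rw [← C_mul, ← C_mul, prod_fin_three_eq _ hik hil hkl]
      congr 1
      have := (a l).ne_zero
      field_simp
    have e' := congrArg (fun x => j (ι x)) e
    simp only [map_mul] at e'
    rw [rescale, map_mul, map_mul]
    linear_combination j (ι (C (a i : F))) * j (ι (C (a k : F))) * h +
      j (ι (f (σ l))) * z (σ l) * e'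

namespace BiquadraticCurve

/-- The frames whose triples have the degrees prescribed by `g`. -/
def frames (D : BiquadraticCurve F) (g : Fin 3 → ℕ) (τ : RatFunc F ≃ₐ[F] RatFunc F) :
    Set (Fin 3 → D.K) :=
  {z | ∃ f, HasDegrees g f ∧ IsFrame (D.twistedMap τ) f z}

variable {D : BiquadraticCurve F}

/-- A frame over the standard embedding is carried to the one twisted by τ by replacing the
transported cofactors with squarefree representatives. The genus condition survives because ⌈deg/2⌉
is invariant under automorphisms of the line. -/
theorem frames_nonempty (h2 : (2 : F) ≠ 0) {g : Fin 3 → ℕ} (hD : D.HasGenera g)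
    (τ : RatFunc F ≃ₐ[F] RatFunc F) : (D.frames g τ).Nonempty := by
  obtain ⟨f, z, hf, hz⟩ := exists_frame_of_hasGenera h2 hD
  choose m hm hdeg r hr hτ using fun i =>
    exists_squarefree_automorphism τ.symm (hf.1.squarefree_cofactor i)
  have hr' : ∀ i, D.twistedMap τ (r i) ≠ 0 := fun i => by rw [Ne, map_eq_zero]; exact hr i
  have hmd : ∀ i, 0 < (m i).natDegree := fun i => by
    have := hdeg i
    rw [hf.2 i] at this
    omega
  obtain ⟨f', z', hf', hz', hdeg'⟩ := exists_frame (j := D.twistedMap τ)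
    (w := fun i => z i / D.twistedMap τ (r i)) hm hmd (fun i => by
      rw [div_pow, hz.sq, ← twistedMap_symm_apply D τ, hτ, map_mul, map_pow,
        mul_div_cancel_left₀ _ (pow_ne_zero 2 (hr' i))])
    (s := τ.symm (ι (f 2) * ι (cofactor f 2)) / (r 0 * r 1 * r 2)) (by
      have h1 := hz.mul 0 1 2 (by decide) (by decide) (by decide)
      rw [map_div₀, twistedMap_symm_apply, map_mul, map_mul, map_mul, ← hz.sq]
      have := hr' 0
      have := hr' 1
      have := hr' 2
      field_simp
      linear_combination z 2 * h1)
  exact ⟨z', f', ⟨hf'.isModel, fun i => by rw [hdeg' i, hdeg i, hf.2 i]⟩, hz'⟩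

/-- The number of frames depends on `g` only. -/
theorem card_frames (h2 : (2 : F) ≠ 0) {g : Fin 3 → ℕ} (hD : D.HasGenera g)
    (τ : RatFunc F ≃ₐ[F] RatFunc F) :
    Nat.card (D.frames g τ) =
      Nat.card ({σ : Equiv.Perm (Fin 3) // ∀ i, g (σ i) = g i} × (Fin 3 → Fˣ)) := by
  obtain ⟨z, f, hf, hz⟩ := frames_nonempty h2 hD τ
  have hadm := hf.isAdmissible
  symm
  refine Nat.card_eq_of_bijective (fun p => ⟨fun i => D.twistedMap τ (ι (C (p.2 i : F))) * z (p.1.1 i),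
    _, hasDegrees_rescale hf p.1.2 p.2, isFrame_rescale hz p.1.1 p.2⟩) ⟨?_, ?_⟩
  · rintro ⟨⟨σ, hσ⟩, a⟩ ⟨⟨σ', hσ'⟩, a'⟩ h
    have h1 : ∀ i, (Pi.single (σ i) (ι (C (a i : F))) : Fin 3 → RatFunc F) =
        Pi.single (σ' i) (ι (C (a' i : F))) := fun i => by
      refine (hz.comb_injective h2 hadm (a := 0) (a' := 0) ?_).2
      rw [comb_single, comb_single]
      exact congrFun (congrArg Subtype.val h) i
    have hne : ∀ i, ι (C (a i : F)) ≠ 0 := fun i =>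
      RatFunc.algebraMap_ne_zero (C_ne_zero.2 (a i).ne_zero)
    have h3 : ∀ i, σ i = σ' i := fun i => by
      by_contra hcon
      have := congrFun (h1 i) (σ i)
      rw [Pi.single_eq_same, Pi.single_eq_of_ne hcon] at this
      exact hne i this
    have h4 : ∀ i, a i = a' i := fun i => by
      have := congrFun (h1 i) (σ i)
      rw [Pi.single_eq_same, h3, Pi.single_eq_same] at this
      exact Units.ext (C_injective (algebraMap_polynomial_injective this))
    have h5 : σ = σ' := Equiv.ext h3
    have h6 : a = a' := funext h4
    subst h5; subst h6; rfl
  · rintro ⟨y, f', hf', hy⟩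
    have hadm' := hf'.isAdmissible
    -- Each y i is a multiple of a single z (s i). Both cofactors are squarefree, so the multiplier
    -- is constant; s is injective because no product y i y k with i ≠ k lies in the base field.
    choose s r hsr using fun i => IsFrame.eq_mul_of_sq h2 hadm hz (spans h2 hadm hz)
      (hy.notMem_range hadm' i) (hy.sq i)
    have hcof : ∀ i, ι (cofactor f' i) = r i ^ 2 * ι (cofactor f (s i)) := fun i =>
      (D.twistedMap τ).injective (by rw [← hy.sq, hsr, mul_pow, hz.sq, map_mul, map_pow])
    choose c hc hrc using fun i => exists_const_of_squarefree
      (hf.1.squarefree_cofactor (s i)) (hf'.1.squarefree_cofactor i) (hcof i)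
    have hs : Function.Injective s := by
      intro i k hik
      by_contra hne
      obtain ⟨l, hil, hkl⟩ := (by decide : ∀ i k : Fin 3, ∃ l, i ≠ l ∧ k ≠ l) i k
      refine hy.mul_mem hne hil hkl hadm' (r := r i * r k * ι (cofactor f (s k))) ?_
      rw [hsr i, hsr k, hik, map_mul, map_mul, ← hz.sq]
      ring
    have hg : ∀ i, g (s i) = g i := by
      intro i
      have h1 : cofactor f' i = C (c i ^ 2) * cofactor f (s i) := by
        apply algebraMap_polynomial_injective (F := F)
        rw [hcof, hrc, map_mul, algebraMap_C_eq, map_pow]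
      have h3 := hf'.2 i
      rw [h1, natDegree_C_mul (pow_ne_zero 2 (hc i)), hf.2] at h3
      omega
    refine ⟨⟨⟨Equiv.ofBijective s (Finite.injective_iff_bijective.1 hs), hg⟩,
      fun i => Units.mk0 (c i) (hc i)⟩, Subtype.ext (funext fun i => ?_)⟩
    change D.twistedMap τ (ι (C (c i))) * z (s i) = y i
    rw [hsr i, hrc i, algebraMap_C_eq]

end BiquadraticCurve

end FrameCount

/-! ### The sign automorphisms of a field with a frame. -/

section SignAutomorphisms

variable {F : Type*} [Field F] {K : Type*} [Field K]

local notation "ι" => algebraMap F[X] (RatFunc F)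

/-- Changing two signs of a frame. -/
theorem IsFrame.sign {j : RatFunc F →+* K} {f : Fin 3 → F[X]} {z : Fin 3 → K} (hz : IsFrame j f z)
    (i : Fin 3) : IsFrame j f fun l => if l = i then z l else -z l := by
  refine ⟨fun l => ?_, fun l k n hlk hln hkn => ?_⟩
  · split_ifs
    · exact hz.sq l
    · rw [neg_sq, hz.sq l]
  · have h := hz.mul l k n hlk hln hkn
    have hcases : ∀ l k n i : Fin 3, l ≠ k → l ≠ n → k ≠ n → (l = i ∧ k ≠ i ∧ n ≠ i) ∨
        (l ≠ i ∧ k = i ∧ n ≠ i) ∨ (l ≠ i ∧ k ≠ i ∧ n = i) := by decide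
    rcases hcases l k n i hlk hln hkn with ⟨h1, h2, h3⟩ | ⟨h1, h2, h3⟩ | ⟨h1, h2, h3⟩
    · rw [if_pos h1, if_neg h2, if_neg h3]; linear_combination -h
    · rw [if_neg h1, if_pos h2, if_neg h3]; linear_combination -h
    · rw [if_neg h1, if_neg h2, if_pos h3]; linear_combination h

variable [Algebra (RatFunc F) K]

theorem IsFrame.linearIndependent (h2 : (2 : F) ≠ 0) {f : Fin 3 → F[X]} {z : Fin 3 → K}
    (hf : IsAdmissible f) (hz : IsFrame (algebraMap (RatFunc F) K) f z) :
    LinearIndependent (RatFunc F) ![1, z 0, z 1, z 2] := by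
  rw [Fintype.linearIndependent_iff]
  intro c hc
  rw [Fin.sum_univ_four] at hc
  simp only [Matrix.cons_val_zero, Matrix.cons_val_one, Matrix.cons_val, Algebra.smul_def,
    mul_one] at hc
  obtain ⟨h0, h1⟩ := hz.independent h2 hf (a := c 0) (b := fun i => c i.succ) (by
    rw [Fin.sum_univ_three, ← add_assoc, ← add_assoc]
    exact hc)
  exact fun i => Fin.cases h0 (fun i => h1 i) i

/-- A field spanned by a frame has degree four. -/
theorem IsFrame.finrank_eq_four (h2 : (2 : F) ≠ 0) {f : Fin 3 → F[X]} {z : Fin 3 → K}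
    (hf : IsAdmissible f) (hz : IsFrame (algebraMap (RatFunc F) K) f z)
    (hs : Spans (algebraMap (RatFunc F) K) z) : Module.finrank (RatFunc F) K = 4 := by
  have hspan : ⊤ ≤ Submodule.span (RatFunc F) (Set.range ![1, z 0, z 1, z 2]) := by
    intro y _
    obtain ⟨a, b, rfl⟩ := hs y
    refine (Submodule.mem_span_range_iff_exists_fun _).2 ⟨![a, b 0, b 1, b 2], ?_⟩
    rw [comb, Fin.sum_univ_four, Fin.sum_univ_three]
    simp only [Matrix.cons_val_zero, Matrix.cons_val_one, Matrix.cons_val, Algebra.smul_def,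
      mul_one]
    ring
  rw [Module.finrank_eq_card_basis (Module.Basis.mk (hz.linearIndependent h2 hf) hspan)]
  rfl

theorem IsFrame.exists_signAut (h2 : (2 : F) ≠ 0) {f : Fin 3 → F[X]} {z : Fin 3 → K}
    (hf : IsAdmissible f) (hz : IsFrame (algebraMap (RatFunc F) K) f z)
    (hs : Spans (algebraMap (RatFunc F) K) z) (i : Fin 3) :
    ∃ σ : K ≃ₐ[RatFunc F] K, ∀ l, σ (z l) = if l = i then z l else -z l := by
  obtain ⟨φ, hφ, hφz⟩ := hz.exists_lift h2 hf hs (hz.sign i)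
  have : FiniteDimensional (RatFunc F) K :=
    FiniteDimensional.of_finrank_pos (by rw [hz.finrank_eq_four h2 hf hs]; norm_num)
  let ψ : K →ₐ[RatFunc F] K := { φ with commutes' := hφ }
  exact ⟨AlgEquiv.ofBijective ψ (Algebra.IsAlgebraic.algHom_bijective ψ), hφz⟩

end SignAutomorphisms

/-! ### Construction of a curve from a triple. -/

section Existence

variable {F : Type u} [Field F]

local notation "ι" => algebraMap F[X] (RatFunc F)

/-- Every admissible triple has a frame spanning an extension of the rational function field. -/
theorem exists_field_of_isAdmissible {f : Fin 3 → F[X]} (hf : IsAdmissible f) :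
    ∃ (K : IntermediateField (RatFunc F) (AlgebraicClosure (RatFunc F))) (z : Fin 3 → K),
      IsFrame (algebraMap (RatFunc F) K) f z ∧ Spans (algebraMap (RatFunc F) K) z := by
  set j := algebraMap (RatFunc F) (AlgebraicClosure (RatFunc F)) with hj
  obtain ⟨z₀, h0⟩ := IsAlgClosed.exists_pow_nat_eq (j (ι (cofactor f 0))) two_pos
  obtain ⟨z₁, h1⟩ := IsAlgClosed.exists_pow_nat_eq (j (ι (cofactor f 1))) two_pos
  have hf2 := IsFrame.map_ne_zero j (hf.isModel.ne_zero 2)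
  have hz : IsFrame j f ![z₀, z₁, z₀ * z₁ / j (ι (f 2))] := by
    refine isFrame_of_mul hf.isModel.ne_zero h0 h1 ?_
    simp only [Matrix.cons_val_zero, Matrix.cons_val_one, Matrix.cons_val]
    field_simp
  set z := ![z₀, z₁, z₀ * z₁ / j (ι (f 2))]
  -- The span of 1 and the frame is a ring by the multiplication table; being algebraic over a
  -- field, it is a field.
  let S : Subalgebra (RatFunc F) (AlgebraicClosure (RatFunc F)) :=
    { carrier := {y | ∃ a b, y = comb j z a b}
      mul_mem' := by
        rintro _ _ ⟨a, b, rfl⟩ ⟨a', b', rfl⟩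
        exact ⟨_, _, hz.comb_mul a a' b b'⟩
      add_mem' := by
        rintro _ _ ⟨a, b, rfl⟩ ⟨a', b', rfl⟩
        exact ⟨_, _, comb_add j z a a' b b'⟩
      algebraMap_mem' := fun r => ⟨r, 0, (comb_zero j z r).symm⟩ }
  refine ⟨S.toIntermediateField' S.isField_of_algebraic, fun i => ⟨z i, 0, Pi.single i 1, ?_⟩,
    ⟨fun i => Subtype.ext (hz.sq i), fun i k l hik hil hkl =>
      Subtype.ext (hz.mul i k l hik hil hkl)⟩, ?_⟩
  · rw [comb_single, map_one, one_mul]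
  · rintro ⟨y, a, b, hab⟩
    refine ⟨a, b, Subtype.ext ?_⟩
    simp only [comb, Fin.sum_univ_three] at hab ⊢
    exact hab

/-- The conjugates of y are integral over F, the four of them add up to 4a, and y + σ_i y = 2a + 2
b_i z_i. So a and b_i² times the cofactor are algebraic over F, hence constants; if b_i were
nonzero, the cofactor would be a constant up to squares. -/
theorem exists_const_of_isIntegral {K : Type*} [Field K] [Algebra (RatFunc F) K] [Algebra F K]
    [IsScalarTower F (RatFunc F) K] (h2 : (2 : F) ≠ 0) {f : Fin 3 → F[X]} {z : Fin 3 → K}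
    (hf : IsAdmissible f) (hz : IsFrame (algebraMap (RatFunc F) K) f z)
    (hs : Spans (algebraMap (RatFunc F) K) z) {y : K} (hy : IsIntegral F y) :
    ∃ c : F, algebraMap F K c = y := by
  set A := algebraMap (RatFunc F) K with hA
  obtain ⟨a, b, rfl⟩ := hs y
  choose σ hσ using hz.exists_signAut h2 hf hs
  have hint : ∀ i, IsIntegral F (σ i (comb A z a b)) := fun i =>
    hy.map ((σ i).toAlgHom.restrictScalars F)
  have hval : ∀ i, σ i (comb A z a b) + comb A z a b = A (2 * a) + A (2 * b i) * z i := by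
    intro i
    have hc : ∀ r, σ i (A r) = A r := (σ i).commutes
    simp only [comb, map_add, map_mul, hc, hσ, Fin.sum_univ_three, map_ofNat]
    fin_cases i <;> simp <;> ring
  have hscale : ∀ (n : F) {x x' : K}, n ≠ 0 → IsIntegral F x' → x' = algebraMap F K n * x →
      IsIntegral F x := by
    intro n x x' hn hx' h
    have := (isIntegral_algebraMap (R := F) (A := K) (x := n⁻¹)).mul hx'
    rwa [h, ← mul_assoc, ← map_mul, inv_mul_cancel₀ hn, map_one, one_mul] at this
  have hFK : algebraMap F K 2 = 2 := map_ofNat _ 2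
  have ha : IsIntegral F (A a) := by
    have h4 := ((hint 0).add (hint 1)).add ((hint 2).add hy)
    refine hscale (2 * 2) (mul_ne_zero h2 h2) h4 ?_
    have e0 := hval 0
    have e1 := hval 1
    have e2 := hval 2
    rw [map_mul, hFK]
    simp only [map_mul, map_ofNat] at e0 e1 e2
    have e : comb A z a b = A a + (A (b 0) * z 0 + A (b 1) * z 1 + A (b 2) * z 2) := by
      rw [comb, Fin.sum_univ_three]
    linear_combination e0 + e1 + e2 - 2 * e
  have hb : ∀ i, b i = 0 := by
    intro i
    by_contra hbi
    have h3 : IsIntegral F (A (b i) * z i) := by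
      refine hscale 2 h2 (((hint i).add hy).sub (ha.add ha)) ?_
      rw [hval, hFK, map_mul, map_mul, map_ofNat]; ring
    have h4 : IsIntegral F (b i ^ 2 * ι (cofactor f i)) := by
      have h5 := h3.pow 2
      rw [mul_pow, hz.sq, ← map_pow, ← map_mul] at h5
      exact (isIntegral_algHom_iff (IsScalarTower.toAlgHom F (RatFunc F) K) A.injective).1 h5
    obtain ⟨c, hc⟩ : ∃ c, b i ^ 2 * ι (cofactor f i) = RatFunc.C c := by
      by_contra hne
      exact RatFunc.transcendental_of_ne_C _ hne h4.isAlgebraic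
    have hc' : b i ^ 2 * ι (cofactor f i) = ι (C c) := hc.trans (RatFunc.algebraMap_C c).symm
    have hsf := hf.isModel.squarefree_cofactor i
    have hc0 : c ≠ 0 := by
      rintro rfl
      rw [C_0, map_zero] at hc'
      exact mul_ne_zero (pow_ne_zero 2 hbi) (RatFunc.algebraMap_ne_zero hsf.ne_zero) hc'
    obtain ⟨d, hd, h5⟩ := eq_C_mul_of_squarefree hsf
      (IsUnit.squarefree (isUnit_C.2 hc0.isUnit)) hc'.symm
    have h6 := congrArg natDegree h5
    rw [natDegree_C, natDegree_C_mul hd] at h6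
    exact (hf.natDegree_pos i).ne h6
  obtain ⟨c, hc⟩ : ∃ c, a = RatFunc.C c := by
    by_contra hne
    exact RatFunc.transcendental_of_ne_C _ hne
      ((isIntegral_algHom_iff (IsScalarTower.toAlgHom F (RatFunc F) K) A.injective).1 ha).isAlgebraic
  refine ⟨c, ?_⟩
  have hb' : b = 0 := funext hb
  rw [hb', comb_zero, hc, IsScalarTower.algebraMap_apply F (RatFunc F) K]
  rfl

/-- The sign changes alone already fix nothing outside the base field. -/
theorem isGalois_of_frame {K : Type*} [Field K] [Algebra (RatFunc F) K]
    [FiniteDimensional (RatFunc F) K] (h2 : (2 : F) ≠ 0) {f : Fin 3 → F[X]} {z : Fin 3 → K}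
    (hf : IsAdmissible f) (hz : IsFrame (algebraMap (RatFunc F) K) f z)
    (hs : Spans (algebraMap (RatFunc F) K) z) : IsGalois (RatFunc F) K := by
  have h2R : (2 : RatFunc F) ≠ 0 := by
    rw [← map_ofNat (algebraMap F (RatFunc F)) 2, Ne, map_eq_zero]; exact h2
  choose σ hσ using hz.exists_signAut h2 hf hs
  refine IsGalois.of_fixedField_eq_bot _ _ (le_antisymm (fun y hy => ?_) bot_le)
  obtain ⟨a, b, rfl⟩ := hs y
  have hb : b = 0 := by
    have key : ∀ i l, l ≠ i → b l = 0 := by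
      intro i l hli
      have h1 : σ i (comb (algebraMap (RatFunc F) K) z a b) = _ :=
        (IntermediateField.mem_fixedField_iff _ _).1 hy (σ i) trivial
      have h3 : σ i (comb (algebraMap (RatFunc F) K) z a b) =
          comb (algebraMap (RatFunc F) K) z a fun l => if l = i then b l else -b l := by
        simp only [comb, map_add, map_sum, map_mul, AlgEquiv.commutes, hσ]
        congr 1
        refine Finset.sum_congr rfl fun l _ => ?_
        split_ifs
        · rfl
        · rw [map_neg]; ring
      rw [h3] at h1
      have h4 := congrFun (hz.comb_injective h2 hf h1).2 l
      rw [if_neg hli] at h4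
      have h5 : 2 * b l = 0 := by linear_combination -h4
      exact (mul_eq_zero.1 h5).resolve_left h2R
    funext l
    obtain ⟨k, _, hlk, _⟩ := exists_other l
    exact key k l hlk
  rw [hb, comb_zero]
  exact IntermediateField.algebraMap_mem _ a

/-- Every automorphism multiplies each z i by a sign, so its square is trivial, and the group has
order four. -/
theorem isKleinFour_of_frame {K : Type*} [Field K] [Algebra (RatFunc F) K]
    [FiniteDimensional (RatFunc F) K] (h2 : (2 : F) ≠ 0) {f : Fin 3 → F[X]} {z : Fin 3 → K}
    (hf : IsAdmissible f) (hz : IsFrame (algebraMap (RatFunc F) K) f z)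
    (hs : Spans (algebraMap (RatFunc F) K) z) : IsKleinFour (K ≃ₐ[RatFunc F] K) := by
  have := isGalois_of_frame h2 hf hz hs
  have h4 : Nat.card (K ≃ₐ[RatFunc F] K) = 4 := by
    rw [IsGalois.card_aut_eq_finrank, hz.finrank_eq_four h2 hf hs]
  refine ⟨h4, ?_⟩
  have hdvd : Monoid.exponent (K ≃ₐ[RatFunc F] K) ∣ 2 := by
    refine Monoid.exponent_dvd_of_forall_pow_eq_one fun σ => ?_
    have hσ : ∀ i, σ (σ (z i)) = z i := by
      intro i
      have h1 : σ (z i) ^ 2 = z i ^ 2 := by rw [← map_pow, hz.sq, AlgEquiv.commutes]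
      rcases sq_eq_sq_iff_eq_or_eq_neg.1 h1 with h | h
      · rw [h, h]
      · rw [h, map_neg, h, neg_neg]
    have h3 : ((σ ^ 2 : K ≃ₐ[RatFunc F] K) : K →+* K) = RingHom.id K := by
      refine hs.hom_ext (fun r => ?_) fun i => ?_
      · exact (σ ^ 2).commutes r
      · rw [pow_two]; exact hσ i
    exact AlgEquiv.ext fun y => congrArg (fun φ : K →+* K => φ y) h3
  rcases (Nat.dvd_prime Nat.prime_two).1 hdvd with h | h
  · have := Monoid.exp_eq_one_iff.1 h
    rw [Nat.card_of_subsingleton 1] at h4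
    norm_num at h4
  · exact h

/-- Every admissible triple defines a biquadratic curve. -/
theorem exists_curve (h2 : (2 : F) ≠ 0) {f : Fin 3 → F[X]} (hf : IsAdmissible f) :
    ∃ (C : BiquadraticCurve F) (z : Fin 3 → C.K),
      IsFrame (algebraMap (RatFunc F) C.K) f z := by
  obtain ⟨K, z, hz, hs⟩ := exists_field_of_isAdmissible hf
  have hfd : FiniteDimensional (RatFunc F) K :=
    FiniteDimensional.of_finrank_pos (by rw [hz.finrank_eq_four h2 hf hs]; norm_num)
  exact ⟨{ K := K
           finiteDimensional := hfd
           isGalois := isGalois_of_frame h2 hf hz hs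
           isKleinFour := isKleinFour_of_frame h2 hf hz hs
           constants := fun a ha => exists_const_of_isIntegral h2 hf hz hs ha }, z, hz⟩

end Existence

/-! ### Weighted counts of curves as counts of triples. -/

section MassFormula

variable {F : Type u} [Field F]

local notation "ι" => algebraMap F[X] (RatFunc F)

theorem IsFrame.map {K K' : Type*} [Field K] [Field K'] {j : RatFunc F →+* K}
    {j' : RatFunc F →+* K'} {f : Fin 3 → F[X]} {z : Fin 3 → K} (hz : IsFrame j f z)
    (φ : K →+* K') (hφ : ∀ r, φ (j r) = j' r) : IsFrame j' f fun i => φ (z i) :=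
  ⟨fun i => by rw [← map_pow, hz.sq, hφ], fun i k l hik hil hkl => by
    rw [← map_mul, hz.mul i k l hik hil hkl, map_mul, hφ]⟩

theorem IsFrame.triple_unique {K : Type*} [Field K] {j : RatFunc F →+* K} {f f' : Fin 3 → F[X]}
    {z : Fin 3 → K} (hf : IsAdmissible f) (hz : IsFrame j f z) (hz' : IsFrame j f' z) : f = f' := by
  funext l
  obtain ⟨i, k, hli, hlk, hik⟩ := exists_other l
  have h1 := hz.mul i k l hik hli.symm hlk.symm
  rw [hz'.mul i k l hik hli.symm hlk.symm] at h1
  exact (algebraMap_polynomial_injective (j.injective (mul_right_cancel₀ (hz.ne_zero hf l) h1))).symm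

namespace BiquadraticCurve

theorem Iso.card_eq {C D : BiquadraticCurve F} (e : Iso C D) : Nat.card (Iso C D) = D.autCard :=
  Nat.card_congr
    { toFun := fun φ => e.symm.trans φ
      invFun := fun φ => e.trans φ
      left_inv := fun φ => Subtype.ext (AlgEquiv.ext fun x => by simp [Iso.trans, Iso.symm])
      right_inv := fun φ => Subtype.ext (AlgEquiv.ext fun x => by simp [Iso.trans, Iso.symm]) }

/-- A choice of a biquadratic curve for every triple. -/
noncomputable def curveOf (h2 : (2 : F) ≠ 0) {g : Fin 3 → ℕ} (f : {f // HasDegrees (F := F) g f}) :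
    BiquadraticCurve F := (exists_curve h2 f.2.isAdmissible).choose

/-- The frame of the chosen curve. -/
noncomputable def frameOf (h2 : (2 : F) ≠ 0) {g : Fin 3 → ℕ}
    (f : {f // HasDegrees (F := F) g f}) : Fin 3 → (curveOf h2 f).K :=
  (exists_curve h2 f.2.isAdmissible).choose_spec.choose

theorem isFrame_frameOf (h2 : (2 : F) ≠ 0) {g : Fin 3 → ℕ} (f : {f // HasDegrees (F := F) g f}) :
    IsFrame (algebraMap (RatFunc F) (curveOf h2 f).K) f.1 (frameOf h2 f) :=
  (exists_curve h2 f.2.isAdmissible).choose_spec.choose_spec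

/-- Isomorphisms from the chosen curves correspond to frames. -/
theorem card_sigma_iso (h2 : (2 : F) ≠ 0) (D : BiquadraticCurve F) (g : Fin 3 → ℕ) :
    ∃ Φ : (Σ f : {f // HasDegrees (F := F) g f}, Iso (curveOf h2 f) D) →
      Σ τ : RatFunc F ≃ₐ[F] RatFunc F, D.frames g τ, Function.Bijective Φ := by
  suffices h : ∃ Φ : (Σ f : {f // HasDegrees (F := F) g f}, Iso (curveOf h2 f) D) →
      {p : (RatFunc F ≃ₐ[F] RatFunc F) × (Fin 3 → D.K) // p.2 ∈ D.frames g p.1},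
      Function.Bijective Φ by
    obtain ⟨Φ, hΦ⟩ := h
    exact ⟨_, (Equiv.subtypeProdEquivSigmaSubtype fun τ z => z ∈ D.frames g τ).bijective.comp hΦ⟩
  refine ⟨fun p => ⟨(p.2.2.choose, fun i => p.2.1 (frameOf h2 p.1 i)), p.1.1, p.1.2,
    (isFrame_frameOf h2 p.1).map (p.2.1 : (curveOf h2 p.1).K →+* D.K) p.2.2.choose_spec⟩, ?_, ?_⟩
  · rintro ⟨f, φ⟩ ⟨f', φ'⟩ h
    have h1 : φ.2.choose = φ'.2.choose := congrArg (fun p => p.1.1) h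
    have h3 : (fun i => φ.1 (frameOf h2 f i)) = fun i => φ'.1 (frameOf h2 f' i) :=
      congrArg (fun p => p.1.2) h
    have hφ := φ.2.choose_spec
    have hφ' := φ'.2.choose_spec
    rw [← h1] at hφ'
    have e1 := (isFrame_frameOf h2 f).map (j' := D.twistedMap φ.2.choose)
      (φ.1 : (curveOf h2 f).K →+* D.K) hφ
    have e2 := (isFrame_frameOf h2 f').map (j' := D.twistedMap φ.2.choose)
      (φ'.1 : (curveOf h2 f').K →+* D.K) hφ'
    have hff : f = f' := by
      refine Subtype.ext (IsFrame.triple_unique f.2.isAdmissible e1 ?_)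
      convert! e2 using 1
    subst hff
    have h4 : (φ.1 : (curveOf h2 f).K →+* D.K) = φ'.1 := by
      refine Spans.hom_ext (spans (τ := AlgEquiv.refl) h2 f.2.isAdmissible (isFrame_frameOf h2 f))
        (fun r => ?_) fun i => congrFun h3 i
      exact (hφ r).trans (hφ' r).symm
    have h5 : φ = φ' := Subtype.ext (AlgEquiv.ext fun y =>
      congrArg (fun ψ : (curveOf h2 f).K →+* D.K => ψ y) h4)
    rw [h5]
  -- A frame of D over f and τ is the image of the chosen frame of C_f under the homomorphism of
  -- `exists_lift`, which is onto because the frame spans D.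
  · rintro ⟨⟨τ, z⟩, f, hf, hz⟩
    set f' : {f // HasDegrees (F := F) g f} := ⟨f, hf⟩
    have hfr := isFrame_frameOf h2 f'
    have hsp := spans (τ := AlgEquiv.refl) h2 hf.isAdmissible hfr
    obtain ⟨φ, hφ, hφz⟩ := hfr.exists_lift h2 hf.isAdmissible hsp hz
    have hsurj : Function.Surjective φ := by
      intro y
      obtain ⟨a, b, rfl⟩ := spans h2 hf.isAdmissible hz y
      refine ⟨comb (algebraMap (RatFunc F) (curveOf h2 f').K) (frameOf h2 f') a b, ?_⟩
      simp only [comb, map_add, map_sum, map_mul, hφ, hφz]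
    let ψ : (curveOf h2 f').K →ₐ[F] D.K :=
      { φ with
        commutes' := fun c => by
          change φ (algebraMap F _ c) = _
          rw [IsScalarTower.algebraMap_apply F (RatFunc F) (curveOf h2 f').K, hφ, twistedMap_apply,
            τ.commutes, ← IsScalarTower.algebraMap_apply] }
    have hψ : ∀ r, ψ (algebraMap (RatFunc F) (curveOf h2 f').K r) =
        algebraMap (RatFunc F) D.K (τ r) := hφ
    let e : Iso (curveOf h2 f') D := ⟨AlgEquiv.ofBijective ψ ⟨φ.injective, hsurj⟩, τ, hψ⟩
    refine ⟨⟨f', e⟩, Subtype.ext (Prod.ext ?_ ?_)⟩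
    · refine AlgEquiv.ext fun r => (algebraMap (RatFunc F) D.K).injective ?_
      exact (e.2.choose_spec r).symm.trans (hψ r)
    · exact funext hφz

variable [Finite F]

/-- The mass of every isomorphism class, counted by triples. -/
noncomputable def mass (F : Type u) [Field F] (g : Fin 3 → ℕ) : ℕ :=
  Nat.card (RatFunc F ≃ₐ[F] RatFunc F) *
    Nat.card ({σ : Equiv.Perm (Fin 3) // ∀ i, g (σ i) = g i} × (Fin 3 → Fˣ))

theorem mass_pos (g : Fin 3 → ℕ) : 0 < mass F g := by
  have : Nonempty {σ : Equiv.Perm (Fin 3) // ∀ i, g (σ i) = g i} := ⟨1, fun _ => rfl⟩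
  exact Nat.mul_pos Nat.card_pos Nat.card_pos

/-- Isomorphisms C_f → D are counted in two ways: |Aut D| for each f with C_f ≅ D, and one for each
τ together with a frame of D, a number independent of D. -/
theorem card_mul_autCard (h2 : (2 : F) ≠ 0) {D : BiquadraticCurve F} {g : Fin 3 → ℕ}
    (hD : D.HasGenera g) (S : Finset {f // HasDegrees (F := F) g f}) (hS : ∀ f, f ∈ S) :
    #{f ∈ S | (⟦curveOf h2 f⟧ : Quotient (isoSetoid F)) = ⟦D⟧} * D.autCard = mass F g := by
  have hN : 0 < Nat.card ({σ : Equiv.Perm (Fin 3) // ∀ i, g (σ i) = g i} × (Fin 3 → Fˣ)) :=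
    Nat.pos_of_mul_pos_left (mass_pos (F := F) g)
  have hfin : ∀ τ, Finite (D.frames g τ) := fun τ =>
    Nat.finite_of_card_ne_zero (by rw [card_frames h2 hD]; exact hN.ne')
  obtain ⟨Φ, hΦ⟩ := card_sigma_iso h2 D g
  have hfinσ : Finite (Σ f : {f // HasDegrees (F := F) g f}, Iso (curveOf h2 f) D) :=
    Finite.of_injective Φ hΦ.1
  have hfinI : ∀ f, Finite (Iso (curveOf h2 f) D) := fun f =>
    Finite.of_injective (Sigma.mk (β := fun f : {f // HasDegrees (F := F) g f} =>
      Iso (curveOf h2 f) D) f) sigma_mk_injective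
  have : Fintype {f // HasDegrees (F := F) g f} := ⟨S, hS⟩
  have hcard := Nat.card_eq_of_bijective Φ hΦ
  have := Fintype.ofFinite (RatFunc F ≃ₐ[F] RatFunc F)
  rw [Nat.card_sigma, Nat.card_sigma, Finset.sum_congr rfl fun τ _ => card_frames h2 hD τ,
    Finset.sum_const, smul_eq_mul, Finset.card_univ, ← Nat.card_eq_fintype_card] at hcard
  rw [mass, ← hcard, Finset.card_filter, Finset.sum_mul]
  have hSu : S = univ := Finset.eq_univ_iff_forall.2 hS
  rw [hSu]
  refine Finset.sum_congr rfl fun f _ => ?_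
  split_ifs with h
  · obtain ⟨e⟩ := Quotient.exact h
    rw [one_mul, Iso.card_eq e]
  · have : IsEmpty (Iso (curveOf h2 f) D) := ⟨fun e => h (Quotient.sound ⟨e⟩)⟩
    rw [zero_mul, Nat.card_of_isEmpty]

theorem hasGenera_curveOf (h2 : (2 : F) ≠ 0) {g : Fin 3 → ℕ} (f : {f // HasDegrees (F := F) g f}) :
    (curveOf h2 f).HasGenera g := hasGenera_of_frame h2 f.2 (isFrame_frameOf h2 f)

/-- The family is finite, and its moments are averages over triples. -/
theorem family_eq_and_moment_eq (h2 : (2 : F) ≠ 0) (g : Fin 3 → ℕ) {Ω : Finset (Fin 3 → F[X])}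
    (hΩ : ∀ f, f ∈ Ω ↔ HasDegrees g f) :
    (family F g).Finite ∧ (Ω.Nonempty → (family F g).Nonempty) ∧
    ∀ (t : (Fin 3 → F[X]) → ℝ), (∀ (C : BiquadraticCurve F) (f z), f ∈ Ω →
      IsFrame (algebraMap (RatFunc F) C.K) f z → (C.trFrob : ℝ) = t f) → ∀ k : ℕ,
      moment F g k = (∑ f ∈ Ω, (t f / √(1 + (Nat.card F : ℝ))) ^ k) / #Ω := by
  set S : Finset {f // HasDegrees (F := F) g f} := Ω.subtype _ with hS
  have hmemS : ∀ f, f ∈ S := fun f => by rw [hS, Finset.mem_subtype, hΩ]; exact f.2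
  set c : {f // HasDegrees (F := F) g f} → Quotient (isoSetoid F) := fun f => ⟦curveOf h2 f⟧ with hc
  have hfam : family F g = ↑(S.image c) := by
    ext x
    constructor
    · rintro ⟨D, rfl, hD⟩
      have h := card_mul_autCard h2 hD S hmemS
      have hpos : 0 < #{f ∈ S | c f = ⟦D⟧} := by
        refine Nat.pos_of_mul_pos_right (b := D.autCard) ?_
        rw [h]; exact mass_pos g
      obtain ⟨f, hf⟩ := Finset.card_pos.1 hpos
      rw [Finset.mem_filter] at hf
      exact Finset.mem_coe.2 (Finset.mem_image.2 ⟨f, hf.1, hf.2⟩)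
    · intro hx
      obtain ⟨f, _, rfl⟩ := Finset.mem_image.1 (Finset.mem_coe.1 hx)
      exact ⟨_, rfl, hasGenera_curveOf h2 f⟩
  refine ⟨by rw [hfam]; exact Finset.finite_toSet _, ?_, fun t ht k => ?_⟩
  · rintro ⟨f, hf⟩
    exact ⟨_, curveOf h2 ⟨f, (hΩ f).1 hf⟩, rfl, hasGenera_curveOf h2 _⟩
  · have hm : (mass F g : ℝ) ≠ 0 := by exact_mod_cast (mass_pos (F := F) g).ne'
    -- The weight of a class is proportional to the number of triples that represent it, so the
    -- constant mass cancels in the moment.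
    have hw : ∀ x ∈ S.image c, weight x = (mass F g : ℝ)⁻¹ * (#{f ∈ S | c f = x} : ℝ) := by
      intro x hx
      obtain ⟨f, _, rfl⟩ := Finset.mem_image.1 hx
      have h := card_mul_autCard h2 (hasGenera_curveOf h2 f) S hmemS
      have ha : ((curveOf h2 f).autCard : ℝ) ≠ 0 := by
        intro h0
        rw [Nat.cast_eq_zero] at h0
        rw [h0, mul_zero] at h
        exact (mass_pos (F := F) g).ne h
      have h' : (#{f' ∈ S | c f' = c f} : ℝ) * (curveOf h2 f).autCard = mass F g := by
        exact_mod_cast h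
      change (1 : ℝ) / (curveOf h2 f).autCard = _
      rw [← h']
      have : (#{f' ∈ S | c f' = c f} : ℝ) ≠ 0 := by
        intro h0
        rw [h0, zero_mul] at h'
        exact hm h'.symm
      field_simp
    have hsum : ∀ φ : Quotient (isoSetoid F) → ℝ,
        ∑ᶠ x ∈ family F g, weight x * φ x = (mass F g : ℝ)⁻¹ * ∑ f ∈ S, φ (c f) := by
      intro φ
      rw [hfam, finsum_mem_coe_finset, Finset.sum_comp φ c, Finset.mul_sum]
      refine Finset.sum_congr rfl fun x hx => ?_
      rw [hw x hx, nsmul_eq_mul, mul_assoc]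
    have hden := hsum fun _ => 1
    simp only [mul_one] at hden
    rw [moment, hsum, hden, mul_div_mul_left _ _ (inv_ne_zero hm)]
    congr 1
    · have : ∀ f ∈ S, normalizedTrace (c f) ^ k = (t f.1 / √(1 + (Nat.card F : ℝ))) ^ k := by
        intro f hf
        rw [← ht (curveOf h2 f) f.1 (frameOf h2 f) ((hΩ _).2 f.2) (isFrame_frameOf h2 f)]
        rfl
      rw [Finset.sum_congr rfl this, hS]
      rw [Finset.sum_subtype_of_mem (fun f => (t f / √(1 + (Nat.card F : ℝ))) ^ k)
        fun f hf => (hΩ f).1 hf]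
    · rw [Finset.sum_const, nsmul_eq_mul, mul_one, hS, Finset.card_subtype,
        Finset.filter_true_of_mem fun f hf => (hΩ f).1 hf]

end BiquadraticCurve

end MassFormula

/-! ### Leading terms with respect to valuation rings. -/

section LeadingCoefficients

variable {F K : Type*} [Field F] [Field K] [Algebra F K]

local notation "κ" => algebraMap F K

/-- The expansion of `w` in powers of `π` starts with `ρ πⁿ`. -/
def HasLead (O : ValuationSubring K) (π w : K) (n : ℤ) (ρ : F) : Prop :=
  O.valuation (w * π ^ (-n) - κ ρ) < 1

/-- A valuation ring that contains the constants and in which `π` is not invertible. -/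
structure IsCentered (F : Type*) [Field F] [Algebra F K] (O : ValuationSubring K) (π : K) :
    Prop where
  const_mem : ∀ c : F, algebraMap F K c ∈ O
  ne_zero : π ≠ 0
  lt_one : O.valuation π < 1

namespace IsCentered

variable {O : ValuationSubring K} {π : K}

theorem valuation_const (hO : IsCentered F O π) {c : F} (hc : c ≠ 0) : O.valuation (κ c) = 1 := by
  refine le_antisymm ((O.valuation_le_one_iff _).2 (hO.const_mem c)) ?_
  have h := (O.valuation_le_one_iff _).2 (hO.const_mem c⁻¹)
  rw [map_inv₀, map_inv₀] at h
  have hc' : O.valuation (κ c) ≠ 0 := by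
    rw [Ne, map_eq_zero, map_eq_zero]; exact hc
  exact (inv_le_one₀ (zero_lt_iff.2 hc')).1 h

theorem valuation_pos (hO : IsCentered F O π) : 0 < O.valuation π :=
  zero_lt_iff.2 ((_root_.map_ne_zero _).2 hO.ne_zero)

theorem zpow_le_one_iff (hO : IsCentered F O π) {n : ℤ} : O.valuation π ^ n ≤ 1 ↔ 0 ≤ n := by
  rw [← zpow_zero (O.valuation π)]
  exact (zpow_right_strictAnti₀ hO.valuation_pos hO.lt_one).le_iff_ge

theorem zpow_lt_one (hO : IsCentered F O π) {n : ℤ} (hn : 0 < n) : O.valuation π ^ n < 1 := by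
  rw [← zpow_zero (O.valuation π)]
  exact zpow_right_strictAnti₀ hO.valuation_pos hO.lt_one hn

end IsCentered

namespace HasLead

variable {O : ValuationSubring K} {π : K}

theorem valuation_mul (hO : IsCentered F O π) {w : K} {n : ℤ} {ρ : F} (hρ : ρ ≠ 0)
    (h : HasLead O π w n ρ) : O.valuation (w * π ^ (-n)) = 1 := by
  have h1 : O.valuation (w * π ^ (-n) - κ ρ) < O.valuation (κ ρ) := by
    rw [hO.valuation_const hρ]; exact h
  rw [← hO.valuation_const hρ, ← Valuation.map_add_eq_of_lt_left _ h1, add_sub_cancel]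

theorem valuation_eq (hO : IsCentered F O π) {w : K} {n : ℤ} {ρ : F} (hρ : ρ ≠ 0)
    (h : HasLead O π w n ρ) : O.valuation w = O.valuation π ^ n := by
  have h1 := h.valuation_mul hO hρ
  have h3 := zpow_ne_zero n hO.valuation_pos.ne'
  rw [map_mul, map_zpow₀, zpow_neg] at h1
  exact (mul_inv_eq_one₀ h3).1 h1

theorem const (c : F) : HasLead O π (κ c) 0 c := by
  rw [HasLead, neg_zero, zpow_zero, mul_one, sub_self, map_zero]; exact zero_lt_one

theorem uniformizer (hO : IsCentered F O π) : HasLead O π π 1 (1 : F) := by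
  rw [HasLead, zpow_neg_one, mul_inv_cancel₀ hO.ne_zero, map_one, sub_self, map_zero]
  exact zero_lt_one

theorem mul (hO : IsCentered F O π) {w w' : K} {n n' : ℤ} {ρ ρ' : F} (hρ : ρ ≠ 0)
    (h : HasLead O π w n ρ) (h' : HasLead O π w' n' ρ') :
    HasLead O π (w * w') (n + n') (ρ * ρ') := by
  have e : w * w' * π ^ (-(n + n')) - κ (ρ * ρ') =
      (w * π ^ (-n)) * (w' * π ^ (-n') - κ ρ') + κ ρ' * (w * π ^ (-n) - κ ρ) := by
    rw [neg_add, zpow_add₀ hO.ne_zero, map_mul]; ring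
  rw [HasLead, e]
  refine Valuation.map_add_lt _ ?_ ?_
  · rw [map_mul, h.valuation_mul hO hρ, one_mul]; exact h'
  · rw [map_mul]
    exact (mul_le_of_le_one_left zero_le ((O.valuation_le_one_iff _).2 (hO.const_mem _))).trans_lt h

theorem inv (hO : IsCentered F O π) {w : K} {n : ℤ} {ρ : F} (hρ : ρ ≠ 0)
    (h : HasLead O π w n ρ) : HasLead O π w⁻¹ (-n) ρ⁻¹ := by
  have h1 := h.valuation_mul hO hρ
  have hw : w * π ^ (-n) ≠ 0 := by
    intro h0; rw [h0, map_zero] at h1; exact zero_ne_one h1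
  have hc : κ ρ ≠ 0 := by rwa [Ne, map_eq_zero]
  have e : w⁻¹ * π ^ (- -n) - κ ρ⁻¹ =
      -((w * π ^ (-n))⁻¹ * (κ ρ)⁻¹ * (w * π ^ (-n) - κ ρ)) := by
    have e1 : w⁻¹ * π ^ (- -n) = (w * π ^ (-n))⁻¹ := by rw [mul_inv, zpow_neg]
    rw [e1, map_inv₀]
    generalize w * π ^ (-n) = x at hw ⊢
    field_simp
    ring
  rw [HasLead, e, Valuation.map_neg, map_mul, map_mul, map_inv₀, map_inv₀, h1,
    hO.valuation_const hρ, inv_one, one_mul, one_mul]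
  exact h

/-- Adding a smaller term. -/
theorem add_small (hO : IsCentered F O π) {w w' : K} {n : ℤ} {ρ : F} (h : HasLead O π w n ρ)
    (h' : O.valuation w' < O.valuation π ^ n) : HasLead O π (w + w') n ρ := by
  have e : (w + w') * π ^ (-n) - κ ρ = (w * π ^ (-n) - κ ρ) + w' * π ^ (-n) := by ring
  rw [HasLead, e]
  refine Valuation.map_add_lt _ h ?_
  rw [map_mul, map_zpow₀, zpow_neg]
  exact (mul_inv_lt_iff₀ (zpow_pos hO.valuation_pos n)).2 (by rwa [one_mul])

theorem mem_iff (hO : IsCentered F O π) {w : K} {n : ℤ} {ρ : F} (hρ : ρ ≠ 0)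
    (h : HasLead O π w n ρ) : w ∈ O ↔ 0 ≤ n := by
  rw [← O.valuation_le_one_iff, h.valuation_eq hO hρ, hO.zpow_le_one_iff]

end HasLead

/-- The valuation rings of a set assign the same leading term to `w`. -/
def Agree (F : Type*) [Field F] [Algebra F K] (𝒪 : Set (ValuationSubring K)) (π w : K) : Prop :=
  ∃ (n : ℤ) (ρ : F), ρ ≠ 0 ∧ ∀ O ∈ 𝒪, HasLead O π w n ρ

/-- The ring `S + S u`. -/
def Subring.adjoinSqrt (S : Subring K) (u : K) (hu : u ^ 2 ∈ S) : Subring K where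
  carrier := {w | ∃ a ∈ S, ∃ b ∈ S, w = a + b * u}
  mul_mem' := by
    rintro _ _ ⟨a, ha, b, hb, rfl⟩ ⟨a', ha', b', hb', rfl⟩
    exact ⟨a * a' + b * b' * u ^ 2, add_mem (mul_mem ha ha') (mul_mem (mul_mem hb hb') hu),
      a * b' + b * a', add_mem (mul_mem ha hb') (mul_mem hb ha'), by ring⟩
  one_mem' := ⟨1, one_mem S, 0, zero_mem S, by simp⟩
  add_mem' := by
    rintro _ _ ⟨a, ha, b, hb, rfl⟩ ⟨a', ha', b', hb', rfl⟩
    exact ⟨a + a', add_mem ha ha', b + b', add_mem hb hb', by ring⟩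
  zero_mem' := ⟨0, zero_mem S, 0, zero_mem S, by simp⟩
  neg_mem' := by
    rintro _ ⟨a, ha, b, hb, rfl⟩
    exact ⟨-a, neg_mem ha, -b, neg_mem hb, by ring⟩

/-- Leading terms extend to a quadratic extension in which the place splits. -/
theorem agree_of_split (h2 : (2 : F) ≠ 0) {𝒪 : Set (ValuationSubring K)} {π : K}
    (hne : 𝒪.Nonempty) (hO : ∀ O ∈ 𝒪, IsCentered F O π) {S : Subring K} (hFS : ∀ c : F, κ c ∈ S)
    (hS : ∀ w ∈ S, w ≠ 0 → Agree F 𝒪 π w) {u : K} (hu : u ^ 2 ∈ S) {s : F} (hs : s ≠ 0)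
    (hus : ∀ O ∈ 𝒪, O.valuation (u - κ s) < 1) :
    ∀ w ∈ S.adjoinSqrt u hu, w ≠ 0 → Agree F 𝒪 π w := by
  rintro _ ⟨a, ha, b, hb, rfl⟩ hw
  by_cases hb0 : b = 0
  · subst hb0
    rw [zero_mul, add_zero] at hw ⊢
    exact hS a ha hw
  set e := a + b * κ s with he
  have heS : e ∈ S := add_mem ha (mul_mem hb (hFS s))
  have hew : a + b * u = e + b * (u - κ s) := by rw [he]; ring
  obtain ⟨n, ρ, hρ, hbl⟩ := hS b hb hb0
  have hsmall : ∀ O ∈ 𝒪, O.valuation (b * (u - κ s)) < O.valuation π ^ n := fun O hOO => by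
    rw [map_mul, (hbl O hOO).valuation_eq (hO O hOO) hρ]
    exact mul_lt_of_lt_one_right (zpow_pos (hO O hOO).valuation_pos n) (hus O hOO)
  -- If the exponent of e = a + b s does not exceed that of b, then e dominates b(u − s). Otherwise
  -- a + b u suffers cancellation, but its conjugate a − b u has the leading term of −2 s b, and a +
  -- b u is the norm divided by the conjugate.
  by_cases hcase : e ≠ 0 ∧ ∃ n' ρ', ρ' ≠ 0 ∧ n' ≤ n ∧ ∀ O ∈ 𝒪, HasLead O π e n' (ρ' : F)
  · obtain ⟨_, n', ρ', hρ', hn, hel⟩ := hcase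
    refine ⟨n', ρ', hρ', fun O hOO => ?_⟩
    rw [hew]
    refine (hel O hOO).add_small (hO O hOO) (lt_of_lt_of_le (hsmall O hOO) ?_)
    exact (zpow_right_strictAnti₀ (hO O hOO).valuation_pos (hO O hOO).lt_one).antitone hn
  · have hev : ∀ O ∈ 𝒪, O.valuation e < O.valuation π ^ n := by
      intro O hOO
      by_cases he0 : e = 0
      · rw [he0, map_zero]; exact zpow_pos (hO O hOO).valuation_pos n
      · obtain ⟨n', ρ', hρ', hel⟩ := hS e heS he0
        rw [(hel O hOO).valuation_eq (hO O hOO) hρ']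
        refine zpow_right_strictAnti₀ (hO O hOO).valuation_pos (hO O hOO).lt_one ?_
        by_contra hn
        exact hcase ⟨he0, n', ρ', hρ', not_lt.1 hn, hel⟩
    have hconj : ∀ O ∈ 𝒪, HasLead O π (a - b * u) (n + 0) (ρ * (-2 * s)) := by
      intro O hOO
      have e1 : a - b * u = b * κ (-2 * s) + (e - b * (u - κ s)) := by
        rw [he, map_mul, map_neg, map_ofNat]; ring
      rw [e1]
      refine ((hbl O hOO).mul (hO O hOO) hρ (HasLead.const _)).add_small (hO O hOO) ?_
      rw [add_zero]
      exact Valuation.map_sub_lt _ (hev O hOO) (hsmall O hOO)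
    have hρ2 : ρ * (-2 * s) ≠ 0 := mul_ne_zero hρ (mul_ne_zero (neg_ne_zero.2 h2) hs)
    obtain ⟨O₀, hO₀⟩ := hne
    have hne' : a - b * u ≠ 0 := by
      intro h0
      have := (hconj O₀ hO₀).valuation_mul (hO O₀ hO₀) hρ2
      rw [h0, zero_mul, map_zero] at this
      exact zero_ne_one this
    have hN : a ^ 2 - b ^ 2 * u ^ 2 ≠ 0 := by
      rw [← mul_pow, sq_sub_sq]
      exact mul_ne_zero hw hne'
    obtain ⟨n', ρ', hρ', hNl⟩ := hS _ (sub_mem (pow_mem ha 2) (mul_mem (pow_mem hb 2) hu)) hN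
    refine ⟨n' + -(n + 0), ρ' * (ρ * (-2 * s))⁻¹, mul_ne_zero hρ' (inv_ne_zero hρ2),
      fun O hOO => ?_⟩
    have e2 : a + b * u = (a ^ 2 - b ^ 2 * u ^ 2) * (a - b * u)⁻¹ := by
      rw [eq_mul_inv_iff_mul_eq₀ hne']; ring
    rw [e2]
    exact (hNl O hOO).mul (hO O hOO) hρ' ((hconj O hOO).inv (hO O hOO) hρ2)

/-- Membership in a quadratic extension in which the place ramifies. -/
theorem mem_iff_of_ramified {𝒪 : Set (ValuationSubring K)} {π : K}
    (hO : ∀ O ∈ 𝒪, IsCentered F O π) {S : Subring K}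
    (hS : ∀ w ∈ S, w ≠ 0 → Agree F 𝒪 π w) {u : K} {N : ℤ} {ρ : F} (hρ : ρ ≠ 0)
    (hN : Odd N) (hus : ∀ O ∈ 𝒪, HasLead O π (u ^ 2) N ρ) {a b : K} (ha : a ∈ S) (hb : b ∈ S) :
    ∃ p : Prop, (∀ O ∈ 𝒪, a + b * u ∈ O ↔ p) ∧
      (p → ∃ c : F, ∀ O ∈ 𝒪, O.valuation (a + b * u - κ c) < 1) := by
  have hbu : ∃ m : ℤ, ∀ O ∈ 𝒪, b ≠ 0 → O.valuation (b * u) ^ 2 = O.valuation π ^ (2 * m + N) := by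
    by_cases hb0 : b = 0
    · exact ⟨0, fun O _ h => absurd hb0 h⟩
    · obtain ⟨m, σ, hσ, hbl⟩ := hS b hb hb0
      refine ⟨m, fun O hOO _ => ?_⟩
      have h := (((hbl O hOO).mul (hO O hOO) hσ (hbl O hOO)).mul (hO O hOO) (mul_ne_zero hσ hσ)
        (hus O hOO)).valuation_eq (hO O hOO) (mul_ne_zero (mul_ne_zero hσ hσ) hρ)
      rw [← map_pow, ← two_mul] at *
      rw [← h]
      congr 1; ring
  obtain ⟨m, hm⟩ := hbu
  have hav : ∃ (n : ℤ) (c : F), ∀ O ∈ 𝒪, a ≠ 0 → O.valuation a = O.valuation π ^ n ∧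
      (0 ≤ n → O.valuation (a - κ c) < 1) := by
    by_cases ha0 : a = 0
    · exact ⟨0, 0, fun O _ h => absurd ha0 h⟩
    · obtain ⟨n, σ, hσ, hal⟩ := hS a ha ha0
      refine ⟨n, if n = 0 then σ else 0, fun O hOO _ => ⟨(hal O hOO).valuation_eq (hO O hOO) hσ,
        fun hn => ?_⟩⟩
      split_ifs with h0
      · have := hal O hOO
        rwa [HasLead, h0, neg_zero, zpow_zero, mul_one] at this
      · rw [map_zero, sub_zero, (hal O hOO).valuation_eq (hO O hOO) hσ]
        exact (hO O hOO).zpow_lt_one (lt_of_le_of_ne hn (Ne.symm h0))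
  obtain ⟨n, c, hn⟩ := hav
  have hbu1 : ∀ O ∈ 𝒪, (b = 0 ∨ 0 ≤ 2 * m + N) → O.valuation (b * u) < 1 := by
    rintro O hOO (h | h)
    · rw [h, zero_mul, map_zero]; exact zero_lt_one
    · by_cases hb0 : b = 0
      · rw [hb0, zero_mul, map_zero]; exact zero_lt_one
      · refine lt_of_pow_lt_pow_left₀ 2 zero_le_one ?_
        rw [hm O hOO hb0, one_pow]
        refine (hO O hOO).zpow_lt_one (lt_of_le_of_ne h fun h0 => ?_)
        obtain ⟨l, rfl⟩ := hN
        omega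
  refine ⟨(a = 0 ∨ 0 ≤ n) ∧ (b = 0 ∨ 0 ≤ 2 * m + N), fun O hOO => ?_, fun hp =>
    ⟨if a = 0 then 0 else c, fun O hOO => ?_⟩⟩
  · have hne : a ≠ 0 → b ≠ 0 → O.valuation a ≠ O.valuation (b * u) := by
      intro ha0 hb0 h
      have h1 := hm O hOO hb0
      rw [← h, (hn O hOO ha0).1, ← zpow_natCast, ← zpow_mul] at h1
      have := (zpow_right_strictAnti₀ (hO O hOO).valuation_pos (hO O hOO).lt_one).injective h1
      obtain ⟨l, rfl⟩ := hN
      push_cast at this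
      omega
    have hbv : b ≠ 0 → (O.valuation (b * u) ≤ 1 ↔ 0 ≤ 2 * m + N) := fun hb0 => by
      rw [← (hO O hOO).zpow_le_one_iff, ← hm O hOO hb0, sq_le_one_iff₀ zero_le]
    have hva : a ≠ 0 → (O.valuation a ≤ 1 ↔ 0 ≤ n) := fun ha0 => by
      rw [(hn O hOO ha0).1, (hO O hOO).zpow_le_one_iff]
    rw [← O.valuation_le_one_iff]
    by_cases ha0 : a = 0
    · by_cases hb0 : b = 0
      · simp [ha0, hb0]
      · simp [ha0, hb0, ← hbv hb0]
    · by_cases hb0 : b = 0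
      · simp [ha0, hb0, ← hva ha0]
      · rw [Valuation.map_add_of_distinct_val _ (hne ha0 hb0), max_le_iff, hva ha0, hbv hb0]
        simp [ha0, hb0]
  · have h1 : O.valuation (a - κ (if a = 0 then 0 else c)) < 1 := by
      split_ifs with ha0
      · rw [ha0, map_zero, sub_zero, map_zero]; exact zero_lt_one
      · exact (hn O hOO ha0).2 (hp.1.resolve_left ha0)
    rw [add_sub_right_comm]
    exact Valuation.map_add_lt _ h1 (hbu1 O hOO hp.2)

end LeadingCoefficients

/-! ### Valuation rings over the rational points of the line. -/

section PlacesOfLine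

variable {F K : Type*} [Field F] [Field K] [Algebra F K] [Algebra (RatFunc F) K]
  [IsScalarTower F (RatFunc F) K]

local notation "ι" => algebraMap F[X] (RatFunc F)
local notation "A" => algebraMap (RatFunc F) K

/-- The uniformizers at the rational points of the projective line. -/
noncomputable def unif : Option F → RatFunc F
  | none => RatFunc.X⁻¹
  | some c => ι (X - C c)

theorem HasLead.zpow {O : ValuationSubring K} {π : K} (hO : IsCentered F O π) (n : ℤ) :
    HasLead O π (π ^ n) n (1 : F) := by
  rw [HasLead, ← zpow_add₀ hO.ne_zero, add_neg_cancel, zpow_zero, map_one, sub_self, map_zero]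
  exact zero_lt_one

theorem IsCentered.polynomial_mem {O : ValuationSubring K} {c : F}
    (hO : IsCentered F O (A (unif (some c)))) (p : F[X]) : A (ι p) ∈ O := by
  have hC : ∀ a : F, A (ι (C a)) ∈ O := fun a => by
    rw [algebraMap_C_eq, ← IsScalarTower.algebraMap_apply]; exact hO.const_mem a
  have hX : A (ι X) ∈ O := by
    have h1 : A (ι (X - C c)) ∈ O := (O.valuation_le_one_iff _).1 hO.lt_one.le
    have := add_mem h1 (hC c)
    rwa [← map_add, ← map_add, sub_add_cancel] at this
  induction p using Polynomial.induction_on' with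
  | add p p' hp hp' => rw [map_add, map_add]; exact add_mem hp hp'
  | monomial n a =>
    rw [← C_mul_X_pow_eq_monomial, map_mul, map_mul, map_pow, map_pow]
    exact mul_mem (hC a) (pow_mem hX n)

theorem hasLead_of_eval {O : ValuationSubring K} {c : F}
    (hO : IsCentered F O (A (unif (some c)))) (p : F[X]) :
    HasLead O (A (unif (some c))) (A (ι p)) 0 (p.eval c) := by
  obtain ⟨r, hr⟩ := X_sub_C_dvd_sub_C_eval (a := c) (p := p)
  rw [HasLead, neg_zero, zpow_zero, mul_one, IsScalarTower.algebraMap_apply F (RatFunc F) K,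
    ← algebraMap_C_eq, ← map_sub, ← map_sub, hr, map_mul, map_mul, map_mul]
  exact mul_lt_of_lt_of_le_one hO.lt_one ((O.valuation_le_one_iff _).2 (hO.polynomial_mem r))

theorem hasLead_of_leadingCoeff {O : ValuationSubring K} (hO : IsCentered F O (A (unif none)))
    {p : F[X]} (hp : p ≠ 0) :
    HasLead O (A (unif none)) (A (ι p)) (-(p.natDegree : ℤ)) p.leadingCoeff := by
  induction hn : p.natDegree using Nat.strong_induction_on generalizing p with
  | _ n ih =>
  have hX : A (ι X) = (A (unif none)) ^ (-1 : ℤ) := by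
    rw [zpow_neg_one, unif, map_inv₀, inv_inv, ratFunc_X_eq]
  have hmon : HasLead O (A (unif none)) (A (ι (C p.leadingCoeff * X ^ p.natDegree)))
      (0 + -(n : ℤ)) (p.leadingCoeff * 1) := by
    have e : A (ι (C p.leadingCoeff * X ^ p.natDegree)) =
        algebraMap F K p.leadingCoeff * (A (unif none)) ^ (-(n : ℤ)) := by
      rw [map_mul, map_mul, algebraMap_C_eq, ← IsScalarTower.algebraMap_apply, map_pow, map_pow, hX,
        ← zpow_natCast, ← zpow_mul, hn, neg_one_mul]
    rw [e]
    exact (HasLead.const _).mul hO (leadingCoeff_ne_zero.2 hp) (HasLead.zpow hO _)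
  rw [zero_add, mul_one] at hmon
  have hsum : A (ι p) =
      A (ι (C p.leadingCoeff * X ^ p.natDegree)) + A (ι p.eraseLead) := by
    rw [← map_add, ← map_add, add_comm, p.eraseLead_add_C_mul_X_pow]
  rw [hsum]
  refine hmon.add_small hO ?_
  by_cases h0 : p.eraseLead = 0
  · rw [h0, map_zero, map_zero, map_zero]
    exact zpow_pos hO.valuation_pos _
  · have hlt : p.eraseLead.natDegree < n := by
      rw [← hn]
      exact (eraseLead_natDegree_lt_or_eraseLead_eq_zero p).resolve_right h0
    rw [(ih _ hlt h0 rfl).valuation_eq hO (leadingCoeff_ne_zero.2 h0)]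
    refine zpow_right_strictAnti₀ hO.valuation_pos hO.lt_one ?_
    omega

/-- Functions on the projective line have the same leading term in all valuation rings over a
rational point. -/
theorem agree_algebraMap (x : Option F) {r : RatFunc F} (hr : r ≠ 0) :
    Agree F {O | IsCentered F O (A (unif x))} (A (unif x)) (A r) := by
  have hpoly : ∀ p : F[X], p ≠ 0 →
      Agree F {O | IsCentered F O (A (unif x))} (A (unif x)) (A (ι p)) := by
    intro p hp
    cases x with
    | none =>
      exact ⟨_, _, leadingCoeff_ne_zero.2 hp, fun O hO => hasLead_of_leadingCoeff hO hp⟩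
    | some c =>
      obtain ⟨p', hpp, hp'⟩ := exists_eq_pow_rootMultiplicity_mul_and_not_dvd p hp c
      have hev : p'.eval c ≠ 0 := fun h => hp' (dvd_iff_isRoot.2 h)
      refine ⟨rootMultiplicity c p + 0, 1 * p'.eval c, mul_ne_zero one_ne_zero hev, fun O hO => ?_⟩
      have h := (HasLead.zpow hO (rootMultiplicity c p : ℤ)).mul hO one_ne_zero
        (hasLead_of_eval hO p')
      convert! h using 1
      conv_lhs => rw [hpp]
      rw [map_mul, map_mul, map_pow, map_pow, zpow_natCast]
      rfl
  obtain ⟨n, ρ, hρ, h1⟩ := hpoly r.num (RatFunc.num_ne_zero hr)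
  obtain ⟨n', ρ', hρ', h3⟩ := hpoly r.denom r.denom_ne_zero
  refine ⟨n + -n', ρ * ρ'⁻¹, mul_ne_zero hρ (inv_ne_zero hρ'), fun O hO => ?_⟩
  rw [← RatFunc.num_div_denom r, div_eq_mul_inv, map_mul, map_inv₀]
  exact (h1 O hO).mul hO hρ ((h3 O hO).inv hO hρ')

/-- The expansion of the products in pairs at a rational point of the line. -/
theorem hasLead_cofactor {f : Fin 3 → F[X]} (hf : IsModel ∅ f) {x : Option F}
    {ρ : Option (Fin 3)} (hρ : RamPlace f x ρ) (i : Fin 3) :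
    ((ρ = none ∨ ρ = some i) → ∃ e : ℤ, ∀ O : ValuationSubring K, IsCentered F O (A (unif x)) →
      HasLead O (A (unif x)) (A (ι (cofactor f i))) (2 * e)
        (∏ j ∈ univ.erase i, localValue f x j)) ∧
    (¬ (ρ = none ∨ ρ = some i) → ∃ (N : ℤ) (σ : F), Odd N ∧ σ ≠ 0 ∧ ∀ O : ValuationSubring K,
      IsCentered F O (A (unif x)) → HasLead O (A (unif x)) (A (ι (cofactor f i))) N σ) := by
  cases x with
  | none =>
    have hlead : ∏ j ∈ univ.erase i, localValue f none j = (cofactor f i).leadingCoeff := by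
      rw [cofactor, leadingCoeff_prod]; rfl
    have hdeg : (cofactor f i).natDegree = ∑ j ∈ univ.erase i, (f j).natDegree :=
      natDegree_prod _ _ fun j _ => hf.ne_zero j
    have hne := (hf.squarefree_cofactor i).ne_zero
    refine ⟨fun h => ?_, fun h => ?_⟩
    · obtain ⟨e, he⟩ := (hρ i).2 h
      refine ⟨-(e : ℤ), fun O hO => ?_⟩
      have := hasLead_of_leadingCoeff hO hne
      rw [hlead]
      convert! this using 1
      rw [hdeg, he]; push_cast; ring
    · have hodd : Odd (cofactor f i).natDegree := by
        rw [hdeg, ← Nat.not_even_iff_odd]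
        exact fun h' => h ((hρ i).1 h')
      exact ⟨_, _, (by exact_mod_cast hodd : Odd ((cofactor f i).natDegree : ℤ)).neg,
        leadingCoeff_ne_zero.2 hne, fun O hO => hasLead_of_leadingCoeff hO hne⟩
  | some c =>
    have heval : ∏ j ∈ univ.erase i, localValue f (some c) j = (cofactor f i).eval c := by
      rw [cofactor, eval_prod]; rfl
    refine ⟨fun _ => ⟨0, fun O hO => ?_⟩, fun h => ?_⟩
    · rw [heval]; exact hasLead_of_eval hO _
    · obtain ⟨k, rfl, hki⟩ : ∃ k, ρ = some k ∧ k ≠ i := by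
        cases ρ with
        | none => exact absurd (Or.inl rfl) h
        | some k => exact ⟨k, rfl, fun hk => h (Or.inr (by rw [hk]))⟩
      obtain ⟨l, hil, hkl⟩ := (by decide : ∀ i k : Fin 3, ∃ l, i ≠ l ∧ k ≠ l) i k
      have hroot : (f k).eval c = 0 := (hρ k).2 rfl
      have hl : (f l).eval c ≠ 0 := fun h0 => hkl (Option.some.inj ((hρ l).1 h0))
      -- Only f k vanishes at c, and only to first order since it is squarefree; hence the odd
      -- exponent is 1.
      obtain ⟨p, hp⟩ := dvd_iff_isRoot.2 hroot
      have hpc : p.eval c ≠ 0 := by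
        intro h0
        obtain ⟨p', rfl⟩ := dvd_iff_isRoot.2 h0
        have hdvd : (X - C c) * (X - C c) ∣ f k := ⟨p', by rw [hp]; ring⟩
        exact not_isUnit_X_sub_C c (hf.1 k _ hdvd)
      refine ⟨1, (p * f l).eval c, odd_one, ?_, fun O hO => ?_⟩
      · rw [eval_mul]; exact mul_ne_zero hpc hl
      · have h1 := (HasLead.uniformizer hO).mul hO one_ne_zero (hasLead_of_eval hO (p * f l))
        rw [add_zero, one_mul] at h1
        convert! h1 using 1
        rw [cofactor_eq (Ne.symm hki) hil hkl, hp, mul_assoc, map_mul, map_mul]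
        rfl

theorem transcendental_unif (x : Option F) : Transcendental F (A (unif x)) := by
  have hX : ∀ c c' : F, ι (X - C c) ≠ ι (C c') := by
    intro c c' h
    have := congrArg natDegree (algebraMap_polynomial_injective h)
    rw [natDegree_X_sub_C, natDegree_C] at this
    exact one_ne_zero this
  have h : Transcendental F (unif x) := by
    refine RatFunc.transcendental_of_ne_C _ ?_
    rintro ⟨c, hc⟩
    rw [← RatFunc.algebraMap_C] at hc
    cases x with
    | none =>
      refine hX 0 c⁻¹ ?_
      rw [unif, inv_eq_iff_eq_inv] at hc
      rw [C_0, sub_zero, ← ratFunc_X_eq, hc, algebraMap_C_eq, algebraMap_C_eq, map_inv₀]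
    | some a => exact hX a c hc
  intro h'
  exact h ((isAlgebraic_algebraMap_iff (algebraMap (RatFunc F) K).injective).1 h')

/-- There are valuation rings over every point of the line. -/
theorem exists_isCentered {π : K} (hπ : Transcendental F π) :
    ∃ O : ValuationSubring K, IsCentered F O π := by
  have hinj := transcendental_iff_injective.1 hπ
  -- F[π] is a polynomial ring because π is transcendental, so π generates a proper ideal, and some
  -- valuation ring contains F[π] with that ideal inside its nonunits.
  set R : Subring K := (aeval π : F[X] →ₐ[F] K).toRingHom.range with hR
  have hmem : ∀ p : F[X], aeval π p ∈ R := fun p => ⟨p, rfl⟩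
  have hπR : π ∈ R := by simpa using hmem X
  set I : Ideal R := Ideal.span {⟨π, hπR⟩} with hI
  have hne : I ≠ ⊤ := by
    intro h
    rw [hI, Ideal.span_singleton_eq_top] at h
    obtain ⟨⟨b, p, rfl⟩, hb⟩ := h.exists_right_inv
    have h1 : π * aeval π p = 1 := congrArg Subtype.val hb
    have h3 : X * p = 1 := hinj (by rw [map_mul, aeval_X, h1, map_one])
    have := congrArg (eval 0) h3
    simp at this
  obtain ⟨O, hO1, hO2⟩ := Ideal.image_subset_nonunits_valuationSubring I hne
  refine ⟨O, fun c => hO1 ?_, ?_, ?_⟩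
  · simpa using hmem (C c)
  · rintro rfl
    refine hπ ⟨X, X_ne_zero, by simp⟩
  · exact (ValuationSubring.mem_nonunits_iff O).1 (hO2 ⟨⟨π, hπR⟩, Ideal.mem_span_singleton_self _, rfl⟩)

end PlacesOfLine

/-! ### Fibres over the rational points of the line. -/

section Fibres

variable {F K : Type*} [Field F] [Field K] [Algebra F K] [Algebra (RatFunc F) K]
  [IsScalarTower F (RatFunc F) K]

local notation "ι" => algebraMap F[X] (RatFunc F)
local notation "A" => algebraMap (RatFunc F) K
local notation "κ" => algebraMap F K

/-- The rational valuation rings over a rational point of the line. -/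
def rationalFibre (F K : Type*) [Field F] [Field K] [Algebra F K] [Algebra (RatFunc F) K]
    (x : Option F) : Set (ValuationSubring K) :=
  {O | IsCentered F O (algebraMap (RatFunc F) K (unif x)) ∧
    ∀ y ∈ O, ∃ c : F, O.valuation (y - algebraMap F K c) < 1}

theorem IsCentered.near_unique {O : ValuationSubring K} {π : K} (hO : IsCentered F O π) {y : K}
    {s s' : F} (h : O.valuation (y - κ s) < 1) (h' : O.valuation (y - κ s') < 1) : s = s' := by
  by_contra hne
  have h1 := Valuation.map_sub_lt _ h' h
  rw [sub_sub_sub_cancel_left, ← map_sub, hO.valuation_const (sub_ne_zero.2 hne)] at h1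
  exact lt_irrefl _ h1

theorem near_or_near_neg {O : ValuationSubring K} {y : K} {s : F}
    (h : O.valuation (y ^ 2 - κ (s ^ 2)) < 1) :
    O.valuation (y - κ s) < 1 ∨ O.valuation (-y - κ s) < 1 := by
  by_contra! hcon
  have e : y ^ 2 - κ (s ^ 2) = -((y - κ s) * (-y - κ s)) := by rw [map_pow]; ring
  rw [e, Valuation.map_neg, map_mul] at h
  exact absurd h (not_lt.2 (one_le_mul hcon.1 hcon.2))

theorem IsCentered.exists_sqrt {x : Option F} {O : ValuationSubring K}
    (hO : O ∈ rationalFibre F K x) {y : K} {ρ : F} (h : O.valuation (y ^ 2 - κ ρ) < 1) :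
    ∃ s, s ^ 2 = ρ ∧ O.valuation (y - κ s) < 1 := by
  have hy : y ∈ O := by
    have h1 : y ^ 2 ∈ O := by
      have := add_mem ((O.valuation_le_one_iff _).1 h.le) (hO.1.const_mem ρ)
      rwa [sub_add_cancel] at this
    rw [← O.valuation_le_one_iff, map_pow] at h1
    rw [← O.valuation_le_one_iff]
    exact (pow_le_one_iff two_ne_zero).1 h1
  obtain ⟨s, hs⟩ := hO.2 y hy
  refine ⟨s, hO.1.near_unique (y := y ^ 2) ?_ h, hs⟩
  have e : y ^ 2 - κ (s ^ 2) = (y + κ s) * (y - κ s) := by rw [map_pow]; ring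
  rw [e, map_mul]
  exact (mul_le_of_le_one_left zero_le
    ((O.valuation_le_one_iff _).2 (add_mem hy (hO.1.const_mem s)))).trans_lt hs

theorem valuation_comap_lt_one_iff (O : ValuationSubring K) (σ : K ≃ₐ[RatFunc F] K) (w : K) :
    (O.comap (σ : K →+* K)).valuation w < 1 ↔ O.valuation (σ w) < 1 := by
  rw [← ValuationSubring.mem_nonunits_iff, ← ValuationSubring.mem_nonunits_iff,
    ValuationSubring.mem_nonunits_iff_or, ValuationSubring.mem_nonunits_iff_or,
    ValuationSubring.mem_comap, map_inv₀]
  simp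

theorem IsCentered.comap {O : ValuationSubring K} {r : RatFunc F} (hO : IsCentered F O (A r))
    (σ : K ≃ₐ[RatFunc F] K) : IsCentered F (O.comap (σ : K →+* K)) (A r) := by
  refine ⟨fun c => ?_, hO.ne_zero, ?_⟩
  · rw [ValuationSubring.mem_comap, IsScalarTower.algebraMap_apply F (RatFunc F) K]
    change σ _ ∈ O
    rw [σ.commutes, ← IsScalarTower.algebraMap_apply]
    exact hO.const_mem c
  · rw [valuation_comap_lt_one_iff, σ.commutes]; exact hO.lt_one

/-- An automorphism changing the sign of `y` moves the residue of `y` to any prescribed root. -/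
theorem exists_centered_near {O : ValuationSubring K} {r : RatFunc F} (hO : IsCentered F O (A r))
    {σ : K ≃ₐ[RatFunc F] K} {y : K} (hσ : σ y = -y) {s : F}
    (h : O.valuation (y ^ 2 - κ (s ^ 2)) < 1) :
    ∃ O' : ValuationSubring K, IsCentered F O' (A r) ∧ O'.valuation (y - κ s) < 1 ∧
      ∀ w t, σ w = w → O.valuation (w - κ t) < 1 → O'.valuation (w - κ t) < 1 := by
  have hconst : ∀ t, σ (κ t) = κ t := fun t => by
    rw [IsScalarTower.algebraMap_apply F (RatFunc F) K, σ.commutes]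
  rcases near_or_near_neg h with h | h
  · exact ⟨O, hO, h, fun w t _ h' => h'⟩
  · refine ⟨_, hO.comap σ, ?_, fun w t hw h' => ?_⟩
    · rw [valuation_comap_lt_one_iff, map_sub, hσ, hconst]; exact h
    · rw [valuation_comap_lt_one_iff, map_sub, hw, hconst]; exact h'

theorem agree_range {x : Option F} {𝒪 : Set (ValuationSubring K)}
    (h𝒪 : ∀ O ∈ 𝒪, IsCentered F O (A (unif x))) :
    ∀ w ∈ (algebraMap (RatFunc F) K).range, w ≠ 0 → Agree F 𝒪 (A (unif x)) w := by
  rintro _ ⟨r, rfl⟩ hr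
  obtain ⟨n, ρ, hρ, h⟩ := agree_algebraMap (K := K) x (r := r) (by rintro rfl; simp at hr)
  exact ⟨n, ρ, hρ, fun O hO => h O (h𝒪 O hO)⟩

theorem const_mem_range (c : F) : κ c ∈ (algebraMap (RatFunc F) K).range :=
  ⟨algebraMap F (RatFunc F) c, (IsScalarTower.algebraMap_apply F (RatFunc F) K c).symm⟩

theorem Subring.le_adjoinSqrt {S : Subring K} {u : K} (hu : u ^ 2 ∈ S) : S ≤ S.adjoinSqrt u hu :=
  fun a ha => ⟨a, ha, 0, zero_mem S, by simp⟩

/-- The fibre over an unramified point. -/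
theorem card_rationalFibre_unramified (h2 : (2 : F) ≠ 0) {x : Option F} {y₀ y₁ : K}
    (h₀ : y₀ ^ 2 ∈ (algebraMap (RatFunc F) K).range)
    (h₁ : y₁ ^ 2 ∈ (algebraMap (RatFunc F) K).range.adjoinSqrt y₀ h₀)
    (htop : ∀ w, w ∈ ((algebraMap (RatFunc F) K).range.adjoinSqrt y₀ h₀).adjoinSqrt y₁ h₁)
    {σ₀ σ₁ : K ≃ₐ[RatFunc F] K} (h₀₀ : σ₀ y₀ = -y₀) (h₁₁ : σ₁ y₁ = -y₁) (h₁₀ : σ₁ y₀ = y₀)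
    {ρ₀ ρ₁ : F} (hρ₀ : ρ₀ ≠ 0) (hρ₁ : ρ₁ ≠ 0)
    (hl₀ : ∀ O : ValuationSubring K, IsCentered F O (A (unif x)) → O.valuation (y₀ ^ 2 - κ ρ₀) < 1)
    (hl₁ : ∀ O : ValuationSubring K, IsCentered F O (A (unif x)) →
      O.valuation (y₁ ^ 2 - κ ρ₁) < 1) :
    Nonempty (rationalFibre F K x ≃ {s : F // s ^ 2 = ρ₀} × {s : F // s ^ 2 = ρ₁}) := by
  have hagree : ∀ {𝒪 : Set (ValuationSubring K)} {s₀ s₁ : F}, 𝒪.Nonempty →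
      (∀ O ∈ 𝒪, IsCentered F O (A (unif x))) → s₀ ^ 2 = ρ₀ → s₁ ^ 2 = ρ₁ →
      (∀ O ∈ 𝒪, O.valuation (y₀ - κ s₀) < 1) → (∀ O ∈ 𝒪, O.valuation (y₁ - κ s₁) < 1) →
      ∀ w, w ≠ 0 → Agree F 𝒪 (A (unif x)) w := by
    intro 𝒪 s₀ s₁ hne hO hs₀ hs₁ hn₀ hn₁ w hw
    have hs₀' : s₀ ≠ 0 := by rintro rfl; exact hρ₀ (by rw [← hs₀]; simp)
    have hs₁' : s₁ ≠ 0 := by rintro rfl; exact hρ₁ (by rw [← hs₁]; simp)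
    exact agree_of_split h2 hne hO (fun c => Subring.le_adjoinSqrt h₀ (const_mem_range c))
      (agree_of_split h2 hne hO const_mem_range (agree_range hO) h₀ hs₀' hn₀) h₁ hs₁' hn₁ w
      (htop w) hw
  have hex : ∀ O : rationalFibre F K x, ∃ p : {s : F // s ^ 2 = ρ₀} × {s : F // s ^ 2 = ρ₁},
      O.1.valuation (y₀ - κ p.1.1) < 1 ∧ O.1.valuation (y₁ - κ p.2.1) < 1 := by
    intro O
    obtain ⟨s, hs, h⟩ := IsCentered.exists_sqrt O.2 (hl₀ O.1 O.2.1)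
    obtain ⟨s', hs', h'⟩ := IsCentered.exists_sqrt O.2 (hl₁ O.1 O.2.1)
    exact ⟨⟨⟨s, hs⟩, ⟨s', hs'⟩⟩, h, h'⟩
  choose Ψ hΨ using hex
  refine ⟨Equiv.ofBijective Ψ ⟨fun O O' hOO => ?_, fun ⟨⟨s₀, hs₀⟩, ⟨s₁, hs₁⟩⟩ => ?_⟩⟩
  -- Two rings with the same residues of y₀ and y₁ give every w the same leading term, hence contain
  -- the same elements.
  · have h := hΨ O
    have h' := hΨ O'
    rw [← hOO] at h'
    have hA := hagree (𝒪 := {O.1, O'.1}) ⟨O.1, Set.mem_insert _ _⟩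
      (by rintro _ (rfl | rfl); exacts [O.2.1, O'.2.1]) (Ψ O).1.2 (Ψ O).2.2
      (by rintro _ (rfl | rfl); exacts [h.1, h'.1]) (by rintro _ (rfl | rfl); exacts [h.2, h'.2])
    refine Subtype.ext (ValuationSubring.ext _ _ fun w => ?_)
    by_cases hw : w = 0
    · rw [hw]; exact iff_of_true (zero_mem _) (zero_mem _)
    · obtain ⟨n, ρ, hρ, hl⟩ := hA w hw
      rw [(hl O.1 (Set.mem_insert _ _)).mem_iff O.2.1 hρ,
        (hl O'.1 (Set.mem_insert_of_mem _ rfl)).mem_iff O'.2.1 hρ]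
  -- From any ring over x the residues of y₀ and y₁ are corrected by sign automorphisms; σ₁ fixes
  -- y₀, so the second correction preserves the first. The existence of leading terms with
  -- coefficients in F also shows that the residue field is F.
  · obtain ⟨O, hO⟩ := exists_isCentered (transcendental_unif (K := K) x)
    obtain ⟨O', hO', hn₀, -⟩ := exists_centered_near hO h₀₀ (s := s₀) (by
      rw [hs₀]; exact hl₀ O hO)
    obtain ⟨O'', hO'', hn₁, hk⟩ := exists_centered_near hO' h₁₁ (s := s₁) (by
      rw [hs₁]; exact hl₁ O' hO')
    have hn₀' := hk y₀ s₀ h₁₀ hn₀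
    have hA := hagree (𝒪 := {O''}) ⟨O'', rfl⟩ (by rintro _ rfl; exact hO'') hs₀ hs₁
      (by rintro _ rfl; exact hn₀') (by rintro _ rfl; exact hn₁)
    have hmem : O'' ∈ rationalFibre F K x := by
      refine ⟨hO'', fun w hw => ?_⟩
      by_cases hw0 : w = 0
      · exact ⟨0, by rw [hw0, map_zero, sub_zero, map_zero]; exact zero_lt_one⟩
      · obtain ⟨n, ρ, hρ, hl⟩ := hA w hw0
        have hl' := hl O'' rfl
        rcases ((hl'.mem_iff hO'' hρ).1 hw).eq_or_lt with h | h
        · refine ⟨ρ, ?_⟩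
          rwa [HasLead, ← h, neg_zero, zpow_zero, mul_one] at hl'
        · refine ⟨0, ?_⟩
          rw [map_zero, sub_zero, hl'.valuation_eq hO'' hρ]
          exact hO''.zpow_lt_one h
    refine ⟨⟨O'', hmem⟩, ?_⟩
    have h := hΨ ⟨O'', hmem⟩
    exact Prod.ext (Subtype.ext (hO''.near_unique h.1 hn₀'))
      (Subtype.ext (hO''.near_unique h.2 hn₁))

/-- The fibre over a ramified point. -/
theorem card_rationalFibre_ramified (h2 : (2 : F) ≠ 0) {x : Option F} {y u : K}
    (hy : y ^ 2 ∈ (algebraMap (RatFunc F) K).range)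
    (hu : u ^ 2 ∈ (algebraMap (RatFunc F) K).range.adjoinSqrt y hy)
    (htop : ∀ w, w ∈ ((algebraMap (RatFunc F) K).range.adjoinSqrt y hy).adjoinSqrt u hu)
    {σ : K ≃ₐ[RatFunc F] K} (hσ : σ y = -y) {ρ τ : F} (hρ : ρ ≠ 0) (hτ : τ ≠ 0) {N : ℤ}
    (hN : Odd N)
    (hl : ∀ O : ValuationSubring K, IsCentered F O (A (unif x)) → O.valuation (y ^ 2 - κ ρ) < 1)
    (hlu : ∀ O : ValuationSubring K, IsCentered F O (A (unif x)) →
      HasLead O (A (unif x)) (u ^ 2) N τ) :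
    Nonempty (rationalFibre F K x ≃ {s : F // s ^ 2 = ρ}) := by
  have hagree : ∀ {𝒪 : Set (ValuationSubring K)} {s : F}, 𝒪.Nonempty →
      (∀ O ∈ 𝒪, IsCentered F O (A (unif x))) → s ^ 2 = ρ →
      (∀ O ∈ 𝒪, O.valuation (y - κ s) < 1) →
      ∀ w, ∃ p : Prop, (∀ O ∈ 𝒪, w ∈ O ↔ p) ∧
        (p → ∃ c : F, ∀ O ∈ 𝒪, O.valuation (w - κ c) < 1) := by
    intro 𝒪 s hne hO hs hn w
    have hs' : s ≠ 0 := by rintro rfl; exact hρ (by rw [← hs]; simp)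
    obtain ⟨a, ha, b, hb, rfl⟩ := htop w
    exact mem_iff_of_ramified hO
      (agree_of_split h2 hne hO const_mem_range (agree_range hO) hy hs' hn) hτ hN
      (fun O hOO => hlu O (hO O hOO)) ha hb
  have hex : ∀ O : rationalFibre F K x, ∃ p : {s : F // s ^ 2 = ρ},
      O.1.valuation (y - κ p.1) < 1 := by
    intro O
    obtain ⟨s, hs, h⟩ := IsCentered.exists_sqrt O.2 (hl O.1 O.2.1)
    exact ⟨⟨s, hs⟩, h⟩
  choose Ψ hΨ using hex
  refine ⟨Equiv.ofBijective Ψ ⟨fun O O' hOO => ?_, fun ⟨s, hs⟩ => ?_⟩⟩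
  · have h := hΨ O
    have h' := hΨ O'
    rw [← hOO] at h'
    refine Subtype.ext (ValuationSubring.ext _ _ fun w => ?_)
    obtain ⟨p, hp, -⟩ := hagree (𝒪 := {O.1, O'.1}) ⟨O.1, Set.mem_insert _ _⟩
      (by rintro _ (rfl | rfl); exacts [O.2.1, O'.2.1]) (Ψ O).2
      (by rintro _ (rfl | rfl); exacts [h, h']) w
    rw [hp O.1 (Set.mem_insert _ _), hp O'.1 (Set.mem_insert_of_mem _ rfl)]
  · obtain ⟨O, hO⟩ := exists_isCentered (transcendental_unif (K := K) x)
    obtain ⟨O', hO', hn, -⟩ := exists_centered_near hO hσ (s := s) (by rw [hs]; exact hl O hO)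
    have hmem : O' ∈ rationalFibre F K x := by
      refine ⟨hO', fun w hw => ?_⟩
      obtain ⟨p, hp, hc⟩ := hagree (𝒪 := {O'}) ⟨O', rfl⟩ (by rintro _ rfl; exact hO') hs
        (by rintro _ rfl; exact hn) w
      obtain ⟨c, hc⟩ := hc ((hp O' rfl).1 hw)
      exact ⟨c, hc O' rfl⟩
    exact ⟨⟨O', hmem⟩, Subtype.ext (hO'.near_unique (hΨ ⟨O', hmem⟩) hn)⟩

end Fibres

/-! ### The number of points over a rational point of the line. -/

section PointCount

variable {F : Type*} [Field F] [Fintype F]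

local notation "ι" => algebraMap F[X] (RatFunc F)

theorem localChar_some (f : Fin 3 → F[X]) (x : Option F) (i : Fin 3) :
    localChar f x (some i) = (quadraticChar F (∏ j ∈ univ.erase i, localValue f x j) : ℝ) := by
  rw [map_prod, Int.cast_prod, localChar, ← Finset.mul_prod_erase univ _ (Finset.mem_univ i)]
  rw [if_neg (by simp), one_mul]
  refine Finset.prod_congr rfl fun j hj => ?_
  rw [if_pos ⟨i, rfl, (Finset.ne_of_mem_erase hj).symm⟩]

theorem card_sqrts (h2 : ringChar F ≠ 2) (a : F) :
    (Nat.card {s : F // s ^ 2 = a} : ℝ) = 1 + quadraticChar F a := by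
  have h := quadraticChar_card_sqrts h2 a
  have e : #{x : F | x ^ 2 = a}.toFinset = Nat.card {s : F // s ^ 2 = a} := by
    rw [Set.toFinset_card, Nat.card_eq_fintype_card]
    exact Fintype.card_congr (Equiv.refl _)
  rw [e] at h
  rw [add_comm]
  exact_mod_cast h

variable {K : Type*} [Field K] [Algebra F K] [Algebra (RatFunc F) K] [IsScalarTower F (RatFunc F) K]

local notation "A" => algebraMap (RatFunc F) K

theorem univ_erase_eq_pair {i k l : Fin 3} (hik : i ≠ k) (hil : i ≠ l) (hkl : k ≠ l) :
    (univ.erase i : Finset (Fin 3)) = {k, l} := by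
  ext x; revert i k l x; decide

/-- The third root is a multiple of z i z k over the base field, so two successive square roots
generate everything. -/
theorem Spans.mem_adjoinSqrt {f : Fin 3 → F[X]} {z : Fin 3 → K} (hf : IsAdmissible f)
    (hz : IsFrame A f z) (hs : Spans A z) {i k : Fin 3} (hik : i ≠ k) {r r' : RatFunc F}
    (hr : r ≠ 0) (hr' : r' ≠ 0) (hi : (z i * A r) ^ 2 ∈ (algebraMap (RatFunc F) K).range)
    (hk : (z k * A r') ^ 2 ∈ (algebraMap (RatFunc F) K).range.adjoinSqrt (z i * A r) hi) (w : K) :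
    w ∈ ((algebraMap (RatFunc F) K).range.adjoinSqrt (z i * A r) hi).adjoinSqrt (z k * A r') hk := by
  obtain ⟨l, hil, hkl⟩ := (by decide : ∀ i k : Fin 3, ∃ l, i ≠ l ∧ k ≠ l) i k
  obtain ⟨a, b, rfl⟩ := hs w
  have hsum : comb A z a b = A a + (A (b i) * z i + (A (b k) * z k + A (b l) * z l)) := by
    rw [comb, ← Finset.add_sum_erase univ _ (Finset.mem_univ i),
      univ_erase_eq_pair hik hil hkl, Finset.sum_pair hkl]
  have h0 : A r ≠ 0 := by rwa [Ne, map_eq_zero]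
  have h1 : A r' ≠ 0 := by rwa [Ne, map_eq_zero]
  have h2 : A (ι (f l)) ≠ 0 := IsFrame.map_ne_zero _ (hf.isModel.ne_zero l)
  have hm := hz.mul i k l hik hil hkl
  refine ⟨A a + A (b i / r) * (z i * A r), ⟨_, ⟨a, rfl⟩, _, ⟨b i / r, rfl⟩, rfl⟩,
    A (b k / r') + A (b l / (ι (f l) * r * r')) * (z i * A r),
    ⟨_, ⟨b k / r', rfl⟩, _, ⟨b l / (ι (f l) * r * r'), rfl⟩, rfl⟩, ?_⟩
  rw [hsum]
  simp only [map_div₀, map_mul]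
  field_simp
  linear_combination (-A (b l)) * hm

/-- The number of rational points over a rational point of the line. -/
theorem card_rationalFibre (h2 : ringChar F ≠ 2) {f : Fin 3 → F[X]} {z : Fin 3 → K}
    (hf : IsAdmissible f) (hz : IsFrame A f z) (hs : Spans A z) (x : Option F) :
    Finite (rationalFibre F K x) ∧ (Nat.card (rationalFibre F K x) : ℝ) = 1 + placeTrace f x := by
  have h2' : (2 : F) ≠ 0 := Ring.two_ne_zero h2
  obtain ⟨ρ, hρ⟩ := exists_ramPlace hf.isModel x
  have hiff : ∀ ρ', RamPlace f x ρ' ↔ ρ' = ρ := fun ρ' =>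
    ⟨fun h => h.unique hρ, fun h => h ▸ hρ⟩
  have hu : unif x ≠ 0 := by
    intro h
    refine transcendental_unif (K := K) x ?_
    rw [h, map_zero]
    exact isAlgebraic_zero
  choose σ hσ using hz.exists_signAut h2' hf hs
  have hσr : ∀ i l r, σ i (z l * A r) = if l = i then z l * A r else -(z l * A r) := by
    intro i l r
    rw [map_mul, hσ, (σ i).commutes]
    split_ifs
    · rfl
    · ring
  have hrange : ∀ i r, (z i * A r) ^ 2 ∈ (algebraMap (RatFunc F) K).range := fun i r =>
    ⟨ι (cofactor f i) * r ^ 2, by rw [mul_pow, hz.sq, map_mul, map_pow]⟩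
  have hval : ∀ j, ρ ≠ some j → localValue f x j ≠ 0 := fun j hj =>
    localValue_ne_zero hf.isModel hρ hj
  have hprod : ∀ i, (ρ = none ∨ ρ = some i) → ∏ j ∈ univ.erase i, localValue f x j ≠ 0 := by
    intro i hi
    refine Finset.prod_ne_zero_iff.2 fun j hj => hval j ?_
    rintro rfl
    rcases hi with h | h
    · cases h
    · exact Finset.ne_of_mem_erase hj (Option.some.inj h)
  have hnear : ∀ i, (ρ = none ∨ ρ = some i) → ∃ r : RatFunc F, r ≠ 0 ∧
      ∀ O : ValuationSubring K, IsCentered F O (A (unif x)) →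
      O.valuation ((z i * A r) ^ 2 -
        algebraMap F K (∏ j ∈ univ.erase i, localValue f x j)) < 1 := by
    intro i hi
    obtain ⟨e, he⟩ := (hasLead_cofactor (K := K) hf.isModel hρ i).1 hi
    -- Dividing z i by the e-th power of the uniformizer makes its square a unit whose residue is
    -- the product of the local values.
    refine ⟨unif x ^ (-e), zpow_ne_zero _ hu, fun O hO => ?_⟩
    have := he O hO
    rw [HasLead] at this
    convert! this using 3
    rw [mul_pow, hz.sq, map_zpow₀, ← zpow_natCast, ← zpow_mul]
    congr 2
    push_cast; ring
  cases ρ with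
  | none =>
    obtain ⟨r₀, hr₀, hn₀⟩ := hnear 0 (Or.inl rfl)
    obtain ⟨r₁, hr₁, hn₁⟩ := hnear 1 (Or.inl rfl)
    have h₁ := Subring.le_adjoinSqrt (hrange 0 r₀) (hrange 1 r₁)
    obtain ⟨e⟩ := card_rationalFibre_unramified h2' (x := x) (hrange 0 r₀) h₁
      (hs.mem_adjoinSqrt hf hz (by decide) hr₀ hr₁ _ _) (σ₀ := σ 1) (σ₁ := σ 0)
      (by rw [hσr, if_neg (by decide)]) (by rw [hσr, if_neg (by decide)])
      (by rw [hσr, if_pos rfl]) (hprod 0 (Or.inl rfl)) (hprod 1 (Or.inl rfl)) hn₀ hn₁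
    refine ⟨Finite.of_equiv _ e.symm, ?_⟩
    rw [Nat.card_congr e, Nat.card_prod, Nat.cast_mul, card_sqrts h2, card_sqrts h2]
    simp only [placeTrace, hiff, true_or, if_true, localChar_some, Fin.sum_univ_three]
    have hc := fun j => quadraticChar_eq_one_or (hval j (by simp))
    have e0 : (univ.erase 0 : Finset (Fin 3)) = {1, 2} := by decide
    have e1 : (univ.erase 1 : Finset (Fin 3)) = {0, 2} := by decide
    have e2 : (univ.erase 2 : Finset (Fin 3)) = {0, 1} := by decide
    rw [e0, e1, e2, Finset.prod_pair (by decide), Finset.prod_pair (by decide),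
      Finset.prod_pair (by decide)]
    simp only [map_mul, Int.cast_mul]
    -- (1 + χ₀)(1 + χ₁) = 1 + χ₀ + χ₁ + χ₂: in χ₀χ₁ the sign of component 2 occurs squared.
    rcases hc 2 with h | h <;> rw [h] <;> ring
  | some i =>
    obtain ⟨k, _, hik, -⟩ := exists_other i
    obtain ⟨r, hr, hn⟩ := hnear i (Or.inr rfl)
    obtain ⟨N, τ, hN, hτ, hl⟩ := (hasLead_cofactor (K := K) hf.isModel hρ k).2 (by simpa using hik)
    have hk := Subring.le_adjoinSqrt (hrange i r) (hrange k 1)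
    obtain ⟨e⟩ := card_rationalFibre_ramified h2' (x := x) (hrange i r) hk
      (hs.mem_adjoinSqrt hf hz hik hr one_ne_zero _ _) (σ := σ k)
      (by rw [hσr, if_neg hik]) (hprod i (Or.inr rfl)) hτ hN hn (fun O hO => by
        rw [map_one, mul_one, hz.sq]; exact hl O hO)
    refine ⟨Finite.of_equiv _ e.symm, ?_⟩
    rw [Nat.card_congr e, card_sqrts h2, ← localChar_some]
    simp only [placeTrace, hiff, reduceCtorEq, false_or, Option.some.injEq]
    rw [Finset.sum_ite_eq' univ i, if_pos (Finset.mem_univ i)]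

end PointCount

/-! ### The trace of Frobenius as a sum of local traces. -/

section TraceFormula

variable {F : Type u} [Field F] [Fintype F]

local notation "ι" => algebraMap F[X] (RatFunc F)

namespace BiquadraticCurve

/-- If X lies in the ring, its residue c ∈ F is the point below; otherwise X⁻¹ is a nonunit and the
place lies over infinity. The point below is unique. -/
theorem rationalPoint_equiv (C : BiquadraticCurve F) :
    Nonempty ((Σ x, rationalFibre F C.K x) ≃ C.RationalPoint) := by
  have hunif : ∀ c, algebraMap (RatFunc F) C.K (unif (some c)) =
      algebraMap (RatFunc F) C.K RatFunc.X - algebraMap F C.K c := fun c => by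
    rw [unif, map_sub, map_sub, algebraMap_C_eq, ratFunc_X_eq,
      IsScalarTower.algebraMap_apply F (RatFunc F) C.K]
  have hnone : algebraMap (RatFunc F) C.K (unif none) =
      (algebraMap (RatFunc F) C.K RatFunc.X)⁻¹ := by rw [unif, map_inv₀]
  have hX0 : algebraMap (RatFunc F) C.K RatFunc.X ≠ 0 := by
    rw [Ne, map_eq_zero]; exact RatFunc.X_ne_zero
  have hne : ∀ x, algebraMap (RatFunc F) C.K (unif x) ≠ 0 := by
    intro x h
    refine transcendental_unif (K := C.K) x ?_
    rw [h]; exact isAlgebraic_zero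
  have hnot : ∀ (O : ValuationSubring C.K) c, IsCentered F O
      (algebraMap (RatFunc F) C.K (unif none)) → ¬ IsCentered F O
      (algebraMap (RatFunc F) C.K (unif (some c))) := by
    intro O c h h'
    have h1 := h'.polynomial_mem X
    rw [← ratFunc_X_eq, ← O.valuation_le_one_iff] at h1
    have h3 := h.lt_one
    rw [hnone, map_inv₀] at h3
    exact absurd h3 (not_lt.2 ((one_le_inv₀ (zero_lt_iff.2 (by
      rw [Ne, map_eq_zero]; exact hX0))).2 h1))
  let Φ : (Σ x, rationalFibre F C.K x) → C.RationalPoint := fun p =>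
    ⟨p.2.1, fun htop => by
      have h := p.2.2.1.lt_one
      rw [← ValuationSubring.mem_nonunits_iff, ValuationSubring.mem_nonunits_iff_or] at h
      rcases h with h | h
      · exact hne _ h
      · exact h (by rw [htop]; trivial), p.2.2.1.const_mem, p.2.2.2⟩
  refine ⟨Equiv.ofBijective Φ ⟨?_, ?_⟩⟩
  · rintro ⟨x, O, hO⟩ ⟨x', O', hO'⟩ h
    obtain rfl : O = O' := congrArg Subtype.val h
    have hx : x = x' := by
      rcases x with _ | c <;> rcases x' with _ | c'
      · rfl
      · exact absurd hO'.1 (hnot O c' hO.1)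
      · exact absurd hO.1 (hnot O c hO'.1)
      · have h1 := hO.1.lt_one
        have h3 := hO'.1.lt_one
        rw [hunif] at h1 h3
        rw [hO.1.near_unique h1 h3]
    subst hx
    rfl
  · rintro ⟨O, htop, hconst, hres⟩
    by_cases hX : algebraMap (RatFunc F) C.K RatFunc.X ∈ O
    · obtain ⟨c, hc⟩ := hres _ hX
      rw [← hunif] at hc
      exact ⟨⟨some c, O, ⟨hconst, hne _, hc⟩, hres⟩, rfl⟩
    · refine ⟨⟨none, O, ⟨hconst, hne _, ?_⟩, hres⟩, rfl⟩
      rw [hnone, ← ValuationSubring.mem_nonunits_iff, ValuationSubring.mem_nonunits_iff_or, inv_inv]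
      exact Or.inr hX

/-- The trace of Frobenius in terms of the local traces. -/
theorem trFrob_eq (h2 : ringChar F ≠ 2) (C : BiquadraticCurve F) {f : Fin 3 → F[X]}
    {z : Fin 3 → C.K} (hf : IsAdmissible f) (hz : IsFrame (algebraMap (RatFunc F) C.K) f z) :
    (C.trFrob : ℝ) = -∑ x, placeTrace f x := by
  have hs := spans (τ := AlgEquiv.refl) (Ring.two_ne_zero h2) hf hz
  have hfib := card_rationalFibre h2 hf hz hs
  have hfin := fun x => (hfib x).1
  obtain ⟨e⟩ := C.rationalPoint_equiv
  have hcard : (Nat.card C.RationalPoint : ℝ) = ∑ x : Option F, (1 + placeTrace f x) := by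
    rw [← Nat.card_congr e, Nat.card_sigma, Nat.cast_sum]
    exact Finset.sum_congr rfl fun x _ => (hfib x).2
  rw [Finset.sum_add_distrib, Finset.sum_const, Finset.card_univ, Fintype.card_option, nsmul_eq_mul,
    mul_one] at hcard
  rw [trFrob, Int.cast_sub, Int.cast_add, Int.cast_natCast, Int.cast_natCast, hcard,
    Nat.card_eq_fintype_card]
  push_cast
  ring

end BiquadraticCurve

end TraceFormula

/-! ### Existence of triples of arbitrary degrees. -/

section Existence

variable {F : Type*} [Field F] [Fintype F]

/-- An element of L either has a minimal polynomial of full degree or satisfies X^{q^e} = X for some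
e below the degree of L; both kinds are counted as roots. -/
theorem card_pow_finrank_le (L : Type*) [Field L] [Algebra F L] [FiniteDimensional F L] :
    Fintype.card F ^ Module.finrank F L ≤
      Module.finrank F L * #{p ∈ monics F (Module.finrank F L) | Irreducible p} +
      ∑ e ∈ Ico 1 (Module.finrank F L), Fintype.card F ^ e := by
  have hfin : Finite L := Module.finite_of_finite F
  let := Fintype.ofFinite L
  rw [← Module.card_eq_pow_finrank (K := F) (V := L)]
  set d := Module.finrank F L
  have hcover : (univ : Finset L) ⊆
      ({p ∈ monics F d | Irreducible p}.biUnion fun p => (p.map (algebraMap F L)).roots.toFinset) ∪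
      (Ico 1 d).biUnion fun e => (X ^ Fintype.card F ^ e - X : L[X]).roots.toFinset := by
    intro a _
    have ha : IsIntegral F a := Algebra.IsIntegral.isIntegral a
    have hirr := minpoly.irreducible ha
    have hle : (minpoly F a).natDegree ≤ d := minpoly.natDegree_le a
    rw [mem_union, mem_biUnion, mem_biUnion]
    rcases hle.lt_or_eq with h | h
    · refine Or.inr ⟨(minpoly F a).natDegree, mem_Ico.2 ⟨hirr.natDegree_pos, h⟩, ?_⟩
      have h1 := hirr.natDegree_dvd_iff_dvd_X_pow_card_pow_sub_X.1 dvd_rfl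
      obtain ⟨b, hb⟩ := h1
      have h2 := congrArg (aeval a) hb
      rw [map_mul, minpoly.aeval, zero_mul, map_sub, map_pow, aeval_X,
        Nat.card_eq_fintype_card] at h2
      rw [Multiset.mem_toFinset, mem_roots (FiniteField.X_pow_card_pow_sub_X_ne_zero _
        hirr.natDegree_pos.ne' Fintype.one_lt_card), IsRoot.def, eval_sub, eval_pow, eval_X]
      exact h2
    · refine Or.inl ⟨minpoly F a, mem_filter.2 ⟨mem_monics.2 ⟨minpoly.monic ha, h⟩, hirr⟩, ?_⟩
      rw [Multiset.mem_toFinset, mem_roots ((minpoly.monic ha).map _).ne_zero, IsRoot.def,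
        eval_map_algebraMap, minpoly.aeval]
  rw [← Finset.card_univ]
  refine (Finset.card_le_card hcover).trans ((Finset.card_union_le _ _).trans (add_le_add ?_ ?_))
  · rw [mul_comm]
    refine Finset.card_biUnion_le_card_mul _ _ _ fun p hp => ?_
    refine (Multiset.toFinset_card_le _).trans ((card_roots' _).trans ?_)
    rw [natDegree_map, (mem_monics.1 (mem_filter.1 hp).1).2]
  · refine Finset.card_biUnion_le.trans (Finset.sum_le_sum fun e he => ?_)
    refine (Multiset.toFinset_card_le _).trans ((card_roots' _).trans ?_)
    rw [FiniteField.X_pow_card_pow_sub_X_natDegree_eq _ (by have := mem_Ico.1 he; omega)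
      Fintype.one_lt_card]

theorem card_pow_le_card_irreducible {d : ℕ} (hd : d ≠ 0) :
    Fintype.card F ^ d ≤ d * #{p ∈ monics F d | Irreducible p} +
      ∑ e ∈ Ico 1 d, Fintype.card F ^ e := by
  obtain ⟨p, hp⟩ := CharP.exists F
  have : Fact (Nat.Prime p) := ⟨CharP.char_is_prime F p⟩
  have : NeZero d := ⟨hd⟩
  have hfr := FiniteField.finrank_extension F p d
  have : FiniteDimensional F (FiniteField.Extension F p d) :=
    FiniteDimensional.of_finrank_pos (by omega)
  have h := card_pow_finrank_le (F := F) (FiniteField.Extension F p d)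
  rwa [hfr] at h

theorem two_mul_sum_pow_add_le {c : ℕ} (hc : 3 ≤ c) {d : ℕ} (hd : d ≠ 0) :
    2 * ∑ e ∈ Ico 1 d, c ^ e + c ≤ c ^ d := by
  induction d with
  | zero => exact absurd rfl hd
  | succ d ih =>
    rcases Nat.eq_zero_or_pos d with rfl | hpos
    · simp
    · have := ih hpos.ne'
      rw [Finset.sum_Ico_succ_top (by omega), pow_succ]
      nlinarith [Nat.mul_le_mul_left (c ^ d) hc]

theorem four_mul_le_three_pow_add (d : ℕ) (hd : d ≠ 0) : 4 * d ≤ 3 ^ d + 1 := by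
  induction d with
  | zero => exact absurd rfl hd
  | succ d ih =>
    rcases Nat.eq_zero_or_pos d with rfl | hpos
    · simp
    · have := ih hpos.ne'
      rw [pow_succ]
      omega

/-- Three are needed when all three degrees coincide. With at most two, q^d ≤ 2d + (q^d − q)/2, so
q^d + q ≤ 4d ≤ 3^d + 1, which is impossible for q ≥ 3. -/
theorem three_le_card_irreducible (hF : 3 ≤ Fintype.card F) {d : ℕ} (hd : d ≠ 0) :
    3 ≤ #{p ∈ monics F d | Irreducible p} := by
  by_contra! hcon
  have h1 := card_pow_le_card_irreducible (F := F) hd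
  have h2 := two_mul_sum_pow_add_le hF hd
  have h3 := four_mul_le_three_pow_add d hd
  have h4 := Nat.pow_le_pow_left hF d
  have h5 : d * #{p ∈ monics F d | Irreducible p} ≤ d * 2 := Nat.mul_le_mul_left d (by omega)
  omega

/-- Distinct irreducible polynomials, or 1 in degree zero. This yields a non-empty family without
the lower bound on the degrees that the density estimates need for small q. -/
theorem triples_nonempty (hF : 3 ≤ Fintype.card F) (d : Fin 3 → ℕ) :
    (triples (∅ : Finset F) d).Nonempty := by
  have hemb : ∀ e : ℕ, ∃ p : Fin 3 → F[X], e ≠ 0 → Function.Injective p ∧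
      ∀ i, (p i).Monic ∧ (p i).natDegree = e ∧ Irreducible (p i) := by
    intro e
    by_cases he : e = 0
    · exact ⟨fun _ => 0, fun h => absurd he h⟩
    · obtain ⟨s, hs, hc⟩ := Finset.exists_subset_card_eq (three_le_card_irreducible hF he)
      refine ⟨fun i => (s.equivFinOfCardEq hc).symm i, fun _ =>
        ⟨Subtype.val_injective.comp (Equiv.injective _), fun i => ?_⟩⟩
      have h := mem_filter.1 (hs ((s.equivFinOfCardEq hc).symm i).2)
      exact ⟨(mem_monics.1 h.1).1, (mem_monics.1 h.1).2, h.2⟩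
  choose p hp using hemb
  refine ⟨fun i => if d i = 0 then 1 else p (d i) i,
    mem_triples.2 ⟨fun i => ?_, fun i => ?_, fun i j hij => ?_, by simp⟩⟩
  · split_ifs with h
    · rw [h, natDegree_one]
    · exact ((hp _ h).2 i).2.1
  · dsimp only
    split_ifs with h
    · exact squarefree_one
    · exact ((hp _ h).2 i).2.2.squarefree
  · dsimp only
    split_ifs with h h' h'
    · exact isCoprime_one_left
    · exact isCoprime_one_left
    · exact isCoprime_one_right
    · obtain ⟨hm, hdeg, hi⟩ := (hp _ h).2 i
      obtain ⟨hm', hdeg', hi'⟩ := (hp _ h').2 j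
      refine (hi.coprime_iff_not_dvd).2 fun hdvd => ?_
      have heq := eq_of_monic_of_associated hm hm' (hi.associated_of_dvd hi' hdvd)
      have hd : d i = d j := by rw [← hdeg, ← hdeg', heq]
      rw [← hd] at heq
      exact hij ((hp _ h).1 heq)

end Existence

/-! ### Degrees of triples with prescribed genera. -/

section Models

variable {F : Type*} [Field F] [Fintype F] {g d : Fin 3 → ℕ}

theorem hasDegrees_iff (f : Fin 3 → F[X]) : HasDegrees g f ↔ IsModel ∅ f ∧
    ((f 1).natDegree + (f 2).natDegree + 1) / 2 = g 0 + 1 ∧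
    ((f 0).natDegree + (f 2).natDegree + 1) / 2 = g 1 + 1 ∧
    ((f 0).natDegree + (f 1).natDegree + 1) / 2 = g 2 + 1 := by
  unfold HasDegrees
  refine and_congr_right fun h => ?_
  have h0 := fun i => (h.1 i).ne_zero
  rw [Fin.forall_fin_succ, Fin.forall_fin_succ, Fin.forall_fin_succ]
  simp only [Fin.succ_zero_eq_one, Fin.succ_one_eq_two, cofactor_zero, cofactor_one, cofactor_two,
    natDegree_mul (h0 _) (h0 _), IsEmpty.forall_iff, and_true]

theorem exists_finset_hasDegrees (F : Type*) [Field F] [Fintype F] (g : Fin 3 → ℕ) :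
    ∃ Ω : Finset (Fin 3 → F[X]), ∀ f, f ∈ Ω ↔ HasDegrees g f := by
  have hfin : {f : Fin 3 → F[X] | HasDegrees g f}.Finite := by
    refine (Set.Finite.pi' fun _ : Fin 3 => finite_setOf_natDegree_le (F := F)
      (2 * (g 0 + g 1 + g 2) + 6)).subset fun f hf => ?_
    obtain ⟨-, h0, h1, h2⟩ := (hasDegrees_iff f).1 hf
    intro i
    change (f i).natDegree ≤ _
    fin_cases i <;> simp <;> omega
  exact ⟨hfin.toFinset, fun f => by simp⟩

theorem hasDegrees_of_mem_triples (h0 : d 1 + d 2 = 2 * g 0 + 2) (h1 : d 0 + d 2 = 2 * g 1 + 2)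
    (h2 : d 0 + d 1 = 2 * g 2 + 2) {f : Fin 3 → F[X]} (hf : f ∈ triples ∅ d) : HasDegrees g f := by
  obtain ⟨hd, hf⟩ := mem_triples.1 hf
  rw [hasDegrees_iff, hd, hd, hd]
  exact ⟨hf, by omega, by omega, by omega⟩

/-- Each cofactor degree is 2g + 2 or 2g + 1. Their sum is even, so none or exactly two of them are
odd; two odd ones mean that the component common to both cofactors is lower by one. -/
theorem hasDegrees_iff_exists_mem_triples (h0 : d 1 + d 2 = 2 * g 0 + 2)
    (h1 : d 0 + d 2 = 2 * g 1 + 2) (h2 : d 0 + d 1 = 2 * g 2 + 2) (hd : ∀ i, 1 ≤ d i)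
    (f : Fin 3 → F[X]) : HasDegrees g f ↔ ∃ r, f ∈ triples ∅ (lower d r) := by
  simp only [mem_triples, lower_apply, hasDegrees_iff, and_comm (b := IsModel ∅ f),
    exists_and_left]
  refine and_congr_right fun _ => ?_
  have hd0 := hd 0
  have hd1 := hd 1
  have hd2 := hd 2
  rw [Option.exists, Fin.exists_fin_succ, Fin.exists_fin_succ, Fin.exists_fin_succ]
  simp only [Fin.forall_fin_succ, Fin.succ_zero_eq_one, Fin.succ_one_eq_two, reduceCtorEq,
    if_false, Option.some.injEq, IsEmpty.forall_iff, and_true, IsEmpty.exists_iff, or_false]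
  simp
  omega

theorem lower_injective (hd : ∀ i, 1 ≤ d i) : Function.Injective (lower d) := by
  intro r s h
  by_contra hne
  have h' := fun i => congrFun h i
  simp only [lower_apply] at h'
  rcases r with _ | i
  · rcases s with _ | j
    · exact hne rfl
    · have h1 := h' j
      have h2 := hd j
      rw [if_neg (by simp), if_pos rfl] at h1
      omega
  · have h1 := h' i
    have h2 := hd i
    rw [if_pos rfl, if_neg (Ne.symm hne)] at h1
    omega

theorem sum_hasDegrees {Ω : Finset (Fin 3 → F[X])} (hΩ : ∀ f, f ∈ Ω ↔ HasDegrees g f)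
    (h0 : d 1 + d 2 = 2 * g 0 + 2) (h1 : d 0 + d 2 = 2 * g 1 + 2) (h2 : d 0 + d 1 = 2 * g 2 + 2)
    (hd : ∀ i, 1 ≤ d i) (t : (Fin 3 → F[X]) → ℝ) :
    ∑ f ∈ Ω, t f = ∑ r, ∑ f ∈ triples ∅ (lower d r), t f := by
  have hΩ' : Ω = univ.biUnion fun r => triples ∅ (lower d r) := by
    ext f
    simp only [hΩ, hasDegrees_iff_exists_mem_triples h0 h1 h2 hd, mem_biUnion, mem_univ, true_and]
  rw [hΩ', Finset.sum_biUnion]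
  intro r _ s _ hrs
  refine Finset.disjoint_left.2 fun f hf hf' => hrs (lower_injective hd (funext fun i => ?_))
  rw [← (mem_triples.1 hf).1, ← (mem_triples.1 hf').1]

end Models

/-! ### The estimate for the moments of the family. -/

section Moments

namespace BiquadraticCurve

theorem exists_abs_moment_sub_le (k : ℕ) {ε : ℝ} (hε : 0 < ε) (hε1 : ε < 1) :
    ∃ A : ℝ, ∀ (F : Type u) [Field F] [Fintype F], ringChar F ≠ 2 →
      ∀ (g d : Fin 3 → ℕ) (m : ℕ), d 1 + d 2 = 2 * g 0 + 2 → d 0 + d 2 = 2 * g 1 + 2 →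
        d 0 + d 1 = 2 * g 2 + 2 → (∀ i, m ≤ d i) →
        (family F g).Finite ∧ (family F g).Nonempty ∧
        |moment F g k - (-1) ^ k * (limitMoment F k / √(1 + (Fintype.card F : ℝ)) ^ k)| ≤
          A * (Fintype.card F : ℝ) ^ (-((1 - ε) / 2) * m + k) := by
  obtain ⟨A, hA⟩ := exists_abs_average_sub_le.{u} k hε hε1
  refine ⟨max A (2 * 6 ^ k * 9 ^ 10), fun F _ _ hF g d m h0 h1 h2 hm => ?_⟩
  obtain ⟨Ω, hΩ⟩ := exists_finset_hasDegrees F g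
  have hne : Ω.Nonempty := by
    obtain ⟨f, hf⟩ := triples_nonempty (three_le_card hF) d
    exact ⟨f, (hΩ f).2 (hasDegrees_of_mem_triples h0 h1 h2 hf)⟩
  obtain ⟨hfin, hfam, hmom⟩ := family_eq_and_moment_eq (Ring.two_ne_zero hF) g hΩ
  refine ⟨hfin, hfam hne, ?_⟩
  set s : ℝ := √(1 + (Fintype.card F : ℝ)) with hs
  have hs0 : 0 < s := Real.sqrt_pos.2 (by positivity)
  have hM := hmom (fun f => -∑ x, placeTrace f x)
    (fun C f z hf hz => C.trFrob_eq hF ((hΩ f).1 hf).isAdmissible hz) k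
  set a : ℝ := (∑ f ∈ Ω, (∑ x : Option F, placeTrace f x) ^ k) / #Ω with ha
  have hMa : moment F g k = (-1) ^ k * (a / s ^ k) := by
    rw [hM, ha, Nat.card_eq_fintype_card, ← hs, div_right_comm, ← mul_div_assoc]
    congr 1
    rw [Finset.sum_div, Finset.mul_sum]
    refine Finset.sum_congr rfl fun f _ => ?_
    rw [div_pow, neg_pow, mul_div_assoc]
  have hcard : (0 : ℝ) < #Ω := by exact_mod_cast hne.card_pos
  have ha' : |a| ≤ (3 * ((Fintype.card F : ℝ) + 1)) ^ k := by
    rw [ha, abs_div, abs_of_pos hcard, div_le_iff₀ hcard, mul_comm, ← nsmul_eq_mul]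
    refine (Finset.abs_sum_le_sum_abs _ _).trans (Finset.sum_le_card_nsmul _ _ _ fun f _ => ?_)
    rw [abs_pow]
    exact pow_le_pow_left₀ (abs_nonneg _) (abs_sum_placeTrace_le f) k
  have key : |a - limitMoment F k| ≤
      max A (2 * 6 ^ k * 9 ^ 10) * (Fintype.card F : ℝ) ^ (-((1 - ε) / 2) * m + k) * s ^ k := by
    -- The main estimate needs room for k prescribed zeros and the lowering at infinity, and for q <
    -- 9 also m ≥ 19 for the lower bound on the number of triples. The complement is covered by the
    -- trivial bound.
    by_cases hmain : k + 1 ≤ m ∧ (9 ≤ Fintype.card F ∨ 19 ≤ m)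
    · have hd : ∀ i, 1 ≤ d i := fun i => by have := hm i; omega
      have hpar : ∀ i j, Even (d i) ↔ Even (d j) := by
        have e01 : Even (d 0) ↔ Even (d 1) := by
          rw [Nat.even_iff, Nat.even_iff]; omega
        have e02 : Even (d 0) ↔ Even (d 2) := by
          rw [Nat.even_iff, Nat.even_iff]; omega
        have e : ∀ i, Even (d 0) ↔ Even (d i) := by
          intro i
          fin_cases i
          exacts [Iff.rfl, e01, e02]
        exact fun i j => (e i).symm.trans (e j)
      have h := hA F hF d m hpar hm hmain.1 hmain.2
      rw [← sum_hasDegrees hΩ h0 h1 h2 hd fun f => (∑ x : Option F, placeTrace f x) ^ k] at h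
      have hc := sum_hasDegrees hΩ h0 h1 h2 hd fun _ => 1
      simp only [Finset.sum_const, nsmul_eq_mul, mul_one] at hc
      rw [← hc] at h
      refine h.trans ?_
      gcongr
      exact le_max_left _ _
    · refine (abs_sub_limitMoment_le_of_small k m hε hε1 hF ha' (by omega)).trans ?_
      gcongr
      exact le_max_right _ _
  rw [hMa, ← mul_sub, ← sub_div, abs_mul, abs_pow, abs_neg, abs_one, one_pow, one_mul, abs_div,
    abs_of_pos (pow_pos hs0 k), div_le_iff₀ (pow_pos hs0 k)]
  exact key

end BiquadraticCurve

end Moments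

end Development



set_option linter.unusedSectionVars false

theorem theorem5p1 (k : ℕ) (ε : ℝ) (hε : 0 < ε) (hε1 : ε < 1) :
    ∃ A : ℝ, ∀ (F : Type u) [Field F] [Finite F], ringChar F ≠ 2 →
      ∀ n n₁ n₂ g₁ g₂ g₃ : ℕ, 0 < g₁ → 0 < g₂ → 0 < g₃ →
        g₁ = (n + n₁ - 1) / 2 → g₂ = (n + n₂ - 1) / 2 → g₃ = (n₁ + n₂ - 1) / 2 →
        (BiquadraticCurve.family F ![g₁, g₂, g₃]).Finite ∧
        (BiquadraticCurve.family F ![g₁, g₂, g₃]).Nonempty ∧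
        ∀ (Ω : Type v) [MeasurableSpace Ω] (P : MeasureTheory.Measure Ω)
          [MeasureTheory.IsProbabilityMeasure P] (X : Fin (Nat.card F + 1) → Ω → ℝ),
          ProbabilityTheory.iIndepFun X P →
          (∀ i, ProbabilityTheory.HasLaw (X i) (BiquadraticCurve.pointLaw (Nat.card F)) P) →
          |BiquadraticCurve.moment F ![g₁, g₂, g₃] k
              - (-1) ^ k * ∫ ω, (1 / √(1 + (Nat.card F : ℝ)) * ∑ i, X i ω) ^ k ∂P|
            ≤ A * (Nat.card F : ℝ) ^ (-((1 - ε) / 2) * (min n (min n₁ n₂) : ℕ) + (k : ℝ)) := by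
  obtain ⟨A, hA⟩ := BiquadraticCurve.exists_abs_moment_sub_le.{u} k hε hε1
  refine ⟨A, fun F _ _ h2 n n₁ n₂ g₁ g₂ g₃ p₁ p₂ p₃ e₁ e₂ e₃ => ?_⟩
  have := Fintype.ofFinite F
  -- This is the solution of the three degree equations. Each 2gᵢ + 2 is the corresponding sum of
  -- two of n, n₁, n₂ or one more, so the three degrees are at least n₂, n₁ and n respectively; in
  -- particular the subtractions are not truncated.
  obtain ⟨hfin, hne, h⟩ := hA F h2 ![g₁, g₂, g₃]
    ![g₂ + g₃ + 1 - g₁, g₁ + g₃ + 1 - g₂, g₁ + g₂ + 1 - g₃] (min n (min n₁ n₂))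
    (by simp; omega) (by simp; omega) (by simp; omega)
    (by intro i; fin_cases i <;> simp <;> omega)
  refine ⟨hfin, hne, fun Ω _ P _ X hX hlaw => ?_⟩
  have e : Fin (Nat.card F + 1) ≃ Option F :=
    Fintype.equivOfCardEq (by simp [Nat.card_eq_fintype_card])
  have hint := integral_sum_pow_eq_limitMoment P e X hX
    (fun i => by rw [← Nat.card_eq_fintype_card]; exact hlaw i) k
  simp only [mul_pow]
  rw [MeasureTheory.integral_const_mul, hint, one_div, inv_pow, inv_mul_eq_div,
    Nat.card_eq_fintype_card]
  exact h
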